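/- \textbf{Setting.} Let $M=\mathbb T^n=\mathbb R^n/\mathbb Z^n$ with the flat metric $\delta=\mathrm{diag}(1,\dots,1)$ in Cartesian coordinates, with coordinate derivatives $\partial_a$ and measure $dx$; $|\cdot|_\delta$ is the pointwise norm of tensors. Let $\beta>0$ be a smooth function on $M$. For a smooth time-dependent tensor field $S$ on $(0,T]\times M$ write $S=O(t^{\beta})$ if for all integers $k,\ell\ge 0$ there is $C>0$ with $|(t\partial_t)^\ell\partial^kS(t,x)|_\delta\le C\,t^{\beta(x)}$ for all $t\in(0,T]$, $x\in M$. An \emph{asymptotically point-wise Kasner--scalar field background with decay $\beta$} on $(0,T_1]\times M$, $T_1\in(0,1]$, is a collection $\Gamma=(\gamma^{ab},\chi_a{}^b,\alpha,\pi,\phi)$ of smooth fields, $\gamma^{ab}$ being (the inverse of) a time-dependent Riemannian metric, for which there are smooth functions $q_1,\dots,q_n,A$ on $M$ with $\sum_iq_i=1$, $\sum_iq_i^2=1-A^2$, $0\le A\le\sqrt{1-1/n}$, such that, with $\bar\gamma^{ab}=\mathrm{diag}(t^{-2q_1},\dots,t^{-2q_n})$, $\bar\chi_a{}^b=t^{-1}\mathrm{diag}(\tfrac1n-q_1,\dots,\tfrac1n-q_n)$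 and with $\gamma^{-1}_{ab},\bar\gamma^{-1}_{ab}$ the inverses of $\gamma^{ab},\bar\gamma^{ab}$, \[(\gamma^{ab}-\bar\gamma^{ab})\bar\gamma^{-1}_{bc}=O(t^\beta),\quad(\gamma^{-1}_{ab}-\bar\gamma^{-1}_{ab})\bar\gamma^{bc}=O(t^\beta),\quad t\chi_a{}^b=t\bar\chi_a{}^b+O(t^\beta),\] \[\alpha=1+O(t^\beta),\quad\pi=A+O(t^\beta),\quad\phi=(A+O(t^\beta))\log t .\] Put $q_{max}=\max_iq_i$, and let $D_a$ be the Levi-Civita connection of $\gamma$. For $\sigma\in[0,1]$ and smooth $F^{(1)},F^{(2)},F^{(3)}$ on $(0,T]\times M$, consider the system for $(u,\nu,\varphi)$ \begin{align*} -t\partial_tu-A\nu+\sigma\bigl(&-(\pi-A)\nu+(1-\alpha)u+\alpha t^2\gamma^{ab}D_aD_b\varphi+\nu t^2\gamma^{ab}D_aD_b\phi\\ &+t^2\gamma^{ab}D_a\alpha D_b\varphi+t^2\gamma^{ab}D_a\nu D_b\phi\bigr)=F^{(1)},\\ -\nu-2Au+\sigma\bigl(&t^2\gamma^{ab}D_aD_b\nu-(t^2\chi_a{}^b\chi_b{}^a+\tfrac1n+A^2-1+\pi^2-A^2)\nu-2(\pi\alpha-A)u\bigr)=F^{(2)},\\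 -t\partial_t\varphi+u+A\nu+\sigma\bigl(&(\alpha-1)u+(\pi-A)\nu\bigr)=F^{(3)}. \end{align*} Write $\|f\|^2_{H^k}=\sum_{l=0}^k\int_M|\partial^lf|_\delta^2\,dx$ and, for a smooth function $\lambda$ on $M$, $E_{k,\lambda}[u](t)=\sum_{l=0}^k\frac12\int_M|t^{-\lambda}\partial^lu(t,\cdot)|_\delta^2\,dx$. \textbf{Proposition (improved decay estimates).} Let $\Gamma$ be an asymptotically point-wise Kasner--scalar field background with decay $\beta$ on $(0,T_1]\times\mathbb T^n$. There is $T_0\in(0,T_1]$, depending only on $\Gamma$, such that for every $T\in(0,T_0]$, every integer $k\ge0$, every $\epsilon>0$, every smooth $\lambda$ on $M$ with $\lambda<\min\{2(1-q_{max}),2A^2\}$ and every smooth $\kappa$ on $M$ with $0<\kappa<1-q_{max}$ there is a constant $C>0$, depending only on $T,k,\epsilon,\lambda,\kappa$ and $\Gamma$, with the following property. For every $\sigma\in[0,1]$, all smooth $F^{(1)},F^{(2)},F^{(3)}$ on $(0,T]\times M$, all $u_*,\varphi_*\in C^\infty(M)$ and every smooth solution $(u,\nu,\varphi)$ of the system on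 $(0,T]\times M$ with $u(T,\cdot)=u_*$ and $\varphi(T,\cdot)=\varphi_*$, \begin{align*} E_{k,\lambda}[u](t)\le C\Bigl(&\|u_*\|^2_{H^{k+2}}+\sigma\|\varphi_*\|^2_{H^{k+3}}+\|\varphi_*\|^2_{H^{k+2}}\\ &+\int_t^T\Bigl(\|s^{-\lambda}F^{(1)}\|^2_{H^{k+2}}+\|s^{-\lambda}F^{(2)}\|^2_{H^{k+2}}+\|s^{-\lambda+2\kappa-\epsilon}F^{(3)}\|^2_{H^{k+3}}\Bigr)s^{-1-2\epsilon}\,ds\Bigr) \end{align*} for all $t\in(0,T]$. -/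

import Mathlib

open Set MeasureTheory
open scoped ContDiff

noncomputable section

namespace LapseScalar

/-! ### Functions on the torus

The torus `𝕋ⁿ = ℝⁿ / ℤⁿ` carries the flat metric `δ = diag(1,…,1)` in its standard Cartesian
coordinates. A function on `𝕋ⁿ` is a function of these coordinates that is `1`-periodic in each of
them, and integrals over `𝕋ⁿ` are integrals over the unit cube. Time-dependent functions are written
`f t x`; only their values for `t ∈ (0, T]` matter. -/

/-- `f ∈ C^∞(𝕋ⁿ)`. -/
def SmoothTorus {n : ℕ} (f : (Fin n → ℝ) → ℝ) : Prop :=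
  ContDiff ℝ ∞ f ∧ ∀ x i, f (x + Pi.single i 1) = f x

/-- `f` is a smooth function on `(0, T] × 𝕋ⁿ` (smooth up to and including `t = T`). -/
def SmoothSlab {n : ℕ} (T : ℝ) (f : ℝ → (Fin n → ℝ) → ℝ) : Prop :=
  ContDiffOn ℝ ∞ (fun p : ℝ × (Fin n → ℝ) => f p.1 p.2) (Ioc 0 T ×ˢ univ) ∧
    ∀ t ∈ Ioc 0 T, ∀ x i, f t (x + Pi.single i 1) = f t x

/-- The spatial partial derivative `∂_i f`. -/
def pderiv {n : ℕ} (i : Fin n) (f : (Fin n → ℝ) → ℝ) (x : Fin n → ℝ) : ℝ :=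
  fderiv ℝ f x (Pi.single i 1)

/-- The component `∂_{a_1} ⋯ ∂_{a_l} f` of the tensor field `∂^l f`. -/
def iterPderiv {n l : ℕ} (a : Fin l → Fin n) (f : (Fin n → ℝ) → ℝ) (x : Fin n → ℝ) : ℝ :=
  iteratedFDeriv ℝ l f x (fun j => Pi.single (a j) 1)

/-- `|∂^l f|²_δ` at `x`. -/
def derivNormSq {n : ℕ} (l : ℕ) (f : (Fin n → ℝ) → ℝ) (x : Fin n → ℝ) : ℝ :=
  ∑ a : Fin l → Fin n, iterPderiv a f x ^ 2

/-- `t ∂_t f` on `(0, T]` (the derivative at `t = T` is one-sided). -/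
def eulerDeriv {n : ℕ} (T : ℝ) (f : ℝ → (Fin n → ℝ) → ℝ) : ℝ → (Fin n → ℝ) → ℝ :=
  fun t x => t * derivWithin (fun s => f s x) (Ioc 0 T) t

/-- `f = O(t^β)`: for all `k` and `l` there is a constant `C > 0` with
`|(t ∂_t)^l ∂^k f|_δ ≤ C t^{β(x)}` on `(0, T] × 𝕋ⁿ`. For tensor fields this is required of
every component. -/
def IsBigOPow {n : ℕ} (T : ℝ) (β : (Fin n → ℝ) → ℝ) (f : ℝ → (Fin n → ℝ) → ℝ) : Prop :=
  ∀ k l : ℕ, ∃ C > 0, ∀ t ∈ Ioc 0 T, ∀ x,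
    Real.sqrt (∑ a : Fin k → Fin n,
      ((eulerDeriv T)^[l] (fun s y => iterPderiv a (f s) y) t x) ^ 2) ≤ C * t ^ β x

/-! ### Norms and energies -/

/-- `‖f‖²_{δ, H^k(𝕋ⁿ)} = ∑_{l ≤ k} ∫ |∂^l f|²_δ dx`. -/
def sobolevSq {n : ℕ} (k : ℕ) (f : (Fin n → ℝ) → ℝ) : ℝ :=
  ∑ l ∈ Finset.range (k + 1), ∫ x in Icc (0 : Fin n → ℝ) 1, derivNormSq l f x

/-- The weighted energy `∑_{l ≤ k} ½ ∫ |t^{-λ} ∂^l u(t,·)|²_δ dx`. -/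
def energy {n : ℕ} (k : ℕ) (lam : (Fin n → ℝ) → ℝ) (u : ℝ → (Fin n → ℝ) → ℝ) (t : ℝ) : ℝ :=
  ∑ l ∈ Finset.range (k + 1),
    (1 / 2) * ∫ x in Icc (0 : Fin n → ℝ) 1, (t ^ (-lam x)) ^ 2 * derivNormSq l (u t) x

/-! ### Levi-Civita calculus of a spatial metric

In what follows `g x` is the matrix of the metric with upper indices `γ^{ab}` at `x`, so that
`(g x)⁻¹` is the matrix of the metric with lower indices. -/

/-- The Christoffel symbol `Γ^c_{ab}`. -/
def christoffel {n : ℕ} (g : (Fin n → ℝ) → Matrix (Fin n) (Fin n) ℝ) (c a b : Fin n)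
    (x : Fin n → ℝ) : ℝ :=
  (1 / 2) * ∑ d, g x c d *
    (pderiv a (fun y => (g y)⁻¹ b d) x + pderiv b (fun y => (g y)⁻¹ a d) x
      - pderiv d (fun y => (g y)⁻¹ a b) x)

/-- `D_a D_b f` for a scalar function `f`. -/
def covHessian {n : ℕ} (g : (Fin n → ℝ) → Matrix (Fin n) (Fin n) ℝ) (f : (Fin n → ℝ) → ℝ)
    (a b : Fin n) (x : Fin n → ℝ) : ℝ :=
  pderiv a (pderiv b f) x - ∑ c, christoffel g c a b x * pderiv c f x

/-- `γ^{ab} D_a D_b f`. -/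
def covLaplacian {n : ℕ} (g : (Fin n → ℝ) → Matrix (Fin n) (Fin n) ℝ) (f : (Fin n → ℝ) → ℝ)
    (x : Fin n → ℝ) : ℝ :=
  ∑ a, ∑ b, g x a b * covHessian g f a b x

/-- `γ^{ab} D_a f D_b h`. -/
def gradProd {n : ℕ} (g : (Fin n → ℝ) → Matrix (Fin n) (Fin n) ℝ) (f h : (Fin n → ℝ) → ℝ)
    (x : Fin n → ℝ) : ℝ :=
  ∑ a, ∑ b, g x a b * pderiv a f x * pderiv b h x

/-! ### Asymptotically point-wise Kasner--scalar field backgrounds -/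

/-- The background fields: `γ t x a b = γ^{ab}(t,x)` (the spatial metric with upper indices),
`χ t x a b = χ_a^b(t,x)`, the lapse `α`, the momentum `π` and the scalar field `φ`. -/
structure Background (n : ℕ) where
  γ : ℝ → (Fin n → ℝ) → Matrix (Fin n) (Fin n) ℝ
  χ : ℝ → (Fin n → ℝ) → Matrix (Fin n) (Fin n) ℝ
  α : ℝ → (Fin n → ℝ) → ℝ
  π : ℝ → (Fin n → ℝ) → ℝ
  φ : ℝ → (Fin n → ℝ) → ℝ

/-- The Kasner metric with upper indices, `diag(t^{-2 q_1}, …, t^{-2 q_n})`. -/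
def kasnerMetric {n : ℕ} (q : Fin n → (Fin n → ℝ) → ℝ) (t : ℝ) (x : Fin n → ℝ) :
    Matrix (Fin n) (Fin n) ℝ :=
  Matrix.diagonal fun i => t ^ (-2 * q i x)

/-- The trace-free part of the Kasner second fundamental form,
`t⁻¹ diag(1/n - q_1, …, 1/n - q_n)`. -/
def kasnerChi {n : ℕ} (q : Fin n → (Fin n → ℝ) → ℝ) (t : ℝ) (x : Fin n → ℝ) :
    Matrix (Fin n) (Fin n) ℝ :=
  Matrix.diagonal fun i => t⁻¹ * (1 / (n : ℝ) - q i x)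

/-- `q_max(x) = max{q_1(x), …, q_n(x)}`. -/
def kasnerMax {n : ℕ} (q : Fin n → (Fin n → ℝ) → ℝ) (x : Fin n → ℝ) : ℝ :=
  ⨆ i, q i x

/-- `Γ` is, on `(0, T] × 𝕋ⁿ`, an asymptotically point-wise Kasner--scalar field background with
decay `β`, Kasner exponents `q` and scalar field strength `A`. Symmetry of `χ` is not needed and not
imposed. -/
structure IsKasnerBackground {n : ℕ} (T : ℝ) (Γ : Background n)
    (q : Fin n → (Fin n → ℝ) → ℝ) (A β : (Fin n → ℝ) → ℝ) : Prop where
  smooth_γ : ∀ a b, SmoothSlab T (fun t x => Γ.γ t x a b)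
  posDef_γ : ∀ t ∈ Ioc 0 T, ∀ x, (Γ.γ t x).PosDef
  smooth_χ : ∀ a b, SmoothSlab T (fun t x => Γ.χ t x a b)
  smooth_α : SmoothSlab T Γ.α
  smooth_π : SmoothSlab T Γ.π
  smooth_φ : SmoothSlab T Γ.φ
  smooth_β : SmoothTorus β
  pos_β : ∀ x, 0 < β x
  smooth_q : ∀ i, SmoothTorus (q i)
  smooth_A : SmoothTorus A
  sum_q : ∀ x, ∑ i, q i x = 1
  sum_q_sq : ∀ x, ∑ i, q i x ^ 2 = 1 - A x ^ 2
  range_A : ∀ x, A x ∈ Icc 0 (Real.sqrt (1 - 1 / (n : ℝ)))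
  /-- `h^{ab} γ̄⁻¹_{bc} = O(t^β)` for `h^{ab} = γ^{ab} - γ̄^{ab}` -/
  asymp_γ : ∀ a c, IsBigOPow T β
    (fun t x => ((Γ.γ t x - kasnerMetric q t x) * (kasnerMetric q t x)⁻¹) a c)
  /-- `h̃_{ab} γ̄^{bc} = O(t^β)` for `h̃_{ab} = γ⁻¹_{ab} - γ̄⁻¹_{ab}` -/
  asymp_γ_inv : ∀ a c, IsBigOPow T β
    (fun t x => (((Γ.γ t x)⁻¹ - (kasnerMetric q t x)⁻¹) * kasnerMetric q t x) a c)
  asymp_χ : ∀ a b, IsBigOPow T β (fun t x => t * Γ.χ t x a b - t * kasnerChi q t x a b)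
  asymp_α : IsBigOPow T β (fun t x => Γ.α t x - 1)
  asymp_π : IsBigOPow T β (fun t x => Γ.π t x - A x)
  /-- `φ = (A + O(t^β)) log t` -/
  asymp_φ : ∃ r : ℝ → (Fin n → ℝ) → ℝ, SmoothSlab T r ∧ IsBigOPow T β r ∧
    ∀ t ∈ Ioc 0 T, ∀ x, Γ.φ t x = (A x + r t x) * Real.log t

/-! ### The linearized lapse-scalar field system with switching parameter -/

/-- `(u, ν, φ)` is a smooth solution on `(0, T] × 𝕋ⁿ` of the linearized lapse-scalar field system
`𝒜[(u,ν,φ)] + σ ℒ[(u,ν,φ)] = (F₁, F₂, F₃)` on the background `Γ` with scalar field strength `A`. -/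
structure IsSolution {n : ℕ} (T : ℝ) (Γ : Background n) (A : (Fin n → ℝ) → ℝ) (σ : ℝ)
    (F₁ F₂ F₃ u ν φ : ℝ → (Fin n → ℝ) → ℝ) : Prop where
  smooth_u : SmoothSlab T u
  smooth_ν : SmoothSlab T ν
  smooth_φ : SmoothSlab T φ
  eq_u : ∀ t ∈ Ioc 0 T, ∀ x,
    -(eulerDeriv T u t x + A x * ν t x)
      + σ * (-(Γ.π t x - A x) * ν t x
        + (1 - Γ.α t x) * u t x
        + Γ.α t x * t ^ 2 * covLaplacian (Γ.γ t) (φ t) x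
        + ν t x * t ^ 2 * covLaplacian (Γ.γ t) (Γ.φ t) x
        + t ^ 2 * gradProd (Γ.γ t) (Γ.α t) (φ t) x
        + t ^ 2 * gradProd (Γ.γ t) (ν t) (Γ.φ t) x) = F₁ t x
  eq_ν : ∀ t ∈ Ioc 0 T, ∀ x,
    -(ν t x + 2 * A x * u t x)
      + σ * (t ^ 2 * covLaplacian (Γ.γ t) (ν t) x
        - ((t ^ 2 * (Γ.χ t x * Γ.χ t x).trace + 1 / (n : ℝ) + A x ^ 2 - 1)
          + (Γ.π t x ^ 2 - A x ^ 2)) * ν t x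
        - 2 * (Γ.π t x * Γ.α t x - A x) * u t x) = F₂ t x
  eq_φ : ∀ t ∈ Ioc 0 T, ∀ x,
    -(eulerDeriv T φ t x - u t x - A x * ν t x)
      + σ * ((Γ.α t x - 1) * u t x + (Γ.π t x - A x) * ν t x) = F₃ t x

end LapseScalar

end

open Set MeasureTheory
open scoped ContDiff

noncomputable section

namespace LapseScalar

/-! ### Calculus of smooth functions on the torus -/

variable {n : ℕ}

/-! Two energy arguments are combined, both integrated backwards from `t = T` with respect to `dt /
t`. Write `P^{ab} = t² γ^{ab}` and `p_a = t^{1 - q_a}`, so that `P` is close to `diag(p_a²)`. Fix a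
constant `δ > 0` below the decay rate of the background and below half the lower bound `κ₀` of the
`1 - q_i`. Errors of relative size `t^δ` are then integrable against `dt / t` and cost only a factor
`exp(K / δ)` (`le_of_fuchsian_ineq`). From the coordinate form of the system on, `β` mostly denotes
an auxiliary positive weight and not the decay rate of the background.

The first argument is a rough estimate. For any smooth weight `β > 0` the energy is `½ ∫ t^{2β} (w
u² + σ P^{ab} ∂_a φ ∂_b φ)`. The weight `w` satisfies `w α = 1 + σ (α - 1)`, so the cross terms of
the wave equation form a divergence. The term `-A u ν` has no sign, but the lapse equation `-2 A u =
ν - σ P ∂∂ν + …` and an integration by parts turn it into `½ ν² + ½ σ P(∂ν, ∂ν)`. The remaining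
cross term `σ A P(∂ν, ∂φ)` completes a square, because `t ∂_t P` is close to `2 (1 - q_a) p_a²` and
`∑ q_i² = 1 - A²` gives `A² ≤ 1 - q_a² ≤ 2 (1 - q_a)`. Hence the energy increases in `t` at a rate
that dominates `u²`, `ν²` and the weighted gradients, and integration yields a space-time bound for
all of them. The carriers are `good_terms_le`, `exists_energyRate_lower`,
`Coeffs.Admissible.torusInt_density` and `Coeffs.Admissible.exists_timeInt_totSq_le`. The field `φ`
itself follows from its transport equation, without a factor `σ`.

The second argument gives the decay of `u`. Inserting the lapse equation into the equation for `u`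
gives `t ∂_t u = 2 A² u + A F₂ - F₁ + O(t^δ) + O(t^s)(∂^{≤2} ν, ∂^{≤2} φ)` for any `s` below `2 (1 -
q_max)` by a margin. With the weight `t^{-λ}` the leading term is favourable as long as `λ < 2 A²`.
The second derivatives are lost, but they were bounded in the first step with weight `t^β`, and they
enter here with weight `t^{s - λ}`. So `s = λ + β` is needed, with `β > 0` and `β ≥ 2 κ - λ`; the
hypotheses on `λ` and `κ` leave room for such a `β` (`exists_weight`,
`Coeffs.Admissible.exists_wInt_u_le`).

The time `T₀` must not depend on the number of derivatives. Smallness of the coefficients is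
therefore demanded only through finitely many conditions of low order (`Coeffs.Small`). Commutators
of top order always carry `t^δ`, and Young's inequality splits them into an absorbable part and a
multiple of `t^δ` times the energy density or `σ ν²`. The function `ν` is not part of the energy:
its terms are absorbed near `t = 0`, and away from `t = 0` they are controlled by an elliptic
estimate or by lower orders (`Coeffs.Admissible.exists_wInt_ν_sq_le`). Commutators without decay are
of lower order and are treated by induction on the order. -/

theorem SmoothTorus.differentiable {f : (Fin n → ℝ) → ℝ} (hf : SmoothTorus f) :
    Differentiable ℝ f := hf.1.differentiable (by simp)

theorem SmoothTorus.continuous {f : (Fin n → ℝ) → ℝ} (hf : SmoothTorus f) : Continuous f :=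
  hf.1.continuous

theorem SmoothTorus.const (c : ℝ) : SmoothTorus (fun _ : Fin n → ℝ => c) :=
  ⟨contDiff_const, fun _ _ => rfl⟩

theorem SmoothTorus.add {f g : (Fin n → ℝ) → ℝ} (hf : SmoothTorus f) (hg : SmoothTorus g) :
    SmoothTorus (fun x => f x + g x) :=
  ⟨hf.1.add hg.1, fun x i => by simp only [hf.2, hg.2]⟩

theorem SmoothTorus.mul {f g : (Fin n → ℝ) → ℝ} (hf : SmoothTorus f) (hg : SmoothTorus g) :
    SmoothTorus (fun x => f x * g x) :=
  ⟨hf.1.mul hg.1, fun x i => by simp only [hf.2, hg.2]⟩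

theorem SmoothTorus.neg {f : (Fin n → ℝ) → ℝ} (hf : SmoothTorus f) :
    SmoothTorus (fun x => -f x) :=
  ⟨hf.1.neg, fun x i => by simp only [hf.2]⟩

theorem SmoothTorus.sub {f g : (Fin n → ℝ) → ℝ} (hf : SmoothTorus f) (hg : SmoothTorus g) :
    SmoothTorus (fun x => f x - g x) :=
  ⟨hf.1.sub hg.1, fun x i => by simp only [hf.2, hg.2]⟩

theorem SmoothTorus.pow {f : (Fin n → ℝ) → ℝ} (hf : SmoothTorus f) (m : ℕ) :
    SmoothTorus (fun x => f x ^ m) :=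
  ⟨hf.1.pow m, fun x i => by simp only [hf.2]⟩

theorem SmoothTorus.sum {ι : Type*} {s : Finset ι} {f : ι → (Fin n → ℝ) → ℝ}
    (hf : ∀ i ∈ s, SmoothTorus (f i)) : SmoothTorus (fun x => ∑ i ∈ s, f i x) :=
  ⟨ContDiff.sum fun i hi => (hf i hi).1,
    fun x j => Finset.sum_congr rfl fun i hi => (hf i hi).2 x j⟩

theorem SmoothTorus.pderiv {f : (Fin n → ℝ) → ℝ} (hf : SmoothTorus f) (i : Fin n) :
    SmoothTorus (pderiv i f) := by
  refine ⟨(hf.1.fderiv_right (m := ∞) (by simp)).clm_apply contDiff_const, fun x j => ?_⟩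
  have h : (fun y => f (y + Pi.single j 1)) = f := funext fun y => hf.2 y j
  unfold LapseScalar.pderiv
  conv_rhs => rw [← h]
  rw [fderiv_comp_add_right]

theorem pderiv_add {f g : (Fin n → ℝ) → ℝ} (hf : SmoothTorus f) (hg : SmoothTorus g) (i : Fin n) :
    pderiv i (fun x => f x + g x) = fun x => pderiv i f x + pderiv i g x := by
  funext x
  simp only [pderiv]
  rw [fderiv_fun_add (hf.differentiable x) (hg.differentiable x)]; rfl

theorem pderiv_mul {f g : (Fin n → ℝ) → ℝ} (hf : SmoothTorus f) (hg : SmoothTorus g) (i : Fin n) :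
    pderiv i (fun x => f x * g x) = fun x => pderiv i f x * g x + f x * pderiv i g x := by
  funext x
  simp only [pderiv]
  rw [fderiv_fun_mul (hf.differentiable x) (hg.differentiable x)]
  simp; ring

theorem pderiv_const (c : ℝ) (i : Fin n) : pderiv i (fun _ => c) = fun _ => 0 := by
  funext x; simp [pderiv]

theorem pderiv_const_mul {f : (Fin n → ℝ) → ℝ} (c : ℝ) (hf : SmoothTorus f) (i : Fin n) :
    pderiv i (fun x => c * f x) = fun x => c * pderiv i f x := by
  rw [pderiv_mul (.const c) hf, pderiv_const]; simp

theorem pderiv_comm {f : (Fin n → ℝ) → ℝ} (hf : SmoothTorus f) (i j : Fin n) :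
    pderiv i (pderiv j f) = pderiv j (pderiv i f) := by
  funext x
  have hd : DifferentiableAt ℝ (fderiv ℝ f) x :=
    (hf.1.fderiv_right (m := ∞) (by simp)).differentiable (by simp) x
  have key : ∀ i j : Fin n, pderiv i (pderiv j f) x
      = fderiv ℝ (fderiv ℝ f) x (Pi.single i 1) (Pi.single j 1) := by
    intro i j
    unfold pderiv
    rw [fderiv_clm_apply hd (differentiableAt_const _)]
    simp
  rw [key, key]
  exact (hf.1.contDiffAt.isSymmSndFDerivAt (by
    simpa using (WithTop.coe_le_coe.2 (le_top : (2 : ℕ∞) ≤ ⊤)))).eq _ _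

/-- The iterated partial derivative `∂_{a_1} ⋯ ∂_{a_l} f` indexed by the list `[a_1, …, a_l]`. -/
def listDeriv : List (Fin n) → ((Fin n → ℝ) → ℝ) → (Fin n → ℝ) → ℝ
  | [], f => f
  | i :: L, f => listDeriv L (pderiv i f)

theorem SmoothTorus.listDeriv {f : (Fin n → ℝ) → ℝ} (hf : SmoothTorus f) (L : List (Fin n)) :
    SmoothTorus (listDeriv L f) := by
  induction L generalizing f with
  | nil => exact hf
  | cons i L ih => exact ih (hf.pderiv i)

theorem listDeriv_add {f g : (Fin n → ℝ) → ℝ} (hf : SmoothTorus f) (hg : SmoothTorus g)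
    (L : List (Fin n)) :
    listDeriv L (fun x => f x + g x) = fun x => listDeriv L f x + listDeriv L g x := by
  induction L generalizing f g with
  | nil => rfl
  | cons i L ih => simp only [listDeriv]; rw [pderiv_add hf hg, ih (hf.pderiv i) (hg.pderiv i)]

theorem listDeriv_const_mul {f : (Fin n → ℝ) → ℝ} (c : ℝ) (hf : SmoothTorus f)
    (L : List (Fin n)) :
    listDeriv L (fun x => c * f x) = fun x => c * listDeriv L f x := by
  induction L generalizing f with
  | nil => rfl
  | cons i L ih => simp only [listDeriv]; rw [pderiv_const_mul c hf, ih (hf.pderiv i)]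

theorem listDeriv_neg {f : (Fin n → ℝ) → ℝ} (hf : SmoothTorus f) (L : List (Fin n)) :
    listDeriv L (fun x => -f x) = fun x => -listDeriv L f x := by
  have := listDeriv_const_mul (-1) hf L
  simpa using this

theorem listDeriv_sub {f g : (Fin n → ℝ) → ℝ} (hf : SmoothTorus f) (hg : SmoothTorus g)
    (L : List (Fin n)) :
    listDeriv L (fun x => f x - g x) = fun x => listDeriv L f x - listDeriv L g x := by
  simp only [sub_eq_add_neg]
  rw [listDeriv_add hf hg.neg, listDeriv_neg hg]

theorem listDeriv_zero (L : List (Fin n)) :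
    listDeriv L (fun _ => 0) = fun _ => 0 := by
  have := listDeriv_const_mul 0 (SmoothTorus.const (n := n) 0) L
  simpa using this

theorem listDeriv_sum {ι : Type*} {s : Finset ι} {f : ι → (Fin n → ℝ) → ℝ}
    (hf : ∀ i ∈ s, SmoothTorus (f i)) (L : List (Fin n)) :
    listDeriv L (fun x => ∑ i ∈ s, f i x) = fun x => ∑ i ∈ s, listDeriv L (f i) x := by
  classical
  induction s using Finset.induction_on with
  | empty => simpa using listDeriv_zero L
  | insert a s ha ih =>
    simp only [Finset.sum_insert ha]
    rw [listDeriv_add (hf a (by simp)) (SmoothTorus.sum fun i hi => hf i (by simp [hi])),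
      ih fun i hi => hf i (by simp [hi])]

theorem pderiv_listDeriv {f : (Fin n → ℝ) → ℝ} (hf : SmoothTorus f) (i : Fin n)
    (L : List (Fin n)) : pderiv i (listDeriv L f) = listDeriv L (pderiv i f) := by
  induction L generalizing f with
  | nil => rfl
  | cons j L ih => simp only [listDeriv]; rw [ih (hf.pderiv j), pderiv_comm hf]

theorem iterPderiv_cons {f : (Fin n → ℝ) → ℝ} (hf : SmoothTorus f) {l : ℕ} (i : Fin n)
    (a : Fin l → Fin n) :
    iterPderiv (Fin.cons i a : Fin (l + 1) → Fin n) f = pderiv i (iterPderiv a f) := by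
  funext x
  have hd : DifferentiableAt ℝ (iteratedFDeriv ℝ l f) x :=
    hf.1.differentiable_iteratedFDeriv (by exact_mod_cast WithTop.coe_lt_top _) x
  have h := fderiv_continuousMultilinear_apply_const_apply hd (fun j => Pi.single (a j) 1)
    (Pi.single i 1)
  exact h.symm

/-- Multi-indices as lists allow structural induction, with one coordinate derivative peeled off at
a time; this is the bridge back to the tensor components in the statement. -/
theorem iterPderiv_eq_listDeriv {f : (Fin n → ℝ) → ℝ} (hf : SmoothTorus f) {l : ℕ}
    (a : Fin l → Fin n) : iterPderiv a f = listDeriv (List.ofFn a) f := by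
  induction l with
  | zero => funext x; simp [iterPderiv, listDeriv]
  | succ l ih =>
    rw [← Fin.cons_self_tail a, iterPderiv_cons hf, ih, List.ofFn_cons, listDeriv,
      pderiv_listDeriv hf]

/-! ### Sums over multi-indices -/

/-- The sum of `F` over all lists of length `l`. -/
def levelSum (l : ℕ) (F : List (Fin n) → ℝ) : ℝ := ∑ a : Fin l → Fin n, F (List.ofFn a)

/-- The sum of `F` over all lists of length less than `m`. -/
def cumSum (m : ℕ) (F : List (Fin n) → ℝ) : ℝ := ∑ l ∈ Finset.range m, levelSum l F

theorem levelSum_zero (F : List (Fin n) → ℝ) : levelSum 0 F = F [] := by simp [levelSum]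

theorem levelSum_succ (l : ℕ) (F : List (Fin n) → ℝ) :
    levelSum (l + 1) F = ∑ i, levelSum l (fun L => F (i :: L)) := by
  unfold levelSum
  rw [← (Fin.consEquiv fun _ : Fin (l + 1) => Fin n).sum_comp, Fintype.sum_prod_type]
  simp [Fin.consEquiv]

theorem levelSum_nonneg {l : ℕ} {F : List (Fin n) → ℝ} (hF : ∀ L, 0 ≤ F L) : 0 ≤ levelSum l F :=
  Finset.sum_nonneg fun _ _ => hF _

theorem cumSum_nonneg {m : ℕ} {F : List (Fin n) → ℝ} (hF : ∀ L, 0 ≤ F L) : 0 ≤ cumSum m F :=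
  Finset.sum_nonneg fun _ _ => levelSum_nonneg hF

theorem cumSum_succ (m : ℕ) (F : List (Fin n) → ℝ) :
    cumSum (m + 1) F = cumSum m F + levelSum m F := Finset.sum_range_succ _ _

theorem le_levelSum {F : List (Fin n) → ℝ} (hF : ∀ L, 0 ≤ F L) (L : List (Fin n)) :
    F L ≤ levelSum L.length F := by
  have := Finset.single_le_sum (f := fun a : Fin L.length → Fin n => F (List.ofFn a))
    (fun _ _ => hF _) (Finset.mem_univ L.get)
  simpa [levelSum] using this

theorem levelSum_le_cumSum {F : List (Fin n) → ℝ} (hF : ∀ L, 0 ≤ F L) {l m : ℕ} (h : l < m) :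
    levelSum l F ≤ cumSum m F :=
  Finset.single_le_sum (f := fun l => levelSum l F) (fun _ _ => levelSum_nonneg hF)
    (Finset.mem_range.2 h)

theorem le_cumSum {F : List (Fin n) → ℝ} (hF : ∀ L, 0 ≤ F L) {L : List (Fin n)} {m : ℕ}
    (h : L.length < m) : F L ≤ cumSum m F :=
  (le_levelSum hF L).trans (levelSum_le_cumSum hF h)

theorem cumSum_le_cumSum {F : List (Fin n) → ℝ} (hF : ∀ L, 0 ≤ F L) {l m : ℕ} (h : l ≤ m) :
    cumSum l F ≤ cumSum m F :=
  Finset.sum_le_sum_of_subset_of_nonneg (Finset.range_mono h) fun _ _ _ => levelSum_nonneg hF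

theorem levelSum_mono {F G : List (Fin n) → ℝ} {l : ℕ} (h : ∀ L, L.length = l → F L ≤ G L) :
    levelSum l F ≤ levelSum l G := Finset.sum_le_sum fun _ _ => h _ (by simp)

theorem cumSum_mono {F G : List (Fin n) → ℝ} {m : ℕ} (h : ∀ L, L.length < m → F L ≤ G L) :
    cumSum m F ≤ cumSum m G :=
  Finset.sum_le_sum fun l hl => levelSum_mono fun L hL => h L (by simpa [hL] using hl)

theorem levelSum_add (l : ℕ) (F G : List (Fin n) → ℝ) :
    levelSum l (fun L => F L + G L) = levelSum l F + levelSum l G := Finset.sum_add_distrib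

theorem cumSum_add (m : ℕ) (F G : List (Fin n) → ℝ) :
    cumSum m (fun L => F L + G L) = cumSum m F + cumSum m G := by
  simp [cumSum, levelSum_add, Finset.sum_add_distrib]

theorem levelSum_const_mul (l : ℕ) (c : ℝ) (F : List (Fin n) → ℝ) :
    levelSum l (fun L => c * F L) = c * levelSum l F := by simp [levelSum, Finset.mul_sum]

theorem cumSum_const_mul (m : ℕ) (c : ℝ) (F : List (Fin n) → ℝ) :
    cumSum m (fun L => c * F L) = c * cumSum m F := by
  simp [cumSum, levelSum_const_mul, Finset.mul_sum]

theorem levelSum_const (l : ℕ) (c : ℝ) :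
    levelSum l (fun _ : List (Fin n) => c) = (n : ℝ) ^ l * c := by
  simp [levelSum]

theorem cumSum_cons_le {F : List (Fin n) → ℝ} (hF : ∀ L, 0 ≤ F L) (i : Fin n) (m : ℕ) :
    cumSum m (fun L => F (i :: L)) ≤ cumSum (m + 1) F := by
  unfold cumSum
  rw [Finset.sum_range_succ' (fun l => levelSum l F)]
  have : ∑ l ∈ Finset.range m, levelSum l (fun L => F (i :: L))
      ≤ ∑ l ∈ Finset.range m, levelSum (l + 1) F := by
    refine Finset.sum_le_sum fun l _ => ?_
    rw [levelSum_succ]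
    exact Finset.single_le_sum (f := fun i => levelSum l (fun L => F (i :: L)))
      (fun _ _ => levelSum_nonneg fun _ => hF _) (Finset.mem_univ i)
  linarith [levelSum_nonneg (l := 0) hF]

theorem levelSum_sq_le (l : ℕ) (F : List (Fin n) → ℝ) :
    levelSum l F ^ 2 ≤ (n : ℝ) ^ l * levelSum l (fun L => F L ^ 2) := by
  have := sq_sum_le_card_mul_sum_sq (s := (Finset.univ : Finset (Fin l → Fin n)))
    (f := fun a => F (List.ofFn a))
  simpa [levelSum] using this

theorem exists_cumSum_sq_le (m : ℕ) : ∃ C > 0, ∀ F : List (Fin n) → ℝ,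
    cumSum m F ^ 2 ≤ C * cumSum m (fun L => F L ^ 2) := by
  refine ⟨m * (∑ l ∈ Finset.range m, (n : ℝ) ^ l) + 1, by positivity, fun F => ?_⟩
  have h1 := sq_sum_le_card_mul_sum_sq (s := Finset.range m) (f := fun l => levelSum l F)
  have h2 : ∑ l ∈ Finset.range m, levelSum l F ^ 2
      ≤ (∑ l ∈ Finset.range m, (n : ℝ) ^ l) * cumSum m (fun L => F L ^ 2) := by
    rw [Finset.sum_mul]
    refine Finset.sum_le_sum fun l hl => (levelSum_sq_le l F).trans ?_
    exact mul_le_mul_of_nonneg_left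
      (levelSum_le_cumSum (fun _ => sq_nonneg _) (Finset.mem_range.1 hl)) (by positivity)
  have h3 : 0 ≤ cumSum m (fun L => F L ^ 2) := cumSum_nonneg fun _ => sq_nonneg _
  simp only [Finset.card_range] at h1
  calc cumSum m F ^ 2 ≤ m * ∑ l ∈ Finset.range m, levelSum l F ^ 2 := h1
    _ ≤ m * ((∑ l ∈ Finset.range m, (n : ℝ) ^ l) * cumSum m (fun L => F L ^ 2)) := by gcongr
    _ ≤ _ := by nlinarith

/-- The sum of `|∂_L f|` over the multi-indices of order less than `m`. -/
def jetAbs (m : ℕ) (f : (Fin n → ℝ) → ℝ) (x : Fin n → ℝ) : ℝ :=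
  cumSum m fun L => |listDeriv L f x|

/-- The sum of `|∂_L f|²` over the multi-indices of order less than `m`. -/
def jetSq (m : ℕ) (f : (Fin n → ℝ) → ℝ) (x : Fin n → ℝ) : ℝ :=
  cumSum m fun L => listDeriv L f x ^ 2

theorem jetAbs_nonneg (m : ℕ) (f : (Fin n → ℝ) → ℝ) (x : Fin n → ℝ) : 0 ≤ jetAbs m f x :=
  cumSum_nonneg fun _ => abs_nonneg _

theorem jetSq_nonneg (m : ℕ) (f : (Fin n → ℝ) → ℝ) (x : Fin n → ℝ) : 0 ≤ jetSq m f x :=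
  cumSum_nonneg fun _ => sq_nonneg _

theorem abs_listDeriv_le_jetAbs {m : ℕ} (f : (Fin n → ℝ) → ℝ) (x : Fin n → ℝ)
    {L : List (Fin n)} (h : L.length < m) : |listDeriv L f x| ≤ jetAbs m f x :=
  le_cumSum (F := fun L => |listDeriv L f x|) (fun _ => abs_nonneg _) h

theorem jetAbs_mono {l m : ℕ} (h : l ≤ m) (f : (Fin n → ℝ) → ℝ) (x : Fin n → ℝ) :
    jetAbs l f x ≤ jetAbs m f x := cumSum_le_cumSum (fun _ => abs_nonneg _) h

theorem jetSq_mono {l m : ℕ} (h : l ≤ m) (f : (Fin n → ℝ) → ℝ) (x : Fin n → ℝ) :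
    jetSq l f x ≤ jetSq m f x := cumSum_le_cumSum (fun _ => sq_nonneg _) h

theorem jetAbs_pderiv_le (m : ℕ) (f : (Fin n → ℝ) → ℝ) (i : Fin n) (x : Fin n → ℝ) :
    jetAbs m (pderiv i f) x ≤ jetAbs (m + 1) f x :=
  cumSum_cons_le (F := fun L => |listDeriv L f x|) (fun _ => abs_nonneg _) i m

theorem jetSq_pderiv_le (m : ℕ) (f : (Fin n → ℝ) → ℝ) (i : Fin n) (x : Fin n → ℝ) :
    jetSq m (pderiv i f) x ≤ jetSq (m + 1) f x :=
  cumSum_cons_le (F := fun L => listDeriv L f x ^ 2) (fun _ => sq_nonneg _) i m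

theorem exists_jetAbs_sq_le (n m : ℕ) : ∃ C > 0, ∀ (f : (Fin n → ℝ) → ℝ) x,
    jetAbs m f x ^ 2 ≤ C * jetSq m f x := by
  obtain ⟨C, hC, h⟩ := exists_cumSum_sq_le (n := n) m
  refine ⟨C, hC, fun f x => ?_⟩
  simpa [jetAbs, jetSq] using h fun L => |listDeriv L f x|

/-- Leibniz bound for the derivatives of a product. -/
theorem abs_listDeriv_mul_le {c f : (Fin n → ℝ) → ℝ} (hc : SmoothTorus c) (hf : SmoothTorus f)
    (L : List (Fin n)) {x : Fin n → ℝ} {w : ℝ}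
    (hw : ∀ M : List (Fin n), M.length ≤ L.length → |listDeriv M c x| ≤ w) :
    |listDeriv L (fun y => c y * f y) x| ≤ 2 ^ L.length * w * jetAbs (L.length + 1) f x := by
  induction L generalizing c f with
  | nil =>
    have h0 : |c x| ≤ w := hw [] le_rfl
    simp only [listDeriv, List.length_nil, pow_zero, one_mul, jetAbs, cumSum, zero_add,
      Finset.range_one, Finset.sum_singleton, levelSum_zero, abs_mul]
    gcongr
  | cons i L ih =>
    have w0 : 0 ≤ w := (abs_nonneg _).trans (hw [] (by simp))
    simp only [listDeriv, List.length_cons]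
    rw [pderiv_mul hc hf, listDeriv_add ((hc.pderiv i).mul hf) (hc.mul (hf.pderiv i))]
    have h1 := ih (hc.pderiv i) hf (fun M hM => hw (i :: M) (by simpa using hM))
    have h2 := ih hc (hf.pderiv i) (fun M hM => hw M (hM.trans (by simp)))
    have h3 := jetAbs_mono (Nat.le_succ (L.length + 1)) f x
    have h4 := jetAbs_pderiv_le (L.length + 1) f i x
    have h5 : (0 : ℝ) ≤ 2 ^ L.length * w := by positivity
    calc _ ≤ _ := abs_add_le _ _
      _ ≤ 2 ^ L.length * w * jetAbs (L.length + 1 + 1) f x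
          + 2 ^ L.length * w * jetAbs (L.length + 1 + 1) f x :=
        add_le_add (h1.trans (mul_le_mul_of_nonneg_left h3 h5))
          (h2.trans (mul_le_mul_of_nonneg_left h4 h5))
      _ = _ := by ring

/-- Commutator bound for the derivatives of a product. -/
theorem abs_listDeriv_mul_sub_le {c f : (Fin n → ℝ) → ℝ} (hc : SmoothTorus c)
    (hf : SmoothTorus f) (L : List (Fin n)) {x : Fin n → ℝ} {w : ℝ} (w0 : 0 ≤ w)
    (hw : ∀ M : List (Fin n), M.length ≤ L.length → |listDeriv M c x| ≤ w) :
    |listDeriv L (fun y => c y * f y) x - c x * listDeriv L f x|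
      ≤ 2 ^ L.length * w * jetAbs L.length f x := by
  induction L generalizing c f with
  | nil => simp [listDeriv, jetAbs, cumSum]
  | cons i L ih =>
    simp only [listDeriv, List.length_cons]
    rw [pderiv_mul hc hf, listDeriv_add ((hc.pderiv i).mul hf) (hc.mul (hf.pderiv i))]
    have h1 := abs_listDeriv_mul_le (hc.pderiv i) hf L (x := x) (w := w)
      (fun M hM => hw (i :: M) (by simpa using hM))
    have h2 := ih hc (hf.pderiv i) (fun M hM => hw M (hM.trans (by simp)))
    have h4 := jetAbs_pderiv_le L.length f i x
    have h5 : (0 : ℝ) ≤ 2 ^ L.length * w := by positivity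
    rw [add_sub_assoc]
    calc _ ≤ _ := abs_add_le _ _
      _ ≤ 2 ^ L.length * w * jetAbs (L.length + 1) f x
          + 2 ^ L.length * w * jetAbs (L.length + 1) f x :=
        add_le_add h1 (h2.trans (mul_le_mul_of_nonneg_left h4 h5))
      _ = _ := by ring

theorem derivNormSq_eq {f : (Fin n → ℝ) → ℝ} (hf : SmoothTorus f) (l : ℕ) (x : Fin n → ℝ) :
    derivNormSq l f x = levelSum l fun L => listDeriv L f x ^ 2 := by
  simp [derivNormSq, levelSum, iterPderiv_eq_listDeriv hf]

/-! ### Integration over the torus -/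

theorem SmoothTorus.integrableOn {f : (Fin n → ℝ) → ℝ} (hf : SmoothTorus f) :
    IntegrableOn f (Icc (0 : Fin n → ℝ) 1) :=
  hf.continuous.continuousOn.integrableOn_compact isCompact_Icc

/-- The divergence theorem on the unit cube for a vector field with a single component: the two
opposite faces contribute the same integral by periodicity and cancel. -/
theorem integral_pderiv {f : (Fin n → ℝ) → ℝ} (hf : SmoothTorus f) (i : Fin n) :
    ∫ x in Icc (0 : Fin n → ℝ) 1, pderiv i f x = 0 := by
  obtain _ | m := n
  · exact i.elim0
  have key := integral_divergence_of_hasFDerivAt_off_countable' (0 : Fin (m + 1) → ℝ) 1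
    (by intro j; simp) (fun j => if j = i then f else 0)
    (fun j x => if j = i then fderiv ℝ f x else 0) ∅ countable_empty
    (by intro j; split_ifs; exacts [hf.continuous.continuousOn, continuousOn_const])
    (by
      intro x _ j; split_ifs
      · exact (hf.differentiable x).hasFDerivAt
      · exact hasFDerivAt_const _ _)
    (by
      refine (hf.pderiv i).integrableOn.congr_fun (fun x _ => ?_) measurableSet_Icc
      rw [Finset.sum_eq_single i (fun j _ hj => by simp [hj]) (by simp)]
      simp [pderiv])
  have h1 : ∀ x : Fin (m + 1) → ℝ, ∑ j, (if j = i then fderiv ℝ f x else 0) (Pi.single j 1)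
      = pderiv i f x := by
    intro x
    rw [Finset.sum_eq_single i (fun j _ hj => by simp [hj]) (by simp)]
    simp [pderiv]
  simp only [h1] at key
  rw [key]
  refine Finset.sum_eq_zero fun j _ => ?_
  split_ifs with hj
  · rw [sub_eq_zero]
    congr 1
    funext x
    refine Eq.trans ?_ (hf.2 (j.insertNth (0 : ℝ) x) j)
    congr 1
    funext k
    refine Fin.succAboveCases j ?_ (fun k => ?_) k <;> simp
  · simp

theorem SmoothTorus.integral_mono {f g : (Fin n → ℝ) → ℝ} (hf : SmoothTorus f)
    (hg : SmoothTorus g) (h : ∀ x, f x ≤ g x) :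
    ∫ x in Icc (0 : Fin n → ℝ) 1, f x ≤ ∫ x in Icc (0 : Fin n → ℝ) 1, g x :=
  MeasureTheory.integral_mono hf.integrableOn hg.integrableOn h

theorem torus_periodic {f : (Fin n → ℝ) → ℝ} (hf : ∀ x i, f (x + Pi.single i 1) = f x)
    (x : Fin n → ℝ) (m : Fin n → ℤ) : f (x + fun i => (m i : ℝ)) = f x := by
  classical
  have key : ∀ s : Finset (Fin n), f (x + ∑ i ∈ s, (m i : ℝ) • Pi.single i (1 : ℝ)) = f x := by
    intro s
    induction s using Finset.induction_on with
    | empty => simp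
    | insert a s ha ih =>
      have hp : Function.Periodic f (Pi.single a (1 : ℝ)) := fun y => hf y a
      rw [Finset.sum_insert ha, add_comm ((m a : ℝ) • _), ← add_assoc, ← ih]
      have := (hp.zsmul (m a)) (x + ∑ i ∈ s, (m i : ℝ) • Pi.single i (1 : ℝ))
      rw [← this]
      congr 2
      ext j; simp
  have h := key Finset.univ
  rw [← h]
  congr 2
  funext j
  simp [Finset.sum_apply, Pi.single_apply]

/-- Taking fractional parts brings every point into the cube. This replaces compactness of the
torus: extrema of periodic functions are found on the cube. -/
theorem exists_mem_Icc_eq {n : ℕ} (x : Fin n → ℝ) : ∃ y ∈ Icc (0 : Fin n → ℝ) 1,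
    ∀ f : (Fin n → ℝ) → ℝ, (∀ x i, f (x + Pi.single i 1) = f x) → f x = f y := by
  refine ⟨fun i => Int.fract (x i), ⟨fun i => Int.fract_nonneg _, fun i => (Int.fract_lt_one _).le⟩,
    fun f hf => ?_⟩
  rw [← torus_periodic hf (fun i => Int.fract (x i)) fun i => ⌊x i⌋]
  congr 1
  funext i
  simp [Int.fract_add_floor]

theorem SmoothTorus.exists_pos_le {f : (Fin n → ℝ) → ℝ} (hf : SmoothTorus f) (h : ∀ x, 0 < f x) :
    ∃ c > 0, ∀ x, c ≤ f x := by
  obtain ⟨y, hy, hmin⟩ := isCompact_Icc.exists_isMinOn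
    (⟨0, ⟨le_rfl, fun _ => zero_le_one⟩⟩ : (Icc (0 : Fin n → ℝ) 1).Nonempty)
    hf.continuous.continuousOn
  refine ⟨f y, h y, fun x => ?_⟩
  obtain ⟨z, hz, e⟩ := exists_mem_Icc_eq x
  rw [e f hf.2]
  exact hmin hz

theorem SmoothTorus.exists_abs_le {f : (Fin n → ℝ) → ℝ} (hf : SmoothTorus f) :
    ∃ C > 0, ∀ x, |f x| ≤ C := by
  obtain ⟨C, hC⟩ := isCompact_Icc.exists_bound_of_continuousOn
    (s := Icc (0 : Fin n → ℝ) 1) hf.continuous.continuousOn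
  refine ⟨max C 1, by positivity, fun x => ?_⟩
  obtain ⟨z, hz, e⟩ := exists_mem_Icc_eq x
  rw [e f hf.2]
  exact (hC z hz).trans (le_max_left _ _)

end LapseScalar

namespace LapseScalar

/-! ### Smooth functions on the slab -/

variable {n : ℕ} {T : ℝ}

theorem SmoothSlab.add {f g : ℝ → (Fin n → ℝ) → ℝ} (hf : SmoothSlab T f) (hg : SmoothSlab T g) :
    SmoothSlab T (fun t x => f t x + g t x) :=
  ⟨hf.1.add hg.1, fun t ht x i => by simp only [hf.2 t ht, hg.2 t ht]⟩

theorem SmoothSlab.mul {f g : ℝ → (Fin n → ℝ) → ℝ} (hf : SmoothSlab T f) (hg : SmoothSlab T g) :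
    SmoothSlab T (fun t x => f t x * g t x) :=
  ⟨hf.1.mul hg.1, fun t ht x i => by simp only [hf.2 t ht, hg.2 t ht]⟩

theorem SmoothSlab.neg {f : ℝ → (Fin n → ℝ) → ℝ} (hf : SmoothSlab T f) :
    SmoothSlab T (fun t x => -f t x) :=
  ⟨hf.1.neg, fun t ht x i => by simp only [hf.2 t ht]⟩

theorem SmoothSlab.sub {f g : ℝ → (Fin n → ℝ) → ℝ} (hf : SmoothSlab T f) (hg : SmoothSlab T g) :
    SmoothSlab T (fun t x => f t x - g t x) :=
  ⟨hf.1.sub hg.1, fun t ht x i => by simp only [hf.2 t ht, hg.2 t ht]⟩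

theorem SmoothSlab.pow {f : ℝ → (Fin n → ℝ) → ℝ} (hf : SmoothSlab T f) (m : ℕ) :
    SmoothSlab T (fun t x => f t x ^ m) :=
  ⟨hf.1.pow m, fun t ht x i => by simp only [hf.2 t ht]⟩

theorem SmoothSlab.inv {f : ℝ → (Fin n → ℝ) → ℝ} (hf : SmoothSlab T f)
    (h : ∀ t ∈ Ioc 0 T, ∀ x, f t x ≠ 0) : SmoothSlab T (fun t x => (f t x)⁻¹) :=
  ⟨hf.1.inv fun p hp => h p.1 hp.1 p.2, fun t ht x i => by simp only [hf.2 t ht]⟩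

theorem SmoothSlab.sum {ι : Type*} {s : Finset ι} {f : ι → ℝ → (Fin n → ℝ) → ℝ}
    (hf : ∀ i ∈ s, SmoothSlab T (f i)) : SmoothSlab T (fun t x => ∑ i ∈ s, f i t x) :=
  ⟨ContDiffOn.sum fun i hi => (hf i hi).1,
    fun t ht x j => Finset.sum_congr rfl fun i hi => (hf i hi).2 t ht x j⟩

theorem SmoothSlab.prod {ι : Type*} {s : Finset ι} {f : ι → ℝ → (Fin n → ℝ) → ℝ}
    (hf : ∀ i ∈ s, SmoothSlab T (f i)) : SmoothSlab T (fun t x => ∏ i ∈ s, f i t x) :=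
  ⟨contDiffOn_prod fun i hi => (hf i hi).1,
    fun t ht x j => Finset.prod_congr rfl fun i hi => (hf i hi).2 t ht x j⟩

theorem SmoothTorus.slab {f : (Fin n → ℝ) → ℝ} (hf : SmoothTorus f) (T : ℝ) :
    SmoothSlab T (fun _ => f) :=
  ⟨(hf.1.comp contDiff_snd).contDiffOn, fun _ _ => hf.2⟩

theorem SmoothSlab.const (c : ℝ) : SmoothSlab T (fun _ (_ : Fin n → ℝ) => c) :=
  (SmoothTorus.const c).slab T

theorem SmoothSlab.of_time {f : ℝ → ℝ} (hf : ContDiffOn ℝ ∞ f (Ioi 0)) :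
    SmoothSlab T (fun t (_ : Fin n → ℝ) => f t) :=
  ⟨hf.comp contDiff_fst.contDiffOn fun _ hp => hp.1.1, fun _ _ _ _ => rfl⟩

theorem SmoothSlab.log : SmoothSlab T (fun t (_ : Fin n → ℝ) => Real.log t) :=
  .of_time (Real.contDiffOn_log.mono fun _ ht => ne_of_gt (mem_Ioi.1 ht))

theorem SmoothSlab.time : SmoothSlab T (fun t (_ : Fin n → ℝ) => t) :=
  .of_time contDiffOn_id

theorem SmoothSlab.congr {f g : ℝ → (Fin n → ℝ) → ℝ} (hf : SmoothSlab T f)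
    (h : ∀ t ∈ Ioc 0 T, ∀ x, g t x = f t x) : SmoothSlab T g :=
  ⟨hf.1.congr fun p hp => h p.1 hp.1 p.2, fun t ht x i => by rw [h t ht, h t ht, hf.2 t ht]⟩

theorem SmoothSlab.rpow {s : (Fin n → ℝ) → ℝ} (hs : SmoothTorus s) :
    SmoothSlab T (fun t x => t ^ s x) := by
  have h : SmoothSlab T (fun t (x : Fin n → ℝ) => Real.log t * s x) :=
    SmoothSlab.log.mul (hs.slab T)
  have h' : SmoothSlab T (fun t (x : Fin n → ℝ) => Real.exp (Real.log t * s x)) :=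
    ⟨h.1.exp, fun t ht x i => congrArg Real.exp (h.2 t ht x i)⟩
  exact h'.congr fun t ht x => Real.rpow_def_of_pos ht.1 _

theorem SmoothSlab.mono {f : ℝ → (Fin n → ℝ) → ℝ} (hf : SmoothSlab T f) {T' : ℝ} (h : T' ≤ T) :
    SmoothSlab T' f :=
  ⟨hf.1.mono (prod_mono (Ioc_subset_Ioc_right h) le_rfl),
    fun t ht => hf.2 t (Ioc_subset_Ioc_right h ht)⟩

theorem SmoothSlab.torus {f : ℝ → (Fin n → ℝ) → ℝ} (hf : SmoothSlab T f) {t : ℝ}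
    (ht : t ∈ Ioc 0 T) : SmoothTorus (f t) := by
  refine ⟨?_, hf.2 t ht⟩
  have h : ContDiff ℝ ∞ (fun x : Fin n → ℝ => (t, x)) := contDiff_const.prodMk contDiff_id
  exact contDiffOn_univ.1 (hf.1.comp h.contDiffOn fun x _ => ⟨ht, mem_univ x⟩)

theorem uniqueDiffOn_slab : UniqueDiffOn ℝ (Ioc 0 T ×ˢ (univ : Set (Fin n → ℝ))) :=
  (uniqueDiffOn_Ioc 0 T).prod uniqueDiffOn_univ

theorem SmoothSlab.hasFDerivWithinAt {f : ℝ → (Fin n → ℝ) → ℝ} (hf : SmoothSlab T f) {t : ℝ}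
    (ht : t ∈ Ioc 0 T) (x : Fin n → ℝ) :
    HasFDerivWithinAt (fun p : ℝ × (Fin n → ℝ) => f p.1 p.2)
      (fderivWithin ℝ (fun p : ℝ × (Fin n → ℝ) => f p.1 p.2) (Ioc 0 T ×ˢ univ) (t, x))
      (Ioc 0 T ×ˢ univ) (t, x) :=
  (hf.1.differentiableOn (by simp) (t, x) ⟨ht, mem_univ x⟩).hasFDerivWithinAt

theorem SmoothSlab.pderiv_eq {f : ℝ → (Fin n → ℝ) → ℝ} (hf : SmoothSlab T f) (i : Fin n) {t : ℝ}
    (ht : t ∈ Ioc 0 T) (x : Fin n → ℝ) :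
    pderiv i (f t) x = fderivWithin ℝ (fun p : ℝ × (Fin n → ℝ) => f p.1 p.2)
      (Ioc 0 T ×ˢ univ) (t, x) (0, Pi.single i 1) := by
  have h1 : HasFDerivWithinAt (fun y : Fin n → ℝ => (t, y))
      (ContinuousLinearMap.inr ℝ ℝ (Fin n → ℝ)) univ x :=
    (hasFDerivAt_prodMk_right t x).hasFDerivWithinAt
  have h2 := (hf.hasFDerivWithinAt ht x).comp x h1 fun y _ => ⟨ht, mem_univ y⟩
  have h3 := (hasFDerivWithinAt_univ.1 h2).fderiv
  simp only [pderiv]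
  change (fderiv ℝ ((fun p : ℝ × (Fin n → ℝ) => f p.1 p.2) ∘ fun y => (t, y)) x) _ = _
  rw [h3]; simp

theorem SmoothSlab.pderiv {f : ℝ → (Fin n → ℝ) → ℝ} (hf : SmoothSlab T f) (i : Fin n) :
    SmoothSlab T (fun t => pderiv i (f t)) := by
  refine ⟨?_, fun t ht => ((hf.torus ht).pderiv i).2⟩
  refine ContDiffOn.congr (f := fun p : ℝ × (Fin n → ℝ) =>
    fderivWithin ℝ (fun p : ℝ × (Fin n → ℝ) => f p.1 p.2)
      (Ioc 0 T ×ˢ univ) p (0, Pi.single i 1)) ?_ fun p hp => hf.pderiv_eq i hp.1 p.2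
  exact (hf.1.fderivWithin (m := ∞) uniqueDiffOn_slab (by simp)).clm_apply contDiffOn_const

theorem SmoothSlab.listDeriv {f : ℝ → (Fin n → ℝ) → ℝ} (hf : SmoothSlab T f)
    (L : List (Fin n)) : SmoothSlab T (fun t => listDeriv L (f t)) := by
  induction L generalizing f with
  | nil => exact hf
  | cons i L ih => exact ih (hf.pderiv i)

/-- The time derivative on `(0, T]`, one-sided at `T`. -/
def timeDeriv (T : ℝ) (f : ℝ → (Fin n → ℝ) → ℝ) : ℝ → (Fin n → ℝ) → ℝ :=
  fun t x => derivWithin (fun s => f s x) (Ioc 0 T) t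

theorem SmoothSlab.hasDerivWithinAt {f : ℝ → (Fin n → ℝ) → ℝ} (hf : SmoothSlab T f) {t : ℝ}
    (ht : t ∈ Ioc 0 T) (x : Fin n → ℝ) :
    HasDerivWithinAt (fun s => f s x) (fderivWithin ℝ (fun p : ℝ × (Fin n → ℝ) => f p.1 p.2)
      (Ioc 0 T ×ˢ univ) (t, x) (1, 0)) (Ioc 0 T) t := by
  have h1 : HasFDerivWithinAt (fun s : ℝ => (s, x))
      (ContinuousLinearMap.inl ℝ ℝ (Fin n → ℝ)) (Ioc 0 T) t :=
    (hasFDerivAt_prodMk_left t x).hasFDerivWithinAt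
  have h2 := (hf.hasFDerivWithinAt ht x).comp t h1
    (fun y hy => (⟨hy, mem_univ x⟩ : (y, x) ∈ Ioc 0 T ×ˢ univ))
  have h3 := h2.hasDerivWithinAt
  rw [ContinuousLinearMap.comp_apply, ContinuousLinearMap.inl_apply] at h3
  exact h3

theorem SmoothSlab.timeDeriv_eq {f : ℝ → (Fin n → ℝ) → ℝ} (hf : SmoothSlab T f) {t : ℝ}
    (ht : t ∈ Ioc 0 T) (x : Fin n → ℝ) :
    timeDeriv T f t x = fderivWithin ℝ (fun p : ℝ × (Fin n → ℝ) => f p.1 p.2)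
      (Ioc 0 T ×ˢ univ) (t, x) (1, 0) :=
  (hf.hasDerivWithinAt ht x).derivWithin (uniqueDiffOn_Ioc 0 T t ht)

theorem SmoothSlab.timeDeriv {f : ℝ → (Fin n → ℝ) → ℝ} (hf : SmoothSlab T f) :
    SmoothSlab T (timeDeriv T f) := by
  refine ⟨?_, fun t ht x i => ?_⟩
  · refine ContDiffOn.congr (f := fun p : ℝ × (Fin n → ℝ) =>
      fderivWithin ℝ (fun p : ℝ × (Fin n → ℝ) => f p.1 p.2)
        (Ioc 0 T ×ˢ univ) p (1, 0)) ?_ fun p hp => hf.timeDeriv_eq hp.1 p.2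
    exact (hf.1.fderivWithin (m := ∞) uniqueDiffOn_slab (by simp)).clm_apply contDiffOn_const
  · exact derivWithin_congr (fun s hs => hf.2 s hs x i) (hf.2 t ht x i)

theorem SmoothSlab.hasDerivAt {f : ℝ → (Fin n → ℝ) → ℝ} (hf : SmoothSlab T f) {t : ℝ}
    (ht : t ∈ Ioo 0 T) (x : Fin n → ℝ) :
    HasDerivAt (fun s => f s x) (LapseScalar.timeDeriv T f t x) t := by
  have ht' : t ∈ Ioc 0 T := ⟨ht.1, ht.2.le⟩
  rw [hf.timeDeriv_eq ht']
  exact (hf.hasDerivWithinAt ht' x).hasDerivAt (Ioc_mem_nhds ht.1 ht.2)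

/-- Symmetry of the second derivative in space-time. At interior times the derivatives within the
slab agree near the point with the full ones; the energy inequalities need only such times, since
they are integrated over an interval. -/
theorem SmoothSlab.timeDeriv_pderiv {f : ℝ → (Fin n → ℝ) → ℝ} (hf : SmoothSlab T f) {t : ℝ}
    (ht : t ∈ Ioo 0 T) (i : Fin n) :
    LapseScalar.timeDeriv T (fun s => LapseScalar.pderiv i (f s)) t
      = LapseScalar.pderiv i (LapseScalar.timeDeriv T f t) := by
  funext x
  set S : Set (ℝ × (Fin n → ℝ)) := Ioc 0 T ×ˢ univ
  set F : ℝ × (Fin n → ℝ) → ℝ := fun p => f p.1 p.2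
  have ht' : t ∈ Ioc 0 T := ⟨ht.1, ht.2.le⟩
  have hS : S ∈ nhds (t, x) := prod_mem_nhds (Ioc_mem_nhds ht.1 ht.2) Filter.univ_mem
  have hc : ContDiffAt ℝ ∞ F (t, x) := hf.1.contDiffAt hS
  have hd : DifferentiableAt ℝ (fderiv ℝ F) (t, x) :=
    (hc.fderiv_right (m := ∞) (by simp)).differentiableAt (by simp)
  have hev : ∀ᶠ p in nhds (t, x), fderivWithin ℝ F S p = fderiv ℝ F p := by
    filter_upwards [eventually_mem_nhds_iff.2 hS] with p hp
    exact fderivWithin_of_mem_nhds hp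
  have hloc : ∀ᶠ p in nhds (t, x), p.1 ∈ Ioc 0 T := by
    filter_upwards [hS] with p hp using hp.1
  rw [(hf.pderiv i).timeDeriv_eq ht', hf.timeDeriv.pderiv_eq i ht',
    fderivWithin_of_mem_nhds hS, fderivWithin_of_mem_nhds hS]
  have e1 : (fun p : ℝ × (Fin n → ℝ) => LapseScalar.pderiv i (f p.1) p.2) =ᶠ[nhds (t, x)]
      fun p => fderiv ℝ F p (0, Pi.single i 1) := by
    filter_upwards [hev, hloc] with p hp hp'
    rw [hf.pderiv_eq i hp' p.2, ← hp]
  have e2 : (fun p : ℝ × (Fin n → ℝ) => LapseScalar.timeDeriv T f p.1 p.2) =ᶠ[nhds (t, x)]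
      fun p => fderiv ℝ F p (1, 0) := by
    filter_upwards [hev, hloc] with p hp hp'
    rw [hf.timeDeriv_eq hp' p.2, ← hp]
  rw [e1.fderiv_eq, e2.fderiv_eq, fderiv_clm_apply hd (differentiableAt_const _),
    fderiv_clm_apply hd (differentiableAt_const _)]
  simp only [fderiv_fun_const, Pi.zero_apply, ContinuousLinearMap.comp_zero, zero_add,
    ContinuousLinearMap.flip_apply]
  exact (hc.isSymmSndFDerivAt (by
    simpa using (WithTop.coe_le_coe.2 (le_top : (2 : ℕ∞) ≤ ⊤)))).eq _ _

theorem SmoothSlab.timeDeriv_listDeriv {f : ℝ → (Fin n → ℝ) → ℝ} (hf : SmoothSlab T f) {t : ℝ}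
    (ht : t ∈ Ioo 0 T) (L : List (Fin n)) :
    LapseScalar.timeDeriv T (fun s => LapseScalar.listDeriv L (f s)) t
      = LapseScalar.listDeriv L (LapseScalar.timeDeriv T f t) := by
  induction L generalizing f with
  | nil => rfl
  | cons i L ih =>
    have := ih (hf.pderiv i)
    simp only [LapseScalar.listDeriv]
    rw [this, hf.timeDeriv_pderiv ht]

theorem SmoothSlab.hasDerivAt_listDeriv {f : ℝ → (Fin n → ℝ) → ℝ} (hf : SmoothSlab T f) {t : ℝ}
    (ht : t ∈ Ioo 0 T) (L : List (Fin n)) (x : Fin n → ℝ) :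
    HasDerivAt (fun s => LapseScalar.listDeriv L (f s) x)
      (LapseScalar.listDeriv L (LapseScalar.timeDeriv T f t) x) t := by
  rw [← hf.timeDeriv_listDeriv ht]
  exact (hf.listDeriv L).hasDerivAt ht x

/-! ### Integrals over the torus depending on time -/

/-- The integral over the torus. -/
def torusInt (f : (Fin n → ℝ) → ℝ) : ℝ := ∫ x in Icc (0 : Fin n → ℝ) 1, f x

theorem torusInt_add {f g : (Fin n → ℝ) → ℝ} (hf : SmoothTorus f) (hg : SmoothTorus g) :
    torusInt (fun x => f x + g x) = torusInt f + torusInt g :=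
  integral_add hf.integrableOn hg.integrableOn

theorem torusInt_sub {f g : (Fin n → ℝ) → ℝ} (hf : SmoothTorus f) (hg : SmoothTorus g) :
    torusInt (fun x => f x - g x) = torusInt f - torusInt g :=
  integral_sub hf.integrableOn hg.integrableOn

theorem torusInt_const_mul (c : ℝ) (f : (Fin n → ℝ) → ℝ) :
    torusInt (fun x => c * f x) = c * torusInt f := integral_const_mul _ _

theorem torusInt_sum {ι : Type*} {s : Finset ι} {f : ι → (Fin n → ℝ) → ℝ}
    (hf : ∀ i ∈ s, SmoothTorus (f i)) :
    torusInt (fun x => ∑ i ∈ s, f i x) = ∑ i ∈ s, torusInt (f i) :=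
  integral_finsetSum _ fun i hi => (hf i hi).integrableOn

theorem torusInt_pderiv {f : (Fin n → ℝ) → ℝ} (hf : SmoothTorus f) (i : Fin n) :
    torusInt (pderiv i f) = 0 := integral_pderiv hf i

theorem torusInt_nonneg {f : (Fin n → ℝ) → ℝ} (h : ∀ x, 0 ≤ f x) : 0 ≤ torusInt f :=
  integral_nonneg h

theorem torusInt_mono {f g : (Fin n → ℝ) → ℝ} (hf : SmoothTorus f) (hg : SmoothTorus g)
    (h : ∀ x, f x ≤ g x) : torusInt f ≤ torusInt g := hf.integral_mono hg h

theorem SmoothSlab.continuousOn_torusInt {f : ℝ → (Fin n → ℝ) → ℝ} (hf : SmoothSlab T f) {a : ℝ}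
    (ha : 0 < a) : ContinuousOn (fun t => torusInt (f t)) (Icc a T) := by
  rw [continuousOn_iff_continuous_domRestrict]
  have hc : Continuous (Function.uncurry fun (t : Icc a T) (x : Fin n → ℝ) => f t x) := by
    have h : Continuous (fun p : Icc a T × (Fin n → ℝ) => ((p.1 : ℝ), p.2)) := by fun_prop
    exact hf.1.continuousOn.comp_continuous h
      fun p => ⟨⟨ha.trans_le p.1.2.1, p.1.2.2⟩, mem_univ _⟩
  exact continuous_parametric_integral_of_continuous hc isCompact_Icc

theorem SmoothSlab.hasDerivAt_torusInt {f : ℝ → (Fin n → ℝ) → ℝ} (hf : SmoothSlab T f) {t : ℝ}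
    (ht : t ∈ Ioo 0 T) :
    HasDerivAt (fun t => torusInt (f t)) (torusInt (LapseScalar.timeDeriv T f t)) t := by
  have h1 : t / 2 < t := by linarith [ht.1]
  have h0 : 0 < t / 2 := by linarith [ht.1]
  have hsub : ∀ s ∈ Ioo (t / 2) T, s ∈ Ioc 0 T := fun s hs => ⟨h0.trans hs.1, hs.2.le⟩
  have ht' : t ∈ Ioc 0 T := ⟨ht.1, ht.2.le⟩
  have hcont : ContinuousOn (fun p : ℝ × (Fin n → ℝ) => LapseScalar.timeDeriv T f p.1 p.2)
      (Icc (t / 2) T ×ˢ Icc 0 1) := hf.timeDeriv.1.continuousOn.mono fun p hp =>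
    ⟨⟨h0.trans_le hp.1.1, hp.1.2⟩, mem_univ _⟩
  obtain ⟨C, hC⟩ := (isCompact_Icc.prod isCompact_Icc).exists_bound_of_continuousOn hcont
  refine (hasDerivAt_integral_of_dominated_loc_of_deriv_le (bound := fun _ => C)
    (Ioo_mem_nhds h1 ht.2) ?_ ?_ ?_ ?_ ?_ ?_).2
  · filter_upwards [Ioo_mem_nhds h1 ht.2] with s hs
    exact (hf.torus (hsub s hs)).integrableOn.aestronglyMeasurable
  · exact (hf.torus ht').integrableOn
  · exact (hf.timeDeriv.torus ht').integrableOn.aestronglyMeasurable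
  · refine (ae_restrict_iff' measurableSet_Icc).2 (Filter.Eventually.of_forall fun x hx s hs => ?_)
    exact hC (s, x) ⟨⟨hs.1.le, hs.2.le⟩, hx⟩
  · exact integrableOn_const isCompact_Icc.measure_ne_top
  · refine Filter.Eventually.of_forall fun x s hs => ?_
    exact hf.hasDerivAt ⟨h0.trans hs.1, hs.2⟩ x

end LapseScalar

namespace LapseScalar

/-! ### Functions whose spatial derivatives are dominated by a power of `t` -/

variable {n : ℕ} {T : ℝ}

/-- The spatial derivatives of `f` of order at most `m` are bounded by a multiple of `t ^ s(x)`. -/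
def DomOrd (m : ℕ) (T : ℝ) (s : (Fin n → ℝ) → ℝ) (f : ℝ → (Fin n → ℝ) → ℝ) : Prop :=
  ∃ C > 0, ∀ t ∈ Ioc 0 T, ∀ x, ∀ L : List (Fin n), L.length ≤ m →
    |listDeriv L (f t) x| ≤ C * t ^ s x

/-- All spatial derivatives of the smooth function `f` are bounded by multiples of `t ^ s(x)`. -/
def IsDom (T : ℝ) (s : (Fin n → ℝ) → ℝ) (f : ℝ → (Fin n → ℝ) → ℝ) : Prop :=
  SmoothSlab T f ∧ ∀ m, DomOrd m T s f

theorem rpow_le_rpow_of_le_one {t a b : ℝ} (ht : 0 < t) (ht1 : t ≤ 1) (h : b ≤ a) :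
    t ^ a ≤ t ^ b := Real.rpow_le_rpow_of_exponent_ge ht ht1 h

theorem DomOrd.mono {m : ℕ} {s s' : (Fin n → ℝ) → ℝ} {f : ℝ → (Fin n → ℝ) → ℝ}
    (h : DomOrd m T s f) (hT : T ≤ 1) (hs : ∀ x, s' x ≤ s x) : DomOrd m T s' f := by
  obtain ⟨C, hC, h⟩ := h
  refine ⟨C, hC, fun t ht x L hL => (h t ht x L hL).trans ?_⟩
  gcongr ?_ * ?_
  exact rpow_le_rpow_of_le_one ht.1 (ht.2.trans hT) (hs x)

theorem IsDom.mono {s s' : (Fin n → ℝ) → ℝ} {f : ℝ → (Fin n → ℝ) → ℝ}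
    (h : IsDom T s f) (hT : T ≤ 1) (hs : ∀ x, s' x ≤ s x) : IsDom T s' f :=
  ⟨h.1, fun m => (h.2 m).mono hT hs⟩

theorem IsDom.restrict {s : (Fin n → ℝ) → ℝ} {f : ℝ → (Fin n → ℝ) → ℝ}
    (h : IsDom T s f) {T' : ℝ} (hT : T' ≤ T) : IsDom T' s f := by
  refine ⟨h.1.mono hT, fun m => ?_⟩
  obtain ⟨C, hC, h⟩ := h.2 m
  exact ⟨C, hC, fun t ht => h t (Ioc_subset_Ioc_right hT ht)⟩

theorem DomOrd.congr {m : ℕ} {s : (Fin n → ℝ) → ℝ} {f g : ℝ → (Fin n → ℝ) → ℝ}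
    (h : DomOrd m T s f) (e : ∀ t ∈ Ioc 0 T, ∀ x, g t x = f t x) : DomOrd m T s g := by
  obtain ⟨C, hC, h⟩ := h
  refine ⟨C, hC, fun t ht x L hL => ?_⟩
  rw [show g t = f t from funext (e t ht)]
  exact h t ht x L hL

theorem IsDom.congr {s : (Fin n → ℝ) → ℝ} {f g : ℝ → (Fin n → ℝ) → ℝ}
    (h : IsDom T s f) (e : ∀ t ∈ Ioc 0 T, ∀ x, g t x = f t x) : IsDom T s g :=
  ⟨h.1.congr e, fun m => (h.2 m).congr e⟩

theorem IsDom.add {s : (Fin n → ℝ) → ℝ} {f g : ℝ → (Fin n → ℝ) → ℝ}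
    (hf : IsDom T s f) (hg : IsDom T s g) : IsDom T s (fun t x => f t x + g t x) := by
  refine ⟨hf.1.add hg.1, fun m => ?_⟩
  obtain ⟨C, hC, h⟩ := hf.2 m
  obtain ⟨C', hC', h'⟩ := hg.2 m
  refine ⟨C + C', by positivity, fun t ht x L hL => ?_⟩
  rw [listDeriv_add (hf.1.torus ht) (hg.1.torus ht), add_mul]
  exact (abs_add_le _ _).trans (add_le_add (h t ht x L hL) (h' t ht x L hL))

theorem IsDom.neg {s : (Fin n → ℝ) → ℝ} {f : ℝ → (Fin n → ℝ) → ℝ}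
    (hf : IsDom T s f) : IsDom T s (fun t x => -f t x) := by
  refine ⟨hf.1.neg, fun m => ?_⟩
  obtain ⟨C, hC, h⟩ := hf.2 m
  refine ⟨C, hC, fun t ht x L hL => ?_⟩
  rw [listDeriv_neg (hf.1.torus ht), abs_neg]
  exact h t ht x L hL

theorem IsDom.sub {s : (Fin n → ℝ) → ℝ} {f g : ℝ → (Fin n → ℝ) → ℝ}
    (hf : IsDom T s f) (hg : IsDom T s g) : IsDom T s (fun t x => f t x - g t x) := by
  simpa only [sub_eq_add_neg] using hf.add hg.neg

theorem IsDom.zero (s : (Fin n → ℝ) → ℝ) : IsDom T s (fun _ _ => 0) :=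
  ⟨.const 0, fun m => ⟨1, one_pos, fun t ht x L _ => by
    rw [listDeriv_zero, abs_zero]
    have := Real.rpow_nonneg ht.1.le (s x)
    linarith⟩⟩

theorem IsDom.sum {ι : Type*} {I : Finset ι} {s : (Fin n → ℝ) → ℝ}
    {f : ι → ℝ → (Fin n → ℝ) → ℝ} (hf : ∀ i ∈ I, IsDom T s (f i)) :
    IsDom T s (fun t x => ∑ i ∈ I, f i t x) := by
  classical
  induction I using Finset.induction_on with
  | empty => simpa using IsDom.zero s
  | insert a I ha ih =>
    simp only [Finset.sum_insert ha]
    exact (hf a (by simp)).add (ih fun i hi => hf i (by simp [hi]))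

theorem jetAbs_le_of_forall {m : ℕ} {f : (Fin n → ℝ) → ℝ} {x : Fin n → ℝ} {w : ℝ}
    (h : ∀ L : List (Fin n), L.length ≤ m → |listDeriv L f x| ≤ w) :
    jetAbs (m + 1) f x ≤ (∑ l ∈ Finset.range (m + 1), (n : ℝ) ^ l) * w := by
  refine (cumSum_mono (G := fun _ => w) fun L hL => h L (by omega)).trans ?_
  simp [cumSum, levelSum_const, Finset.sum_mul]

theorem DomOrd.mul {m : ℕ} {s s' : (Fin n → ℝ) → ℝ} {f g : ℝ → (Fin n → ℝ) → ℝ}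
    (sf : SmoothSlab T f) (sg : SmoothSlab T g) (hf : DomOrd m T s f) (hg : DomOrd m T s' g) :
    DomOrd m T (fun x => s x + s' x) (fun t x => f t x * g t x) := by
  obtain ⟨C, hC, h⟩ := hf
  obtain ⟨C', hC', h'⟩ := hg
  refine ⟨2 ^ m * C * ((∑ l ∈ Finset.range (m + 1), (n : ℝ) ^ l) * C') + 1, by positivity,
    fun t ht x L hL => ?_⟩
  have p1 := Real.rpow_nonneg ht.1.le (s x)
  have p2 := Real.rpow_nonneg ht.1.le (s' x)
  have h1 := abs_listDeriv_mul_le (sf.torus ht) (sg.torus ht) L (x := x) (w := C * t ^ s x)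
    fun M hM => h t ht x M (hM.trans hL)
  have h2 := jetAbs_le_of_forall fun M hM => h' t ht x M hM
  have h3 := jetAbs_mono (Nat.succ_le_succ hL) (g t) x
  have h4 : (2 : ℝ) ^ L.length ≤ 2 ^ m := pow_le_pow_right₀ (by norm_num) hL
  rw [Real.rpow_add ht.1]
  calc _ ≤ _ := h1
    _ ≤ 2 ^ m * (C * t ^ s x) * ((∑ l ∈ Finset.range (m + 1), (n : ℝ) ^ l) * (C' * t ^ s' x)) := by
      gcongr
      · exact jetAbs_nonneg _ _ _
      · exact h3.trans h2
    _ = 2 ^ m * C * ((∑ l ∈ Finset.range (m + 1), (n : ℝ) ^ l) * C') * (t ^ s x * t ^ s' x) := by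
      ring
    _ ≤ _ := by
      have : 0 ≤ t ^ s x * t ^ s' x := by positivity
      nlinarith

theorem IsDom.mul {s s' : (Fin n → ℝ) → ℝ} {f g : ℝ → (Fin n → ℝ) → ℝ}
    (hf : IsDom T s f) (hg : IsDom T s' g) :
    IsDom T (fun x => s x + s' x) (fun t x => f t x * g t x) :=
  ⟨hf.1.mul hg.1, fun m => (hf.2 m).mul hf.1 hg.1 (hg.2 m)⟩

theorem IsDom.pderiv {s : (Fin n → ℝ) → ℝ} {f : ℝ → (Fin n → ℝ) → ℝ}
    (hf : IsDom T s f) (i : Fin n) : IsDom T s (fun t => pderiv i (f t)) := by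
  refine ⟨hf.1.pderiv i, fun m => ?_⟩
  obtain ⟨C, hC, h⟩ := hf.2 (m + 1)
  exact ⟨C, hC, fun t ht x L hL => h t ht x (i :: L) (by simpa using hL)⟩

theorem DomOrd.of_pderiv {m : ℕ} {s : (Fin n → ℝ) → ℝ} {f : ℝ → (Fin n → ℝ) → ℝ}
    (h0 : DomOrd 0 T s f) (h : ∀ i, DomOrd m T s (fun t => LapseScalar.pderiv i (f t))) :
    DomOrd (m + 1) T s f := by
  obtain ⟨C, hC, h0⟩ := h0
  choose C' hC' h using h
  refine ⟨C + ∑ i, C' i, add_pos_of_pos_of_nonneg hC (Finset.sum_nonneg fun i _ => (hC' i).le),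
    fun t ht x L hL => ?_⟩
  have p1 := Real.rpow_nonneg ht.1.le (s x)
  have p2 : 0 ≤ ∑ i, C' i := Finset.sum_nonneg fun i _ => (hC' i).le
  cases L with
  | nil => exact (h0 t ht x [] le_rfl).trans (by gcongr; linarith)
  | cons i L =>
    refine (h i t ht x L (by simpa using hL)).trans ?_
    gcongr
    have := Finset.single_le_sum (f := C') (fun i _ => (hC' i).le) (Finset.mem_univ i)
    linarith

theorem IsDom.torus {f : (Fin n → ℝ) → ℝ} (hf : SmoothTorus f) :
    IsDom T (fun _ => 0) (fun _ => f) := by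
  refine ⟨hf.slab T, fun m => ?_⟩
  induction m generalizing f with
  | zero =>
    obtain ⟨C, hC, h⟩ := hf.exists_abs_le
    refine ⟨C, hC, fun t ht x L hL => ?_⟩
    obtain rfl : L = [] := List.length_eq_zero_iff.1 (by omega)
    simpa [listDeriv] using h x
  | succ m ih =>
    refine DomOrd.of_pderiv ?_ fun i => ih (hf.pderiv i)
    obtain ⟨C, hC, h⟩ := hf.exists_abs_le
    refine ⟨C, hC, fun t ht x L hL => ?_⟩
    obtain rfl : L = [] := List.length_eq_zero_iff.1 (by omega)
    simpa [listDeriv] using h x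

theorem IsDom.of_time {f : ℝ → ℝ} (hf : ContDiffOn ℝ ∞ f (Ioi 0)) {s C : ℝ}
    (h : ∀ t ∈ Ioc 0 T, |f t| ≤ C * t ^ s) :
    IsDom T (fun _ => s) (fun t (_ : Fin n → ℝ) => f t) := by
  refine ⟨.of_time hf, fun m => ⟨|C| + 1, by positivity, fun t ht x L hL => ?_⟩⟩
  have p1 := Real.rpow_nonneg ht.1.le s
  cases L with
  | nil =>
    refine (h t ht).trans ?_
    gcongr
    linarith [le_abs_self C]
  | cons i L =>
    rw [listDeriv, pderiv_const, listDeriv_zero, abs_zero]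
    positivity

theorem abs_log_le_rpow {t ε : ℝ} (ht : 0 < t) (ht1 : t ≤ 1) (hε : 0 < ε) :
    |Real.log t| ≤ 1 / ε * t ^ (-ε) := by
  have h := (Real.abs_log_mul_self_rpow_lt t ε ht ht1 hε).le
  rw [abs_mul, abs_of_nonneg (Real.rpow_nonneg ht.le ε)] at h
  rw [Real.rpow_neg ht.le]
  have := Real.rpow_pos_of_pos ht ε
  rwa [← div_eq_mul_inv, le_div_iff₀ this]

theorem IsDom.log (hT : T ≤ 1) {ε : ℝ} (hε : 0 < ε) :
    IsDom T (fun _ => -ε) (fun t (_ : Fin n → ℝ) => Real.log t) :=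
  .of_time (Real.contDiffOn_log.mono fun _ ht => ne_of_gt (mem_Ioi.1 ht)) fun _ ht =>
    abs_log_le_rpow ht.1 (ht.2.trans hT) hε

theorem IsDom.rpow_const (c : ℝ) : IsDom T (fun _ => c) (fun t (_ : Fin n → ℝ) => t ^ c) :=
  .of_time (C := 1) (fun t ht =>
    (Real.contDiffAt_rpow_const_of_ne (ne_of_gt (mem_Ioi.1 ht))).contDiffWithinAt) fun t ht => by
      rw [abs_of_nonneg (Real.rpow_nonneg ht.1.le _), one_mul]

theorem pderiv_rpow {s : (Fin n → ℝ) → ℝ} (hs : SmoothTorus s) {t : ℝ} (ht : 0 < t) (i : Fin n) :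
    pderiv i (fun x => t ^ s x) = fun x => (Real.log t * pderiv i s x) * t ^ s x := by
  funext x
  have h := ((hs.differentiable x).hasFDerivAt.const_rpow ht).fderiv
  simp only [pderiv]
  rw [h]
  simp
  ring

/-- Each spatial derivative of `t ^ s(x)` produces a factor `log t`. An arbitrarily small loss `ε`
in the exponent absorbs all of them, half of it being spent on the new logarithm at every induction
step. This is the origin of the `ε` in all bounds on the coefficients. -/
theorem IsDom.rpow {s : (Fin n → ℝ) → ℝ} (hs : SmoothTorus s) (hT : T ≤ 1) {ε : ℝ} (hε : 0 < ε) :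
    IsDom T (fun x => s x - ε) (fun t x => t ^ s x) := by
  refine ⟨.rpow hs, fun m => ?_⟩
  have h0 : ∀ ε > 0, DomOrd 0 T (fun x => s x - ε) (fun t x => t ^ s x) := by
    refine fun ε hε => ⟨1, one_pos, fun t ht x L hL => ?_⟩
    obtain rfl : L = [] := List.length_eq_zero_iff.1 (by omega)
    simp only [listDeriv, one_mul]
    rw [abs_of_nonneg (Real.rpow_nonneg ht.1.le _)]
    exact rpow_le_rpow_of_le_one ht.1 (ht.2.trans hT) (by linarith)
  induction m generalizing ε with
  | zero => exact h0 ε hε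
  | succ m ih =>
    refine DomOrd.of_pderiv (h0 ε hε) fun i => ?_
    have h2 : 0 < ε / 2 := by linarith
    have d1 := (IsDom.log (n := n) hT h2).mul (IsDom.torus (T := T) (hs.pderiv i))
    have d2 := DomOrd.mul d1.1 (.rpow hs) (d1.2 m) (ih h2)
    refine (d2.mono hT fun x => le_of_eq ?_).congr fun t ht x => by rw [pderiv_rpow hs ht.1]
    ring

theorem IsDom.abs_le {s : (Fin n → ℝ) → ℝ} {f : ℝ → (Fin n → ℝ) → ℝ} (hf : IsDom T s f) :
    ∃ C > 0, ∀ t ∈ Ioc 0 T, ∀ x, |f t x| ≤ C * t ^ s x := by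
  obtain ⟨C, hC, h⟩ := hf.2 0
  exact ⟨C, hC, fun t ht x => h t ht x [] le_rfl⟩

theorem IsDom.listDeriv_mul_le {s : (Fin n → ℝ) → ℝ} {c : ℝ → (Fin n → ℝ) → ℝ}
    (hc : IsDom T s c) (m : ℕ) : ∃ C > 0, ∀ t ∈ Ioc 0 T, ∀ x, ∀ L : List (Fin n), L.length ≤ m →
      ∀ f, SmoothTorus f → |listDeriv L (fun y => c t y * f y) x|
        ≤ C * t ^ s x * jetAbs (L.length + 1) f x := by
  obtain ⟨C, hC, h⟩ := hc.2 m
  refine ⟨2 ^ m * C, by positivity, fun t ht x L hL f hf => ?_⟩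
  have p1 := Real.rpow_nonneg ht.1.le (s x)
  refine (abs_listDeriv_mul_le (hc.1.torus ht) hf L (x := x) (w := C * t ^ s x)
    fun M hM => h t ht x M (hM.trans hL)).trans ?_
  rw [← mul_assoc]
  have := jetAbs_nonneg (L.length + 1) f x
  gcongr
  norm_num

theorem IsDom.listDeriv_mul_sub_le {s : (Fin n → ℝ) → ℝ} {c : ℝ → (Fin n → ℝ) → ℝ}
    (hc : IsDom T s c) (m : ℕ) : ∃ C > 0, ∀ t ∈ Ioc 0 T, ∀ x, ∀ L : List (Fin n), L.length ≤ m →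
      ∀ f, SmoothTorus f → |listDeriv L (fun y => c t y * f y) x - c t x * listDeriv L f x|
        ≤ C * t ^ s x * jetAbs L.length f x := by
  obtain ⟨C, hC, h⟩ := hc.2 m
  refine ⟨2 ^ m * C, by positivity, fun t ht x L hL f hf => ?_⟩
  have p1 := Real.rpow_nonneg ht.1.le (s x)
  refine (abs_listDeriv_mul_sub_le (hc.1.torus ht) hf L (x := x) (w := C * t ^ s x) (by positivity)
    fun M hM => h t ht x M (hM.trans hL)).trans ?_
  rw [← mul_assoc]
  have := jetAbs_nonneg L.length f x
  gcongr
  norm_num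

/-- The variable rate `β(x)` is weakened to a constant `δ` below it, which is all that the Fuchsian
arguments require. No time derivatives enter. -/
theorem IsBigOPow.isDom {β : (Fin n → ℝ) → ℝ} {f : ℝ → (Fin n → ℝ) → ℝ} (h : IsBigOPow T β f)
    (hf : SmoothSlab T f) (hT : T ≤ 1) {δ : ℝ} (hδ : ∀ x, δ ≤ β x) :
    IsDom T (fun _ => δ) f := by
  refine ⟨hf, fun m => ?_⟩
  choose C hC hb using fun k => h k 0
  refine ⟨∑ k ∈ Finset.range (m + 1), C k, Finset.sum_pos (fun k _ => hC k) ⟨0, by simp⟩,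
    fun t ht x L hL => ?_⟩
  have h1 := hb L.length t ht x
  simp only [Function.iterate_zero, id] at h1
  have h2 : |listDeriv L (f t) x| ≤ Real.sqrt (∑ a : Fin L.length → Fin n,
      iterPderiv a (f t) x ^ 2) := by
    rw [← Real.sqrt_sq_eq_abs]
    refine Real.sqrt_le_sqrt ?_
    have := Finset.single_le_sum (f := fun a : Fin L.length → Fin n => iterPderiv a (f t) x ^ 2)
      (fun _ _ => sq_nonneg _) (Finset.mem_univ L.get)
    simpa [iterPderiv_eq_listDeriv (hf.torus ht)] using this
  refine (h2.trans h1).trans ?_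
  refine mul_le_mul ?_ ?_ (Real.rpow_nonneg ht.1.le _) (Finset.sum_nonneg fun k _ => (hC k).le)
  · exact Finset.single_le_sum (f := C) (fun k _ => (hC k).le)
      (Finset.mem_range.2 (Nat.lt_succ_of_le hL))
  · exact rpow_le_rpow_of_le_one ht.1 (ht.2.trans hT) (hδ x)

/-- A single time derivative without spatial derivatives is enough: it is needed for `γ` and `α`,
which occur as coefficients in the energy density. -/
theorem IsBigOPow.exists_deriv_le {β : (Fin n → ℝ) → ℝ} {f : ℝ → (Fin n → ℝ) → ℝ}
    (h : IsBigOPow T β f) (hf : SmoothSlab T f) (hT : T ≤ 1) {δ : ℝ} (hδ : ∀ x, δ ≤ β x) :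
    ∃ C > 0, ∀ t ∈ Ioo 0 T, ∀ x, |t * deriv (fun s => f s x) t| ≤ C * t ^ δ := by
  obtain ⟨C, hC, hb⟩ := h 0 1
  refine ⟨C, hC, fun t ht x => ?_⟩
  have ht' : t ∈ Ioc 0 T := ⟨ht.1, ht.2.le⟩
  have h1 := hb t ht' x
  simp only [Function.iterate_one, Finset.univ_unique, Finset.sum_singleton,
    Real.sqrt_sq_eq_abs] at h1
  have h2 : eulerDeriv T (fun s y => iterPderiv (default : Fin 0 → Fin n) (f s) y) t x
      = t * deriv (fun s => f s x) t := by
    rw [(hf.hasDerivAt ht x).deriv]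
    simp [eulerDeriv, timeDeriv, iterPderiv]
  rw [← h2]
  refine h1.trans ?_
  gcongr ?_ * ?_
  exact rpow_le_rpow_of_le_one ht.1 (ht'.2.trans hT) (hδ x)

end LapseScalar

namespace LapseScalar

/-! ### The system in coordinates -/

variable {n : ℕ} {T : ℝ}

/-- The coefficients of the lapse-scalar field system written in coordinates. -/
structure Coeffs (n : ℕ) where
  q : Fin n → (Fin n → ℝ) → ℝ
  A : (Fin n → ℝ) → ℝ
  P : Fin n → Fin n → ℝ → (Fin n → ℝ) → ℝ
  G : Fin n → ℝ → (Fin n → ℝ) → ℝ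
  B : Fin n → ℝ → (Fin n → ℝ) → ℝ
  H : Fin n → ℝ → (Fin n → ℝ) → ℝ
  α : ℝ → (Fin n → ℝ) → ℝ
  c₁ : ℝ → (Fin n → ℝ) → ℝ
  c₃ : ℝ → (Fin n → ℝ) → ℝ
  c₄ : ℝ → (Fin n → ℝ) → ℝ
  c₆ : ℝ → (Fin n → ℝ) → ℝ

/-- The bounds on the coefficients that enter the energy estimates. -/
structure Coeffs.Admissible (𝒞 : Coeffs n) (T δ κ₀ : ℝ) : Prop where
  T_pos : 0 < T
  T_le : T ≤ 1
  δ_pos : 0 < δ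
  δ_le : δ ≤ κ₀ / 2
  smooth_q : ∀ i, SmoothTorus (𝒞.q i)
  smooth_A : SmoothTorus 𝒞.A
  A_sq : ∀ x i, 𝒞.A x ^ 2 ≤ 2 * (1 - 𝒞.q i x)
  A_nonneg : ∀ x, 0 ≤ 𝒞.A x
  A_le : ∀ x, 𝒞.A x ≤ 1
  q_le : ∀ x i, κ₀ ≤ 1 - 𝒞.q i x
  le_q : ∀ x i, 1 - 𝒞.q i x ≤ 2
  P_symm : ∀ a b, ∀ t ∈ Ioc 0 T, ∀ x, 𝒞.P a b t x = 𝒞.P b a t x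
  P_dom : ∀ a b, ∀ ε > 0, IsDom T (fun x => 2 - 2 * 𝒞.q b x - ε) (𝒞.P a b)
  G_dom : ∀ b, ∀ ε > 0, IsDom T (fun x => 2 - 2 * 𝒞.q b x - ε) (𝒞.G b)
  B_dom : ∀ b, ∀ ε > 0, IsDom T (fun x => 2 - 2 * 𝒞.q b x - ε) (𝒞.B b)
  H_dom : ∀ b, ∀ ε > 0, IsDom T (fun x => 2 - 2 * 𝒞.q b x - ε) (𝒞.H b)
  α_dom : IsDom T (fun _ => δ) (fun t x => 𝒞.α t x - 1)
  c₁_dom : IsDom T (fun _ => δ) 𝒞.c₁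
  c₃_dom : IsDom T (fun _ => δ) 𝒞.c₃
  c₄_dom : IsDom T (fun _ => δ) 𝒞.c₄
  c₆_dom : IsDom T (fun _ => δ) 𝒞.c₆
  α_dot : ∃ C > 0, ∀ t ∈ Ioo 0 T, ∀ x, |t * deriv (fun s => 𝒞.α s x) t| ≤ C * t ^ δ
  P_near : ∃ C > 0, ∀ a b, ∀ t ∈ Ioc 0 T, ∀ x,
    |𝒞.P a b t x - if a = b then (t ^ (1 - 𝒞.q a x)) ^ 2 else 0|
      ≤ C * t ^ δ * (t ^ (1 - 𝒞.q a x) * t ^ (1 - 𝒞.q b x))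
  P_dot : ∃ C > 0, ∀ a b, ∀ t ∈ Ioo 0 T, ∀ x,
    |t * deriv (fun s => 𝒞.P a b s x) t
        - if a = b then 2 * (1 - 𝒞.q a x) * (t ^ (1 - 𝒞.q a x)) ^ 2 else 0|
      ≤ C * t ^ δ * (t ^ (1 - 𝒞.q a x) * t ^ (1 - 𝒞.q b x))

/-- `(u, ν, φ)` solves the system with coefficients `𝒞`. -/
structure Coeffs.Solves (𝒞 : Coeffs n) (T σ : ℝ) (F₁ F₂ F₃ u ν φ : ℝ → (Fin n → ℝ) → ℝ) :
    Prop where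
  smooth_u : SmoothSlab T u
  smooth_ν : SmoothSlab T ν
  smooth_φ : SmoothSlab T φ
  smooth_F₁ : SmoothSlab T F₁
  smooth_F₂ : SmoothSlab T F₂
  smooth_F₃ : SmoothSlab T F₃
  eq_u : ∀ t ∈ Ioc 0 T, ∀ x, t * timeDeriv T u t x = -(𝒞.A x * ν t x) - F₁ t x
    + σ * (𝒞.c₁ t x * ν t x - (𝒞.α t x - 1) * u t x
      + ∑ a, ∑ b, (𝒞.α t x * 𝒞.P a b t x) * pderiv b (pderiv a (φ t)) x
      + ∑ b, 𝒞.B b t x * pderiv b (φ t) x + ∑ b, 𝒞.H b t x * pderiv b (ν t) x)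
  eq_ν : ∀ t ∈ Ioc 0 T, ∀ x, ν t x = -(2 * 𝒞.A x * u t x) - F₂ t x
    + σ * (𝒞.c₃ t x * ν t x + 𝒞.c₄ t x * u t x
      + ∑ a, ∑ b, 𝒞.P a b t x * pderiv b (pderiv a (ν t)) x
      + ∑ b, 𝒞.G b t x * pderiv b (ν t) x)
  eq_φ : ∀ t ∈ Ioc 0 T, ∀ x, t * timeDeriv T φ t x = u t x + 𝒞.A x * ν t x - F₃ t x
    + σ * ((𝒞.α t x - 1) * u t x + 𝒞.c₆ t x * ν t x)

/-- The geometric mean of two bounds. Applied to a symmetric matrix bounded by the weight of its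
column, hence also of its row, it gives the mixed weight `p_a p_b` that quadratic forms call for. -/
theorem abs_le_mul_of_abs_le_sq {z C u v : ℝ} (hu : 0 ≤ u) (hv : 0 ≤ v) (hC : 0 ≤ C)
    (h1 : |z| ≤ C * u ^ 2) (h2 : |z| ≤ C * v ^ 2) : |z| ≤ C * (u * v) := by
  refine abs_le_of_sq_le_sq (b := C * (u * v)) ?_ (by positivity)
  calc z ^ 2 = |z| * |z| := by rw [← sq, sq_abs]
    _ ≤ (C * u ^ 2) * (C * v ^ 2) := by gcongr
    _ = _ := by ring

/-- The coefficients of the system on the background `Γ`. -/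
def Background.coeffs (Γ : Background n) (q : Fin n → (Fin n → ℝ) → ℝ) (A : (Fin n → ℝ) → ℝ) :
    Coeffs n where
  q := q
  A := A
  P a b t x := t ^ 2 * Γ.γ t x a b
  G c t x := -∑ a, ∑ b, t ^ 2 * Γ.γ t x a b * christoffel (Γ.γ t) c a b x
  B b t x := Γ.α t x * (-∑ a, ∑ d, t ^ 2 * Γ.γ t x a d * christoffel (Γ.γ t) b a d x)
    + ∑ a, t ^ 2 * Γ.γ t x a b * pderiv a (Γ.α t) x
  H b t x := ∑ a, t ^ 2 * Γ.γ t x a b * pderiv a (Γ.φ t) x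
  α := Γ.α
  c₁ t x := -(Γ.π t x - A x) + t ^ 2 * covLaplacian (Γ.γ t) (Γ.φ t) x
  c₃ t x := -((t ^ 2 * (Γ.χ t x * Γ.χ t x).trace + 1 / (n : ℝ) + A x ^ 2 - 1)
          + (Γ.π t x ^ 2 - A x ^ 2))
  c₄ t x := -(2 * (Γ.π t x * Γ.α t x - A x))
  c₆ t x := Γ.π t x - A x

theorem kasnerMetric_apply (q : Fin n → (Fin n → ℝ) → ℝ) (t : ℝ) (x : Fin n → ℝ) (a b : Fin n) :
    kasnerMetric q t x a b = if a = b then t ^ (-2 * q a x) else 0 := by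
  simp [kasnerMetric, Matrix.diagonal_apply]

theorem kasnerMetric_inv (q : Fin n → (Fin n → ℝ) → ℝ) {t : ℝ} (ht : 0 < t) (x : Fin n → ℝ) :
    (kasnerMetric q t x)⁻¹ = Matrix.diagonal fun i => t ^ (2 * q i x) := by
  refine Matrix.inv_eq_right_inv ?_
  rw [kasnerMetric, Matrix.diagonal_mul_diagonal, ← Matrix.diagonal_one]
  congr 1
  funext i
  rw [← Real.rpow_add ht]
  simp

theorem smoothSlab_det {ι : Type*} [Fintype ι] [DecidableEq ι]
    {M : ℝ → (Fin n → ℝ) → Matrix ι ι ℝ}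
    (h : ∀ a b, SmoothSlab T (fun t x => M t x a b)) : SmoothSlab T (fun t x => (M t x).det) := by
  simp only [Matrix.det_apply, Units.smul_def, zsmul_eq_mul]
  exact .sum fun s _ => (SmoothSlab.const _).mul (.prod fun i _ => h _ _)

theorem smoothSlab_inv {M : ℝ → (Fin n → ℝ) → Matrix (Fin n) (Fin n) ℝ}
    (h : ∀ a b, SmoothSlab T (fun t x => M t x a b))
    (hdet : ∀ t ∈ Ioc 0 T, ∀ x, (M t x).det ≠ 0) (a b : Fin n) :
    SmoothSlab T (fun t x => (M t x)⁻¹ a b) := by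
  simp only [Matrix.inv_def, Ring.inverse_eq_inv', Matrix.smul_apply, smul_eq_mul,
    Matrix.adjugate_apply]
  refine ((smoothSlab_det h).inv hdet).mul (smoothSlab_det fun c d => ?_)
  by_cases hc : c = b
  · subst hc; simp only [Matrix.updateRow_self]; exact .const _
  · simp only [Matrix.updateRow_ne hc]; exact h c d

/-! ### Size of the coefficients on a Kasner background -/

namespace IsKasnerBackground

variable {Γ : Background n} {q : Fin n → (Fin n → ℝ) → ℝ} {A β : (Fin n → ℝ) → ℝ}

theorem γ_symm (h : IsKasnerBackground T Γ q A β) {t : ℝ} (ht : t ∈ Ioc 0 T) (x : Fin n → ℝ)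
    (a b : Fin n) : Γ.γ t x a b = Γ.γ t x b a := by
  have := (h.posDef_γ t ht x).isHermitian.apply a b
  simpa using this.symm

theorem γ_inv_symm (h : IsKasnerBackground T Γ q A β) {t : ℝ} (ht : t ∈ Ioc 0 T)
    (x : Fin n → ℝ) (a b : Fin n) : (Γ.γ t x)⁻¹ a b = (Γ.γ t x)⁻¹ b a := by
  have := (h.posDef_γ t ht x).isHermitian.inv.apply a b
  simpa using this.symm

theorem smooth_γ_inv (h : IsKasnerBackground T Γ q A β) (a b : Fin n) :
    SmoothSlab T (fun t x => (Γ.γ t x)⁻¹ a b) :=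
  smoothSlab_inv h.smooth_γ (fun t ht x => (h.posDef_γ t ht x).det_pos.ne') a b

theorem smooth_kasner (h : IsKasnerBackground T Γ q A β) (a b : Fin n) :
    SmoothSlab T (fun t x => kasnerMetric q t x a b) := by
  simp only [kasnerMetric_apply]
  split_ifs
  · exact .rpow ((SmoothTorus.const (-2)).mul (h.smooth_q a))
  · exact .const 0

theorem kasner_dom (h : IsKasnerBackground T Γ q A β) (hT : T ≤ 1) (a b : Fin n) {ε : ℝ}
    (hε : 0 < ε) : IsDom T (fun x => -2 * q b x - ε) (fun t x => kasnerMetric q t x a b) := by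
  simp only [kasnerMetric_apply]
  split_ifs with hab
  · subst hab; exact .rpow ((SmoothTorus.const (-2)).mul (h.smooth_q a)) hT hε
  · exact .zero _

theorem γ_eq {t : ℝ} (ht : 0 < t) (x : Fin n → ℝ) (a b : Fin n) :
    Γ.γ t x a b = kasnerMetric q t x a b
      + ((Γ.γ t x - kasnerMetric q t x) * (kasnerMetric q t x)⁻¹) a b * t ^ (-2 * q b x) := by
  rw [kasnerMetric_inv q ht, Matrix.mul_diagonal, mul_assoc, ← Real.rpow_add ht]
  simp

theorem γ_inv_eq {t : ℝ} (ht : 0 < t) (x : Fin n → ℝ) (a b : Fin n) :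
    (Γ.γ t x)⁻¹ a b = (kasnerMetric q t x)⁻¹ a b
      + (((Γ.γ t x)⁻¹ - (kasnerMetric q t x)⁻¹) * kasnerMetric q t x) a b * t ^ (2 * q b x) := by
  conv_rhs => rw [kasnerMetric, Matrix.mul_diagonal, mul_assoc, ← Real.rpow_add ht]
  simp

theorem asymp_smooth (h : IsKasnerBackground T Γ q A β) (a b : Fin n) :
    SmoothSlab T (fun t x =>
      ((Γ.γ t x - kasnerMetric q t x) * (kasnerMetric q t x)⁻¹) a b) := by
  refine SmoothSlab.congr (f := fun t x => (Γ.γ t x a b - kasnerMetric q t x a b)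
    * t ^ (2 * q b x)) (((h.smooth_γ a b).sub (h.smooth_kasner a b)).mul
      (.rpow ((SmoothTorus.const 2).mul (h.smooth_q b)))) fun t ht x => ?_
  rw [kasnerMetric_inv q ht.1, Matrix.mul_diagonal, Matrix.sub_apply]

theorem asymp_inv_smooth (h : IsKasnerBackground T Γ q A β) (a b : Fin n) :
    SmoothSlab T (fun t x =>
      (((Γ.γ t x)⁻¹ - (kasnerMetric q t x)⁻¹) * kasnerMetric q t x) a b) := by
  refine SmoothSlab.congr (f := fun t x => ((Γ.γ t x)⁻¹ a b - if a = b then t ^ (2 * q b x) else 0)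
    * t ^ (-2 * q b x)) (((h.smooth_γ_inv a b).sub ?_).mul
      (.rpow ((SmoothTorus.const (-2)).mul (h.smooth_q b)))) fun t ht x => ?_
  · split_ifs
    · exact .rpow ((SmoothTorus.const 2).mul (h.smooth_q b))
    · exact .const 0
  · rw [kasnerMetric_inv q ht.1, kasnerMetric, Matrix.mul_diagonal, Matrix.sub_apply,
      Matrix.diagonal_apply]
    split_ifs with hab
    · rw [hab]
    · rfl

/-- The asymptotics control the error relative to the Kasner metric in the second index, so the
weight is that of `b` also off the diagonal. By symmetry either index may be used, and the later
estimates choose whichever cancels. -/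
theorem γ_dom (h : IsKasnerBackground T Γ q A β) (hT : T ≤ 1) (a b : Fin n) {ε : ℝ}
    (hε : 0 < ε) : IsDom T (fun x => -2 * q b x - ε) (fun t x => Γ.γ t x a b) := by
  have h1 := (h.asymp_γ a b).isDom (h.asymp_smooth a b) hT (δ := 0) fun x => (h.pos_β x).le
  have h2 := h1.mul (IsDom.rpow (T := T) ((SmoothTorus.const (-2)).mul (h.smooth_q b)) hT hε)
  exact ((h.kasner_dom hT a b hε).add (h2.mono hT fun x => by linarith)).congr
    fun t ht x => γ_eq ht.1 x a b

theorem γ_inv_dom (h : IsKasnerBackground T Γ q A β) (hT : T ≤ 1) (a b : Fin n) {ε : ℝ}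
    (hε : 0 < ε) : IsDom T (fun x => 2 * q b x - ε) (fun t x => (Γ.γ t x)⁻¹ a b) := by
  have h1 := (h.asymp_γ_inv a b).isDom (h.asymp_inv_smooth a b) hT (δ := 0)
    fun x => (h.pos_β x).le
  have h3 := IsDom.rpow (T := T) ((SmoothTorus.const 2).mul (h.smooth_q b)) hT hε
  have h2 := h1.mul h3
  have h4 : IsDom T (fun x => 2 * q b x - ε) (fun t x => (kasnerMetric q t x)⁻¹ a b) := by
    by_cases hab : a = b
    · subst hab
      exact h3.congr fun t ht x => by rw [kasnerMetric_inv q ht.1, Matrix.diagonal_apply_eq]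
    · exact (IsDom.zero _).congr fun t ht x => by
        rw [kasnerMetric_inv q ht.1, Matrix.diagonal_apply_ne _ hab]
  exact (h4.add (h2.mono hT fun x => by linarith)).congr fun t ht x => γ_inv_eq ht.1 x a b

theorem P_dom (h : IsKasnerBackground T Γ q A β) (hT : T ≤ 1) (a b : Fin n) {ε : ℝ}
    (hε : 0 < ε) : IsDom T (fun x => 2 - 2 * q b x - ε) (fun t x => t ^ 2 * Γ.γ t x a b) := by
  have h1 := (IsDom.rpow_const (n := n) (T := T) 2).mul (h.γ_dom hT a b hε)
  refine (h1.mono hT fun x => le_of_eq (by ring)).congr fun t ht x => ?_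
  rw [← Real.rpow_natCast]; norm_num

theorem P_dom' (h : IsKasnerBackground T Γ q A β) (hT : T ≤ 1) (a b : Fin n) {ε : ℝ}
    (hε : 0 < ε) : IsDom T (fun x => 2 - 2 * q a x - ε) (fun t x => t ^ 2 * Γ.γ t x a b) :=
  (h.P_dom hT b a hε).congr fun t ht x => by rw [h.γ_symm ht x a b]

theorem γ_inv_dom' (h : IsKasnerBackground T Γ q A β) (hT : T ≤ 1) (a b : Fin n) {ε : ℝ}
    (hε : 0 < ε) : IsDom T (fun x => 2 * q a x - ε) (fun t x => (Γ.γ t x)⁻¹ a b) :=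
  (h.γ_inv_dom hT b a hε).congr fun _ ht x => h.γ_inv_symm ht x a b

/-- In `γ^{ab} γ^{cd} ∂ γ⁻¹` every term of the Christoffel symbol shares an index `a` or `b` between
`γ^{ab}` and the differentiated inverse metric. Giving both factors the weight of that common index
makes `t^{-2q}` and `t^{2q}` cancel, and only `t² γ^{cd}` with the weight of `c` remains. -/
theorem G_dom (h : IsKasnerBackground T Γ q A β) (hT : T ≤ 1) (c : Fin n) {ε : ℝ}
    (hε : 0 < ε) : IsDom T (fun x => 2 - 2 * q c x - ε)
      (fun t x => -∑ a, ∑ b, t ^ 2 * Γ.γ t x a b * christoffel (Γ.γ t) c a b x) := by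
  have h3 : 0 < ε / 3 := by linarith
  refine (IsDom.sum fun a _ => IsDom.sum fun b _ => ?_).neg
  have key : ∀ d, IsDom T (fun x => 2 - 2 * q c x - ε) (fun t x => (t ^ 2 * Γ.γ t x a b)
      * (Γ.γ t x c d * (pderiv a (fun y => (Γ.γ t y)⁻¹ b d) x
        + pderiv b (fun y => (Γ.γ t y)⁻¹ a d) x - pderiv d (fun y => (Γ.γ t y)⁻¹ a b) x))) := by
    intro d
    have hc := (h.γ_dom hT d c h3).congr fun t ht x => h.γ_symm ht x c d
    have e1 := (h.P_dom hT a b h3).mul (hc.mul ((h.γ_inv_dom' hT b d h3).pderiv a))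
    have e2 := (h.P_dom' hT a b h3).mul (hc.mul ((h.γ_inv_dom' hT a d h3).pderiv b))
    have e3 := (h.P_dom' hT a b h3).mul (hc.mul ((h.γ_inv_dom' hT a b h3).pderiv d))
    have e1' := e1.mono (s' := fun x => 2 - 2 * q c x - ε) hT fun x => by linarith
    have e2' := e2.mono (s' := fun x => 2 - 2 * q c x - ε) hT fun x => by linarith
    have e3' := e3.mono (s' := fun x => 2 - 2 * q c x - ε) hT fun x => by linarith
    refine ((e1'.add e2').sub e3').congr fun t ht x => by ring
  have h1 := (IsDom.torus (T := T) (SmoothTorus.const (n := n) (1 / 2))).mul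
    (IsDom.sum (I := Finset.univ) fun d _ => key d)
  refine (h1.mono hT fun x => le_of_eq (by ring)).congr fun t ht x => ?_
  simp only [christoffel, Finset.mul_sum]
  exact Finset.sum_congr rfl fun d _ => by ring

theorem φ_dom (h : IsKasnerBackground T Γ q A β) (hT : T ≤ 1) {ε : ℝ} (hε : 0 < ε) :
    IsDom T (fun _ => -ε) Γ.φ := by
  obtain ⟨r, hr, hr', e⟩ := h.asymp_φ
  have h1 := ((IsDom.torus (T := T) h.smooth_A).add
    (hr'.isDom hr hT (δ := 0) fun x => (h.pos_β x).le)).mul (IsDom.log hT hε)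
  exact (h1.mono hT fun x => le_of_eq (by ring)).congr e

theorem H_dom (h : IsKasnerBackground T Γ q A β) (hT : T ≤ 1) (b : Fin n) {ε : ℝ} (hε : 0 < ε) :
    IsDom T (fun x => 2 - 2 * q b x - ε)
      (fun t x => ∑ a, t ^ 2 * Γ.γ t x a b * pderiv a (Γ.φ t) x) := by
  have h2 : 0 < ε / 2 := by linarith
  exact IsDom.sum fun a _ => ((h.P_dom hT a b h2).mul ((h.φ_dom hT h2).pderiv a)).mono hT
    fun x => le_of_eq (by ring)

theorem α_dom (h : IsKasnerBackground T Γ q A β) (hT : T ≤ 1) : IsDom T (fun _ => 0) Γ.α := by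
  have h1 := h.asymp_α.isDom (h.smooth_α.sub (.const 1)) hT (δ := 0) fun x => (h.pos_β x).le
  exact (h1.add (IsDom.torus (.const 1))).congr fun t ht x => by ring

theorem B_dom (h : IsKasnerBackground T Γ q A β) (hT : T ≤ 1) (b : Fin n) {ε : ℝ} (hε : 0 < ε) :
    IsDom T (fun x => 2 - 2 * q b x - ε) (fun t x =>
      Γ.α t x * (-∑ a, ∑ d, t ^ 2 * Γ.γ t x a d * christoffel (Γ.γ t) b a d x)
        + ∑ a, t ^ 2 * Γ.γ t x a b * pderiv a (Γ.α t) x) := by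
  have h1 := ((h.α_dom hT).mul (h.G_dom hT b hε)).mono (s' := fun x => 2 - 2 * q b x - ε) hT
    fun x => by linarith
  refine h1.add (IsDom.sum fun a _ => ?_)
  exact ((h.P_dom hT a b hε).mul ((h.α_dom hT).pderiv a)).mono hT fun x => by linarith

theorem covLaplacian_eq (g : (Fin n → ℝ) → Matrix (Fin n) (Fin n) ℝ) {f : (Fin n → ℝ) → ℝ}
    (hf : SmoothTorus f) (t : ℝ) (x : Fin n → ℝ) :
    t ^ 2 * covLaplacian g f x = ∑ a, ∑ b, t ^ 2 * g x a b * pderiv b (pderiv a f) x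
      + ∑ c, (-∑ a, ∑ b, t ^ 2 * g x a b * christoffel g c a b x) * pderiv c f x := by
  have h2 : ∑ c, (-∑ a, ∑ b, t ^ 2 * g x a b * christoffel g c a b x) * pderiv c f x
      = ∑ a, ∑ b, -∑ c, t ^ 2 * g x a b * (christoffel g c a b x * pderiv c f x) := by
    simp only [neg_mul, Finset.sum_mul, ← Finset.sum_neg_distrib]
    rw [Finset.sum_comm]
    refine Finset.sum_congr rfl fun a _ => ?_
    rw [Finset.sum_comm]
    exact Finset.sum_congr rfl fun b _ => Finset.sum_congr rfl fun c _ => by ring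
  rw [h2, ← Finset.sum_add_distrib, covLaplacian, Finset.mul_sum]
  refine Finset.sum_congr rfl fun a _ => ?_
  rw [← Finset.sum_add_distrib, Finset.mul_sum]
  refine Finset.sum_congr rfl fun b _ => ?_
  rw [covHessian, ← Finset.mul_sum, pderiv_comm hf a b]
  ring

/-- The background scalar field grows like `log t`. Since `2 - 2 q ≥ 2 κ₀`, two losses of `κ₀ / 4`,
one for the metric and one for the logarithm, still leave more than `δ`. -/
theorem laplacian_φ_dom (h : IsKasnerBackground T Γ q A β) (hT : T ≤ 1) {κ₀ δ : ℝ} (hκ : 0 < κ₀)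
    (hq : ∀ x i, κ₀ ≤ 1 - q i x) (hδ : δ ≤ κ₀ / 2) :
    IsDom T (fun _ => δ) (fun t x => t ^ 2 * covLaplacian (Γ.γ t) (Γ.φ t) x) := by
  have h4 : 0 < κ₀ / 4 := by linarith
  have e1 : IsDom T (fun _ => δ) (fun t x =>
      ∑ a, ∑ b, t ^ 2 * Γ.γ t x a b * pderiv b (pderiv a (Γ.φ t)) x) :=
    IsDom.sum fun a _ => IsDom.sum fun b _ =>
      ((h.P_dom hT a b h4).mul (((h.φ_dom hT h4).pderiv a).pderiv b)).mono hT
        fun x => by linarith [hq x b]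
  have e2 : IsDom T (fun _ => δ) (fun t x => ∑ c,
      (-∑ a, ∑ b, t ^ 2 * Γ.γ t x a b * christoffel (Γ.γ t) c a b x) * pderiv c (Γ.φ t) x) :=
    IsDom.sum fun c _ => ((h.G_dom hT c h4).mul ((h.φ_dom hT h4).pderiv c)).mono hT
        fun x => by linarith [hq x c]
  exact (e1.add e2).congr fun t ht x => covLaplacian_eq _ (h.smooth_φ.torus ht) t x

/-- The Kasner relations annihilate the leading part: `∑ (1/n - q_i)² = 1 - A² - 1/n`, so only the
deviations of `t χ` and `π` from their limits are left. -/
theorem c₃_dom (h : IsKasnerBackground T Γ q A β) (hT : T ≤ 1) {δ : ℝ} (hδ0 : 0 ≤ δ)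
    (hδ : ∀ x, δ ≤ β x) : IsDom T (fun _ => δ) (fun t x =>
      -((t ^ 2 * (Γ.χ t x * Γ.χ t x).trace + 1 / (n : ℝ) + A x ^ 2 - 1)
          + (Γ.π t x ^ 2 - A x ^ 2))) := by
  -- Dimension zero is excluded because an empty sum cannot equal one.
  have hn : (n : ℝ) ≠ 0 := by
    rintro hn
    obtain rfl : n = 0 := by exact_mod_cast hn
    simpa using h.sum_q 0
  set K : Fin n → Fin n → (Fin n → ℝ) → ℝ := fun a b x => if a = b then 1 / (n : ℝ) - q a x else 0
  have hK : ∀ a b, SmoothTorus (K a b) := by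
    intro a b
    simp only [K]
    split_ifs
    · exact (SmoothTorus.const _).sub (h.smooth_q a)
    · exact .const 0
  have hKe : ∀ a b, ∀ t ∈ Ioc 0 T, ∀ x, t * kasnerChi q t x a b = K a b x := by
    intro a b t ht x
    simp only [kasnerChi, Matrix.diagonal_apply, K]
    split_ifs
    · rw [← mul_assoc, mul_inv_cancel₀ ht.1.ne', one_mul]
    · simp
  have he : ∀ a b, IsDom T (fun _ => δ) (fun t x => t * Γ.χ t x a b - K a b x) := by
    intro a b
    have hs : SmoothSlab T (fun t x => t * Γ.χ t x a b - t * kasnerChi q t x a b) :=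
      ((SmoothSlab.time.mul (h.smooth_χ a b)).sub ((hK a b).slab T)).congr fun t ht x => by
        rw [hKe a b t ht]
    exact ((h.asymp_χ a b).isDom hs hT hδ).congr fun t ht x => by rw [hKe a b t ht]
  have hπ := h.asymp_π.isDom (h.smooth_π.sub (h.smooth_A.slab T)) hT hδ
  have hsum : ∀ x, ∑ a, ∑ b, K a b x * K b a x = 1 - A x ^ 2 - 1 / n := by
    intro x
    have e1 : ∀ a, ∑ b, K a b x * K b a x = (1 / (n : ℝ) - q a x) ^ 2 := by
      intro a
      rw [Finset.sum_eq_single a (fun b _ hb => by simp [K, hb]) (by simp)]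
      simp [K]; ring
    simp only [e1, sub_sq, Finset.sum_add_distrib, Finset.sum_sub_distrib, h.sum_q_sq x,
      ← Finset.mul_sum, h.sum_q x]
    simp
    field_simp
    ring
  have d1 : IsDom T (fun _ => δ) (fun t x => ∑ a, ∑ b,
      ((t * Γ.χ t x a b - K a b x) * ((t * Γ.χ t x b a - K b a x) + K b a x)
        + K a b x * (t * Γ.χ t x b a - K b a x))) := by
    refine IsDom.sum fun a _ => IsDom.sum fun b _ => ?_
    have k0 := (he a b).mul (((he b a).mono (s' := fun _ => 0) hT fun _ => hδ0).add
      (IsDom.torus (hK b a)))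
    have k1 := (IsDom.torus (T := T) (hK a b)).mul (he b a)
    exact (k0.mono hT fun x => by linarith).add (k1.mono hT fun x => by linarith)
  have d2 := hπ.mul ((hπ.mono (s' := fun _ => 0) hT fun _ => hδ0).add
    (IsDom.torus (T := T) ((SmoothTorus.const 2).mul h.smooth_A)))
  refine (d1.add (d2.mono (s' := fun _ => δ) hT fun x => by linarith)).neg.congr fun t ht x => ?_
  have e3 : t ^ 2 * (Γ.χ t x * Γ.χ t x).trace
      = ∑ a, ∑ b, (t * Γ.χ t x a b) * (t * Γ.χ t x b a) := by
    simp only [Matrix.trace, Matrix.diag, Matrix.mul_apply, Finset.mul_sum]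
    exact Finset.sum_congr rfl fun a _ => Finset.sum_congr rfl fun b _ => by ring
  have e4 : ∑ a, ∑ b,
      ((t * Γ.χ t x a b - K a b x) * ((t * Γ.χ t x b a - K b a x) + K b a x)
        + K a b x * (t * Γ.χ t x b a - K b a x))
      = ∑ a, ∑ b, (t * Γ.χ t x a b) * (t * Γ.χ t x b a) - ∑ a, ∑ b, K a b x * K b a x := by
    simp only [← Finset.sum_sub_distrib]
    exact Finset.sum_congr rfl fun a _ => Finset.sum_congr rfl fun b _ => by ring
  rw [e4, hsum, e3]
  ring

theorem c₄_dom (h : IsKasnerBackground T Γ q A β) (hT : T ≤ 1) {δ : ℝ}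
    (hδ : ∀ x, δ ≤ β x) : IsDom T (fun _ => δ) (fun t x =>
      -(2 * (Γ.π t x * Γ.α t x - A x))) := by
  have hπ := h.asymp_π.isDom (h.smooth_π.sub (h.smooth_A.slab T)) hT hδ
  have hα := h.asymp_α.isDom (h.smooth_α.sub (.const 1)) hT hδ
  have k1 := (hπ.mul (h.α_dom hT)).mono (s' := fun _ => δ) hT fun x => by linarith
  have k2 := ((IsDom.torus (T := T) h.smooth_A).mul hα).mono (s' := fun _ => δ) hT
    fun x => by linarith
  have k3 := ((IsDom.torus (T := T) (SmoothTorus.const (n := n) 2)).mul (k1.add k2)).neg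
  exact (k3.mono hT fun x => by linarith).congr fun t ht x => by ring

theorem P_near_aux (h : IsKasnerBackground T Γ q A β) (hT : T ≤ 1) {δ : ℝ}
    (hδ : ∀ x, δ ≤ β x) : ∃ C > 0, ∀ a b, ∀ t ∈ Ioc 0 T, ∀ x,
    |t ^ 2 * Γ.γ t x a b - if a = b then (t ^ (1 - q a x)) ^ 2 else 0|
      ≤ C * t ^ δ * (t ^ (1 - q b x)) ^ 2 := by
  choose C hC hb using fun a b => ((h.asymp_γ a b).isDom (h.asymp_smooth a b) hT hδ).abs_le
  refine ⟨1 + ∑ a, ∑ b, C a b, add_pos_of_pos_of_nonneg one_pos (Finset.sum_nonneg fun a _ =>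
    Finset.sum_nonneg fun b _ => (hC a b).le), fun a b t ht x => ?_⟩
  have e0 : ∀ b, t ^ 2 * t ^ (-2 * q b x) = (t ^ (1 - q b x)) ^ 2 := by
    intro b
    rw [← Real.rpow_natCast, ← Real.rpow_natCast, ← Real.rpow_mul ht.1.le, ← Real.rpow_add ht.1]
    congr 1
    push_cast; ring
  have e1 : t ^ 2 * Γ.γ t x a b - (if a = b then (t ^ (1 - q a x)) ^ 2 else 0)
      = ((Γ.γ t x - kasnerMetric q t x) * (kasnerMetric q t x)⁻¹) a b
        * (t ^ (1 - q b x)) ^ 2 := by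
    rw [γ_eq (q := q) ht.1 x a b, ← e0 b, kasnerMetric_apply]
    split_ifs
    · rw [← e0 a]; ring
    · ring
  rw [e1, abs_mul, abs_of_nonneg (sq_nonneg (t ^ (1 - q b x)))]
  have p := Real.rpow_nonneg ht.1.le δ
  have h1 : C a b ≤ 1 + ∑ a, ∑ b, C a b := by
    have s1 := Finset.single_le_sum (f := fun b => C a b) (fun b _ => (hC a b).le)
      (Finset.mem_univ b)
    have s2 := Finset.single_le_sum (f := fun a => ∑ b, C a b)
      (fun a _ => Finset.sum_nonneg fun b _ => (hC a b).le) (Finset.mem_univ a)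
    linarith
  gcongr
  exact (hb a b t ht x).trans (by gcongr)

/-- The one-sided bound is used for `(a, b)` and `(b, a)`, and the symmetry of `γ` turns the two
into the mixed weight. -/
theorem P_near (h : IsKasnerBackground T Γ q A β) (hT : T ≤ 1) {δ : ℝ}
    (hδ : ∀ x, δ ≤ β x) : ∃ C > 0, ∀ a b, ∀ t ∈ Ioc 0 T, ∀ x,
    |t ^ 2 * Γ.γ t x a b - if a = b then (t ^ (1 - q a x)) ^ 2 else 0|
      ≤ C * t ^ δ * (t ^ (1 - q a x) * t ^ (1 - q b x)) := by
  obtain ⟨C, hC, hb⟩ := h.P_near_aux hT hδ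
  refine ⟨C, hC, fun a b t ht x => ?_⟩
  have p := Real.rpow_nonneg ht.1.le δ
  have h1 := hb b a t ht x
  refine abs_le_mul_of_abs_le_sq (Real.rpow_nonneg ht.1.le _) (Real.rpow_nonneg ht.1.le _)
    (by positivity) ?_ (hb a b t ht x)
  rw [h.γ_symm ht x a b]
  by_cases hab : a = b
  · subst hab; exact h1
  · simpa [hab, Ne.symm hab] using h1

/-- Write `P^{ab} = (f + δ^{ab}) t^{2(1 - q_b)}` with `f` the relative error. Then `t ∂_t` either
acts on the power, giving `2 (1 - q_b)` times the entry, or on `f`, which stays `O(t^δ)`. -/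
theorem P_dot_aux (h : IsKasnerBackground T Γ q A β) (hT : T ≤ 1) {δ : ℝ}
    (hδ : ∀ x, δ ≤ β x) (hq : ∀ x i, 0 ≤ 1 - q i x) (hq' : ∀ x i, 1 - q i x ≤ 2) :
    ∃ C > 0, ∀ a b, ∀ t ∈ Ioo 0 T, ∀ x,
    |t * deriv (fun s => s ^ 2 * Γ.γ s x a b) t
        - if a = b then 2 * (1 - q a x) * (t ^ (1 - q a x)) ^ 2 else 0|
      ≤ C * t ^ δ * (t ^ (1 - q b x)) ^ 2 := by
  choose C hC hb using fun a b => (h.asymp_γ a b).exists_deriv_le (h.asymp_smooth a b) hT hδ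
  obtain ⟨C', hC', hb'⟩ := h.P_near_aux hT hδ
  refine ⟨4 * C' + ∑ a, ∑ b, C a b, add_pos_of_pos_of_nonneg (by positivity) (Finset.sum_nonneg
    fun a _ => Finset.sum_nonneg fun b _ => (hC a b).le), fun a b t ht x => ?_⟩
  have ht' : t ∈ Ioc 0 T := ⟨ht.1, ht.2.le⟩
  set f : ℝ → ℝ := fun s => ((Γ.γ s x - kasnerMetric q s x) * (kasnerMetric q s x)⁻¹) a b
  have e0 : ∀ s : ℝ, 0 < s → s ^ 2 * s ^ (-2 * q b x) = s ^ (2 * (1 - q b x)) := by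
    intro s hs
    rw [← Real.rpow_natCast, ← Real.rpow_add hs]
    congr 1
    push_cast; ring
  have e1 : ∀ s : ℝ, 0 < s → s ^ 2 * Γ.γ s x a b
      = (f s + if a = b then 1 else 0) * s ^ (2 * (1 - q b x)) := by
    intro s hs
    have g : Γ.γ s x a b = kasnerMetric q s x a b + f s * s ^ (-2 * q b x) :=
      γ_eq (q := q) hs x a b
    rw [g, ← e0 s hs, kasnerMetric_apply]
    split_ifs with hab
    · rw [hab]; ring
    · ring
  have hf : HasDerivAt f (deriv f t) t :=
    ((h.asymp_smooth a b).hasDerivAt ht x).differentiableAt.hasDerivAt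
  have hd := (hf.add_const (if a = b then (1 : ℝ) else 0)).mul
    (Real.hasDerivAt_rpow_const (x := t) (p := 2 * (1 - q b x)) (Or.inl ht.1.ne'))
  have hd' := hd.congr_of_eventuallyEq (f₁ := fun s => s ^ 2 * Γ.γ s x a b) (by
    filter_upwards [Ioi_mem_nhds ht.1] with s hs using e1 s hs)
  rw [hd'.deriv]
  have e2 : t * t ^ (2 * (1 - q b x) - 1) = (t ^ (1 - q b x)) ^ 2 := by
    rw [← Real.rpow_natCast, ← Real.rpow_mul ht.1.le]
    nth_rewrite 1 [← Real.rpow_one t]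
    rw [← Real.rpow_add ht.1]
    congr 1
    push_cast; ring
  have e3 : t ^ (2 * (1 - q b x)) = (t ^ (1 - q b x)) ^ 2 := by
    rw [← Real.rpow_natCast, ← Real.rpow_mul ht.1.le]
    congr 1
    push_cast; ring
  have e4 : t * (deriv f t * t ^ (2 * (1 - q b x)) + (f t + if a = b then 1 else 0)
        * (2 * (1 - q b x) * t ^ (2 * (1 - q b x) - 1)))
      - (if a = b then 2 * (1 - q a x) * (t ^ (1 - q a x)) ^ 2 else 0)
      = (t * deriv f t) * (t ^ (1 - q b x)) ^ 2
        + 2 * (1 - q b x) * (t ^ 2 * Γ.γ t x a b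
          - if a = b then (t ^ (1 - q a x)) ^ 2 else 0) := by
    rw [e1 t ht.1, e3, ← e2]
    split_ifs with hab
    · rw [hab, ← e2]; ring
    · ring
  rw [e4]
  have p := Real.rpow_nonneg ht.1.le δ
  have h1 : C a b ≤ ∑ a, ∑ b, C a b := by
    have s1 := Finset.single_le_sum (f := fun b => C a b) (fun b _ => (hC a b).le)
      (Finset.mem_univ b)
    have s2 := Finset.single_le_sum (f := fun a => ∑ b, C a b)
      (fun a _ => Finset.sum_nonneg fun b _ => (hC a b).le) (Finset.mem_univ a)
    linarith
  refine (abs_add_le _ _).trans ?_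
  rw [abs_mul (t * deriv f t), abs_mul (2 * (1 - q b x)),
    abs_of_nonneg (sq_nonneg (t ^ (1 - q b x))),
    abs_of_nonneg (by linarith [hq x b] : 0 ≤ 2 * (1 - q b x))]
  have t1 : |t * deriv f t| * (t ^ (1 - q b x)) ^ 2
      ≤ (∑ a, ∑ b, C a b) * t ^ δ * (t ^ (1 - q b x)) ^ 2 := by
    gcongr
    exact (hb a b t ht x).trans (by gcongr)
  have t2 := mul_le_mul (by linarith [hq' x b] : 2 * (1 - q b x) ≤ 4) (hb' a b t ht' x)
    (abs_nonneg _) (by norm_num)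
  linarith

theorem P_dot (h : IsKasnerBackground T Γ q A β) (hT : T ≤ 1) {δ : ℝ}
    (hδ : ∀ x, δ ≤ β x) (hq : ∀ x i, 0 ≤ 1 - q i x) (hq' : ∀ x i, 1 - q i x ≤ 2) :
    ∃ C > 0, ∀ a b, ∀ t ∈ Ioo 0 T, ∀ x,
    |t * deriv (fun s => s ^ 2 * Γ.γ s x a b) t
        - if a = b then 2 * (1 - q a x) * (t ^ (1 - q a x)) ^ 2 else 0|
      ≤ C * t ^ δ * (t ^ (1 - q a x) * t ^ (1 - q b x)) := by
  obtain ⟨C, hC, hb⟩ := h.P_dot_aux hT hδ hq hq'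
  refine ⟨C, hC, fun a b t ht x => ?_⟩
  have p := Real.rpow_nonneg ht.1.le δ
  have h1 := hb b a t ht x
  refine abs_le_mul_of_abs_le_sq (Real.rpow_nonneg ht.1.le _) (Real.rpow_nonneg ht.1.le _)
    (by positivity) ?_ (hb a b t ht x)
  have e : deriv (fun s => s ^ 2 * Γ.γ s x a b) t = deriv (fun s => s ^ 2 * Γ.γ s x b a) t := by
    refine Filter.EventuallyEq.deriv_eq ?_
    filter_upwards [Ioc_mem_nhds ht.1 ht.2] with s hs
    rw [h.γ_symm hs x a b]
  rw [e]
  by_cases hab : a = b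
  · subst hab; exact h1
  · simpa [hab, Ne.symm hab] using h1

theorem q_sq_le (h : IsKasnerBackground T Γ q A β) (x : Fin n → ℝ) (i : Fin n) :
    q i x ^ 2 + A x ^ 2 ≤ 1 := by
  have := Finset.single_le_sum (f := fun i => q i x ^ 2) (fun _ _ => sq_nonneg _)
    (Finset.mem_univ i)
  have h2 := h.sum_q_sq x
  linarith

theorem admissible (h : IsKasnerBackground T Γ q A β) (hT0 : 0 < T) (hT : T ≤ 1) {κ₀ δ : ℝ}
    (hκ : 0 < κ₀) (hq : ∀ x i, κ₀ ≤ 1 - q i x) (hδ0 : 0 < δ) (hδκ : δ ≤ κ₀ / 2)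
    (hδ : ∀ x, δ ≤ β x) : (Γ.coeffs q A).Admissible T δ κ₀ where
  T_pos := hT0
  T_le := hT
  δ_pos := hδ0
  δ_le := hδκ
  smooth_q := h.smooth_q
  smooth_A := h.smooth_A
  -- This is where the Kasner relation enters the energy estimate: `A² ≤ 1 - q_i²`, and `1 - q² = 2
  -- (1 - q) - (1 - q)²`.
  A_sq x i := by
    have := h.q_sq_le x i
    change A x ^ 2 ≤ 2 * (1 - q i x)
    nlinarith [sq_nonneg (1 - q i x)]
  A_nonneg x := (h.range_A x).1
  A_le x := by
    have h1 : A x ^ 2 ≤ 1 := by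
      have := h.sum_q_sq x
      have h2 : 0 ≤ ∑ i, q i x ^ 2 := Finset.sum_nonneg fun _ _ => sq_nonneg _
      linarith
    change A x ≤ 1
    nlinarith
  q_le := hq
  le_q x i := by
    have := h.q_sq_le x i
    change 1 - q i x ≤ 2
    nlinarith [sq_nonneg (A x)]
  P_symm a b t ht x := by
    change t ^ 2 * Γ.γ t x a b = t ^ 2 * Γ.γ t x b a
    rw [h.γ_symm ht]
  P_dom a b _ hε := h.P_dom hT a b hε
  G_dom b _ hε := h.G_dom hT b hε
  B_dom b _ hε := h.B_dom hT b hε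
  H_dom b _ hε := h.H_dom hT b hε
  α_dom := h.asymp_α.isDom (h.smooth_α.sub (.const 1)) hT hδ
  c₁_dom := (h.asymp_π.isDom (h.smooth_π.sub (h.smooth_A.slab T)) hT hδ).neg.add
    (h.laplacian_φ_dom hT hκ hq hδκ)
  c₃_dom := h.c₃_dom hT hδ0.le hδ
  c₄_dom := h.c₄_dom hT hδ
  c₆_dom := h.asymp_π.isDom (h.smooth_π.sub (h.smooth_A.slab T)) hT hδ
  α_dot := by
    simpa [Background.coeffs] using h.asymp_α.exists_deriv_le (h.smooth_α.sub (.const 1)) hT hδ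
  P_near := h.P_near hT hδ
  P_dot := h.P_dot hT hδ (fun x i => hκ.le.trans (hq x i)) fun x i => by
    have := h.q_sq_le x i
    nlinarith [sq_nonneg (A x)]

theorem solves (h : IsKasnerBackground T Γ q A β) {T' : ℝ} (hT' : T' ≤ T) {σ : ℝ}
    {F₁ F₂ F₃ u ν φ : ℝ → (Fin n → ℝ) → ℝ} (h₁ : SmoothSlab T' F₁) (h₂ : SmoothSlab T' F₂)
    (h₃ : SmoothSlab T' F₃) (hs : IsSolution T' Γ A σ F₁ F₂ F₃ u ν φ) :
    (Γ.coeffs q A).Solves T' σ F₁ F₂ F₃ u ν φ where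
  smooth_u := hs.smooth_u
  smooth_ν := hs.smooth_ν
  smooth_φ := hs.smooth_φ
  smooth_F₁ := h₁
  smooth_F₂ := h₂
  smooth_F₃ := h₃
  eq_u t ht x := by
    have e := hs.eq_u t ht x
    have e1 := covLaplacian_eq (Γ.γ t) (hs.smooth_φ.torus ht) t x
    have hsym := fun a b => h.γ_symm (Ioc_subset_Ioc_right hT' ht) x a b
    have e2 : t ^ 2 * gradProd (Γ.γ t) (Γ.α t) (φ t) x
        = ∑ b, (∑ a, t ^ 2 * Γ.γ t x a b * pderiv a (Γ.α t) x) * pderiv b (φ t) x := by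
      simp only [gradProd, Finset.mul_sum, Finset.sum_mul]
      rw [Finset.sum_comm]
      exact Finset.sum_congr rfl fun b _ => Finset.sum_congr rfl fun a _ => by ring
    have e3 : t ^ 2 * gradProd (Γ.γ t) (ν t) (Γ.φ t) x
        = ∑ b, (∑ a, t ^ 2 * Γ.γ t x a b * pderiv a (Γ.φ t) x) * pderiv b (ν t) x := by
      simp only [gradProd, Finset.mul_sum, Finset.sum_mul]
      exact Finset.sum_congr rfl fun b _ => Finset.sum_congr rfl fun a _ => by
        rw [hsym b a]; ring
    simp only [eulerDeriv] at e
    change t * timeDeriv T' u t x = _ at *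
    simp only [Background.coeffs, timeDeriv, add_mul, Finset.sum_add_distrib]
    rw [← e3, ← e2]
    have e4 : ∑ a, ∑ b, Γ.α t x * (t ^ 2 * Γ.γ t x a b) * pderiv b (pderiv a (φ t)) x
        = Γ.α t x * ∑ a, ∑ b, t ^ 2 * Γ.γ t x a b * pderiv b (pderiv a (φ t)) x := by
      simp only [Finset.mul_sum, mul_assoc]
    have e5 : ∑ c, Γ.α t x * (-∑ a, ∑ d, t ^ 2 * Γ.γ t x a d * christoffel (Γ.γ t) c a d x)
          * pderiv c (φ t) x = Γ.α t x * ∑ c, (-∑ a, ∑ d, t ^ 2 * Γ.γ t x a d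
            * christoffel (Γ.γ t) c a d x) * pderiv c (φ t) x := by
      simp only [Finset.mul_sum, mul_assoc]
    rw [e4, e5]
    linear_combination (-1) * e + σ * Γ.α t x * e1
  eq_ν t ht x := by
    have e := hs.eq_ν t ht x
    have e1 := covLaplacian_eq (Γ.γ t) (hs.smooth_ν.torus ht) t x
    simp only [Background.coeffs]
    linear_combination (-1) * e + σ * e1
  eq_φ t ht x := by
    have e := hs.eq_φ t ht x
    simp only [eulerDeriv] at e
    simp only [Background.coeffs, timeDeriv]
    linear_combination (-1) * e

end IsKasnerBackground

end LapseScalar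

namespace LapseScalar

/-! ### The algebraic core of the energy estimate -/

variable {n : ℕ}

theorem young {η x y : ℝ} (hη : 0 < η) : x * y ≤ η * x ^ 2 + 1 / (4 * η) * y ^ 2 := by
  have h : 0 ≤ η * (x - 1 / (2 * η) * y) ^ 2 := by positivity
  have e : η * (x - 1 / (2 * η) * y) ^ 2 = η * x ^ 2 + 1 / (4 * η) * y ^ 2 - x * y := by
    field_simp; ring
  linarith

theorem abs_sum_sum_le {P : Fin n → Fin n → ℝ} {p ξ ζ : Fin n → ℝ} {K : ℝ}
    (hP : ∀ a b, |P a b| ≤ K * (p a * p b)) :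
    |∑ a, ∑ b, P a b * (ξ a * ζ b)| ≤ K * ((∑ a, p a * |ξ a|) * ∑ b, p b * |ζ b|) := by
  refine (Finset.abs_sum_le_sum_abs _ _).trans ?_
  rw [Finset.sum_mul, Finset.mul_sum]
  refine Finset.sum_le_sum fun a _ => (Finset.abs_sum_le_sum_abs _ _).trans ?_
  rw [Finset.mul_sum, Finset.mul_sum]
  refine Finset.sum_le_sum fun b _ => ?_
  rw [abs_mul, abs_mul]
  calc |P a b| * (|ξ a| * |ζ b|) ≤ K * (p a * p b) * (|ξ a| * |ζ b|) := by
        gcongr; exact hP a b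
    _ = _ := by ring

theorem sq_sum_mul_abs_le (p ξ : Fin n → ℝ) :
    (∑ a, p a * |ξ a|) ^ 2 ≤ n * ∑ a, (p a * ξ a) ^ 2 := by
  have := sq_sum_le_card_mul_sum_sq (s := (Finset.univ : Finset (Fin n)))
    (f := fun a => p a * |ξ a|)
  simpa [mul_pow, sq_abs] using this

theorem sum_diag (g : Fin n → ℝ) (ξ ζ : Fin n → ℝ) :
    ∑ a, ∑ b, (if a = b then g a else 0) * (ξ a * ζ b) = ∑ a, g a * (ξ a * ζ a) := by
  refine Finset.sum_congr rfl fun a _ => ?_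
  rw [Finset.sum_eq_single a (fun b _ hb => by simp [Ne.symm hb]) (by simp)]
  simp

/-- The quadratic expression that remains of the time derivative of the energy density after
integration by parts. -/
def energyRate (σ β w wd u ν A R₁ R₂ : ℝ) (P Pd : Fin n → Fin n → ℝ) (φ v R₃ N M : Fin n → ℝ) :
    ℝ :=
  β * (w * u ^ 2 + σ * ∑ a, ∑ b, P a b * (φ a * φ b)) + 1 / 2 * wd * u ^ 2
    - (w - 1) * A * u * ν + 1 / 2 * ν ^ 2 + 1 / 2 * σ * ∑ a, ∑ b, P a b * (v a * v b)
    - 1 / 2 * ν * R₂ + 1 / 2 * σ * ν * ∑ b, N b * v b + w * u * R₁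
    + 1 / 2 * σ * ∑ a, ∑ b, Pd a b * (φ a * φ b) + σ * A * ∑ a, ∑ b, P a b * (v a * φ b)
    + σ * ∑ a, ∑ b, P a b * (R₃ a * φ b) - σ * u * ∑ b, M b * φ b

/-- Coercivity of the principal part. Half of `P(v + A φ, v + A φ)` accounts for `½ P(v, v)` and the
cross term at the cost of `½ A² P(φ, φ)`. That cost is covered by `½ Pd(φ, φ)`, whose leading part
is `∑ d_a (p_a φ_a)²` with `A² ≤ 2 d_a`. The whole of `β P(φ, φ)` is left over, so any weight `β ≥
b₀ > 0` makes the form positive definite up to errors with the factor `τ`. -/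
theorem good_terms_le {σ τ β A K : ℝ} {P Pd : Fin n → Fin n → ℝ} {p d φ v : Fin n → ℝ} {b₀ B : ℝ}
    (hb₀ : 0 < b₀) (hσ : 0 ≤ σ) (hτ : 0 ≤ τ) (hK : 0 ≤ K) (hβ : b₀ ≤ β) (hβB : β ≤ B)
    (hA0 : 0 ≤ A) (hA1 : A ≤ 1) (hsymm : ∀ a b, P a b = P b a)
    (hlow : ∀ ξ : Fin n → ℝ, 1 / 2 * ∑ a, (p a * ξ a) ^ 2 ≤ ∑ a, ∑ b, P a b * (ξ a * ξ b))
    (hPn : ∀ a b, |P a b - if a = b then p a ^ 2 else 0| ≤ K * τ * (p a * p b))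
    (hPd : ∀ a b, |Pd a b - if a = b then 2 * d a * p a ^ 2 else 0| ≤ K * τ * (p a * p b))
    (hd : ∀ a, A ^ 2 ≤ 2 * d a) :
    min (b₀ / 3) (1 / 8) * (σ * ∑ a, (p a * v a) ^ 2 + σ * ∑ a, (p a * φ a) ^ 2)
      - (B + 2) * K * n * τ * (σ * ∑ a, (p a * φ a) ^ 2)
    ≤ σ * β * ∑ a, ∑ b, P a b * (φ a * φ b) + 1 / 2 * σ * ∑ a, ∑ b, P a b * (v a * v b)
      + 1 / 2 * σ * ∑ a, ∑ b, Pd a b * (φ a * φ b) + σ * A * ∑ a, ∑ b, P a b * (v a * φ b) := by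
  set SX := ∑ a, (p a * v a) ^ 2
  set SY := ∑ a, (p a * φ a) ^ 2 with hSY
  set Pφφ := ∑ a, ∑ b, P a b * (φ a * φ b) with hPφφ
  set Pvv := ∑ a, ∑ b, P a b * (v a * v b) with hPvv
  set Pvφ := ∑ a, ∑ b, P a b * (v a * φ b) with hPvφ
  set Dφφ := ∑ a, ∑ b, Pd a b * (φ a * φ b) with hDφφ
  have hSY0 : 0 ≤ SY := Finset.sum_nonneg fun _ _ => sq_nonneg _
  have hSX0 : 0 ≤ SX := Finset.sum_nonneg fun _ _ => sq_nonneg _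
  -- the completed square
  have e1 : ∑ a, ∑ b, P a b * ((v a + A * φ a) * (v b + A * φ b))
      = Pvv + 2 * A * Pvφ + A ^ 2 * Pφφ := by
    have h2 : ∑ a, ∑ b, P a b * (φ a * v b) = Pvφ := by
      rw [Finset.sum_comm, hPvφ]
      exact Finset.sum_congr rfl fun a _ => Finset.sum_congr rfl fun b _ => by
        rw [hsymm b a]; ring
    have h3 : ∑ a, ∑ b, P a b * ((v a + A * φ a) * (v b + A * φ b))
        = Pvv + A * Pvφ + A * ∑ a, ∑ b, P a b * (φ a * v b) + A ^ 2 * Pφφ := by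
      simp only [hPvv, hPvφ, hPφφ, Finset.mul_sum, ← Finset.sum_add_distrib]
      exact Finset.sum_congr rfl fun a _ => Finset.sum_congr rfl fun b _ => by ring
    rw [h3, h2]; ring
  have h1 := hlow fun a => v a + A * φ a
  rw [e1] at h1
  have h2 : SX / 2 - SY ≤ ∑ a, (p a * (v a + A * φ a)) ^ 2 := by
    rw [Finset.sum_div, hSY, ← Finset.sum_sub_distrib]
    refine Finset.sum_le_sum fun a _ => ?_
    have hA2 : A ^ 2 ≤ 1 := by nlinarith
    have := mul_nonneg (sub_nonneg.2 hA2) (sq_nonneg (p a * φ a))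
    -- With `x = p v` and `y = p φ`, the difference `(x + A y)² - x²/2 + y²` equals `½ (x + 2 A y)²
    -- + (1 - A²) y²`.
    nlinarith [sq_nonneg (p a * v a + 2 * A * (p a * φ a))]
  -- the remaining part of the form in `φ`
  have hYb := sq_sum_mul_abs_le p φ
  have e2 : |Pφφ - SY| ≤ K * τ * (n * SY) := by
    have h := abs_sum_sum_le (ξ := φ) (ζ := φ) hPn
    have e : ∑ a, ∑ b, (P a b - if a = b then p a ^ 2 else 0) * (φ a * φ b) = Pφφ - SY := by
      simp only [sub_mul, Finset.sum_sub_distrib, sum_diag, hSY]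
      congr 1
      exact Finset.sum_congr rfl fun a _ => by ring
    rw [e, ← sq] at h
    exact h.trans (mul_le_mul_of_nonneg_left hYb (by positivity))
  have e3 : |Dφφ - ∑ a, 2 * d a * (p a * φ a) ^ 2| ≤ K * τ * (n * SY) := by
    have h := abs_sum_sum_le (ξ := φ) (ζ := φ) hPd
    have e : ∑ a, ∑ b, (Pd a b - if a = b then 2 * d a * p a ^ 2 else 0) * (φ a * φ b)
        = Dφφ - ∑ a, 2 * d a * (p a * φ a) ^ 2 := by
      simp only [sub_mul, Finset.sum_sub_distrib, sum_diag]
      congr 1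
      exact Finset.sum_congr rfl fun a _ => by ring
    rw [e, ← sq] at h
    exact h.trans (mul_le_mul_of_nonneg_left hYb (by positivity))
  have e4 : A ^ 2 * SY ≤ ∑ a, 2 * d a * (p a * φ a) ^ 2 := by
    rw [hSY, Finset.mul_sum]
    exact Finset.sum_le_sum fun a _ => mul_le_mul_of_nonneg_right (hd a) (sq_nonneg _)
  have hE0 : 0 ≤ K * τ * (n * SY) := by positivity
  have e5 : (β - A ^ 2 / 2) * SY - (B + 1) * (K * τ * (n * SY)) ≤ (β - A ^ 2 / 2) * Pφφ := by
    have hb : |β - A ^ 2 / 2| ≤ B + 1 := by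
      rw [abs_le]; constructor <;> nlinarith
    have h := abs_mul (β - A ^ 2 / 2) (Pφφ - SY)
    have h' := mul_le_mul hb e2 (abs_nonneg _) (by linarith)
    have := neg_abs_le ((β - A ^ 2 / 2) * (Pφφ - SY))
    nlinarith
  have e6 := neg_abs_le (Dφφ - ∑ a, 2 * d a * (p a * φ a) ^ 2)
  -- collect
  set m := min (b₀ / 3) (1 / 8)
  have hm1 : m ≤ b₀ / 3 := min_le_left _ _
  have hm2 : m ≤ 1 / 8 := min_le_right _ _
  have hm0 : 0 ≤ m := le_min (by linarith) (by norm_num)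
  have h7 : m * (SX + SY) - (B + 2) * (K * τ * (n * SY))
      ≤ β * Pφφ + 1 / 2 * Pvv + 1 / 2 * Dφφ + A * Pvφ := by
    have s1 : 0 ≤ ∑ a, (p a * (v a + A * φ a)) ^ 2 := Finset.sum_nonneg fun _ _ => sq_nonneg _
    generalize ∑ a, (p a * (v a + A * φ a)) ^ 2 = W at *
    generalize ∑ a, 2 * d a * (p a * φ a) ^ 2 = V at *
    have s2 : 2 * m * (SX / 2 - SY) ≤ 2 * m * W := mul_le_mul_of_nonneg_left h2 (by linarith)
    have s3 : 2 * m * W ≤ 1 / 4 * W := mul_le_mul_of_nonneg_right (by linarith) s1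
    have s4 : 3 * m * SY ≤ β * SY := mul_le_mul_of_nonneg_right (by linarith) hSY0
    linarith
  have := mul_le_mul_of_nonneg_left h7 hσ
  linarith

theorem abs_sum_mul_le {N p v : Fin n → ℝ} {k : ℝ} (h : ∀ b, |N b| ≤ k * p b) :
    |∑ b, N b * v b| ≤ k * ∑ b, p b * |v b| := by
  refine (Finset.abs_sum_le_sum_abs _ _).trans ?_
  rw [Finset.mul_sum]
  refine Finset.sum_le_sum fun b _ => ?_
  rw [abs_mul, ← mul_assoc]
  exact mul_le_mul_of_nonneg_right (h b) (abs_nonneg _)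

-- Sorting of the error terms, with `τ = t^δ` in mind. The number `y` collects sources and lower
-- orders, while `z` and `z'` collect top-order jets and always come with `τ`. Young's inequality
-- splits a product such as `u · τ z` into `s z²` with `s` as small as desired and a large multiple
-- of `τ² u² ≤ τ u²`. Thus top-order commutators cost only an absorbable fraction and a Fuchsian
-- term, and no smallness of `τ` is required. The constant in front of the good terms does not
-- depend on `s`.
set_option maxHeartbeats 1000000 in
theorem exists_energyRate_lower {b₀ B K s : ℝ} (hb₀ : 0 < b₀) (hB : 0 ≤ B) (hK : 0 ≤ K)
    (hs : 0 < s) : ∃ C > 0, ∀ {σ τ u ν A β w wd y z z' R₁ R₂ : ℝ} {P Pd : Fin n → Fin n → ℝ}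
      {p d φ v R₃ N M : Fin n → ℝ},
      0 ≤ σ → σ ≤ 1 → 0 ≤ τ → τ ≤ 1 → b₀ ≤ β → β ≤ B → 0 ≤ A → A ≤ 1 → 1 / 2 ≤ w → w ≤ 2 →
      |w - 1| ≤ K * τ → |wd| ≤ K * τ → (∀ a, 0 ≤ p a) → (∀ a b, P a b = P b a) →
      (∀ ξ : Fin n → ℝ, 1 / 2 * ∑ a, (p a * ξ a) ^ 2 ≤ ∑ a, ∑ b, P a b * (ξ a * ξ b)) →
      (∀ a b, |P a b| ≤ K * (p a * p b)) →
      (∀ a b, |P a b - if a = b then p a ^ 2 else 0| ≤ K * τ * (p a * p b)) →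
      (∀ a b, |Pd a b - if a = b then 2 * d a * p a ^ 2 else 0| ≤ K * τ * (p a * p b)) →
      (∀ a, A ^ 2 ≤ 2 * d a) → (∀ b, |N b| ≤ K * τ * p b) → (∀ b, |M b| ≤ K * τ * p b) →
      0 ≤ y → 0 ≤ z → 0 ≤ z' → |R₁| ≤ y + K * τ * z → |R₂| ≤ y + σ * (K * τ * z') →
      (∀ a, p a * |R₃ a| ≤ y + K * τ * z) →
      min (b₀ / 3) (1 / 8) / 2 * (u ^ 2 + ν ^ 2 + σ * ∑ a, (p a * v a) ^ 2
          + σ * ∑ a, (p a * φ a) ^ 2) - s * (z ^ 2 + σ * z' ^ 2)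
        - C * (τ * (u ^ 2 + σ * ∑ a, (p a * φ a) ^ 2 + σ * ν ^ 2) + y ^ 2)
      ≤ energyRate σ β w wd u ν A R₁ R₂ P Pd φ v R₃ N M := by
  obtain ⟨c, hc⟩ : ∃ c, c = min (b₀ / 3) (1 / 8) := ⟨_, rfl⟩
  have hc1 : c ≤ b₀ / 3 := hc ▸ min_le_left _ _
  have hc2 : c ≤ 1 / 8 := hc ▸ min_le_right _ _
  have hc0 : 0 < c := hc ▸ lt_min (by linarith) (by norm_num)
  obtain ⟨η, hη⟩ : ∃ η, η = c / 8 := ⟨_, rfl⟩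
  have hη0 : 0 < η := by rw [hη]; positivity
  -- The division by `n + 1` pays for the Cauchy–Schwarz factor `n` between `(∑ p_a |v_a|)²` and `∑
  -- (p_a v_a)²`.
  obtain ⟨η', hη'⟩ : ∃ η', η' = η / (n + 1 : ℝ) := ⟨_, rfl⟩
  have hη'0 : 0 < η' := by rw [hη']; positivity
  obtain ⟨k₁, hk₁⟩ : ∃ k, k = (B + 2) * K * n := ⟨_, rfl⟩
  have pk₁ : 0 ≤ k₁ := by rw [hk₁]; positivity
  obtain ⟨k₃, hk₃⟩ : ∃ k, k = 1 / (4 * η) * K ^ 2 := ⟨_, rfl⟩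
  have pk₃ : 0 ≤ k₃ := by rw [hk₃]; positivity
  obtain ⟨k₄, hk₄⟩ : ∃ k, k = 1 / (4 * η) * 1 := ⟨_, rfl⟩
  have pk₄ : 0 ≤ k₄ := by rw [hk₄]; positivity
  obtain ⟨k₅, hk₅⟩ : ∃ k, k = 1 / (4 * s) * K ^ 2 := ⟨_, rfl⟩
  have pk₅ : 0 ≤ k₅ := by rw [hk₅]; positivity
  obtain ⟨k₆, hk₆⟩ : ∃ k, k = 1 / (4 * η') * K ^ 2 := ⟨_, rfl⟩
  have pk₆ : 0 ≤ k₆ := by rw [hk₆]; positivity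
  obtain ⟨k₇, hk₇⟩ : ∃ k, k = 1 / (4 * η) * 4 := ⟨_, rfl⟩
  have pk₇ : 0 ≤ k₇ := by rw [hk₇]; positivity
  obtain ⟨k₈, hk₈⟩ : ∃ k, k = 1 / (4 * (s / 2)) * (4 * K ^ 2) := ⟨_, rfl⟩
  have pk₈ : 0 ≤ k₈ := by rw [hk₈]; positivity
  obtain ⟨k₉, hk₉⟩ : ∃ k, k = 1 / (4 * η') * (K * n) ^ 2 := ⟨_, rfl⟩
  have pk₉ : 0 ≤ k₉ := by rw [hk₉]; positivity
  obtain ⟨k₁₀, hk₁₀⟩ : ∃ k, k = 1 / (4 * (s / 2)) * ((K * K * n) ^ 2 * n) := ⟨_, rfl⟩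
  have pk₁₀ : 0 ≤ k₁₀ := by rw [hk₁₀]; positivity
  obtain ⟨k₁₁, hk₁₁⟩ : ∃ k, k = K + K * n := ⟨_, rfl⟩
  have pk₁₁ : 0 ≤ k₁₁ := by rw [hk₁₁]; positivity
  rw [← hc]
  -- Strict positivity of the sum is drawn from `k₄`; the summands with a factor `K` or `n` may
  -- vanish.
  have hk0 : 0 < k₄ := by rw [hk₄]; positivity
  refine ⟨k₁ + K + k₃ + k₄ + k₅ + k₆ + k₇ + k₈ + k₉ + k₁₀ + k₁₁, by positivity, ?_⟩
  intro σ τ u ν A β w wd y z z' R₁ R₂ P Pd p d φ v R₃ N M hσ hσ1 hτ hτ1 hβ hβB hA0 hA1 hw1 hw2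
    hw hwd hp hsymm hlow hPb hPn hPd hd hN hM hy hz hz' hR₁ hR₂ hR₃
  have g := hc ▸ good_terms_le (v := v) (φ := φ) hb₀ hσ hτ hK hβ hβB hA0 hA1 hsymm hlow hPn hPd hd
  have nN := abs_sum_mul_le (v := v) hN
  have nM := abs_sum_mul_le (v := φ) hM
  have nR := abs_sum_sum_le (ξ := R₃) (ζ := φ) hPb
  have nR' : ∑ a, p a * |R₃ a| ≤ n * (y + K * τ * z) := by
    refine (Finset.sum_le_sum fun a _ => hR₃ a).trans ?_
    simp [mul_add]
  have sX := sq_sum_mul_abs_le p v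
  have sY := sq_sum_mul_abs_le p φ
  have pX : 0 ≤ ∑ a, p a * |v a| := Finset.sum_nonneg fun a _ => mul_nonneg (hp a) (abs_nonneg _)
  have pY : 0 ≤ ∑ a, p a * |φ a| := Finset.sum_nonneg fun a _ => mul_nonneg (hp a) (abs_nonneg _)
  have pSX : 0 ≤ ∑ a, (p a * v a) ^ 2 := Finset.sum_nonneg fun _ _ => sq_nonneg _
  have pSY : 0 ≤ ∑ a, (p a * φ a) ^ 2 := Finset.sum_nonneg fun _ _ => sq_nonneg _
  unfold energyRate
  generalize ∑ a, ∑ b, P a b * (φ a * φ b) = Pφφ at *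
  generalize ∑ a, ∑ b, P a b * (v a * v b) = Pvv at *
  generalize ∑ a, ∑ b, P a b * (v a * φ b) = Pvφ at *
  generalize ∑ a, ∑ b, Pd a b * (φ a * φ b) = Dφφ at *
  generalize ∑ a, ∑ b, P a b * (R₃ a * φ b) = PRφ at *
  generalize ∑ b, N b * v b = Nv at *
  generalize ∑ b, M b * φ b = Mφ at *
  generalize ∑ a, (p a * v a) ^ 2 = SX at *
  generalize ∑ a, (p a * φ a) ^ 2 = SY at *
  generalize ∑ a, p a * |v a| = X at *
  generalize ∑ a, p a * |φ a| = Y at *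
  generalize ∑ a, p a * |R₃ a| = RS at *
  clear hlow hPb hPn hPd hd hN hM hR₃ hsymm
  have hττ : τ ^ 2 ≤ τ := pow_le_of_le_one hτ hτ1 two_ne_zero
  have hσσ : σ ^ 2 ≤ σ := pow_le_of_le_one hσ hσ1 two_ne_zero
  have d1 : 0 ≤ τ * u ^ 2 := by positivity
  have d2 : 0 ≤ τ * (σ * SY) := by positivity
  have d3 : 0 ≤ τ * (σ * ν ^ 2) := by positivity
  have d4 : 0 ≤ y ^ 2 := by positivity
  obtain ⟨D, hD⟩ : ∃ D, D = τ * (u ^ 2 + σ * SY + σ * ν ^ 2) + y ^ 2 := ⟨_, rfl⟩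
  rw [← hD]
  have hD1 : τ * u ^ 2 ≤ D := by rw [hD]; linarith
  have hD2 : τ * (σ * SY) ≤ D := by rw [hD]; linarith
  have hD3 : τ * (σ * ν ^ 2) ≤ D := by rw [hD]; linarith
  have hD4 : y ^ 2 ≤ D := by rw [hD]; linarith
  have hX : η' * X ^ 2 ≤ η * SX := by
    calc η' * X ^ 2 ≤ η' * (n * SX) := by gcongr
      _ ≤ η' * ((n + 1) * SX) := by gcongr; linarith
      _ = η * SX := by rw [hη']; field_simp
  have hY : η' * Y ^ 2 ≤ η * SY := by
    calc η' * Y ^ 2 ≤ η' * (n * SY) := by gcongr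
      _ ≤ η' * ((n + 1) * SY) := by gcongr; linarith
      _ = η * SY := by rw [hη']; field_simp
  have t0 : 3 / 2 * c * u ^ 2 ≤ β * (w * u ^ 2) := by
    have h1 : b₀ * (1 / 2) ≤ β * w := mul_le_mul hβ hw1 (by norm_num) (hb₀.le.trans hβ)
    have h2 : 3 / 2 * c ≤ β * w := by linarith only [h1, hc1]
    rw [← mul_assoc]
    exact mul_le_mul_of_nonneg_right h2 (sq_nonneg u)
  have t1 : (B + 2) * K * n * τ * (σ * SY) ≤ k₁ * D := by
    rw [← hk₁, mul_assoc]; gcongr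
  have t2 : |1 / 2 * wd * u ^ 2| ≤ K * D := by
    rw [abs_mul, abs_mul, abs_of_nonneg (sq_nonneg u), abs_of_nonneg (by norm_num : (0:ℝ) ≤ 1/2)]
    calc 1 / 2 * |wd| * u ^ 2 ≤ 1 * (K * τ) * u ^ 2 := by gcongr; norm_num
      _ = K * (τ * u ^ 2) := by ring
      _ ≤ K * D := by gcongr
  have t3 : |(w - 1) * A * u * ν| ≤ η * ν ^ 2 + k₃ * D := by
    rw [abs_mul, abs_mul, abs_mul, abs_of_nonneg hA0]
    have h1 : |w - 1| * A * |u| * |ν| ≤ |ν| * (K * τ * |u|) := by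
      calc |w - 1| * A * |u| * |ν| ≤ (K * τ) * 1 * |u| * |ν| := by gcongr
        _ = _ := by ring
    have h2 := young (x := |ν|) (y := K * τ * |u|) hη0
    rw [sq_abs, mul_pow, mul_pow, sq_abs] at h2
    have h3 : 1 / (4 * η) * (K ^ 2 * τ ^ 2 * u ^ 2) ≤ k₃ * D := by
      calc 1 / (4 * η) * (K ^ 2 * τ ^ 2 * u ^ 2) ≤ 1 / (4 * η) * (K ^ 2 * τ * u ^ 2) := by gcongr
        _ = k₃ * (τ * u ^ 2) := by rw [hk₃]; ring
        _ ≤ _ := by gcongr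
    linarith only [h1, h2, h3]
  have t4 : |1 / 2 * ν * R₂| ≤ η * ν ^ 2 + k₄ * D + s * (σ * z' ^ 2) + k₅ * D := by
    rw [abs_mul, abs_mul, abs_of_nonneg (by norm_num : (0:ℝ) ≤ 1/2)]
    have h1 : 1 / 2 * |ν| * |R₂| ≤ |ν| * y + σ * (z' * (K * τ * |ν|)) := by
      calc 1 / 2 * |ν| * |R₂| ≤ 1 * |ν| * (y + σ * (K * τ * z')) := by gcongr; norm_num
        _ = _ := by ring
    have h2 := young (x := |ν|) (y := y) hη0
    have h3 := young (x := z') (y := K * τ * |ν|) hs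
    rw [sq_abs] at h2
    rw [mul_pow, mul_pow, sq_abs] at h3
    have h4 := mul_le_mul_of_nonneg_left h3 hσ
    have h5 : σ * (1 / (4 * s) * (K ^ 2 * τ ^ 2 * ν ^ 2)) ≤ k₅ * D := by
      calc σ * (1 / (4 * s) * (K ^ 2 * τ ^ 2 * ν ^ 2))
          ≤ σ * (1 / (4 * s) * (K ^ 2 * τ * ν ^ 2)) := by gcongr
        _ = k₅ * (τ * (σ * ν ^ 2)) := by rw [hk₅]; ring
        _ ≤ _ := by gcongr
    have h6 : 1 / (4 * η) * y ^ 2 ≤ k₄ * D := by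
      rw [hk₄, mul_one]; gcongr
    linarith only [h1, h2, h3, h4, h5, h6]
  have t6 : |1 / 2 * σ * ν * Nv| ≤ η * (σ * SX) + k₆ * D := by
    rw [abs_mul, abs_mul, abs_of_nonneg (by positivity : (0:ℝ) ≤ 1 / 2 * σ)]
    have h1 : 1 / 2 * σ * |ν| * |Nv| ≤ σ * (X * (K * τ * |ν|)) := by
      calc 1 / 2 * σ * |ν| * |Nv| ≤ 1 * σ * |ν| * (K * τ * X) := by gcongr; norm_num
        _ = _ := by ring
    have h3 := young (x := X) (y := K * τ * |ν|) hη'0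
    rw [mul_pow (K * τ), mul_pow, sq_abs] at h3
    have h4 := mul_le_mul_of_nonneg_left h3 hσ
    have h5 : σ * (1 / (4 * η') * (K ^ 2 * τ ^ 2 * ν ^ 2)) ≤ k₆ * D := by
      calc σ * (1 / (4 * η') * (K ^ 2 * τ ^ 2 * ν ^ 2))
          ≤ σ * (1 / (4 * η') * (K ^ 2 * τ * ν ^ 2)) := by gcongr
        _ = k₆ * (τ * (σ * ν ^ 2)) := by rw [hk₆]; ring
        _ ≤ _ := by gcongr
    have h6 := mul_le_mul_of_nonneg_left hX hσ
    linarith only [h1, h3, h4, h5, h6]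
  have t7 : |w * u * R₁| ≤ η * u ^ 2 + k₇ * D + s / 2 * z ^ 2 + k₈ * D := by
    rw [abs_mul, abs_mul, abs_of_nonneg (by linarith : (0:ℝ) ≤ w)]
    have h1 : w * |u| * |R₁| ≤ |u| * (2 * y) + z * (2 * K * τ * |u|) := by
      calc w * |u| * |R₁| ≤ 2 * |u| * (y + K * τ * z) := by gcongr
        _ = _ := by ring
    have h2 := young (x := |u|) (y := 2 * y) hη0
    have h3 := young (x := z) (y := 2 * K * τ * |u|) (half_pos hs)
    rw [sq_abs] at h2
    rw [mul_pow (2 * K * τ), sq_abs] at h3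
    have h5 : 1 / (4 * (s / 2)) * ((2 * K * τ) ^ 2 * u ^ 2) ≤ k₈ * D := by
      calc 1 / (4 * (s / 2)) * ((2 * K * τ) ^ 2 * u ^ 2)
          = 1 / (4 * (s / 2)) * (4 * K ^ 2 * τ ^ 2 * u ^ 2) := by ring
        _ ≤ 1 / (4 * (s / 2)) * (4 * K ^ 2 * τ * u ^ 2) := by gcongr
        _ = k₈ * (τ * u ^ 2) := by rw [hk₈]; ring
        _ ≤ _ := by gcongr
    have h6 : 1 / (4 * η) * (2 * y) ^ 2 ≤ k₇ * D := by
      calc 1 / (4 * η) * (2 * y) ^ 2 = k₇ * y ^ 2 := by rw [hk₇]; ring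
        _ ≤ _ := by gcongr
    linarith only [h1, h2, h3, h5, h6]
  have t9 : |σ * PRφ| ≤ η * (σ * SY) + k₉ * D + s / 2 * z ^ 2 + k₁₀ * D := by
    rw [abs_mul, abs_of_nonneg hσ]
    have h1 : σ * |PRφ| ≤ σ * (Y * (K * n * y)) + z * (σ * (K * K * n) * τ * Y) := by
      calc σ * |PRφ| ≤ σ * (K * ((n * (y + K * τ * z)) * Y)) := by
            gcongr
            exact nR.trans (by gcongr)
        _ = _ := by ring
    have h2 := mul_le_mul_of_nonneg_left (young (x := Y) (y := K * n * y) hη'0) hσ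
    have h3 := young (x := z) (y := σ * (K * K * n) * τ * Y) (half_pos hs)
    have h5 : 1 / (4 * (s / 2)) * (σ * (K * K * n) * τ * Y) ^ 2 ≤ k₁₀ * D := by
      calc 1 / (4 * (s / 2)) * (σ * (K * K * n) * τ * Y) ^ 2
          = 1 / (4 * (s / 2)) * ((K * K * n) ^ 2 * (τ ^ 2 * (σ ^ 2 * Y ^ 2))) := by ring
        _ ≤ 1 / (4 * (s / 2)) * ((K * K * n) ^ 2 * (τ * (σ * (n * SY)))) := by gcongr
        _ = k₁₀ * (τ * (σ * SY)) := by rw [hk₁₀]; ring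
        _ ≤ _ := by gcongr
    have h6 : σ * (1 / (4 * η') * (K * n * y) ^ 2) ≤ k₉ * D := by
      calc σ * (1 / (4 * η') * (K * n * y) ^ 2) ≤ 1 * (1 / (4 * η') * (K * n * y) ^ 2) := by
            gcongr
        _ = k₉ * y ^ 2 := by rw [hk₉]; ring
        _ ≤ _ := by gcongr
    have h7 := mul_le_mul_of_nonneg_left hY hσ
    linarith only [h1, h2, h3, h5, h6, h7]
  have t11 : |σ * u * Mφ| ≤ k₁₁ * D := by
    rw [abs_mul, abs_mul, abs_of_nonneg hσ]
    have h1 : σ * |u| * |Mφ| ≤ K * τ * (|u| * (σ * Y)) := by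
      calc σ * |u| * |Mφ| ≤ σ * |u| * (K * τ * Y) := by gcongr
        _ = _ := by ring
    have h2 : |u| * (σ * Y) ≤ u ^ 2 + σ * (n * SY) := by
      have h3 : |u| * (σ * Y) ≤ |u| ^ 2 + (σ * Y) ^ 2 := by
        linarith only [two_mul_le_add_sq |u| (σ * Y), sq_nonneg |u|, sq_nonneg (σ * Y)]
      have h4 : (σ * Y) ^ 2 ≤ σ * (n * SY) := by
        rw [mul_pow]; gcongr
      rw [sq_abs] at h3
      linarith only [h3, h4]
    calc σ * |u| * |Mφ| ≤ K * τ * (u ^ 2 + σ * (n * SY)) := h1.trans (by gcongr)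
      _ = K * (τ * u ^ 2) + K * n * (τ * (σ * SY)) := by ring
      _ ≤ K * D + K * n * D := by gcongr
      _ = _ := by rw [hk₁₁]; ring
  have a2 := neg_abs_le (1 / 2 * wd * u ^ 2)
  have a3 := le_abs_self ((w - 1) * A * u * ν)
  have a4 := le_abs_self (1 / 2 * ν * R₂)
  have a6 := neg_abs_le (1 / 2 * σ * ν * Nv)
  have a7 := neg_abs_le (w * u * R₁)
  have a9 := neg_abs_le (σ * PRφ)
  have a11 := le_abs_self (σ * u * Mφ)
  have pu := sq_nonneg u
  have pν : c * ν ^ 2 ≤ 1 / 8 * ν ^ 2 := mul_le_mul_of_nonneg_right hc2 (sq_nonneg ν)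
  have p1 : 0 ≤ c * u ^ 2 := by positivity
  have p2 : 0 ≤ c * ν ^ 2 := by positivity
  have p3 : 0 ≤ c * (σ * SX) := by positivity
  have p4 : 0 ≤ c * (σ * SY) := by positivity
  have q1 : η * u ^ 2 = c * u ^ 2 / 8 := by rw [hη]; ring
  have q2 : η * ν ^ 2 = c * ν ^ 2 / 8 := by rw [hη]; ring
  have q3 : η * (σ * SX) = c * (σ * SX) / 8 := by rw [hη]; ring
  have q4 : η * (σ * SY) = c * (σ * SY) / 8 := by rw [hη]; ring
  rw [q1] at t7
  rw [q2] at t3 t4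
  rw [q3] at t6
  rw [q4] at t9
  linarith only [g, t0, t1, t2, t3, t4, t6, t7, t9, t11, a2, a3, a4, a6, a7, a9, a11, pν, p1, p2, p3, p4]

end LapseScalar

namespace LapseScalar

/-! ### The differentiated system -/

variable {n : ℕ} {T δ κ₀ σ : ℝ}

namespace Coeffs

/-- The weight `t ^ (1 - q_b)` of the derivative `∂_b`. -/
def p (𝒞 : Coeffs n) (b : Fin n) (t : ℝ) (x : Fin n → ℝ) : ℝ := t ^ (1 - 𝒞.q b x)

/-- The sum of the weighted derivatives `t ^ (1 - q_b) |∂_b ∂_L f|` with `L` of order less than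
`m`. -/
def gradAbs (𝒞 : Coeffs n) (m : ℕ) (f : (Fin n → ℝ) → ℝ) (t : ℝ) (x : Fin n → ℝ) : ℝ :=
  ∑ b, 𝒞.p b t x * jetAbs m (pderiv b f) x

/-- The sum of the squares of the weighted derivatives `t ^ (1 - q_b) ∂_b ∂_L f` with `L` of order
less than `m`. -/
def gradSq (𝒞 : Coeffs n) (m : ℕ) (f : (Fin n → ℝ) → ℝ) (t : ℝ) (x : Fin n → ℝ) : ℝ :=
  ∑ b, 𝒞.p b t x ^ 2 * jetSq m (pderiv b f) x

variable {𝒞 : Coeffs n}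

theorem p_pos {t : ℝ} (ht : 0 < t) (b : Fin n) (x : Fin n → ℝ) : 0 < 𝒞.p b t x :=
  Real.rpow_pos_of_pos ht _

theorem gradAbs_nonneg {t : ℝ} (ht : 0 < t) (m : ℕ) (f : (Fin n → ℝ) → ℝ) (x : Fin n → ℝ) :
    0 ≤ 𝒞.gradAbs m f t x :=
  Finset.sum_nonneg fun b _ => mul_nonneg (p_pos ht b x).le (jetAbs_nonneg _ _ _)

theorem gradSq_nonneg (t : ℝ) (m : ℕ) (f : (Fin n → ℝ) → ℝ) (x : Fin n → ℝ) :
    0 ≤ 𝒞.gradSq m f t x :=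
  Finset.sum_nonneg fun _ _ => mul_nonneg (sq_nonneg _) (jetSq_nonneg _ _ _)

theorem exists_gradAbs_sq_le (𝒞 : Coeffs n) (m : ℕ) :
    ∃ C > 0, ∀ f t x, 𝒞.gradAbs m f t x ^ 2 ≤ C * 𝒞.gradSq m f t x := by
  obtain ⟨C, hC, h⟩ := exists_jetAbs_sq_le n m
  refine ⟨n * C + 1, by positivity, fun f t x => ?_⟩
  have h1 := sq_sum_le_card_mul_sum_sq (s := (Finset.univ : Finset (Fin n)))
    (f := fun b => 𝒞.p b t x * jetAbs m (LapseScalar.pderiv b f) x)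
  simp only [Finset.card_univ, Fintype.card_fin] at h1
  have h2 : ∑ b, (𝒞.p b t x * jetAbs m (LapseScalar.pderiv b f) x) ^ 2 ≤ C * 𝒞.gradSq m f t x := by
    rw [gradSq, Finset.mul_sum]
    refine Finset.sum_le_sum fun b _ => ?_
    rw [mul_pow]
    calc _ ≤ 𝒞.p b t x ^ 2 * (C * jetSq m (LapseScalar.pderiv b f) x) := by gcongr; exact h _ _
      _ = _ := by ring
  have h3 := gradSq_nonneg (𝒞 := 𝒞) t m f x
  calc _ ≤ _ := h1
    _ ≤ n * (C * 𝒞.gradSq m f t x) := by gcongr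
    _ ≤ _ := by linarith

/-- Domination by `t ^ δ` times the weight of `∂_b`. -/
theorem Admissible.dom_weight (h : 𝒞.Admissible T δ κ₀) {b : Fin n} {f : ℝ → (Fin n → ℝ) → ℝ}
    (hf : IsDom T (fun x => 2 - 2 * 𝒞.q b x - κ₀ / 2) f) :
    IsDom T (fun x => δ + (1 - 𝒞.q b x)) f :=
  hf.mono h.T_le fun x => by linarith [h.q_le x b, h.δ_le, h.δ_pos]

theorem Admissible.κ₀_pos (h : 𝒞.Admissible T δ κ₀) : 0 < κ₀ := by
  linarith [h.δ_pos, h.δ_le]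

theorem Admissible.P_dom₁ (h : 𝒞.Admissible T δ κ₀) (a b : Fin n) :
    IsDom T (fun x => δ + (1 - 𝒞.q b x)) (𝒞.P a b) :=
  h.dom_weight (h.P_dom a b _ (half_pos h.κ₀_pos))

theorem Admissible.G_dom₁ (h : 𝒞.Admissible T δ κ₀) (b : Fin n) :
    IsDom T (fun x => δ + (1 - 𝒞.q b x)) (𝒞.G b) :=
  h.dom_weight (h.G_dom b _ (half_pos h.κ₀_pos))

theorem Admissible.B_dom₁ (h : 𝒞.Admissible T δ κ₀) (b : Fin n) :
    IsDom T (fun x => δ + (1 - 𝒞.q b x)) (𝒞.B b) :=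
  h.dom_weight (h.B_dom b _ (half_pos h.κ₀_pos))

theorem Admissible.H_dom₁ (h : 𝒞.Admissible T δ κ₀) (b : Fin n) :
    IsDom T (fun x => δ + (1 - 𝒞.q b x)) (𝒞.H b) :=
  h.dom_weight (h.H_dom b _ (half_pos h.κ₀_pos))

theorem Admissible.α_dom₀ (h : 𝒞.Admissible T δ κ₀) : IsDom T (fun _ => 0) 𝒞.α :=
  ((h.α_dom.mono (s' := fun _ => 0) h.T_le fun _ => h.δ_pos.le).add
    (IsDom.torus (.const 1))).congr fun t ht x => by ring

theorem Admissible.αP_dom (h : 𝒞.Admissible T δ κ₀) (a b : Fin n) {ε : ℝ} (hε : 0 < ε) :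
    IsDom T (fun x => 2 - 2 * 𝒞.q b x - ε) (fun t x => 𝒞.α t x * 𝒞.P a b t x) :=
  (h.α_dom₀.mul (h.P_dom a b ε hε)).mono h.T_le fun x => by linarith

theorem Admissible.αP_dom₁ (h : 𝒞.Admissible T δ κ₀) (a b : Fin n) :
    IsDom T (fun x => δ + (1 - 𝒞.q b x)) (fun t x => 𝒞.α t x * 𝒞.P a b t x) :=
  h.dom_weight (h.αP_dom a b (half_pos h.κ₀_pos))

theorem rpow_add_weight {t : ℝ} (ht : 0 < t) (b : Fin n) (x : Fin n → ℝ) :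
    t ^ (δ + (1 - 𝒞.q b x)) = t ^ δ * 𝒞.p b t x := Real.rpow_add ht _ _

end Coeffs

theorem sum_mul_le_sum_mul_sum {ι : Type*} [Fintype ι] {C r : ι → ℝ} (hC : ∀ i, 0 ≤ C i)
    (hr : ∀ i, 0 ≤ r i) : ∑ i, C i * r i ≤ (∑ i, C i) * ∑ i, r i := by
  rw [Finset.sum_mul]
  refine Finset.sum_le_sum fun i _ => mul_le_mul_of_nonneg_left ?_ (hC i)
  exact Finset.single_le_sum (fun i _ => hr i) (Finset.mem_univ i)

namespace Coeffs

variable {𝒞 : Coeffs n}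

/-- The coefficient of `∂_b` has size `t^{2 - 2 q_b}` up to `ε`, which exceeds `t^δ` times the
weight `p_b` carried by `∂_b` in the energy. First-order terms of top order therefore keep the small
factor `t^δ`. -/
theorem exists_listDeriv_first_order {G : Fin n → ℝ → (Fin n → ℝ) → ℝ}
    (hG : ∀ b, IsDom T (fun x => δ + (1 - 𝒞.q b x)) (G b)) (m : ℕ) :
    ∃ C > 0, ∀ t ∈ Ioc 0 T, ∀ x, ∀ L : List (Fin n), L.length ≤ m → ∀ f, SmoothTorus f →
      |listDeriv L (fun y => ∑ b, G b t y * pderiv b f y) x|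
        ≤ C * t ^ δ * 𝒞.gradAbs (L.length + 1) f t x := by
  choose C hC hb using fun b => (hG b).listDeriv_mul_le m
  refine ⟨∑ b, C b + 1, add_pos_of_nonneg_of_pos (Finset.sum_nonneg fun b _ => (hC b).le) one_pos,
    fun t ht x L hL f hf => ?_⟩
  rw [listDeriv_sum fun b _ => ((hG b).1.torus ht).mul (hf.pderiv b)]
  have pδ := Real.rpow_nonneg ht.1.le δ
  have pg := gradAbs_nonneg (𝒞 := 𝒞) ht.1 (L.length + 1) f x
  refine (Finset.abs_sum_le_sum_abs _ _).trans ?_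
  calc _ ≤ ∑ b, t ^ δ * (C b * (𝒞.p b t x * jetAbs (L.length + 1) (LapseScalar.pderiv b f) x)) := by
        refine Finset.sum_le_sum fun b _ => (hb b t ht x L hL _ (hf.pderiv b)).trans (le_of_eq ?_)
        rw [rpow_add_weight ht.1]; ring
    _ = t ^ δ * ∑ b, C b * (𝒞.p b t x * jetAbs (L.length + 1) (LapseScalar.pderiv b f) x) := by
        rw [Finset.mul_sum]
    _ ≤ t ^ δ * ((∑ b, C b) * 𝒞.gradAbs (L.length + 1) f t x) := by
        gcongr
        exact sum_mul_le_sum_mul_sum (fun b => (hC b).le) fun b =>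
          mul_nonneg (p_pos ht.1 b x).le (jetAbs_nonneg _ _ _)
    _ ≤ _ := by nlinarith [mul_nonneg pδ pg]

/-- In the commutator at least one derivative falls on `P`, so `f` receives at most one derivative
beyond the length of the multi-index. Counting `∂_b` separately, with the weight `p_b` taken from
`P^{ab}`, leaves a jet of `∂_b f` that the weighted gradient contains. -/
theorem exists_listDeriv_second_order {P : Fin n → Fin n → ℝ → (Fin n → ℝ) → ℝ}
    (hP : ∀ a b, IsDom T (fun x => δ + (1 - 𝒞.q b x)) (P a b)) (m : ℕ) :
    ∃ C > 0, ∀ t ∈ Ioc 0 T, ∀ x, ∀ L : List (Fin n), L.length ≤ m → ∀ f, SmoothTorus f →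
      |listDeriv L (fun y => ∑ a, ∑ b, P a b t y * pderiv b (pderiv a f) y) x
        - ∑ a, ∑ b, P a b t x * pderiv b (pderiv a (listDeriv L f)) x|
        ≤ C * t ^ δ * 𝒞.gradAbs (L.length + 1) f t x := by
  choose C hC hb using fun a b => (hP a b).listDeriv_mul_sub_le m
  refine ⟨∑ a, ∑ b, C a b + 1, add_pos_of_nonneg_of_pos (Finset.sum_nonneg fun a _ =>
    Finset.sum_nonneg fun b _ => (hC a b).le) one_pos, fun t ht x L hL f hf => ?_⟩
  rw [listDeriv_sum fun a _ => .sum fun b _ => ((hP a b).1.torus ht).mul ((hf.pderiv a).pderiv b)]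
  have e : ∀ a, listDeriv L (fun y => ∑ b, P a b t y * LapseScalar.pderiv b
      (LapseScalar.pderiv a f) y) x = ∑ b, listDeriv L (fun y => P a b t y * LapseScalar.pderiv b
      (LapseScalar.pderiv a f) y) x := fun a => by
    rw [listDeriv_sum fun b _ => ((hP a b).1.torus ht).mul ((hf.pderiv a).pderiv b)]
  simp only [e, ← Finset.sum_sub_distrib]
  have pδ := Real.rpow_nonneg ht.1.le δ
  have pg := gradAbs_nonneg (𝒞 := 𝒞) ht.1 (L.length + 1) f x
  refine (Finset.abs_sum_le_sum_abs _ _).trans ?_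
  calc _ ≤ ∑ a, t ^ δ * ((∑ b, C a b) * 𝒞.gradAbs (L.length + 1) f t x) := by
        refine Finset.sum_le_sum fun a _ => (Finset.abs_sum_le_sum_abs _ _).trans ?_
        calc _ ≤ ∑ b, t ^ δ * (C a b * (𝒞.p b t x
                * jetAbs (L.length + 1) (LapseScalar.pderiv b f) x)) := by
              refine Finset.sum_le_sum fun b _ => ?_
              have h1 := hb a b t ht x L hL _ ((hf.pderiv a).pderiv b)
              rw [← pderiv_listDeriv (hf.pderiv a), ← pderiv_listDeriv hf,
                rpow_add_weight ht.1] at h1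
              refine h1.trans ?_
              have h2 := jetAbs_pderiv_le L.length (LapseScalar.pderiv b f) a x
              rw [pderiv_comm hf a b] at h2
              have h3 := p_pos (𝒞 := 𝒞) ht.1 b x
              have h4 := hC a b
              calc _ ≤ C a b * (t ^ δ * 𝒞.p b t x)
                    * jetAbs (L.length + 1) (LapseScalar.pderiv b f) x := by gcongr
                _ = _ := by ring
          _ = t ^ δ * ∑ b, C a b * (𝒞.p b t x
                * jetAbs (L.length + 1) (LapseScalar.pderiv b f) x) := by rw [Finset.mul_sum]
          _ ≤ _ := by
              gcongr
              exact sum_mul_le_sum_mul_sum (fun b => (hC a b).le) fun b =>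
                mul_nonneg (p_pos ht.1 b x).le (jetAbs_nonneg _ _ _)
    _ = t ^ δ * ((∑ a, ∑ b, C a b) * 𝒞.gradAbs (L.length + 1) f t x) := by
        rw [Finset.sum_mul, Finset.mul_sum]
    _ ≤ _ := by nlinarith [mul_nonneg pδ pg]

/-- The coefficient `A` does not decay in `t`, so neither does this commutator; it is harmless
because it involves only derivatives of strictly lower order. -/
theorem exists_listDeriv_torus_mul {A : (Fin n → ℝ) → ℝ} (hA : SmoothTorus A) (m : ℕ) :
    ∃ C > 0, ∀ x, ∀ L : List (Fin n), L.length ≤ m → ∀ f, SmoothTorus f →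
      |listDeriv L (fun y => A y * f y) x - A x * listDeriv L f x|
        ≤ C * jetAbs L.length f x := by
  obtain ⟨C, hC, h⟩ := (IsDom.torus (T := 1) hA).listDeriv_mul_sub_le m
  refine ⟨C, hC, fun x L hL f hf => ?_⟩
  simpa using h 1 (by simp) x L hL f hf

/-- The remainder in the differentiated equation for `u`. -/
theorem Admissible.exists_listDeriv_eq_u (h : 𝒞.Admissible T δ κ₀) (m : ℕ) :
    ∃ C > 0, ∀ {σ : ℝ} {F₁ F₂ F₃ u ν φ : ℝ → (Fin n → ℝ) → ℝ}, 0 ≤ σ → σ ≤ 1 →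
      𝒞.Solves T σ F₁ F₂ F₃ u ν φ → ∀ t ∈ Ioc 0 T, ∀ x, ∀ L : List (Fin n), L.length ≤ m →
      |t * listDeriv L (timeDeriv T u t) x + 𝒞.A x * listDeriv L (ν t) x
          - σ * (𝒞.α t x * ∑ a, ∑ b, 𝒞.P a b t x * pderiv b (pderiv a (listDeriv L (φ t))) x)|
        ≤ |listDeriv L (F₁ t) x| + C * jetAbs L.length (ν t) x
          + C * t ^ δ * (jetAbs (L.length + 1) (u t) x + jetAbs (L.length + 1) (ν t) x
            + σ * 𝒞.gradAbs (L.length + 1) (φ t) t x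
            + σ * 𝒞.gradAbs (L.length + 1) (ν t) t x) := by
  obtain ⟨C1, hC1, h1⟩ := exists_listDeriv_torus_mul h.smooth_A m
  obtain ⟨C2, hC2, h2⟩ := h.c₁_dom.listDeriv_mul_le m
  obtain ⟨C3, hC3, h3⟩ := h.α_dom.listDeriv_mul_le m
  obtain ⟨C4, hC4, h4⟩ := exists_listDeriv_second_order (𝒞 := 𝒞) h.αP_dom₁ m
  obtain ⟨C5, hC5, h5⟩ := exists_listDeriv_first_order (𝒞 := 𝒞) h.B_dom₁ m
  obtain ⟨C6, hC6, h6⟩ := exists_listDeriv_first_order (𝒞 := 𝒞) h.H_dom₁ m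
  refine ⟨C1 + C2 + C3 + C4 + C5 + C6, by positivity, ?_⟩
  intro σ F₁ F₂ F₃ u ν φ hσ hσ1 hs t ht x L hL
  have su := hs.smooth_u.torus ht
  have sν := hs.smooth_ν.torus ht
  have sφ := hs.smooth_φ.torus ht
  have sF := hs.smooth_F₁.torus ht
  have s1 : SmoothTorus (fun y => 𝒞.A y * ν t y) := h.smooth_A.mul sν
  have s2 : SmoothTorus (fun y => 𝒞.c₁ t y * ν t y) := (h.c₁_dom.1.torus ht).mul sν
  have s3 : SmoothTorus (fun y => (𝒞.α t y - 1) * u t y) := (h.α_dom.1.torus ht).mul su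
  have s4 : SmoothTorus (fun y => ∑ a, ∑ b, (𝒞.α t y * 𝒞.P a b t y)
      * pderiv b (pderiv a (φ t)) y) := .sum fun a _ => .sum fun b _ =>
    ((h.αP_dom₁ a b).1.torus ht).mul ((sφ.pderiv a).pderiv b)
  have s5 : SmoothTorus (fun y => ∑ b, 𝒞.B b t y * pderiv b (φ t) y) := .sum fun b _ =>
    ((h.B_dom₁ b).1.torus ht).mul (sφ.pderiv b)
  have s6 : SmoothTorus (fun y => ∑ b, 𝒞.H b t y * pderiv b (ν t) y) := .sum fun b _ =>
    ((h.H_dom₁ b).1.torus ht).mul (sν.pderiv b)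
  have e : (fun y => t * timeDeriv T u t y) = _ := funext fun y => hs.eq_u t ht y
  have e' := congrFun (congrArg (listDeriv L) e) x
  rw [listDeriv_const_mul t (hs.smooth_u.timeDeriv.torus ht),
    listDeriv_add (s1.neg.sub sF) ((SmoothTorus.const σ).mul
      ((((s2.sub s3).add s4).add s5).add s6)), listDeriv_sub s1.neg sF, listDeriv_neg s1,
    listDeriv_const_mul σ ((((s2.sub s3).add s4).add s5).add s6),
    listDeriv_add (((s2.sub s3).add s4).add s5) s6, listDeriv_add ((s2.sub s3).add s4) s5,
    listDeriv_add (s2.sub s3) s4, listDeriv_sub s2 s3] at e'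
  have b1 := h1 x L hL _ sν
  have b2 := h2 t ht x L hL _ sν
  have b3 := h3 t ht x L hL _ su
  have b4 := h4 t ht x L hL _ sφ
  have b5 := h5 t ht x L hL _ sφ
  have b6 := h6 t ht x L hL _ sν
  have e4 : ∑ a, ∑ b, 𝒞.α t x * 𝒞.P a b t x * pderiv b (pderiv a (listDeriv L (φ t))) x
      = 𝒞.α t x * ∑ a, ∑ b, 𝒞.P a b t x * pderiv b (pderiv a (listDeriv L (φ t))) x := by
    simp only [Finset.mul_sum, mul_assoc]
  rw [e4] at b4
  dsimp only at e'
  rw [e']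
  have pδ := Real.rpow_nonneg ht.1.le δ
  have g1 := jetAbs_nonneg (L.length + 1) (u t) x
  have g2 := jetAbs_nonneg (L.length + 1) (ν t) x
  have g3 := gradAbs_nonneg (𝒞 := 𝒞) ht.1 (L.length + 1) (φ t) x
  have g4 := gradAbs_nonneg (𝒞 := 𝒞) ht.1 (L.length + 1) (ν t) x
  have g5 := jetAbs_nonneg L.length (ν t) x
  generalize listDeriv L (fun y => 𝒞.A y * ν t y) x = v1 at *
  generalize listDeriv L (fun y => 𝒞.c₁ t y * ν t y) x = v2 at *
  generalize listDeriv L (fun y => (𝒞.α t y - 1) * u t y) x = v3 at *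
  generalize listDeriv L (fun y => ∑ a, ∑ b, (𝒞.α t y * 𝒞.P a b t y)
      * pderiv b (pderiv a (φ t)) y) x = v4 at *
  generalize listDeriv L (fun y => ∑ b, 𝒞.B b t y * pderiv b (φ t) y) x = v5 at *
  generalize listDeriv L (fun y => ∑ b, 𝒞.H b t y * pderiv b (ν t) y) x = v6 at *
  generalize 𝒞.α t x * ∑ a, ∑ b, 𝒞.P a b t x * pderiv b (pderiv a (listDeriv L (φ t))) x = w4 at *
  generalize jetAbs (L.length + 1) (u t) x = J1 at *
  generalize jetAbs (L.length + 1) (ν t) x = J2 at *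
  generalize 𝒞.gradAbs (L.length + 1) (φ t) t x = J3 at *
  generalize 𝒞.gradAbs (L.length + 1) (ν t) t x = J4 at *
  generalize jetAbs L.length (ν t) x = J5 at *
  generalize listDeriv L (F₁ t) x = f at *
  generalize listDeriv L (ν t) x = νL at *
  generalize t ^ δ = τ at *
  have e5 : -v1 - f + σ * (v2 - v3 + v4 + v5 + v6) + 𝒞.A x * νL - σ * w4
      = -(v1 - 𝒞.A x * νL) + -f + σ * v2 + -(σ * v3) + σ * (v4 - w4) + σ * v5 + σ * v6 := by ring
  rw [e5]
  have k : ∀ {v r : ℝ}, |v| ≤ r → |σ * v| ≤ σ * r := fun hv => by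
    rw [abs_mul, abs_of_nonneg hσ]; gcongr
  have k' : ∀ {v r : ℝ}, |v| ≤ r → |σ * v| ≤ r := fun hv => by
    rw [abs_mul, abs_of_nonneg hσ]
    exact (mul_le_of_le_one_left (abs_nonneg _) hσ1).trans hv
  have a2 := k' b2
  have a3 := k' b3
  have a4 := k b4
  have a5 := k b5
  have a6 := k b6
  have tri : |-(v1 - 𝒞.A x * νL) + -f + σ * v2 + -(σ * v3) + σ * (v4 - w4) + σ * v5 + σ * v6|
      ≤ |v1 - 𝒞.A x * νL| + |f| + |σ * v2| + |σ * v3| + |σ * (v4 - w4)| + |σ * v5| + |σ * v6| := by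
    refine (abs_add_le _ _).trans (add_le_add_left ((abs_add_le _ _).trans (add_le_add_left
      ((abs_add_le _ _).trans (add_le_add_left ((abs_add_le _ _).trans (add_le_add
        ((abs_add_le _ _).trans (add_le_add_left ((abs_add_le _ _).trans ?_) _)) ?_)) _)) _)) _)
    · rw [abs_neg, abs_neg]
    · rw [abs_neg]
  have c1 : C2 * τ * J2 + C3 * τ * J1 + C4 * τ * (σ * J3) + C5 * τ * (σ * J3) + C6 * τ * (σ * J4)
      + C1 * J5 ≤ (C1 + C2 + C3 + C4 + C5 + C6) * J5
        + (C1 + C2 + C3 + C4 + C5 + C6) * τ * (J1 + J2 + σ * J3 + σ * J4) := by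
    have q1 : 0 ≤ τ * J1 := by positivity
    have q2 : 0 ≤ τ * J2 := by positivity
    have q3 : 0 ≤ τ * (σ * J3) := by positivity
    have q4 : 0 ≤ τ * (σ * J4) := by positivity
    have r : ∀ {a b j : ℝ}, 0 ≤ j → a ≤ b → a * j ≤ b * j := fun hj hab =>
      mul_le_mul_of_nonneg_right hab hj
    have r1 : C3 * (τ * J1) ≤ (C1 + C2 + C3 + C4 + C5 + C6) * (τ * J1) := r q1 (by linarith)
    have r2 : C2 * (τ * J2) ≤ (C1 + C2 + C3 + C4 + C5 + C6) * (τ * J2) := r q2 (by linarith)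
    have r3 : (C4 + C5) * (τ * (σ * J3)) ≤ (C1 + C2 + C3 + C4 + C5 + C6) * (τ * (σ * J3)) :=
      r q3 (by linarith)
    have r4 : C6 * (τ * (σ * J4)) ≤ (C1 + C2 + C3 + C4 + C5 + C6) * (τ * (σ * J4)) :=
      r q4 (by linarith)
    have r5 : C1 * J5 ≤ (C1 + C2 + C3 + C4 + C5 + C6) * J5 := r g5 (by linarith)
    linarith only [r1, r2, r3, r4, r5]
  linarith only [tri, a2, a3, a4, a5, a6, b1, c1]

end Coeffs

end LapseScalar

/-! ### The differentiated equations for `ν` and `φ` -/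

namespace LapseScalar

variable {n : ℕ} {T δ κ₀ σ : ℝ}

namespace Coeffs

variable {𝒞 : Coeffs n}

/-- The remainder in the differentiated equation for `ν`. -/
theorem Admissible.exists_listDeriv_eq_ν (h : 𝒞.Admissible T δ κ₀) (m : ℕ) :
    ∃ C > 0, ∀ {σ : ℝ} {F₁ F₂ F₃ u ν φ : ℝ → (Fin n → ℝ) → ℝ}, 0 ≤ σ → σ ≤ 1 →
      𝒞.Solves T σ F₁ F₂ F₃ u ν φ → ∀ t ∈ Ioc 0 T, ∀ x, ∀ L : List (Fin n), L.length ≤ m →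
      |listDeriv L (ν t) x + 2 * 𝒞.A x * listDeriv L (u t) x
          - σ * ∑ a, ∑ b, 𝒞.P a b t x * pderiv b (pderiv a (listDeriv L (ν t))) x|
        ≤ |listDeriv L (F₂ t) x| + C * jetAbs L.length (u t) x
          + σ * (C * t ^ δ * (jetAbs (L.length + 1) (ν t) x + jetAbs (L.length + 1) (u t) x
            + 𝒞.gradAbs (L.length + 1) (ν t) t x)) := by
  obtain ⟨C1, hC1, h1⟩ := exists_listDeriv_torus_mul ((SmoothTorus.const 2).mul h.smooth_A) m
  obtain ⟨C2, hC2, h2⟩ := h.c₃_dom.listDeriv_mul_le m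
  obtain ⟨C3, hC3, h3⟩ := h.c₄_dom.listDeriv_mul_le m
  obtain ⟨C4, hC4, h4⟩ := exists_listDeriv_second_order (𝒞 := 𝒞) h.P_dom₁ m
  obtain ⟨C5, hC5, h5⟩ := exists_listDeriv_first_order (𝒞 := 𝒞) h.G_dom₁ m
  refine ⟨C1 + C2 + C3 + C4 + C5, by positivity, ?_⟩
  intro σ F₁ F₂ F₃ u ν φ hσ hσ1 hs t ht x L hL
  have su := hs.smooth_u.torus ht
  have sν := hs.smooth_ν.torus ht
  have sF := hs.smooth_F₂.torus ht
  have s1 : SmoothTorus (fun y => 2 * 𝒞.A y * u t y) :=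
    ((SmoothTorus.const 2).mul h.smooth_A).mul su
  have s2 : SmoothTorus (fun y => 𝒞.c₃ t y * ν t y) := (h.c₃_dom.1.torus ht).mul sν
  have s3 : SmoothTorus (fun y => 𝒞.c₄ t y * u t y) := (h.c₄_dom.1.torus ht).mul su
  have s4 : SmoothTorus (fun y => ∑ a, ∑ b, 𝒞.P a b t y * pderiv b (pderiv a (ν t)) y) :=
    .sum fun a _ => .sum fun b _ => ((h.P_dom₁ a b).1.torus ht).mul ((sν.pderiv a).pderiv b)
  have s5 : SmoothTorus (fun y => ∑ b, 𝒞.G b t y * pderiv b (ν t) y) := .sum fun b _ =>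
    ((h.G_dom₁ b).1.torus ht).mul (sν.pderiv b)
  have e : (fun y => ν t y) = _ := funext fun y => hs.eq_ν t ht y
  have e' := congrFun (congrArg (listDeriv L) e) x
  rw [listDeriv_add (s1.neg.sub sF) ((SmoothTorus.const σ).mul (((s2.add s3).add s4).add s5)),
    listDeriv_sub s1.neg sF, listDeriv_neg s1, listDeriv_const_mul σ (((s2.add s3).add s4).add s5),
    listDeriv_add ((s2.add s3).add s4) s5, listDeriv_add (s2.add s3) s4,
    listDeriv_add s2 s3] at e'
  have b1 := h1 x L hL _ su
  have b2 := h2 t ht x L hL _ sν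
  have b3 := h3 t ht x L hL _ su
  have b4 := h4 t ht x L hL _ sν
  have b5 := h5 t ht x L hL _ sν
  dsimp only at e'
  change listDeriv L (ν t) x = _ at e'
  have pδ := Real.rpow_nonneg ht.1.le δ
  have g1 := jetAbs_nonneg (L.length + 1) (u t) x
  have g2 := jetAbs_nonneg (L.length + 1) (ν t) x
  have g4 := gradAbs_nonneg (𝒞 := 𝒞) ht.1 (L.length + 1) (ν t) x
  have g5 := jetAbs_nonneg L.length (u t) x
  generalize listDeriv L (fun y => 2 * 𝒞.A y * u t y) x = v1 at *
  generalize listDeriv L (fun y => 𝒞.c₃ t y * ν t y) x = v2 at *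
  generalize listDeriv L (fun y => 𝒞.c₄ t y * u t y) x = v3 at *
  generalize listDeriv L (fun y => ∑ a, ∑ b, 𝒞.P a b t y * pderiv b (pderiv a (ν t)) y) x
    = v4 at *
  generalize listDeriv L (fun y => ∑ b, 𝒞.G b t y * pderiv b (ν t) y) x = v5 at *
  generalize ∑ a, ∑ b, 𝒞.P a b t x * pderiv b (pderiv a (listDeriv L (ν t))) x = w4 at *
  generalize jetAbs (L.length + 1) (u t) x = J1 at *
  generalize jetAbs (L.length + 1) (ν t) x = J2 at *
  generalize 𝒞.gradAbs (L.length + 1) (ν t) t x = J4 at *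
  generalize jetAbs L.length (u t) x = J5 at *
  generalize listDeriv L (F₂ t) x = f at *
  generalize listDeriv L (ν t) x = νL at *
  generalize listDeriv L (u t) x = uL at *
  generalize t ^ δ = τ at *
  have e5 : νL + 2 * 𝒞.A x * uL - σ * w4
      = -(v1 - 2 * 𝒞.A x * uL) + -f + σ * (v2 + v3 + (v4 - w4) + v5) := by linarith
  rw [e5]
  have tri2 : |v2 + v3 + (v4 - w4) + v5| ≤ |v2| + |v3| + |v4 - w4| + |v5| :=
    (abs_add_le _ _).trans (add_le_add_left ((abs_add_le _ _).trans (add_le_add_left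
      (abs_add_le _ _) _)) _)
  have tri : |-(v1 - 2 * 𝒞.A x * uL) + -f + σ * (v2 + v3 + (v4 - w4) + v5)|
      ≤ |v1 - 2 * 𝒞.A x * uL| + |f| + σ * |v2 + v3 + (v4 - w4) + v5| := by
    refine (abs_add_le _ _).trans (add_le_add ((abs_add_le _ _).trans ?_) ?_)
    · rw [abs_neg, abs_neg]
    · rw [abs_mul, abs_of_nonneg hσ]
  have r : ∀ {a b j : ℝ}, 0 ≤ j → a ≤ b → a * j ≤ b * j := fun hj hab =>
      mul_le_mul_of_nonneg_right hab hj
  have q1 : 0 ≤ τ * J1 := by positivity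
  have q2 : 0 ≤ τ * J2 := by positivity
  have q4 : 0 ≤ τ * J4 := by positivity
  have r1 : C3 * (τ * J1) ≤ (C1 + C2 + C3 + C4 + C5) * (τ * J1) := r q1 (by linarith)
  have r2 : C2 * (τ * J2) ≤ (C1 + C2 + C3 + C4 + C5) * (τ * J2) := r q2 (by linarith)
  have r4 : (C4 + C5) * (τ * J4) ≤ (C1 + C2 + C3 + C4 + C5) * (τ * J4) := r q4 (by linarith)
  have r5 : C1 * J5 ≤ (C1 + C2 + C3 + C4 + C5) * J5 := r g5 (by linarith)
  have c1 : |v2 + v3 + (v4 - w4) + v5| ≤ (C1 + C2 + C3 + C4 + C5) * τ * (J2 + J1 + J4) := by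
    linarith only [r1, r2, r4, tri2, b2, b3, b4, b5]
  have c2 := mul_le_mul_of_nonneg_left c1 hσ
  linarith only [tri, b1, c2, r5]

theorem Admissible.p_le_rpow (h : 𝒞.Admissible T δ κ₀) {t : ℝ} (ht : t ∈ Ioc 0 T) (b : Fin n)
    (x : Fin n → ℝ) : 𝒞.p b t x ≤ t ^ δ :=
  rpow_le_rpow_of_le_one ht.1 (ht.2.trans h.T_le) (by linarith [h.q_le x b, h.δ_le, h.κ₀_pos])

theorem Admissible.rpow_le_one (h : 𝒞.Admissible T δ κ₀) {t : ℝ} (ht : t ∈ Ioc 0 T) :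
    t ^ δ ≤ 1 := Real.rpow_le_one ht.1.le (ht.2.trans h.T_le) h.δ_pos.le

theorem mul_abs_pderiv_le_gradAbs {t : ℝ} (ht : 0 < t) (b : Fin n) {f : (Fin n → ℝ) → ℝ}
    (hf : SmoothTorus f) (L : List (Fin n)) (x : Fin n → ℝ) :
    𝒞.p b t x * |pderiv b (listDeriv L f) x| ≤ 𝒞.gradAbs (L.length + 1) f t x := by
  rw [pderiv_listDeriv hf]
  calc _ ≤ 𝒞.p b t x * jetAbs (L.length + 1) (LapseScalar.pderiv b f) x := by
        have := p_pos (𝒞 := 𝒞) ht b x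
        gcongr
        exact abs_listDeriv_le_jetAbs _ _ (by omega)
    _ ≤ _ := Finset.single_le_sum (f := fun b => 𝒞.p b t x
        * jetAbs (L.length + 1) (LapseScalar.pderiv b f) x)
        (fun b _ => mul_nonneg (p_pos ht b x).le (jetAbs_nonneg _ _ _)) (Finset.mem_univ b)

/-- The remainder in the differentiated equation for the derivatives of `φ`. -/
theorem Admissible.exists_listDeriv_eq_pderiv_φ (h : 𝒞.Admissible T δ κ₀) (m : ℕ) :
    ∃ C > 0, ∀ {σ : ℝ} {F₁ F₂ F₃ u ν φ : ℝ → (Fin n → ℝ) → ℝ}, 0 ≤ σ → σ ≤ 1 →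
      𝒞.Solves T σ F₁ F₂ F₃ u ν φ → ∀ t ∈ Ioc 0 T, ∀ x, ∀ L : List (Fin n), L.length ≤ m →
      ∀ c, 𝒞.p c t x * |t * pderiv c (listDeriv L (timeDeriv T φ t)) x
          - (1 + σ * (𝒞.α t x - 1)) * pderiv c (listDeriv L (u t)) x
          - 𝒞.A x * pderiv c (listDeriv L (ν t)) x|
        ≤ 𝒞.p c t x * |pderiv c (listDeriv L (F₃ t)) x|
          + C * t ^ δ * (jetAbs (L.length + 1) (u t) x + jetAbs (L.length + 1) (ν t) x
            + σ * 𝒞.gradAbs (L.length + 1) (ν t) t x) := by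
  obtain ⟨C1, hC1, h1⟩ := exists_listDeriv_torus_mul h.smooth_A (m + 1)
  obtain ⟨C2, hC2, h2⟩ := h.α_dom.listDeriv_mul_sub_le (m + 1)
  obtain ⟨C3, hC3, h3⟩ := h.c₆_dom.listDeriv_mul_sub_le (m + 1)
  obtain ⟨C4, hC4, h4⟩ := h.c₆_dom.abs_le
  refine ⟨C1 + C2 + C3 + C4, by positivity, ?_⟩
  intro σ F₁ F₂ F₃ u ν φ hσ hσ1 hs t ht x L hL c
  have su := hs.smooth_u.torus ht
  have sν := hs.smooth_ν.torus ht
  have sF := hs.smooth_F₃.torus ht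
  have s1 : SmoothTorus (fun y => 𝒞.A y * ν t y) := h.smooth_A.mul sν
  have s2 : SmoothTorus (fun y => (𝒞.α t y - 1) * u t y) := (h.α_dom.1.torus ht).mul su
  have s3 : SmoothTorus (fun y => 𝒞.c₆ t y * ν t y) := (h.c₆_dom.1.torus ht).mul sν
  have e : (fun y => t * timeDeriv T φ t y) = _ := funext fun y => hs.eq_φ t ht y
  have e' := congrFun (congrArg (listDeriv (c :: L)) e) x
  rw [listDeriv_const_mul t (hs.smooth_φ.timeDeriv.torus ht),
    listDeriv_add ((su.add s1).sub sF) ((SmoothTorus.const σ).mul (s2.add s3)),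
    listDeriv_sub (su.add s1) sF, listDeriv_add su s1, listDeriv_const_mul σ (s2.add s3),
    listDeriv_add s2 s3] at e'
  have hL' : (c :: L).length ≤ m + 1 := by simpa using hL
  have b1 := h1 x (c :: L) hL' _ sν
  have b2 := h2 t ht x (c :: L) hL' _ su
  have b3 := h3 t ht x (c :: L) hL' _ sν
  have b4 := h4 t ht x
  dsimp only at e'
  rw [pderiv_listDeriv (hs.smooth_φ.timeDeriv.torus ht), pderiv_listDeriv su, pderiv_listDeriv sF]
  have b5 := mul_abs_pderiv_le_gradAbs (𝒞 := 𝒞) ht.1 c sν L x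
  rw [pderiv_listDeriv sν] at b5 ⊢
  simp only [List.length_cons] at b1 b2 b3
  change |_ - _ * listDeriv L (LapseScalar.pderiv c (ν t)) x| ≤ _ at b1
  change |_ - _ * listDeriv L (LapseScalar.pderiv c (u t)) x| ≤ _ at b2
  change |_ - _ * listDeriv L (LapseScalar.pderiv c (ν t)) x| ≤ _ at b3
  change t * listDeriv L (LapseScalar.pderiv c (timeDeriv T φ t)) x
    = listDeriv L (LapseScalar.pderiv c (u t)) x + _
      - listDeriv L (LapseScalar.pderiv c (F₃ t)) x + _ at e'
  rw [e']
  have pδ := Real.rpow_nonneg ht.1.le δ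
  have pp := (p_pos (𝒞 := 𝒞) ht.1 c x).le
  have pl := h.p_le_rpow ht c x
  have τ1 := h.rpow_le_one ht
  have g1 := jetAbs_nonneg (L.length + 1) (u t) x
  have g2 := jetAbs_nonneg (L.length + 1) (ν t) x
  have g4 := gradAbs_nonneg (𝒞 := 𝒞) ht.1 (L.length + 1) (ν t) x
  generalize listDeriv (c :: L) (fun y => 𝒞.A y * ν t y) x = v1 at *
  generalize listDeriv (c :: L) (fun y => (𝒞.α t y - 1) * u t y) x = v2 at *
  generalize listDeriv (c :: L) (fun y => 𝒞.c₆ t y * ν t y) x = v3 at *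
  generalize jetAbs (L.length + 1) (u t) x = J1 at *
  generalize jetAbs (L.length + 1) (ν t) x = J2 at *
  generalize 𝒞.gradAbs (L.length + 1) (ν t) t x = J4 at *
  generalize listDeriv L (LapseScalar.pderiv c (F₃ t)) x = f at *
  generalize listDeriv L (LapseScalar.pderiv c (ν t)) x = νL at *
  generalize listDeriv L (LapseScalar.pderiv c (u t)) x = uL at *
  generalize 𝒞.p c t x = p at *
  generalize t ^ δ = τ at *
  have e5 : uL + v1 - f + σ * (v2 + v3) - (1 + σ * (𝒞.α t x - 1)) * uL - 𝒞.A x * νL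
      = (v1 - 𝒞.A x * νL) + -f + σ * (v2 - (𝒞.α t x - 1) * uL)
        + σ * (v3 - 𝒞.c₆ t x * νL) + σ * (𝒞.c₆ t x * νL) := by ring
  rw [e5]
  have tri : |(v1 - 𝒞.A x * νL) + -f + σ * (v2 - (𝒞.α t x - 1) * uL)
        + σ * (v3 - 𝒞.c₆ t x * νL) + σ * (𝒞.c₆ t x * νL)|
      ≤ |v1 - 𝒞.A x * νL| + |f| + σ * |v2 - (𝒞.α t x - 1) * uL|
        + σ * |v3 - 𝒞.c₆ t x * νL| + σ * (|𝒞.c₆ t x| * |νL|) := by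
    refine (abs_add_le _ _).trans (add_le_add ((abs_add_le _ _).trans (add_le_add
      ((abs_add_le _ _).trans (add_le_add ((abs_add_le _ _).trans (add_le_add le_rfl ?_)) ?_))
        ?_)) ?_)
    · rw [abs_neg]
    · rw [abs_mul, abs_of_nonneg hσ]
    · rw [abs_mul, abs_of_nonneg hσ]
    · rw [abs_mul, abs_of_nonneg hσ, abs_mul]
  -- The commutator with `A` is of top order here, since one more derivative has been taken. It
  -- becomes a small error only because the weight satisfies `p_c ≤ t^δ`.
  have a1 : p * |v1 - 𝒞.A x * νL| ≤ C1 * (τ * J2) := by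
    calc _ ≤ τ * (C1 * J2) := by gcongr
      _ = _ := by ring
  have a2 : p * (σ * |v2 - (𝒞.α t x - 1) * uL|) ≤ C2 * (τ * J1) := by
    calc _ ≤ 1 * (1 * (C2 * τ * J1)) := by gcongr; exact pl.trans τ1
      _ = _ := by ring
  have a3 : p * (σ * |v3 - 𝒞.c₆ t x * νL|) ≤ C3 * (τ * J2) := by
    calc _ ≤ 1 * (1 * (C3 * τ * J2)) := by gcongr; exact pl.trans τ1
      _ = _ := by ring
  have a4 : p * (σ * (|𝒞.c₆ t x| * |νL|)) ≤ C4 * (τ * (σ * J4)) := by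
    calc _ = σ * (|𝒞.c₆ t x| * (p * |νL|)) := by ring
      _ ≤ σ * (C4 * τ * J4) := by gcongr
      _ = _ := by ring
  have tri' := mul_le_mul_of_nonneg_left tri pp
  have r : ∀ {a b j : ℝ}, 0 ≤ j → a ≤ b → a * j ≤ b * j := fun hj hab =>
      mul_le_mul_of_nonneg_right hab hj
  have r1 : C2 * (τ * J1) ≤ (C1 + C2 + C3 + C4) * (τ * J1) := r (by positivity) (by linarith)
  have r2 : (C1 + C3) * (τ * J2) ≤ (C1 + C2 + C3 + C4) * (τ * J2) :=
    r (by positivity) (by linarith)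
  have r4 : C4 * (τ * (σ * J4)) ≤ (C1 + C2 + C3 + C4) * (τ * (σ * J4)) :=
    r (by positivity) (by linarith)
  linarith only [tri', a1, a2, a3, a4, r1, r2, r4]

/-- The differentiated equation for `φ`, crudely. -/
theorem Admissible.exists_listDeriv_eq_φ (h : 𝒞.Admissible T δ κ₀) (m : ℕ) :
    ∃ C > 0, ∀ {σ : ℝ} {F₁ F₂ F₃ u ν φ : ℝ → (Fin n → ℝ) → ℝ}, 0 ≤ σ → σ ≤ 1 →
      𝒞.Solves T σ F₁ F₂ F₃ u ν φ → ∀ t ∈ Ioc 0 T, ∀ x, ∀ L : List (Fin n), L.length ≤ m →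
      |t * listDeriv L (timeDeriv T φ t) x|
        ≤ |listDeriv L (F₃ t) x|
          + C * (jetAbs (L.length + 1) (u t) x + jetAbs (L.length + 1) (ν t) x) := by
  obtain ⟨C1, hC1, h1⟩ := (IsDom.torus (T := T) h.smooth_A).listDeriv_mul_le m
  obtain ⟨C2, hC2, h2⟩ := h.α_dom.listDeriv_mul_le m
  obtain ⟨C3, hC3, h3⟩ := h.c₆_dom.listDeriv_mul_le m
  refine ⟨1 + C1 + C2 + C3, by positivity, ?_⟩
  intro σ F₁ F₂ F₃ u ν φ hσ hσ1 hs t ht x L hL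
  have su := hs.smooth_u.torus ht
  have sν := hs.smooth_ν.torus ht
  have sF := hs.smooth_F₃.torus ht
  have s1 : SmoothTorus (fun y => 𝒞.A y * ν t y) := h.smooth_A.mul sν
  have s2 : SmoothTorus (fun y => (𝒞.α t y - 1) * u t y) := (h.α_dom.1.torus ht).mul su
  have s3 : SmoothTorus (fun y => 𝒞.c₆ t y * ν t y) := (h.c₆_dom.1.torus ht).mul sν
  have e : (fun y => t * timeDeriv T φ t y) = _ := funext fun y => hs.eq_φ t ht y
  have e' := congrFun (congrArg (listDeriv L) e) x
  rw [listDeriv_const_mul t (hs.smooth_φ.timeDeriv.torus ht),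
    listDeriv_add ((su.add s1).sub sF) ((SmoothTorus.const σ).mul (s2.add s3)),
    listDeriv_sub (su.add s1) sF, listDeriv_add su s1, listDeriv_const_mul σ (s2.add s3),
    listDeriv_add s2 s3] at e'
  have b1 := h1 t ht x L hL _ sν
  have b2 := h2 t ht x L hL _ su
  have b3 := h3 t ht x L hL _ sν
  have b0 := abs_listDeriv_le_jetAbs (m := L.length + 1) (u t) x (L := L) (by omega)
  dsimp only at e'
  change t * listDeriv L (timeDeriv T φ t) x = listDeriv L (u t) x + _ - _ + _ at e'
  rw [e']
  have pδ := Real.rpow_nonneg ht.1.le δ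
  have τ1 := h.rpow_le_one ht
  have g1 := jetAbs_nonneg (L.length + 1) (u t) x
  have g2 := jetAbs_nonneg (L.length + 1) (ν t) x
  rw [Real.rpow_zero, mul_one] at b1
  generalize listDeriv L (fun y => 𝒞.A y * ν t y) x = v1 at *
  generalize listDeriv L (fun y => (𝒞.α t y - 1) * u t y) x = v2 at *
  generalize listDeriv L (fun y => 𝒞.c₆ t y * ν t y) x = v3 at *
  generalize jetAbs (L.length + 1) (u t) x = J1 at *
  generalize jetAbs (L.length + 1) (ν t) x = J2 at *
  generalize listDeriv L (F₃ t) x = f at *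
  generalize listDeriv L (u t) x = uL at *
  generalize t ^ δ = τ at *
  have tri : |uL + v1 - f + σ * (v2 + v3)| ≤ |uL| + |v1| + |f| + σ * (|v2| + |v3|) := by
    refine (abs_add_le _ _).trans (add_le_add ((abs_sub _ _).trans (add_le_add
      (abs_add_le _ _) le_rfl)) ?_)
    rw [abs_mul, abs_of_nonneg hσ]
    exact mul_le_mul_of_nonneg_left (abs_add_le _ _) hσ
  have a2 : |v2| ≤ C2 * J1 := b2.trans (by
    calc _ ≤ C2 * 1 * J1 := by gcongr
      _ = _ := by ring)
  have a3 : |v3| ≤ C3 * J2 := b3.trans (by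
    calc _ ≤ C3 * 1 * J2 := by gcongr
      _ = _ := by ring)
  have a4 : σ * (|v2| + |v3|) ≤ |v2| + |v3| := mul_le_of_le_one_left (by positivity) hσ1
  have q1 : 0 ≤ C1 * J1 := by positivity
  have q2 : 0 ≤ C3 * J1 := by positivity
  have q3 : 0 ≤ C2 * J2 := by positivity
  linarith only [tri, a2, a3, a4, b1, b0, q1, q2, q3, g2]

end Coeffs

end LapseScalar

namespace LapseScalar

variable {n : ℕ} {T δ κ₀ σ : ℝ}

/-! ### A differential inequality -/

/-- Gronwall's argument from `T` down to `t`. The integrating factor `exp(K s^δ / δ)` absorbs the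
term `K s^δ E`, and it lies between `1` and `exp(K / δ)` on `(0, 1]`; so the constant is uniform as
`t → 0` for every `K`, however large. -/
theorem le_of_fuchsian_ineq {t T K δ : ℝ} {E E' U h : ℝ → ℝ} (ht : 0 < t) (htT : t ≤ T)
    (hT : T ≤ 1) (hδ : 0 < δ) (hK : 0 ≤ K) (hE : ContinuousOn E (Icc t T))
    (hE' : ∀ s ∈ Ioo t T, HasDerivAt E (E' s) s) (hU : ContinuousOn U (Icc t T))
    (hh : ContinuousOn h (Icc t T)) (E0 : ∀ s ∈ Icc t T, 0 ≤ E s) (U0 : ∀ s ∈ Icc t T, 0 ≤ U s)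
    (h0 : ∀ s ∈ Icc t T, 0 ≤ h s)
    (hineq : ∀ s ∈ Ioo t T, U s - K * s ^ δ * E s - h s ≤ s * E' s) :
    E t + ∫ s in t..T, U s * s⁻¹ ≤ Real.exp (K / δ) * (E T + ∫ s in t..T, h s * s⁻¹) := by
  have hpos : ∀ s ∈ Icc t T, 0 < s := fun s hs => ht.trans_le hs.1
  set μ : ℝ → ℝ := fun s => K / δ * s ^ δ with hμ
  have hμd : ∀ s, 0 < s → HasDerivAt μ (K * s ^ (δ - 1)) s := fun s hs => by
    have := (Real.hasDerivAt_rpow_const (p := δ) (Or.inl hs.ne')).const_mul (K / δ)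
    rwa [← mul_assoc, div_mul_cancel₀ _ hδ.ne'] at this
  have hμ0 : ∀ s, 0 < s → 0 ≤ μ s := fun s hs => by
    have := Real.rpow_nonneg hs.le δ
    positivity
  have hμ1 : ∀ s, 0 < s → s ≤ 1 → μ s ≤ K / δ := fun s hs hs1 => by
    have := Real.rpow_le_one hs.le hs1 hδ.le
    exact mul_le_of_le_one_right (by positivity) this
  have hinv : ContinuousOn (fun s : ℝ => s⁻¹) (Icc t T) :=
    continuousOn_inv₀.mono fun s hs => (hpos s hs).ne'
  have hμc : ContinuousOn μ (Icc t T) := fun s hs =>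
    (hμd s (hpos s hs)).continuousAt.continuousWithinAt
  have iU : IntervalIntegrable (fun s => U s * s⁻¹) volume t T :=
    (hU.mul hinv).intervalIntegrable_of_Icc htT
  have ih : IntervalIntegrable (fun s => h s * s⁻¹) volume t T :=
    (hh.mul hinv).intervalIntegrable_of_Icc htT
  have key := intervalIntegral.integral_le_sub_of_hasDeriv_right_of_le htT
    (g := fun s => Real.exp (μ s) * E s)
    (g' := fun s => Real.exp (μ s) * (K * s ^ (δ - 1)) * E s + Real.exp (μ s) * E' s)
    (φ := fun s => U s * s⁻¹ - Real.exp (K / δ) * (h s * s⁻¹))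
    ((Real.continuous_exp.comp_continuousOn hμc).mul hE)
    (fun s hs => ((hμd s (ht.trans hs.1)).exp.mul (hE' s hs)).hasDerivWithinAt)
    ((intervalIntegrable_iff_integrableOn_Icc_of_le htT).1 (iU.sub (ih.const_mul _)))
    (fun s hs => by
      have hs' : s ∈ Icc t T := ⟨hs.1.le, hs.2.le⟩
      have sp := hpos s hs'
      have h1 := hineq s hs
      have e1 : s ^ (δ - 1) = s ^ δ * s⁻¹ := by rw [Real.rpow_sub_one sp.ne']; rfl
      have m0 : 1 ≤ Real.exp (μ s) := Real.one_le_exp (hμ0 s sp)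
      have m1 : Real.exp (μ s) ≤ Real.exp (K / δ) :=
        Real.exp_le_exp.2 (hμ1 s sp (hs.2.le.trans hT))
      have i0 : 0 ≤ s⁻¹ := (inv_pos.2 sp).le
      have h2 : (U s - h s) * s⁻¹ ≤ K * s ^ (δ - 1) * E s + E' s := by
        rw [e1, ← div_eq_mul_inv, div_le_iff₀ sp]
        have : (K * (s ^ δ * s⁻¹) * E s + E' s) * s = K * s ^ δ * E s + s * E' s := by
          field_simp
        rw [this]; linarith
      have h3 := mul_le_mul_of_nonneg_left h2 (Real.exp_pos (μ s)).le
      have u0 := mul_nonneg (U0 s hs') i0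
      have hh0 := mul_nonneg (h0 s hs') i0
      have h4 := mul_le_mul_of_nonneg_right m0 u0
      have h5 := mul_le_mul_of_nonneg_right m1 hh0
      have h6 : Real.exp (μ s) * ((U s - h s) * s⁻¹)
        = Real.exp (μ s) * (U s * s⁻¹) - Real.exp (μ s) * (h s * s⁻¹) := by ring
      have h7 : Real.exp (μ s) * (K * s ^ (δ - 1) * E s + E' s)
        = Real.exp (μ s) * (K * s ^ (δ - 1)) * E s + Real.exp (μ s) * E' s := by ring
      linarith)
  rw [intervalIntegral.integral_sub iU (ih.const_mul _), intervalIntegral.integral_const_mul] at key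
  have tT : T ∈ Icc t T := ⟨htT, le_rfl⟩
  have tt : t ∈ Icc t T := ⟨le_rfl, htT⟩
  have k1 : E t ≤ Real.exp (μ t) * E t :=
    le_mul_of_one_le_left (E0 t tt) (Real.one_le_exp (hμ0 t ht))
  have k2 : Real.exp (μ T) * E T ≤ Real.exp (K / δ) * E T :=
    mul_le_mul_of_nonneg_right (Real.exp_le_exp.2 (hμ1 T (hpos T tT) hT)) (E0 T tT)
  linarith

/-! ### Smallness of the coefficients for small times -/

theorem exists_rpow_le {T δ η : ℝ} (hT : 0 < T) (hδ : 0 < δ) (hη : 0 < η) :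
    ∃ T₀ ∈ Ioc 0 T, ∀ t ∈ Ioc 0 T₀, t ^ δ ≤ η := by
  refine ⟨min T (η ^ δ⁻¹), ⟨lt_min hT (Real.rpow_pos_of_pos hη _), min_le_left _ _⟩,
    fun t ht => ?_⟩
  calc t ^ δ ≤ (η ^ δ⁻¹) ^ δ :=
        Real.rpow_le_rpow ht.1.le (ht.2.trans (min_le_right _ _)) hδ.le
    _ = η := by rw [← Real.rpow_mul hη.le, inv_mul_cancel₀ hδ.ne', Real.rpow_one]

/-- Quantitative smallness of the error terms on `(0, T]`. -/
structure Coeffs.Small (𝒞 : Coeffs n) (T : ℝ) : Prop where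
  α_le : ∀ t ∈ Ioc 0 T, ∀ x, |𝒞.α t x - 1| ≤ 1 / 2
  P_lower : ∀ t ∈ Ioc 0 T, ∀ x (ξ : Fin n → ℝ),
    1 / 2 * ∑ a, (𝒞.p a t x * ξ a) ^ 2 ≤ ∑ a, ∑ b, 𝒞.P a b t x * (ξ a * ξ b)
  c₃_le : ∀ t ∈ Ioc 0 T, ∀ x, |𝒞.c₃ t x| ≤ 1 / 8
  c₄_le : ∀ t ∈ Ioc 0 T, ∀ x, |𝒞.c₄ t x| ≤ 1
  div_le : ∀ t ∈ Ioc 0 T, ∀ x b,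
    |𝒞.G b t x - ∑ a, pderiv a (𝒞.P a b t) x| ≤ 1 / (2 * (n + 1)) * 𝒞.p b t x

namespace Coeffs

variable {𝒞 : Coeffs n}

theorem Small.restrict (h : 𝒞.Small T) {T' : ℝ} (hT : T' ≤ T) : 𝒞.Small T' where
  α_le t ht := h.α_le t (Ioc_subset_Ioc_right hT ht)
  P_lower t ht := h.P_lower t (Ioc_subset_Ioc_right hT ht)
  c₃_le t ht := h.c₃_le t (Ioc_subset_Ioc_right hT ht)
  c₄_le t ht := h.c₄_le t (Ioc_subset_Ioc_right hT ht)
  div_le t ht := h.div_le t (Ioc_subset_Ioc_right hT ht)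

theorem Admissible.restrict (h : 𝒞.Admissible T δ κ₀) {T' : ℝ} (h0 : 0 < T') (hT : T' ≤ T) :
    𝒞.Admissible T' δ κ₀ :=
  { h with
    T_pos := h0
    T_le := hT.trans h.T_le
    P_symm := fun a b t ht => h.P_symm a b t (Ioc_subset_Ioc_right hT ht)
    P_dom := fun a b ε hε => (h.P_dom a b ε hε).restrict hT
    G_dom := fun b ε hε => (h.G_dom b ε hε).restrict hT
    B_dom := fun b ε hε => (h.B_dom b ε hε).restrict hT
    H_dom := fun b ε hε => (h.H_dom b ε hε).restrict hT
    α_dom := h.α_dom.restrict hT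
    c₁_dom := h.c₁_dom.restrict hT
    c₃_dom := h.c₃_dom.restrict hT
    c₄_dom := h.c₄_dom.restrict hT
    c₆_dom := h.c₆_dom.restrict hT
    α_dot := by
      obtain ⟨C, hC, hb⟩ := h.α_dot
      exact ⟨C, hC, fun t ht => hb t ⟨ht.1, ht.2.trans_le hT⟩⟩
    P_near := by
      obtain ⟨C, hC, hb⟩ := h.P_near
      exact ⟨C, hC, fun a b t ht => hb a b t (Ioc_subset_Ioc_right hT ht)⟩
    P_dot := by
      obtain ⟨C, hC, hb⟩ := h.P_dot
      exact ⟨C, hC, fun a b t ht => hb a b t ⟨ht.1, ht.2.trans_le hT⟩⟩ }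

/-- The conditions involve the coefficients and the first derivatives of `P` only. They fix the time
`T₀` once and for all, before the order of differentiation, the weights or `ε` are chosen. -/
theorem Admissible.exists_small (h : 𝒞.Admissible T δ κ₀) : ∃ T₀ ∈ Ioc 0 T, 𝒞.Small T₀ := by
  obtain ⟨C1, hC1, h1⟩ := h.α_dom.abs_le
  obtain ⟨C2, hC2, h2⟩ := h.P_near
  obtain ⟨C3, hC3, h3⟩ := h.c₃_dom.abs_le
  obtain ⟨C4, hC4, h4⟩ := h.c₄_dom.abs_le
  have hd : ∀ b, IsDom T (fun x => δ + (1 - 𝒞.q b x))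
      (fun t x => 𝒞.G b t x - ∑ a, pderiv a (𝒞.P a b t) x) := fun b =>
    (h.G_dom₁ b).sub (.sum fun a _ => (h.P_dom₁ a b).pderiv a)
  choose C5 hC5 h5 using fun b => (hd b).abs_le
  have hS : 0 ≤ ∑ b, C5 b := Finset.sum_nonneg fun b _ => (hC5 b).le
  -- The factor `8` yields the bounds `1/8`, and `n + 1` serves both the Cauchy–Schwarz factor in
  -- the lower bound for `P` and the divergence condition.
  obtain ⟨D, hD⟩ : ∃ D, D = 8 * (C1 + C2 + C3 + C4 + ∑ b, C5 b) * (n + 1) := ⟨_, rfl⟩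
  have hD0 : 0 < D := by rw [hD]; positivity
  obtain ⟨T₀, hT₀, hsm⟩ := exists_rpow_le h.T_pos h.δ_pos (inv_pos.2 hD0)
  have hn : (0 : ℝ) ≤ n := Nat.cast_nonneg n
  have hsm' : ∀ t ∈ Ioc 0 T₀, ∀ C, 0 ≤ C → C ≤ C1 + C2 + C3 + C4 + ∑ b, C5 b →
      C * t ^ δ * (8 * (n + 1)) ≤ 1 := fun t ht C hC hCD => by
    have e : t ^ δ * D ≤ 1 := by
      have := mul_le_mul_of_nonneg_right (hsm t ht) hD0.le
      rwa [inv_mul_cancel₀ hD0.ne'] at this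
    have pt := Real.rpow_nonneg ht.1.le δ
    calc C * t ^ δ * (8 * (n + 1)) ≤ (C1 + C2 + C3 + C4 + ∑ b, C5 b) * t ^ δ * (8 * (n + 1)) := by
          gcongr
      _ = t ^ δ * D := by rw [hD]; ring
      _ ≤ 1 := e
  have hsm8 : ∀ t ∈ Ioc 0 T₀, ∀ C, 0 ≤ C → C ≤ C1 + C2 + C3 + C4 + ∑ b, C5 b →
      C * t ^ δ ≤ 1 / 8 := fun t ht C hC hCD => by
    have h1 := hsm' t ht C hC hCD
    have h2 : 0 ≤ C * t ^ δ := mul_nonneg hC (Real.rpow_nonneg ht.1.le δ)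
    nlinarith
  have sub : Ioc 0 T₀ ⊆ Ioc 0 T := Ioc_subset_Ioc_right hT₀.2
  refine ⟨T₀, hT₀, ⟨fun t ht x => ?_, fun t ht x ξ => ?_, fun t ht x => ?_, fun t ht x => ?_,
    fun t ht x b => ?_⟩⟩
  · have := hsm8 t ht C1 hC1.le (by linarith)
    linarith [h1 t (sub ht) x]
  · have e2 := abs_sum_sum_le (ξ := ξ) (ζ := ξ) fun a b => h2 a b t (sub ht) x
    have e3 := sq_sum_mul_abs_le (fun a => 𝒞.p a t x) ξ
    have e : ∑ a, ∑ b, (𝒞.P a b t x - if a = b then (t ^ (1 - 𝒞.q a x)) ^ 2 else 0) * (ξ a * ξ b)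
        = ∑ a, ∑ b, 𝒞.P a b t x * (ξ a * ξ b) - ∑ a, (𝒞.p a t x * ξ a) ^ 2 := by
      simp only [sub_mul, Finset.sum_sub_distrib, sum_diag]
      congr 1
      exact Finset.sum_congr rfl fun a _ => by rw [p]; ring
    rw [e, ← sq] at e2
    have e4 := hsm' t ht C2 hC2.le (by linarith)
    change _ ≤ C2 * t ^ δ * (∑ a, 𝒞.p a t x * |ξ a|) ^ 2 at e2
    have S0 : 0 ≤ ∑ a, (𝒞.p a t x * ξ a) ^ 2 := Finset.sum_nonneg fun _ _ => sq_nonneg _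
    have pt : 0 ≤ C2 * t ^ δ := mul_nonneg hC2.le (Real.rpow_nonneg ht.1.le δ)
    have e5 := mul_le_mul_of_nonneg_left e3 pt
    have e6 := neg_abs_le (∑ a, ∑ b, 𝒞.P a b t x * (ξ a * ξ b) - ∑ a, (𝒞.p a t x * ξ a) ^ 2)
    have e7 := mul_le_mul_of_nonneg_right e4 S0
    nlinarith [mul_nonneg pt S0, mul_nonneg (mul_nonneg pt hn) S0]
  · have := hsm8 t ht C3 hC3.le (by linarith)
    linarith [h3 t (sub ht) x]
  · have := hsm8 t ht C4 hC4.le (by linarith)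
    linarith [h4 t (sub ht) x]
  · have e1 := h5 b t (sub ht) x
    have hCb : C5 b ≤ ∑ b, C5 b :=
      Finset.single_le_sum (fun b _ => (hC5 b).le) (Finset.mem_univ b)
    have e2 := hsm' t ht (C5 b) (hC5 b).le (by linarith)
    rw [rpow_add_weight ht.1, ← mul_assoc] at e1
    have pp := p_pos (𝒞 := 𝒞) ht.1 b x
    refine e1.trans (mul_le_mul_of_nonneg_right ?_ pp.le)
    rw [le_div_iff₀ (by positivity)]
    have : 0 ≤ C5 b * t ^ δ * (n + 1) :=
      mul_nonneg (mul_nonneg (hC5 b).le (Real.rpow_nonneg ht.1.le δ)) (by positivity)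
    linarith

end Coeffs

/-! ### Integration by parts -/

theorem torusInt_divergence {K : Fin n → Fin n → (Fin n → ℝ) → ℝ} {g h : (Fin n → ℝ) → ℝ}
    (hK : ∀ a b, SmoothTorus (K a b)) (hg : SmoothTorus g) (hh : SmoothTorus h) :
    torusInt (fun x => ∑ a, ∑ b, (pderiv a (K a b) x * (g x * pderiv b h x)
      + K a b x * (pderiv a g x * pderiv b h x) + K a b x * (g x * pderiv b (pderiv a h) x)))
      = 0 := by
  have s : ∀ a b, SmoothTorus (fun x => K a b x * (g x * pderiv b h x)) := fun a b =>
    (hK a b).mul (hg.mul (hh.pderiv b))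
  have e : (fun x => ∑ a, ∑ b, (pderiv a (K a b) x * (g x * pderiv b h x)
      + K a b x * (pderiv a g x * pderiv b h x) + K a b x * (g x * pderiv b (pderiv a h) x)))
      = fun x => ∑ a, ∑ b, pderiv a (fun x => K a b x * (g x * pderiv b h x)) x := by
    funext x
    refine Finset.sum_congr rfl fun a _ => Finset.sum_congr rfl fun b _ => ?_
    rw [pderiv_mul (hK a b) (hg.mul (hh.pderiv b)), pderiv_mul hg (hh.pderiv b),
      pderiv_comm hh a b]
    ring
  rw [e, torusInt_sum fun a _ => .sum fun b _ => (s a b).pderiv a]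
  refine Finset.sum_eq_zero fun a _ => ?_
  rw [torusInt_sum fun b _ => (s a b).pderiv a]
  exact Finset.sum_eq_zero fun b _ => torusInt_pderiv (s a b) a

/-- The lapse equation multiplied by `ν`. The last bracket is the divergence of `ν P ∂ν`, which
integrates to zero. The term `-σ Q ≤ -σ S / 2` hidden in it absorbs the gradient `¼ σ S` that comes
from the first-order terms. In all `¾ v²` is moved to the left, and multiplication of the remaining
`¼ v²` by four gives the `40`. -/
theorem elliptic_pointwise {N σ A c₃ c₄ u F v Lν Gν Dν X S Q : ℝ} (hN : 0 ≤ N) (hσ : 0 ≤ σ)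
    (hσ1 : σ ≤ 1) (hA0 : 0 ≤ A) (hA1 : A ≤ 1) (h3 : |c₃| ≤ 1 / 8) (h4 : |c₄| ≤ 1) (S0 : 0 ≤ S)
    (hX : X ^ 2 ≤ N * S) (hG : |Gν - Dν| ≤ 1 / (2 * (N + 1)) * X) (hP : 1 / 2 * S ≤ Q)
    (eν : v = -(2 * A * u) - F + σ * (c₃ * v + c₄ * u + Lν + Gν)) :
    v ^ 2 ≤ 40 * (u ^ 2 + F ^ 2) + 4 * σ * (v * Dν + Q + v * Lν) := by
  have hv := sq_nonneg v
  have t1 : |v * (Gν - Dν)| ≤ 1 / 4 * v ^ 2 + 1 / 4 * S := by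
    rw [abs_mul]
    have a1 : |v| * |Gν - Dν| ≤ |v| * (1 / (2 * (N + 1)) * X) := by gcongr
    have a2 := young (x := |v|) (y := 1 / (2 * (N + 1)) * X) (by norm_num : (0:ℝ) < 1 / 4)
    rw [sq_abs] at a2
    -- The constant `1 / (2 (N + 1))` in the smallness condition is chosen for this step: it beats
    -- the factor `N` in `X² ≤ N S`.
    have a3 : (1 / (2 * (N + 1)) * X) ^ 2 ≤ 1 / 4 * S := by
      rw [mul_pow, div_pow, one_pow, mul_pow]
      calc 1 / (2 ^ 2 * (N + 1) ^ 2) * X ^ 2 ≤ 1 / (2 ^ 2 * (N + 1) ^ 2) * (N * S) := by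
            gcongr
        _ ≤ 1 / (2 ^ 2 * (N + 1) ^ 2) * ((N + 1) ^ 2 * S) := by gcongr; nlinarith only [hN]
        _ = 1 / 4 * S := by field_simp; ring
    have a4 : 1 / (4 * (1 / 4 : ℝ)) = 1 := by norm_num
    rw [a4, one_mul] at a2
    linarith only [a1, a2, a3]
  have t1' : σ * (v * (Gν - Dν)) ≤ σ * (1 / 4 * S) + 1 / 4 * v ^ 2 := by
    have b1 := mul_le_mul_of_nonneg_left ((le_abs_self _).trans t1) hσ
    have b2 := mul_le_mul_of_nonneg_right hσ1 hv
    linarith only [b1, b2]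
  have t2 : -(2 * A * u * v) ≤ 1 / 8 * v ^ 2 + 8 * u ^ 2 := by
    have a2 : A ^ 2 ≤ 1 := pow_le_one₀ hA0 hA1
    have a3 := mul_le_mul_of_nonneg_right a2 (sq_nonneg u)
    linarith only [a3, sq_nonneg (v + 8 * (A * u))]
  have t3 : -(F * v) ≤ 1 / 8 * v ^ 2 + 2 * F ^ 2 := by linarith only [sq_nonneg (v + 4 * F)]
  have t4 : σ * (c₃ * v * v) ≤ 1 / 8 * v ^ 2 := by
    have a0 := mul_le_mul_of_nonneg_right ((le_abs_self c₃).trans h3) hv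
    have a2 := mul_le_mul_of_nonneg_left a0 hσ
    have a3 := mul_le_mul_of_nonneg_right hσ1 hv
    linarith only [a2, a3]
  have t5 : σ * (c₄ * u * v) ≤ 1 / 8 * v ^ 2 + 2 * u ^ 2 := by
    have a0 : (σ * c₄) ^ 2 ≤ 1 := by
      rw [sq_le_one_iff_abs_le_one, abs_mul, abs_of_nonneg hσ]
      exact mul_le_one₀ hσ1 (abs_nonneg _) h4
    have a3 := mul_le_mul_of_nonneg_right a0 (sq_nonneg u)
    linarith only [a3, sq_nonneg (v - 4 * (σ * c₄ * u))]
  have ev : v * v = v * (-(2 * A * u) - F + σ * (c₃ * v + c₄ * u + Lν + Gν)) :=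
    congrArg (v * ·) eν
  have hQ := mul_le_mul_of_nonneg_left hP hσ
  have hS' := mul_nonneg hσ S0
  linarith only [ev, t1', t2, t3, t4, t5, hQ, hS', sq_nonneg F]

namespace Coeffs

variable {𝒞 : Coeffs n}

/-- The unweighted elliptic estimate for `ν`. -/
theorem Admissible.torusInt_ν_sq_le (h : 𝒞.Admissible T δ κ₀) (hsm : 𝒞.Small T) {σ : ℝ}
    {F₁ F₂ F₃ u ν φ : ℝ → (Fin n → ℝ) → ℝ} (hσ : 0 ≤ σ) (hσ1 : σ ≤ 1)
    (hs : 𝒞.Solves T σ F₁ F₂ F₃ u ν φ) {t : ℝ} (ht : t ∈ Ioc 0 T) :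
    torusInt (fun x => ν t x ^ 2) ≤ 40 * torusInt (fun x => u t x ^ 2 + F₂ t x ^ 2) := by
  have su := hs.smooth_u.torus ht
  have sν := hs.smooth_ν.torus ht
  have sF := hs.smooth_F₂.torus ht
  have sP : ∀ a b, SmoothTorus (𝒞.P a b t) := fun a b => (h.P_dom₁ a b).1.torus ht
  have s1 : SmoothTorus (fun x => ν t x ^ 2) := sν.pow 2
  have s2 : SmoothTorus (fun x => u t x ^ 2 + F₂ t x ^ 2) := (su.pow 2).add (sF.pow 2)
  have sD : SmoothTorus (fun x => ∑ a, ∑ b, (pderiv a (𝒞.P a b t) x * (ν t x * pderiv b (ν t) x)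
      + 𝒞.P a b t x * (pderiv a (ν t) x * pderiv b (ν t) x)
      + 𝒞.P a b t x * (ν t x * pderiv b (pderiv a (ν t)) x))) :=
    .sum fun a _ => .sum fun b _ => ((((sP a b).pderiv a).mul (sν.mul (sν.pderiv b))).add
      ((sP a b).mul ((sν.pderiv a).mul (sν.pderiv b)))).add
      ((sP a b).mul (sν.mul ((sν.pderiv a).pderiv b)))
  have hD := torusInt_divergence sP sν sν
  have e : torusInt (fun x => 40 * (u t x ^ 2 + F₂ t x ^ 2)
      + 4 * σ * ∑ a, ∑ b, (pderiv a (𝒞.P a b t) x * (ν t x * pderiv b (ν t) x)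
      + 𝒞.P a b t x * (pderiv a (ν t) x * pderiv b (ν t) x)
      + 𝒞.P a b t x * (ν t x * pderiv b (pderiv a (ν t)) x)))
      = 40 * torusInt (fun x => u t x ^ 2 + F₂ t x ^ 2) := by
    rw [torusInt_add ((SmoothTorus.const 40).mul s2) ((SmoothTorus.const (4 * σ)).mul sD),
      torusInt_const_mul, torusInt_const_mul, hD, mul_zero, add_zero]
  rw [← e]
  refine torusInt_mono s1 (((SmoothTorus.const 40).mul s2).add
    ((SmoothTorus.const (4 * σ)).mul sD)) fun x => ?_
  have eν := hs.eq_ν t ht x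
  have hP := hsm.P_lower t ht x fun a => pderiv a (ν t) x
  have h3 := hsm.c₃_le t ht x
  have h4 := hsm.c₄_le t ht x
  have hA0 := h.A_nonneg x
  have hA1 := h.A_le x
  -- the first order terms
  have hG : |∑ b, (𝒞.G b t x - ∑ a, pderiv a (𝒞.P a b t) x) * pderiv b (ν t) x|
      ≤ 1 / (2 * (n + 1)) * ∑ b, 𝒞.p b t x * |pderiv b (ν t) x| := by
    refine (Finset.abs_sum_le_sum_abs _ _).trans ?_
    rw [Finset.mul_sum]
    refine Finset.sum_le_sum fun b _ => ?_
    rw [abs_mul, ← mul_assoc]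
    exact mul_le_mul_of_nonneg_right (hsm.div_le t ht x b) (abs_nonneg _)
  have hX := sq_sum_mul_abs_le (fun a => 𝒞.p a t x) (fun a => pderiv a (ν t) x)
  have eD : ∑ a, ∑ b, (pderiv a (𝒞.P a b t) x * (ν t x * pderiv b (ν t) x)
      + 𝒞.P a b t x * (pderiv a (ν t) x * pderiv b (ν t) x)
      + 𝒞.P a b t x * (ν t x * pderiv b (pderiv a (ν t)) x))
      = ν t x * (∑ b, (∑ a, pderiv a (𝒞.P a b t) x) * pderiv b (ν t) x)
        + ∑ a, ∑ b, 𝒞.P a b t x * (pderiv a (ν t) x * pderiv b (ν t) x)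
        + ν t x * ∑ a, ∑ b, 𝒞.P a b t x * pderiv b (pderiv a (ν t)) x := by
    simp only [Finset.sum_add_distrib]
    congr 1
    · congr 1
      rw [Finset.sum_comm, Finset.mul_sum]
      refine Finset.sum_congr rfl fun b _ => ?_
      rw [Finset.sum_mul, Finset.mul_sum]
      exact Finset.sum_congr rfl fun a _ => by ring
    · simp only [Finset.mul_sum]
      exact Finset.sum_congr rfl fun a _ => Finset.sum_congr rfl fun b _ => by ring
  have eG : ∑ b, (𝒞.G b t x - ∑ a, pderiv a (𝒞.P a b t) x) * pderiv b (ν t) x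
      = ∑ b, 𝒞.G b t x * pderiv b (ν t) x
        - ∑ b, (∑ a, pderiv a (𝒞.P a b t) x) * pderiv b (ν t) x := by
    rw [← Finset.sum_sub_distrib]
    exact Finset.sum_congr rfl fun b _ => by ring
  rw [eG] at hG
  rw [eD]
  have hn : (0 : ℝ) ≤ n := Nat.cast_nonneg n
  have X0 : 0 ≤ ∑ b, 𝒞.p b t x * |pderiv b (ν t) x| :=
    Finset.sum_nonneg fun b _ => mul_nonneg (p_pos ht.1 b x).le (abs_nonneg _)
  generalize ∑ b, 𝒞.G b t x * pderiv b (ν t) x = Gν at *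
  generalize ∑ b, (∑ a, pderiv a (𝒞.P a b t) x) * pderiv b (ν t) x = Dν at *
  generalize ∑ b, 𝒞.p b t x * |pderiv b (ν t) x| = X at *
  generalize ∑ a, ∑ b, 𝒞.P a b t x * pderiv b (pderiv a (ν t)) x = Lν at *
  generalize ∑ a, ∑ b, 𝒞.P a b t x * (pderiv a (ν t) x * pderiv b (ν t) x) = Q at *
  have S0 : 0 ≤ ∑ a, (𝒞.p a t x * pderiv a (ν t) x) ^ 2 := Finset.sum_nonneg fun _ _ => sq_nonneg _
  generalize ∑ a, (𝒞.p a t x * pderiv a (ν t) x) ^ 2 = S at *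
  generalize u t x = u' at *
  generalize F₂ t x = F at *
  generalize 𝒞.c₃ t x = c3 at *
  generalize 𝒞.c₄ t x = c4 at *
  generalize 𝒞.A x = A at *
  generalize ν t x = v at *
  exact elliptic_pointwise hn hσ hσ1 hA0 hA1 h3 h4 S0 hX hG hP eν

end Coeffs

end LapseScalar

namespace LapseScalar

variable {n : ℕ} {T δ κ₀ σ : ℝ}

/-! ### The energy density -/

namespace Coeffs

/-- The weight in front of the square of `u` in the energy density. -/
def w (𝒞 : Coeffs n) (σ t : ℝ) (x : Fin n → ℝ) : ℝ := σ + (1 - σ) * (𝒞.α t x)⁻¹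

/-- The energy density of `(U, Φ)` with weight `t ^ (2 β)`. -/
def density (𝒞 : Coeffs n) (σ : ℝ) (β : (Fin n → ℝ) → ℝ) (U Φ : ℝ → (Fin n → ℝ) → ℝ) (t : ℝ)
    (x : Fin n → ℝ) : ℝ :=
  1 / 2 * t ^ (2 * β x) * (𝒞.w σ t x * U t x ^ 2
    + σ * ∑ a, ∑ b, 𝒞.P a b t x * (pderiv a (Φ t) x * pderiv b (Φ t) x))

/-- The weighted divergence of the coefficients `P`. -/
def N (𝒞 : Coeffs n) (β : (Fin n → ℝ) → ℝ) (b : Fin n) (t : ℝ) (x : Fin n → ℝ) : ℝ :=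
  ∑ a, (2 * pderiv a β x * Real.log t * 𝒞.P a b t x + pderiv a (𝒞.P a b t) x)

/-- The weighted divergence of the coefficients `(1 + σ (α - 1)) P`. -/
def M (𝒞 : Coeffs n) (σ : ℝ) (β : (Fin n → ℝ) → ℝ) (b : Fin n) (t : ℝ) (x : Fin n → ℝ) : ℝ :=
  (1 + σ * (𝒞.α t x - 1)) * 𝒞.N β b t x
    + σ * ∑ a, pderiv a (fun y => 𝒞.α t y - 1) x * 𝒞.P a b t x

/-- The time derivative of the energy density up to divergences and the weight. -/
def rate (𝒞 : Coeffs n) (T σ : ℝ) (β : (Fin n → ℝ) → ℝ) (U V Φ : ℝ → (Fin n → ℝ) → ℝ) (t : ℝ)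
    (x : Fin n → ℝ) : ℝ :=
  energyRate σ (β x) (𝒞.w σ t x) (t * timeDeriv T (𝒞.w σ) t x) (U t x) (V t x) (𝒞.A x)
    (t * timeDeriv T U t x + 𝒞.A x * V t x
      - σ * (𝒞.α t x * ∑ a, ∑ b, 𝒞.P a b t x * pderiv b (pderiv a (Φ t)) x))
    (V t x + 2 * 𝒞.A x * U t x - σ * ∑ a, ∑ b, 𝒞.P a b t x * pderiv b (pderiv a (V t)) x)
    (fun a b => 𝒞.P a b t x) (fun a b => t * timeDeriv T (𝒞.P a b) t x)
    (fun a => pderiv a (Φ t) x) (fun a => pderiv a (V t) x)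
    (fun a => t * pderiv a (timeDeriv T Φ t) x
      - (1 + σ * (𝒞.α t x - 1)) * pderiv a (U t) x - 𝒞.A x * pderiv a (V t) x)
    (fun b => 𝒞.N β b t x) (fun b => 𝒞.M σ β b t x)

variable {𝒞 : Coeffs n}

theorem Small.α_pos (h : 𝒞.Small T) {t : ℝ} (ht : t ∈ Ioc 0 T) (x : Fin n → ℝ) :
    1 / 2 ≤ 𝒞.α t x := by linarith [(abs_le.1 (h.α_le t ht x)).1]

theorem Admissible.smooth_α (h : 𝒞.Admissible T δ κ₀) : SmoothSlab T 𝒞.α :=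
  (h.α_dom.1.add (.const 1)).congr fun t _ x => by ring

theorem Admissible.smooth_w (h : 𝒞.Admissible T δ κ₀) (hsm : 𝒞.Small T) (σ : ℝ) :
    SmoothSlab T (𝒞.w σ) :=
  (SmoothSlab.const σ).add ((SmoothSlab.const (1 - σ)).mul (h.smooth_α.inv fun t ht x => by
    linarith [hsm.α_pos ht x]))

/-- The defining property of `w`. Multiplied by `w u`, the second-order term of the equation for `u`
has the same coefficient as `u` in the equation for `φ`, so `u ∂∂φ` and `∂u ∂φ` form a divergence
for every `σ`. -/
theorem Small.w_mul_α (hsm : 𝒞.Small T) (σ : ℝ) {t : ℝ} (ht : t ∈ Ioc 0 T) (x : Fin n → ℝ) :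
    𝒞.w σ t x * 𝒞.α t x = 1 + σ * (𝒞.α t x - 1) := by
  have := hsm.α_pos ht x
  rw [w, add_mul, mul_assoc, inv_mul_cancel₀ (by linarith)]
  ring

theorem Admissible.smooth_density (h : 𝒞.Admissible T δ κ₀) (hsm : 𝒞.Small T) (σ : ℝ)
    {β : (Fin n → ℝ) → ℝ} (hβ : SmoothTorus β) {U Φ : ℝ → (Fin n → ℝ) → ℝ}
    (hU : SmoothSlab T U) (hΦ : SmoothSlab T Φ) : SmoothSlab T (𝒞.density σ β U Φ) :=
  ((SmoothSlab.const _).mul (.rpow ((SmoothTorus.const 2).mul hβ))).mul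
    (((h.smooth_w hsm σ).mul (hU.pow 2)).add ((SmoothSlab.const σ).mul
      (.sum fun a _ => .sum fun b _ => (h.P_dom₁ a b).1.mul ((hΦ.pderiv a).mul (hΦ.pderiv b)))))

theorem pderiv_weight {β : (Fin n → ℝ) → ℝ} (hβ : SmoothTorus β) {f : (Fin n → ℝ) → ℝ}
    (hf : SmoothTorus f) {t : ℝ} (ht : 0 < t) (a : Fin n) (x : Fin n → ℝ) :
    pderiv a (fun x => t ^ (2 * β x) * f x) x
      = t ^ (2 * β x) * (2 * pderiv a β x * Real.log t * f x + pderiv a f x) := by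
  have s : SmoothTorus (fun x => 2 * β x) := (SmoothTorus.const 2).mul hβ
  have s' : SmoothTorus (fun x => t ^ (2 * β x)) :=
    (SmoothSlab.rpow (T := t) s).torus ⟨ht, le_rfl⟩
  rw [pderiv_mul s' hf, pderiv_rpow s ht, pderiv_const_mul 2 hβ]
  ring

theorem Admissible.density_hasDerivAt (h : 𝒞.Admissible T δ κ₀) (hsm : 𝒞.Small T) (σ : ℝ)
    (β : (Fin n → ℝ) → ℝ) {U Φ : ℝ → (Fin n → ℝ) → ℝ} (hU : SmoothSlab T U) (hΦ : SmoothSlab T Φ)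
    {t : ℝ} (ht : t ∈ Ioo 0 T) (x : Fin n → ℝ) :
    HasDerivAt (fun s => 𝒞.density σ β U Φ s x)
      (t⁻¹ * (t ^ (2 * β x) * (β x * (𝒞.w σ t x * U t x ^ 2
          + σ * ∑ a, ∑ b, 𝒞.P a b t x * (pderiv a (Φ t) x * pderiv b (Φ t) x))
        + 1 / 2 * (t * timeDeriv T (𝒞.w σ) t x) * U t x ^ 2
        + 𝒞.w σ t x * U t x * (t * timeDeriv T U t x)
        + σ * (1 / 2 * ∑ a, ∑ b, (t * timeDeriv T (𝒞.P a b) t x)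
            * (pderiv a (Φ t) x * pderiv b (Φ t) x)
          + ∑ a, ∑ b, 𝒞.P a b t x * ((t * pderiv a (timeDeriv T Φ t) x) * pderiv b (Φ t) x)))))
      t := by
  have t0 := ht.1
  have d1 : HasDerivAt (fun s : ℝ => s ^ (2 * β x)) (2 * β x * t ^ (2 * β x) * t⁻¹) t := by
    have := Real.hasDerivAt_rpow_const (x := t) (p := 2 * β x) (Or.inl t0.ne')
    rwa [Real.rpow_sub_one t0.ne', div_eq_mul_inv, ← mul_assoc] at this
  have d2 := (h.smooth_w hsm σ).hasDerivAt ht x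
  have d3 := hU.hasDerivAt ht x
  have d4 : ∀ a, HasDerivAt (fun s => pderiv a (Φ s) x) (pderiv a (timeDeriv T Φ t) x) t :=
    fun a => hΦ.hasDerivAt_listDeriv ht [a] x
  have d5 : ∀ a b, HasDerivAt (fun s => 𝒞.P a b s x) (timeDeriv T (𝒞.P a b) t x) t := fun a b =>
    (h.P_dom₁ a b).1.hasDerivAt ht x
  have d6 : HasDerivAt (fun s => ∑ a, ∑ b, 𝒞.P a b s x * (pderiv a (Φ s) x * pderiv b (Φ s) x))
      (∑ a, ∑ b, (timeDeriv T (𝒞.P a b) t x * (pderiv a (Φ t) x * pderiv b (Φ t) x)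
        + 𝒞.P a b t x * (pderiv a (timeDeriv T Φ t) x * pderiv b (Φ t) x
          + pderiv a (Φ t) x * pderiv b (timeDeriv T Φ t) x))) t :=
    .fun_sum fun a _ => .fun_sum fun b _ => (d5 a b).mul ((d4 a).mul (d4 b))
  have d7 := (d1.const_mul (1 / 2)).mul ((d2.mul (d3.pow 2)).add (d6.const_mul σ))
  have e : ∑ a, ∑ b, (timeDeriv T (𝒞.P a b) t x * (pderiv a (Φ t) x * pderiv b (Φ t) x)
        + 𝒞.P a b t x * (pderiv a (timeDeriv T Φ t) x * pderiv b (Φ t) x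
          + pderiv a (Φ t) x * pderiv b (timeDeriv T Φ t) x))
      = t⁻¹ * (∑ a, ∑ b, (t * timeDeriv T (𝒞.P a b) t x)
            * (pderiv a (Φ t) x * pderiv b (Φ t) x)
          + 2 * ∑ a, ∑ b, 𝒞.P a b t x
            * ((t * pderiv a (timeDeriv T Φ t) x) * pderiv b (Φ t) x)) := by
    have e1 : ∑ a, ∑ b, 𝒞.P a b t x * (pderiv a (Φ t) x * pderiv b (timeDeriv T Φ t) x)
        = ∑ a, ∑ b, 𝒞.P a b t x * (pderiv a (timeDeriv T Φ t) x * pderiv b (Φ t) x) := by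
      rw [Finset.sum_comm]
      refine Finset.sum_congr rfl fun a _ => Finset.sum_congr rfl fun b _ => ?_
      rw [h.P_symm b a t ⟨ht.1, ht.2.le⟩ x]; ring
    have e2 : ∑ a, ∑ b, (t * timeDeriv T (𝒞.P a b) t x)
            * (pderiv a (Φ t) x * pderiv b (Φ t) x)
        = t * ∑ a, ∑ b, timeDeriv T (𝒞.P a b) t x * (pderiv a (Φ t) x * pderiv b (Φ t) x) := by
      simp only [Finset.mul_sum]
      exact Finset.sum_congr rfl fun a _ => Finset.sum_congr rfl fun b _ => by ring
    have e3 : ∑ a, ∑ b, 𝒞.P a b t x * ((t * pderiv a (timeDeriv T Φ t) x) * pderiv b (Φ t) x)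
        = t * ∑ a, ∑ b, 𝒞.P a b t x * (pderiv a (timeDeriv T Φ t) x * pderiv b (Φ t) x) := by
      simp only [Finset.mul_sum]
      exact Finset.sum_congr rfl fun a _ => Finset.sum_congr rfl fun b _ => by ring
    simp only [mul_add, Finset.sum_add_distrib]
    rw [e1, e2, e3]
    field_simp
    ring
  rw [e] at d7
  refine HasDerivAt.congr_deriv (f := fun s => 𝒞.density σ β U Φ s x) d7 ?_
  have ti := inv_mul_cancel₀ t0.ne'
  generalize ∑ a, ∑ b, (t * timeDeriv T (𝒞.P a b) t x)
            * (pderiv a (Φ t) x * pderiv b (Φ t) x) = S1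
  generalize ∑ a, ∑ b, 𝒞.P a b t x
            * ((t * pderiv a (timeDeriv T Φ t) x) * pderiv b (Φ t) x) = S2
  simp only [Pi.pow_apply, Pi.mul_apply, Pi.add_apply]
  field_simp
  ring

/-- The energy identity. It is purely algebraic and holds for arbitrary smooth `U`, `V`, `Φ`,
because the remainders inside `rate` are defined as the defects of the principal equations. Two
divergences are discarded: that of `U P ∂Φ`, which joins the two halves of the wave equation, and
that of `V P ∂V`, which makes the gradient of the lapse appear with a good sign. -/
theorem Admissible.torusInt_density (h : 𝒞.Admissible T δ κ₀) (hsm : 𝒞.Small T) (σ : ℝ)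
    {β : (Fin n → ℝ) → ℝ} (hβ : SmoothTorus β) {U V Φ : ℝ → (Fin n → ℝ) → ℝ}
    (hU : SmoothSlab T U) (hV : SmoothSlab T V) (hΦ : SmoothSlab T Φ) {t : ℝ}
    (ht : t ∈ Ioo 0 T) :
    SmoothTorus (fun x => t ^ (2 * β x) * 𝒞.rate T σ β U V Φ t x) ∧
    t * torusInt (timeDeriv T (𝒞.density σ β U Φ) t)
      = torusInt (fun x => t ^ (2 * β x) * 𝒞.rate T σ β U V Φ t x) := by
  have ht' : t ∈ Ioc 0 T := ⟨ht.1, ht.2.le⟩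
  have t0 := ht.1
  have sU := hU.torus ht'
  have sV := hV.torus ht'
  have sΦ := hΦ.torus ht'
  have sω : SmoothTorus (fun x => t ^ (2 * β x)) :=
    (SmoothSlab.rpow (T := T) ((SmoothTorus.const 2).mul hβ)).torus ht'
  have sP : ∀ a b, SmoothTorus (𝒞.P a b t) := fun a b => (h.P_dom₁ a b).1.torus ht'
  have sα : SmoothTorus (fun x => 𝒞.α t x - 1) := h.α_dom.1.torus ht'
  have sm : SmoothTorus (fun x => 1 + σ * (𝒞.α t x - 1)) :=
    (SmoothTorus.const 1).add ((SmoothTorus.const σ).mul sα)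
  have sK1 : ∀ a b, SmoothTorus
      (fun x => t ^ (2 * β x) * ((1 + σ * (𝒞.α t x - 1)) * 𝒞.P a b t x)) := fun a b =>
    sω.mul (sm.mul (sP a b))
  have sK2 : ∀ a b, SmoothTorus (fun x => t ^ (2 * β x) * 𝒞.P a b t x) := fun a b =>
    sω.mul (sP a b)
  have sD : ∀ {K : Fin n → Fin n → (Fin n → ℝ) → ℝ} {g f : (Fin n → ℝ) → ℝ},
      (∀ a b, SmoothTorus (K a b)) → SmoothTorus g → SmoothTorus f →
      SmoothTorus (fun x => ∑ a, ∑ b, (pderiv a (K a b) x * (g x * pderiv b f x)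
      + K a b x * (pderiv a g x * pderiv b f x) + K a b x * (g x * pderiv b (pderiv a f) x))) :=
    fun hK hg hf => .sum fun a _ => .sum fun b _ => ((((hK a b).pderiv a).mul
      (hg.mul (hf.pderiv b))).add ((hK a b).mul ((hg.pderiv a).mul (hf.pderiv b)))).add
      ((hK a b).mul (hg.mul ((hf.pderiv a).pderiv b)))
  have s1 := sD sK1 sU sΦ
  have s2 := sD sK2 sV sV
  have i1 := torusInt_divergence sK1 sU sΦ
  have i2 := torusInt_divergence sK2 sV sV
  have sdens := ((h.smooth_density hsm σ hβ hU hΦ).timeDeriv).torus ht'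
  have key : (fun x => t ^ (2 * β x) * 𝒞.rate T σ β U V Φ t x) = fun x =>
      (t * timeDeriv T (𝒞.density σ β U Φ) t x
        - σ * ∑ a, ∑ b, (pderiv a (fun x => t ^ (2 * β x)
              * ((1 + σ * (𝒞.α t x - 1)) * 𝒞.P a b t x)) x * (U t x * pderiv b (Φ t) x)
            + t ^ (2 * β x) * ((1 + σ * (𝒞.α t x - 1)) * 𝒞.P a b t x)
              * (pderiv a (U t) x * pderiv b (Φ t) x)
            + t ^ (2 * β x) * ((1 + σ * (𝒞.α t x - 1)) * 𝒞.P a b t x)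
              * (U t x * pderiv b (pderiv a (Φ t)) x)))
      + σ / 2 * ∑ a, ∑ b, (pderiv a (fun x => t ^ (2 * β x) * 𝒞.P a b t x) x
              * (V t x * pderiv b (V t) x)
            + t ^ (2 * β x) * 𝒞.P a b t x * (pderiv a (V t) x * pderiv b (V t) x)
            + t ^ (2 * β x) * 𝒞.P a b t x * (V t x * pderiv b (pderiv a (V t)) x)) := by
    funext x
    have e1 : ∑ a, ∑ b, (pderiv a (fun x => t ^ (2 * β x)
              * ((1 + σ * (𝒞.α t x - 1)) * 𝒞.P a b t x)) x * (U t x * pderiv b (Φ t) x)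
            + t ^ (2 * β x) * ((1 + σ * (𝒞.α t x - 1)) * 𝒞.P a b t x)
              * (pderiv a (U t) x * pderiv b (Φ t) x)
            + t ^ (2 * β x) * ((1 + σ * (𝒞.α t x - 1)) * 𝒞.P a b t x)
              * (U t x * pderiv b (pderiv a (Φ t)) x))
        = t ^ (2 * β x) * (U t x * ∑ b, 𝒞.M σ β b t x * pderiv b (Φ t) x
          + (1 + σ * (𝒞.α t x - 1))
              * ∑ a, ∑ b, 𝒞.P a b t x * (pderiv a (U t) x * pderiv b (Φ t) x)
          + (1 + σ * (𝒞.α t x - 1)) * (U t x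
              * ∑ a, ∑ b, 𝒞.P a b t x * pderiv b (pderiv a (Φ t)) x)) := by
      simp only [Finset.sum_add_distrib, mul_add, Finset.mul_sum]
      congr 1
      · congr 1
        · rw [Finset.sum_comm]
          refine Finset.sum_congr rfl fun b _ => ?_
          have : 𝒞.M σ β b t x = ∑ a, ((1 + σ * (𝒞.α t x - 1))
              * (2 * pderiv a β x * Real.log t * 𝒞.P a b t x + pderiv a (𝒞.P a b t) x)
              + σ * (pderiv a (fun y => 𝒞.α t y - 1) x * 𝒞.P a b t x)) := by
            rw [M, N, Finset.mul_sum, Finset.mul_sum, ← Finset.sum_add_distrib]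
          rw [this, Finset.sum_mul, Finset.mul_sum, Finset.mul_sum]
          refine Finset.sum_congr rfl fun a _ => ?_
          rw [pderiv_weight hβ (sm.mul (sP a b)) t0, pderiv_mul sm (sP a b),
            pderiv_add (SmoothTorus.const 1) ((SmoothTorus.const σ).mul sα),
            pderiv_const_mul σ sα, pderiv_const]
          ring
        · exact Finset.sum_congr rfl fun a _ => Finset.sum_congr rfl fun b _ => by ring
      · exact Finset.sum_congr rfl fun a _ => Finset.sum_congr rfl fun b _ => by ring
    have e2 : ∑ a, ∑ b, (pderiv a (fun x => t ^ (2 * β x) * 𝒞.P a b t x) x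
              * (V t x * pderiv b (V t) x)
            + t ^ (2 * β x) * 𝒞.P a b t x * (pderiv a (V t) x * pderiv b (V t) x)
            + t ^ (2 * β x) * 𝒞.P a b t x * (V t x * pderiv b (pderiv a (V t)) x))
        = t ^ (2 * β x) * (V t x * ∑ b, 𝒞.N β b t x * pderiv b (V t) x
          + ∑ a, ∑ b, 𝒞.P a b t x * (pderiv a (V t) x * pderiv b (V t) x)
          + V t x * ∑ a, ∑ b, 𝒞.P a b t x * pderiv b (pderiv a (V t)) x) := by
      simp only [Finset.sum_add_distrib, mul_add, Finset.mul_sum]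
      congr 1
      · congr 1
        · rw [Finset.sum_comm]
          refine Finset.sum_congr rfl fun b _ => ?_
          rw [N, Finset.sum_mul, Finset.mul_sum, Finset.mul_sum]
          refine Finset.sum_congr rfl fun a _ => ?_
          rw [pderiv_weight hβ (sP a b) t0]
          ring
        · exact Finset.sum_congr rfl fun a _ => Finset.sum_congr rfl fun b _ => by ring
      · exact Finset.sum_congr rfl fun a _ => Finset.sum_congr rfl fun b _ => by ring
    have e3 := ((h.smooth_density hsm σ hβ hU hΦ).hasDerivAt ht x).unique
      (h.density_hasDerivAt hsm σ β hU hΦ ht x)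
    have e4 : ∑ a, ∑ b, 𝒞.P a b t x * ((t * pderiv a (timeDeriv T Φ t) x) * pderiv b (Φ t) x)
        = ∑ a, ∑ b, 𝒞.P a b t x * ((t * pderiv a (timeDeriv T Φ t) x
          - (1 + σ * (𝒞.α t x - 1)) * pderiv a (U t) x - 𝒞.A x * pderiv a (V t) x)
            * pderiv b (Φ t) x)
          + (1 + σ * (𝒞.α t x - 1))
            * ∑ a, ∑ b, 𝒞.P a b t x * (pderiv a (U t) x * pderiv b (Φ t) x)
          + 𝒞.A x * ∑ a, ∑ b, 𝒞.P a b t x * (pderiv a (V t) x * pderiv b (Φ t) x) := by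
      simp only [Finset.mul_sum, ← Finset.sum_add_distrib]
      exact Finset.sum_congr rfl fun a _ => Finset.sum_congr rfl fun b _ => by ring
    -- With the defect `R₂` inserted, `-A U V` equals `½ V² - ½ σ V P ∂∂V - ½ V R₂`; this hidden
    -- substitution is what `ring` checks.
    rw [e1, e2, e3, e4, rate, energyRate, ← hsm.w_mul_α σ ht' x, mul_inv_cancel_left₀ t0.ne']
    ring
  refine ⟨by rw [key]; exact (((SmoothTorus.const t).mul sdens).sub
    ((SmoothTorus.const σ).mul s1)).add ((SmoothTorus.const (σ / 2)).mul s2), ?_⟩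
  rw [key, torusInt_add (((SmoothTorus.const t).mul sdens).sub ((SmoothTorus.const σ).mul s1))
    ((SmoothTorus.const (σ / 2)).mul s2), torusInt_sub ((SmoothTorus.const t).mul sdens)
    ((SmoothTorus.const σ).mul s1), torusInt_const_mul, torusInt_const_mul, torusInt_const_mul,
    i1, i2]
  ring

/-! ### Bounds on the coefficients of the energy identity -/

/-- The derivative of the weight `t^{2β}` brings a factor `log t`. Since `P` is smaller than the
weight requires, the two losses `κ₀ / 4` for the logarithm and for `P` are affordable. -/
theorem Admissible.N_dom (h : 𝒞.Admissible T δ κ₀) {β : (Fin n → ℝ) → ℝ} (hβ : SmoothTorus β)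
    (b : Fin n) : IsDom T (fun x => δ + (1 - 𝒞.q b x)) (𝒞.N β b) := by
  have k4 : 0 < κ₀ / 4 := by linarith [h.κ₀_pos]
  refine .sum fun a _ => .add ?_ ((h.P_dom₁ a b).pderiv a)
  refine h.dom_weight ((((IsDom.torus ((SmoothTorus.const 2).mul (hβ.pderiv a))).mul
    (IsDom.log h.T_le k4)).mul (h.P_dom a b _ k4)).mono h.T_le fun x => ?_)
  linarith

theorem Admissible.exists_N_M_le (h : 𝒞.Admissible T δ κ₀) {β : (Fin n → ℝ) → ℝ}
    (hβ : SmoothTorus β) : ∃ C > 0, ∀ σ, 0 ≤ σ → σ ≤ 1 → ∀ t ∈ Ioc 0 T, ∀ x b,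
      |𝒞.N β b t x| ≤ C * t ^ δ * 𝒞.p b t x ∧ |𝒞.M σ β b t x| ≤ C * t ^ δ * 𝒞.p b t x := by
  have h2 : ∀ b, IsDom T (fun x => δ + (1 - 𝒞.q b x)) (fun t x => (𝒞.α t x - 1) * 𝒞.N β b t x) :=
    fun b => (h.α_dom.mul (h.N_dom hβ b)).mono h.T_le fun x => by linarith [h.δ_pos]
  have h3 : ∀ b, IsDom T (fun x => δ + (1 - 𝒞.q b x))
      (fun t x => ∑ a, pderiv a (fun y => 𝒞.α t y - 1) x * 𝒞.P a b t x) :=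
    fun b => .sum fun a _ => ((h.α_dom.pderiv a).mul (h.P_dom₁ a b)).mono h.T_le fun x => by
      linarith [h.δ_pos]
  choose C1 hC1 b1 using fun b => (h.N_dom hβ b).abs_le
  choose C2 hC2 b2 using fun b => ((h2 b).add (h3 b)).abs_le
  have S1 : 0 ≤ ∑ b, C1 b := Finset.sum_nonneg fun b _ => (hC1 b).le
  have S2 : 0 ≤ ∑ b, C2 b := Finset.sum_nonneg fun b _ => (hC2 b).le
  refine ⟨∑ b, C1 b + ∑ b, C2 b + 1, by positivity, fun σ hσ hσ1 t ht x b => ?_⟩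
  have l1 := Finset.single_le_sum (fun b _ => (hC1 b).le) (Finset.mem_univ b)
  have l2 := Finset.single_le_sum (fun b _ => (hC2 b).le) (Finset.mem_univ b)
  have a1 := b1 b t ht x
  have a2 := b2 b t ht x
  rw [rpow_add_weight ht.1, ← mul_assoc] at a1 a2
  have pp : 0 ≤ t ^ δ * 𝒞.p b t x :=
    mul_nonneg (Real.rpow_nonneg ht.1.le δ) (p_pos (𝒞 := 𝒞) ht.1 b x).le
  have m1 := mul_le_mul_of_nonneg_right l1 pp
  have m2 := mul_le_mul_of_nonneg_right l2 pp
  have m3 := mul_nonneg S1 pp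
  have m4 := mul_nonneg S2 pp
  refine ⟨by linarith, ?_⟩
  have e : 𝒞.M σ β b t x = 𝒞.N β b t x + σ * ((𝒞.α t x - 1) * 𝒞.N β b t x
      + ∑ a, pderiv a (fun y => 𝒞.α t y - 1) x * 𝒞.P a b t x) := by rw [M]; ring
  rw [e]
  refine (abs_add_le _ _).trans ?_
  rw [abs_mul, abs_of_nonneg hσ]
  have := mul_le_of_le_one_left (abs_nonneg ((𝒞.α t x - 1) * 𝒞.N β b t x
      + ∑ a, pderiv a (fun y => 𝒞.α t y - 1) x * 𝒞.P a b t x)) hσ1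
  linarith

theorem Small.w_le (hsm : 𝒞.Small T) (hσ : 0 ≤ σ) (hσ1 : σ ≤ 1) {t : ℝ} (ht : t ∈ Ioc 0 T)
    (x : Fin n → ℝ) : 1 / 2 ≤ 𝒞.w σ t x ∧ 𝒞.w σ t x ≤ 2 := by
  have h1 := hsm.α_pos ht x
  have h2 := (abs_le.1 (hsm.α_le t ht x)).2
  have e := hsm.w_mul_α σ ht x
  constructor <;> nlinarith

theorem Admissible.exists_w_le (h : 𝒞.Admissible T δ κ₀) (hsm : 𝒞.Small T) :
    ∃ C > 0, ∀ σ, 0 ≤ σ → σ ≤ 1 → ∀ t ∈ Ioo 0 T, ∀ x,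
      |𝒞.w σ t x - 1| ≤ C * t ^ δ ∧ |t * timeDeriv T (𝒞.w σ) t x| ≤ C * t ^ δ := by
  obtain ⟨C1, hC1, h1⟩ := h.α_dom.abs_le
  obtain ⟨C2, hC2, h2⟩ := h.α_dot
  refine ⟨2 * C1 + 4 * C2, by positivity, fun σ hσ hσ1 t ht x => ?_⟩
  have ht' : t ∈ Ioc 0 T := ⟨ht.1, ht.2.le⟩
  have hα := hsm.α_pos ht' x
  have hα0 : 𝒞.α t x ≠ 0 := by linarith
  have pt := Real.rpow_nonneg ht.1.le δ
  have a1 := h1 t ht' x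
  have a2 := h2 t ht x
  have q1 : 0 ≤ C1 * t ^ δ := by positivity
  have q2 : 0 ≤ C2 * t ^ δ := by positivity
  have i2 : |(𝒞.α t x)⁻¹| ≤ 2 := by
    rw [abs_of_nonneg (by positivity), inv_le_comm₀ (by linarith) two_pos]; linarith
  have s1 : |1 - σ| ≤ 1 := by rw [abs_le]; constructor <;> linarith
  have dα := h.smooth_α.hasDerivAt ht x
  constructor
  · have e : 𝒞.w σ t x - 1 = (1 - σ) * (-(𝒞.α t x - 1) * (𝒞.α t x)⁻¹) := by
      rw [w]; field_simp; ring
    rw [e, abs_mul, abs_mul, abs_neg]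
    calc _ ≤ 1 * (C1 * t ^ δ * 2) := by gcongr
      _ ≤ _ := by linarith
  · have dw : HasDerivAt (fun s => 𝒞.w σ s x)
        ((1 - σ) * (-(timeDeriv T 𝒞.α t x) / 𝒞.α t x ^ 2)) t :=
      ((dα.fun_inv hα0).const_mul (1 - σ)).const_add σ
    rw [((h.smooth_w hsm σ).hasDerivAt ht x).unique dw]
    rw [dα.deriv] at a2
    have e : t * ((1 - σ) * (-(timeDeriv T 𝒞.α t x) / 𝒞.α t x ^ 2))
        = (1 - σ) * (-(t * timeDeriv T 𝒞.α t x) * ((𝒞.α t x)⁻¹ * (𝒞.α t x)⁻¹)) := by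
      field_simp
    rw [e, abs_mul, abs_mul, abs_neg, abs_mul (𝒞.α t x)⁻¹]
    calc _ ≤ 1 * (C2 * t ^ δ * (2 * 2)) := by gcongr
      _ ≤ _ := by linarith

theorem Admissible.exists_P_le (h : 𝒞.Admissible T δ κ₀) :
    ∃ C > 0, ∀ t ∈ Ioc 0 T, ∀ x a b, |𝒞.P a b t x| ≤ C * (𝒞.p a t x * 𝒞.p b t x) := by
  obtain ⟨C, hC, hb⟩ := h.P_near
  refine ⟨C + 1, by positivity, fun t ht x a b => ?_⟩
  have h1 := hb a b t ht x
  have pa := p_pos (𝒞 := 𝒞) ht.1 a x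
  have pb := p_pos (𝒞 := 𝒞) ht.1 b x
  have h2 : |if a = b then (t ^ (1 - 𝒞.q a x)) ^ 2 else 0| ≤ 𝒞.p a t x * 𝒞.p b t x := by
    split_ifs with hab
    · subst hab
      rw [abs_of_nonneg (sq_nonneg _), p, sq]
    · rw [abs_zero]; positivity
  have h3 := abs_sub_abs_le_abs_sub (𝒞.P a b t x)
    (if a = b then (t ^ (1 - 𝒞.q a x)) ^ 2 else 0)
  have h4 : C * t ^ δ * (𝒞.p a t x * 𝒞.p b t x) ≤ C * 1 * (𝒞.p a t x * 𝒞.p b t x) := by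
    gcongr
    exact h.rpow_le_one ht
  change _ ≤ C * t ^ δ * (𝒞.p a t x * 𝒞.p b t x) at h1
  linarith

end Coeffs

end LapseScalar

/-! ### Pointwise lower bound for the energy rate at every order -/

namespace LapseScalar

variable {n : ℕ} {T δ κ₀ σ : ℝ}

namespace Coeffs

/-- The square of the weighted first order jet of `(u, ν, φ)` that the energy controls. -/
def localSq (𝒞 : Coeffs n) (σ : ℝ) (u ν φ : (Fin n → ℝ) → ℝ) (t : ℝ) (x : Fin n → ℝ) : ℝ :=
  u x ^ 2 + ν x ^ 2 + σ * ∑ a, (𝒞.p a t x * pderiv a ν x) ^ 2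
    + σ * ∑ a, (𝒞.p a t x * pderiv a φ x) ^ 2

/-- The sum of `localSq` over all derivatives of order less than `m`. -/
def totSq (𝒞 : Coeffs n) (σ : ℝ) (m : ℕ) (u ν φ : (Fin n → ℝ) → ℝ) (t : ℝ) (x : Fin n → ℝ) : ℝ :=
  jetSq m u x + jetSq m ν x + σ * 𝒞.gradSq m ν t x + σ * 𝒞.gradSq m φ t x

/-- The square of the sources at one multiindex. -/
def srcLocal (F₁ F₂ F₃ : (Fin n → ℝ) → ℝ) (x : Fin n → ℝ) : ℝ :=
  F₁ x ^ 2 + F₂ x ^ 2 + ∑ b, pderiv b F₃ x ^ 2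

/-- The sum of `srcLocal` over all derivatives of order less than `m`. -/
def srcSq (m : ℕ) (F₁ F₂ F₃ : (Fin n → ℝ) → ℝ) (x : Fin n → ℝ) : ℝ :=
  jetSq m F₁ x + jetSq m F₂ x + ∑ b, jetSq m (pderiv b F₃) x

/-- The terms that carry a factor `t ^ δ` in the energy estimate. -/
def lowSq (𝒞 : Coeffs n) (σ : ℝ) (u ν φ : (Fin n → ℝ) → ℝ) (t : ℝ) (x : Fin n → ℝ) : ℝ :=
  u x ^ 2 + σ * ∑ a, (𝒞.p a t x * pderiv a φ x) ^ 2 + σ * ν x ^ 2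

variable {𝒞 : Coeffs n}

theorem totSq_nonneg (hσ : 0 ≤ σ) (m : ℕ) (u ν φ : (Fin n → ℝ) → ℝ) (t : ℝ) (x : Fin n → ℝ) :
    0 ≤ 𝒞.totSq σ m u ν φ t x := by
  have h1 := jetSq_nonneg m u x
  have h2 := jetSq_nonneg m ν x
  have h3 := gradSq_nonneg (𝒞 := 𝒞) t m ν x
  have h4 := gradSq_nonneg (𝒞 := 𝒞) t m φ x
  rw [totSq]; positivity

theorem srcSq_nonneg (m : ℕ) (F₁ F₂ F₃ : (Fin n → ℝ) → ℝ) (x : Fin n → ℝ) :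
    0 ≤ srcSq m F₁ F₂ F₃ x :=
  add_nonneg (add_nonneg (jetSq_nonneg _ _ _) (jetSq_nonneg _ _ _))
    (Finset.sum_nonneg fun _ _ => jetSq_nonneg _ _ _)

theorem srcLocal_nonneg (F₁ F₂ F₃ : (Fin n → ℝ) → ℝ) (x : Fin n → ℝ) :
    0 ≤ srcLocal F₁ F₂ F₃ x :=
  add_nonneg (add_nonneg (sq_nonneg _) (sq_nonneg _)) (Finset.sum_nonneg fun _ _ => sq_nonneg _)

theorem levelSum_sum {ι : Type*} (s : Finset ι) (l : ℕ) (F : ι → List (Fin n) → ℝ) :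
    levelSum l (fun L => ∑ i ∈ s, F i L) = ∑ i ∈ s, levelSum l (F i) := Finset.sum_comm

theorem jetSq_succ (m : ℕ) (f : (Fin n → ℝ) → ℝ) (x : Fin n → ℝ) :
    jetSq (m + 1) f x = jetSq m f x + levelSum m fun L => listDeriv L f x ^ 2 := cumSum_succ _ _

theorem gradSq_succ {f : (Fin n → ℝ) → ℝ} (hf : SmoothTorus f) (m : ℕ) (t : ℝ)
    (x : Fin n → ℝ) : 𝒞.gradSq (m + 1) f t x = 𝒞.gradSq m f t x
      + levelSum m fun L => ∑ a, (𝒞.p a t x * pderiv a (listDeriv L f) x) ^ 2 := by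
  rw [levelSum_sum, gradSq, gradSq, ← Finset.sum_add_distrib]
  refine Finset.sum_congr rfl fun a _ => ?_
  rw [jetSq_succ, mul_add, ← levelSum_const_mul]
  simp only [pderiv_listDeriv hf, mul_pow]

theorem totSq_succ {u ν φ : (Fin n → ℝ) → ℝ} (hν : SmoothTorus ν) (hφ : SmoothTorus φ) (m : ℕ)
    (t : ℝ) (x : Fin n → ℝ) : 𝒞.totSq σ (m + 1) u ν φ t x = 𝒞.totSq σ m u ν φ t x
      + levelSum m fun L => 𝒞.localSq σ (listDeriv L u) (listDeriv L ν) (listDeriv L φ) t x := by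
  simp only [localSq, levelSum_add, levelSum_const_mul]
  rw [totSq, totSq, jetSq_succ, jetSq_succ, gradSq_succ hν, gradSq_succ hφ]
  ring

theorem srcSq_succ {F₁ F₂ F₃ : (Fin n → ℝ) → ℝ} (hF : SmoothTorus F₃) (m : ℕ)
    (x : Fin n → ℝ) : srcSq (m + 1) F₁ F₂ F₃ x = srcSq m F₁ F₂ F₃ x
      + levelSum m fun L => srcLocal (listDeriv L F₁) (listDeriv L F₂) (listDeriv L F₃) x := by
  simp only [srcLocal, levelSum_add, levelSum_sum]
  rw [srcSq, srcSq, jetSq_succ, jetSq_succ]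
  simp only [jetSq_succ, Finset.sum_add_distrib, pderiv_listDeriv hF]
  ring

theorem Admissible.p_le_one (h : 𝒞.Admissible T δ κ₀) {t : ℝ} (ht : t ∈ Ioc 0 T) (b : Fin n)
    (x : Fin n → ℝ) : 𝒞.p b t x ≤ 1 := (h.p_le_rpow ht b x).trans (h.rpow_le_one ht)

theorem sq_source_le {N K j a b S u v A B SS : ℝ} (hN : 0 ≤ N) (hj : 0 ≤ j) (hA : 0 ≤ A)
    (hB : 0 ≤ B) (hSS : 0 ≤ SS) (hu : u ^ 2 ≤ j * A) (hv : v ^ 2 ≤ j * B)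
    (hS : S ^ 2 ≤ N * SS) :
    (|a| + |b| + S + K * (u + v)) ^ 2
      ≤ 5 * (1 + N + K ^ 2 * j) * (A + B + (a ^ 2 + b ^ 2 + SS)) := by
  have h1 : (|a| + |b| + S + K * (u + v)) ^ 2
      ≤ 5 * (|a| ^ 2 + |b| ^ 2 + S ^ 2 + (K * u) ^ 2 + (K * v) ^ 2) := by
    linarith only [sq_nonneg (|a| - |b|), sq_nonneg (|a| - S), sq_nonneg (|a| - K * u),
      sq_nonneg (|a| - K * v), sq_nonneg (|b| - S), sq_nonneg (|b| - K * u),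
      sq_nonneg (|b| - K * v), sq_nonneg (S - K * u), sq_nonneg (S - K * v),
      sq_nonneg (K * u - K * v)]
  rw [sq_abs, sq_abs, mul_pow, mul_pow] at h1
  have h2 : K ^ 2 * u ^ 2 ≤ K ^ 2 * j * A := by
    rw [mul_assoc]; exact mul_le_mul_of_nonneg_left hu (sq_nonneg K)
  have h3 : K ^ 2 * v ^ 2 ≤ K ^ 2 * j * B := by
    rw [mul_assoc]; exact mul_le_mul_of_nonneg_left hv (sq_nonneg K)
  have k : 0 ≤ K ^ 2 * j := by positivity
  have q1 := mul_nonneg hN (add_nonneg hA hB)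
  have q2 := mul_nonneg k hSS
  have q3 := mul_nonneg (add_nonneg hN k) (add_nonneg (sq_nonneg a) (sq_nonneg b))
  linarith only [h1, h2, h3, hS, q1, q2, q3, hA, hB, hSS]

/-- Bookkeeping of `σ`: the total square contains the gradients only with one factor `σ`, which
suffices because they enter the remainders either as `σ f` or inside a square multiplied by `σ`. -/
theorem sq_remainder_le {σ j u v f g A B F G : ℝ} (hσ : 0 ≤ σ) (hσ1 : σ ≤ 1) (hj : 0 ≤ j)
    (hF : 0 ≤ F) (hu : u ^ 2 ≤ j * A)
    (hv : v ^ 2 ≤ j * B) (hf : f ^ 2 ≤ j * F) (hg : g ^ 2 ≤ j * G) :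
    (u + v + σ * f + σ * g) ^ 2 + σ * (v + u + g) ^ 2 ≤ 7 * j * (A + B + σ * G + σ * F) := by
  have h1 : (u + v + σ * f + σ * g) ^ 2 ≤ 4 * (u ^ 2 + v ^ 2 + σ ^ 2 * f ^ 2 + σ ^ 2 * g ^ 2) := by
    linarith only [sq_nonneg (u - v), sq_nonneg (u - σ * f), sq_nonneg (u - σ * g),
      sq_nonneg (v - σ * f), sq_nonneg (v - σ * g), sq_nonneg (σ * f - σ * g)]
  have h2 : (v + u + g) ^ 2 ≤ 3 * (u ^ 2 + v ^ 2 + g ^ 2) := by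
    linarith only [sq_nonneg (u - v), sq_nonneg (u - g), sq_nonneg (v - g)]
  have hs : σ ^ 2 ≤ σ := pow_le_of_le_one hσ hσ1 two_ne_zero
  have h3 := mul_le_mul_of_nonneg_left h2 hσ
  have h4 := mul_le_mul_of_nonneg_right hs (sq_nonneg f)
  have h5 := mul_le_mul_of_nonneg_right hs (sq_nonneg g)
  have h6 := mul_le_mul_of_nonneg_right hσ1 (add_nonneg (sq_nonneg u) (sq_nonneg v))
  have h7 := mul_le_mul_of_nonneg_left hf hσ
  have h8 := mul_le_mul_of_nonneg_left hg hσ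
  have h9 : 0 ≤ j * (σ * F) := by positivity
  linarith only [h1, h3, h4, h5, h6, h7, h8, hu, hv, h9]

/-- The order of the quantifiers matters: `c` depends neither on `l` nor on `s`. One can therefore
choose `s` so small that the sum over all multi-indices of length `l` of the top-order errors is
absorbed by the good terms. -/
theorem Admissible.exists_rate_lower (h : 𝒞.Admissible T δ κ₀) (hsm : 𝒞.Small T)
    {β : (Fin n → ℝ) → ℝ} (hβ : SmoothTorus β) (hβ0 : ∀ x, 0 < β x) :
    ∃ c > 0, ∀ (l : ℕ) (s : ℝ), 0 < s → ∃ C > 0,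
      ∀ {σ : ℝ} {F₁ F₂ F₃ u ν φ : ℝ → (Fin n → ℝ) → ℝ}, 0 ≤ σ → σ ≤ 1 →
      𝒞.Solves T σ F₁ F₂ F₃ u ν φ → ∀ t ∈ Ioo 0 T, ∀ x, ∀ L : List (Fin n), L.length = l →
      c * 𝒞.localSq σ (listDeriv L (u t)) (listDeriv L (ν t)) (listDeriv L (φ t)) t x
        - s * 𝒞.totSq σ (l + 1) (u t) (ν t) (φ t) t x
        - C * (t ^ δ * 𝒞.lowSq σ (listDeriv L (u t)) (listDeriv L (ν t)) (listDeriv L (φ t)) t x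
          + (𝒞.totSq σ l (u t) (ν t) (φ t) t x
            + srcLocal (listDeriv L (F₁ t)) (listDeriv L (F₂ t)) (listDeriv L (F₃ t)) x))
      ≤ 𝒞.rate T σ β (fun t => listDeriv L (u t)) (fun t => listDeriv L (ν t))
          (fun t => listDeriv L (φ t)) t x := by
  obtain ⟨b₀, hb₀, hb⟩ := hβ.exists_pos_le hβ0
  obtain ⟨B, hB, hB'⟩ := hβ.exists_abs_le
  refine ⟨min (b₀ / 3) (1 / 8) / 2, by positivity, fun l s hs => ?_⟩
  obtain ⟨Cu, hCu, hu⟩ := h.exists_listDeriv_eq_u l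
  obtain ⟨Cν, hCν, hν⟩ := h.exists_listDeriv_eq_ν l
  obtain ⟨Cφ, hCφ, hφ⟩ := h.exists_listDeriv_eq_pderiv_φ l
  obtain ⟨Cw, hCw, hw⟩ := h.exists_w_le hsm
  obtain ⟨CN, hCN, hN⟩ := h.exists_N_M_le hβ
  obtain ⟨CP, hCP, hP⟩ := h.exists_P_le
  obtain ⟨C1, hC1, hP1⟩ := h.P_near
  obtain ⟨C2, hC2, hP2⟩ := h.P_dot
  obtain ⟨K, hK⟩ : ∃ K, K = Cu + Cν + Cφ + Cw + CN + CP + C1 + C2 := ⟨_, rfl⟩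
  have hK0 : 0 ≤ K := by rw [hK]; positivity
  obtain ⟨j1, hj1, hj1'⟩ := exists_jetAbs_sq_le n l
  obtain ⟨j2, hj2, hj2'⟩ := exists_jetAbs_sq_le n (l + 1)
  obtain ⟨j3, hj3, hj3'⟩ := exists_gradAbs_sq_le 𝒞 (l + 1)
  obtain ⟨j, hj⟩ : ∃ j, j = j1 + j2 + j3 := ⟨_, rfl⟩
  have hj0 : 0 < j := by rw [hj]; positivity
  obtain ⟨C, hC, hmain⟩ := exists_energyRate_lower (n := n) hb₀ hB.le hK0
    -- The quotient by `7 j` cancels the constant with which the squared remainders are bounded by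
    -- the total square.
    (div_pos hs (by positivity : 0 < 7 * j))
  have hn : (0 : ℝ) ≤ n := Nat.cast_nonneg n
  refine ⟨C * (1 + 5 * (1 + n + K ^ 2 * j)), by positivity, ?_⟩
  intro σ F₁ F₂ F₃ u ν φ hσ hσ1 hsol t ht x L hL
  have ht' : t ∈ Ioc 0 T := ⟨ht.1, ht.2.le⟩
  have t0 := ht.1
  have pδ := Real.rpow_nonneg t0.le δ
  have δ1 := h.rpow_le_one ht'
  obtain ⟨w1, w2⟩ := hsm.w_le hσ hσ1 ht' x
  obtain ⟨w3, w4⟩ := hw σ hσ hσ1 t ht x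
  have pp := fun a => (p_pos (𝒞 := 𝒞) t0 a x).le
  have up : ∀ {C r : ℝ}, 0 ≤ r → C ≤ K → C * r ≤ K * r := fun hr hc =>
    mul_le_mul_of_nonneg_right hc hr
  have up' : ∀ {C r : ℝ}, 0 ≤ r → C ≤ K → C * t ^ δ * r ≤ K * t ^ δ * r := fun hr hc =>
    mul_le_mul_of_nonneg_right (mul_le_mul_of_nonneg_right hc pδ) hr
  have gu := jetAbs_nonneg (l + 1) (u t) x
  have gν := jetAbs_nonneg (l + 1) (ν t) x
  have gu' := jetAbs_nonneg l (u t) x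
  have gν' := jetAbs_nonneg l (ν t) x
  have gφ := gradAbs_nonneg (𝒞 := 𝒞) t0 (l + 1) (φ t) x
  have gν2 := gradAbs_nonneg (𝒞 := 𝒞) t0 (l + 1) (ν t) x
  have S0 : 0 ≤ ∑ b, |pderiv b (listDeriv L (F₃ t)) x| := Finset.sum_nonneg fun _ _ => abs_nonneg _
  -- Sources and jets of order below `l` go into `y`; jets of order up to `l`, which come with
  -- `t^δ`, go into `z` and `z'`. The separate `z'` is needed because the remainder in the lapse
  -- equation contains the gradient of `ν` with only one overall factor `σ`.
  have key := hmain (σ := σ) (τ := t ^ δ) (u := listDeriv L (u t) x) (ν := listDeriv L (ν t) x)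
    (A := 𝒞.A x) (β := β x) (w := 𝒞.w σ t x) (wd := t * timeDeriv T (𝒞.w σ) t x)
    (y := |listDeriv L (F₁ t) x| + |listDeriv L (F₂ t) x|
      + ∑ b, |pderiv b (listDeriv L (F₃ t)) x| + K * (jetAbs l (u t) x + jetAbs l (ν t) x))
    (z := jetAbs (l + 1) (u t) x + jetAbs (l + 1) (ν t) x + σ * 𝒞.gradAbs (l + 1) (φ t) t x
      + σ * 𝒞.gradAbs (l + 1) (ν t) t x)
    (z' := jetAbs (l + 1) (ν t) x + jetAbs (l + 1) (u t) x + 𝒞.gradAbs (l + 1) (ν t) t x)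
    (R₁ := t * timeDeriv T (fun t => listDeriv L (u t)) t x + 𝒞.A x * listDeriv L (ν t) x
      - σ * (𝒞.α t x * ∑ a, ∑ b, 𝒞.P a b t x * pderiv b (pderiv a (listDeriv L (φ t))) x))
    (R₂ := listDeriv L (ν t) x + 2 * 𝒞.A x * listDeriv L (u t) x
      - σ * ∑ a, ∑ b, 𝒞.P a b t x * pderiv b (pderiv a (listDeriv L (ν t))) x)
    (P := fun a b => 𝒞.P a b t x) (Pd := fun a b => t * timeDeriv T (𝒞.P a b) t x)
    (p := fun a => 𝒞.p a t x) (d := fun a => 1 - 𝒞.q a x)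
    (φ := fun a => pderiv a (listDeriv L (φ t)) x) (v := fun a => pderiv a (listDeriv L (ν t)) x)
    (R₃ := fun a => t * pderiv a (timeDeriv T (fun t => listDeriv L (φ t)) t) x
      - (1 + σ * (𝒞.α t x - 1)) * pderiv a (listDeriv L (u t)) x
      - 𝒞.A x * pderiv a (listDeriv L (ν t)) x)
    (N := fun b => 𝒞.N β b t x) (M := fun b => 𝒞.M σ β b t x)
    hσ hσ1 pδ δ1 (hb x) ((le_abs_self _).trans (hB' x)) (h.A_nonneg x) (h.A_le x) w1 w2
    (w3.trans (up pδ (by rw [hK]; linarith))) (w4.trans (up pδ (by rw [hK]; linarith))) pp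
    (fun a b => h.P_symm a b t ht' x) (hsm.P_lower t ht' x)
    (fun a b => (hP t ht' x a b).trans (up (mul_nonneg (pp a) (pp b)) (by rw [hK]; linarith)))
    (fun a b => (hP1 a b t ht' x).trans (up' (mul_nonneg (pp a) (pp b)) (by rw [hK]; linarith)))
    (fun a b => by
      have e := hP2 a b t ht x
      rw [((h.P_dom₁ a b).1.hasDerivAt ht x).deriv] at e
      exact e.trans (up' (mul_nonneg (pp a) (pp b)) (by rw [hK]; linarith)))
    (h.A_sq x)
    (fun b => (hN σ hσ hσ1 t ht' x b).1.trans (up' (pp b) (by rw [hK]; linarith)))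
    (fun b => (hN σ hσ hσ1 t ht' x b).2.trans (up' (pp b) (by rw [hK]; linarith)))
    (by positivity) (by positivity) (by positivity)
    (by
      rw [hsol.smooth_u.timeDeriv_listDeriv ht]
      refine (hu hσ hσ1 hsol t ht' x L hL.le).trans ?_
      rw [hL]
      have r1 : Cu * jetAbs l (ν t) x ≤ K * jetAbs l (ν t) x := up gν' (by rw [hK]; linarith)
      have r2 := up' (C := Cu) (r := jetAbs (l + 1) (u t) x + jetAbs (l + 1) (ν t) x
        + σ * 𝒞.gradAbs (l + 1) (φ t) t x + σ * 𝒞.gradAbs (l + 1) (ν t) t x) (by positivity)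
        (by rw [hK]; linarith)
      linarith only [r1, r2, S0, abs_nonneg (listDeriv L (F₂ t) x), mul_nonneg hK0 gu'])
    (by
      refine (hν hσ hσ1 hsol t ht' x L hL.le).trans ?_
      rw [hL]
      have r1 : Cν * jetAbs l (u t) x ≤ K * jetAbs l (u t) x := up gu' (by rw [hK]; linarith)
      have r2 := mul_le_mul_of_nonneg_left (up' (C := Cν) (r := jetAbs (l + 1) (ν t) x
        + jetAbs (l + 1) (u t) x + 𝒞.gradAbs (l + 1) (ν t) t x) (by positivity)
        (by rw [hK]; linarith)) hσ
      linarith only [r1, r2, S0, abs_nonneg (listDeriv L (F₁ t) x), mul_nonneg hK0 gν'])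
    (fun a => by
      have e := hφ hσ hσ1 hsol t ht' x L hL.le a
      rw [hsol.smooth_φ.timeDeriv_listDeriv ht]
      refine e.trans ?_
      rw [hL]
      have r2 := up' (C := Cφ) (r := jetAbs (l + 1) (u t) x + jetAbs (l + 1) (ν t) x
        + σ * 𝒞.gradAbs (l + 1) (ν t) t x) (by positivity) (by rw [hK]; linarith)
      have r3 : 𝒞.p a t x * |pderiv a (listDeriv L (F₃ t)) x|
          ≤ ∑ b, |pderiv b (listDeriv L (F₃ t)) x| :=
        (mul_le_of_le_one_left (abs_nonneg _) (h.p_le_one ht' a x)).trans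
          (Finset.single_le_sum (f := fun b => |pderiv b (listDeriv L (F₃ t)) x|)
            (fun _ _ => abs_nonneg _) (Finset.mem_univ a))
      have r4 : 0 ≤ K * t ^ δ * (σ * 𝒞.gradAbs (l + 1) (φ t) t x) := by positivity
      linarith only [r2, r3, r4, abs_nonneg (listDeriv L (F₁ t) x),
        abs_nonneg (listDeriv L (F₂ t) x), mul_nonneg hK0 gν', mul_nonneg hK0 gu'])
  refine le_trans ?_ key
  clear key hmain up up' hu hν hφ hw hN hP hP1 hP2
  have ju := jetSq_nonneg l (u t) x
  have jν := jetSq_nonneg l (ν t) x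
  have ju2 := jetSq_nonneg (l + 1) (u t) x
  have jν2 := jetSq_nonneg (l + 1) (ν t) x
  have kφ := gradSq_nonneg (𝒞 := 𝒞) t (l + 1) (φ t) x
  have kν := gradSq_nonneg (𝒞 := 𝒞) t (l + 1) (ν t) x
  have kφ' := gradSq_nonneg (𝒞 := 𝒞) t l (φ t) x
  have kν' := gradSq_nonneg (𝒞 := 𝒞) t l (ν t) x
  have SS0 : 0 ≤ ∑ b, pderiv b (listDeriv L (F₃ t)) x ^ 2 := Finset.sum_nonneg fun _ _ => sq_nonneg _
  have upj : ∀ {c r : ℝ}, 0 ≤ r → c ≤ j → c * r ≤ j * r := fun hr hc =>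
    mul_le_mul_of_nonneg_right hc hr
  have hz := sq_remainder_le hσ hσ1 hj0.le kφ
    ((hj2' (u t) x).trans (upj ju2 (by rw [hj]; linarith)))
    ((hj2' (ν t) x).trans (upj jν2 (by rw [hj]; linarith)))
    ((hj3' (φ t) t x).trans (upj kφ (by rw [hj]; linarith)))
    ((hj3' (ν t) t x).trans (upj kν (by rw [hj]; linarith)))
  have hy := sq_source_le (N := n) (K := K) (a := listDeriv L (F₁ t) x)
    (b := listDeriv L (F₂ t) x) hn hj0.le ju jν SS0
    ((hj1' (u t) x).trans (upj ju (by rw [hj]; linarith)))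
    ((hj1' (ν t) x).trans (upj jν (by rw [hj]; linarith)))
    (S := ∑ b, |pderiv b (listDeriv L (F₃ t)) x|) (by
      simpa using sq_sum_mul_abs_le (fun _ : Fin n => (1 : ℝ))
        (fun b => pderiv b (listDeriv L (F₃ t)) x))
  have hz' := mul_le_mul_of_nonneg_left hz (div_pos hs (by positivity : 0 < 7 * j)).le
  have ez : s / (7 * j) * (7 * j * (jetSq (l + 1) (u t) x + jetSq (l + 1) (ν t) x
      + σ * 𝒞.gradSq (l + 1) (ν t) t x + σ * 𝒞.gradSq (l + 1) (φ t) t x))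
      = s * 𝒞.totSq σ (l + 1) (u t) (ν t) (φ t) t x := by
    rw [totSq, ← mul_assoc, div_mul_cancel₀ _ (by positivity)]
  rw [ez] at hz'
  generalize s / (7 * j) * _ = Z at *
  generalize (|listDeriv L (F₁ t) x| + |listDeriv L (F₂ t) x|
      + ∑ b, |pderiv b (listDeriv L (F₃ t)) x|
      + K * (jetAbs l (u t) x + jetAbs l (ν t) x)) ^ 2 = Y at *
  have hD : 5 * (1 + n + K ^ 2 * j) * (jetSq l (u t) x + jetSq l (ν t) x
      + (listDeriv L (F₁ t) x ^ 2 + listDeriv L (F₂ t) x ^ 2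
        + ∑ b, pderiv b (listDeriv L (F₃ t)) x ^ 2))
      ≤ 5 * (1 + n + K ^ 2 * j) * (𝒞.totSq σ l (u t) (ν t) (φ t) t x
            + srcLocal (listDeriv L (F₁ t)) (listDeriv L (F₂ t)) (listDeriv L (F₃ t)) x) := by
    refine mul_le_mul_of_nonneg_left ?_ (by positivity)
    rw [totSq, srcLocal]
    linarith only [mul_nonneg hσ kφ', mul_nonneg hσ kν']
  have W0 : 0 ≤ 𝒞.totSq σ l (u t) (ν t) (φ t) t x
            + srcLocal (listDeriv L (F₁ t)) (listDeriv L (F₂ t)) (listDeriv L (F₃ t)) x :=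
    add_nonneg (totSq_nonneg hσ _ _ _ _ _ _) (srcLocal_nonneg _ _ _ _)
  have V0 : 0 ≤ t ^ δ * 𝒞.lowSq σ (listDeriv L (u t)) (listDeriv L (ν t)) (listDeriv L (φ t)) t x :=
    mul_nonneg pδ (add_nonneg (add_nonneg (sq_nonneg _) (mul_nonneg hσ
      (Finset.sum_nonneg fun _ _ => sq_nonneg _))) (mul_nonneg hσ (sq_nonneg _)))
  have eV : t ^ δ * (listDeriv L (u t) x ^ 2
        + σ * ∑ a, (𝒞.p a t x * pderiv a (listDeriv L (φ t)) x) ^ 2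
        + σ * listDeriv L (ν t) x ^ 2)
      = t ^ δ * 𝒞.lowSq σ (listDeriv L (u t)) (listDeriv L (ν t)) (listDeriv L (φ t)) t x := rfl
  have eG : listDeriv L (u t) x ^ 2 + listDeriv L (ν t) x ^ 2
        + σ * ∑ a, (𝒞.p a t x * pderiv a (listDeriv L (ν t)) x) ^ 2
        + σ * ∑ a, (𝒞.p a t x * pderiv a (listDeriv L (φ t)) x) ^ 2
      = 𝒞.localSq σ (listDeriv L (u t)) (listDeriv L (ν t)) (listDeriv L (φ t)) t x := rfl
  rw [eV, eG]
  generalize t ^ δ * 𝒞.lowSq σ _ _ _ t x = V at *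
  generalize 𝒞.totSq σ l (u t) (ν t) (φ t) t x + _ = W at *
  have k0 : 0 ≤ C * (5 * (1 + n + K ^ 2 * j)) * V + C * W := by positivity
  have f1 := mul_le_mul_of_nonneg_left (hy.trans hD) hC.le
  linarith only [hz', f1, k0]

end Coeffs

end LapseScalar

namespace LapseScalar

variable {n : ℕ} {T δ κ₀ σ : ℝ}

theorem SmoothSlab.levelSum {F : List (Fin n) → ℝ → (Fin n → ℝ) → ℝ} {l : ℕ}
    (hF : ∀ L, SmoothSlab T (F L)) : SmoothSlab T (fun t x => levelSum l fun L => F L t x) :=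
  .sum fun _ _ => hF _

theorem SmoothSlab.jetSq {f : ℝ → (Fin n → ℝ) → ℝ} (hf : SmoothSlab T f) (m : ℕ) :
    SmoothSlab T (fun t => jetSq m (f t)) :=
  SmoothSlab.sum (s := Finset.range m) (f := fun l t x => LapseScalar.levelSum l fun L =>
    LapseScalar.listDeriv L (f t) x ^ 2) fun _ _ => .levelSum fun L => (hf.listDeriv L).pow 2

/-! ### Weighted integrals -/

/-- The integral over the torus with weight `t ^ (2 β)`. -/
def wInt (β : (Fin n → ℝ) → ℝ) (t : ℝ) (f : (Fin n → ℝ) → ℝ) : ℝ :=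
  torusInt fun x => t ^ (2 * β x) * f x

section wInt

variable {β : (Fin n → ℝ) → ℝ} {t : ℝ} {f g : (Fin n → ℝ) → ℝ}

theorem smooth_weight (hβ : SmoothTorus β) (ht : 0 < t) : SmoothTorus (fun x => t ^ (2 * β x)) :=
  (SmoothSlab.rpow (T := t) ((SmoothTorus.const 2).mul hβ)).torus ⟨ht, le_rfl⟩

theorem wInt_add (hβ : SmoothTorus β) (ht : 0 < t) (hf : SmoothTorus f) (hg : SmoothTorus g) :
    wInt β t (fun x => f x + g x) = wInt β t f + wInt β t g := by
  have s := smooth_weight hβ ht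
  simp only [wInt, mul_add]
  exact torusInt_add (s.mul hf) (s.mul hg)

theorem wInt_sub (hβ : SmoothTorus β) (ht : 0 < t) (hf : SmoothTorus f) (hg : SmoothTorus g) :
    wInt β t (fun x => f x - g x) = wInt β t f - wInt β t g := by
  have s := smooth_weight hβ ht
  simp only [wInt, mul_sub]
  exact torusInt_sub (s.mul hf) (s.mul hg)

theorem wInt_const_mul (c : ℝ) (f : (Fin n → ℝ) → ℝ) :
    wInt β t (fun x => c * f x) = c * wInt β t f := by
  simp only [wInt, ← torusInt_const_mul]
  congr 1
  funext x
  ring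

theorem wInt_mono (hβ : SmoothTorus β) (ht : 0 < t) (hf : SmoothTorus f) (hg : SmoothTorus g)
    (h : ∀ x, f x ≤ g x) : wInt β t f ≤ wInt β t g :=
  torusInt_mono ((smooth_weight hβ ht).mul hf) ((smooth_weight hβ ht).mul hg) fun x =>
    mul_le_mul_of_nonneg_left (h x) (Real.rpow_nonneg ht.le _)

theorem wInt_nonneg (ht : 0 < t) (h : ∀ x, 0 ≤ f x) : 0 ≤ wInt β t f :=
  torusInt_nonneg fun x => mul_nonneg (Real.rpow_nonneg ht.le _) (h x)

theorem wInt_levelSum (hβ : SmoothTorus β) (ht : 0 < t) {F : List (Fin n) → (Fin n → ℝ) → ℝ}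
    (hF : ∀ L, SmoothTorus (F L)) (l : ℕ) :
    wInt β t (fun x => levelSum l fun L => F L x) = levelSum l fun L => wInt β t (F L) := by
  simp only [wInt, levelSum, Finset.mul_sum]
  exact torusInt_sum fun a _ => (smooth_weight hβ ht).mul (hF _)

theorem continuousOn_wInt (hβ : SmoothTorus β) {F : ℝ → (Fin n → ℝ) → ℝ} (hF : SmoothSlab T F)
    {a : ℝ} (ha : 0 < a) : ContinuousOn (fun t => wInt β t (F t)) (Icc a T) :=
  SmoothSlab.continuousOn_torusInt (f := fun t x => t ^ (2 * β x) * F t x)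
    ((SmoothSlab.rpow ((SmoothTorus.const 2).mul hβ)).mul hF) ha

end wInt

/-! ### Energies of fixed order and control of `ν` -/

namespace Coeffs

variable {𝒞 : Coeffs n}

theorem Admissible.smooth_p (h : 𝒞.Admissible T δ κ₀) (b : Fin n) {T' : ℝ} :
    SmoothSlab T' (𝒞.p b) := .rpow ((SmoothTorus.const 1).sub (h.smooth_q b))

theorem Admissible.smooth_gradSq (h : 𝒞.Admissible T δ κ₀) {f : ℝ → (Fin n → ℝ) → ℝ}
    (hf : SmoothSlab T f) (m : ℕ) : SmoothSlab T (fun t x => 𝒞.gradSq m (f t) t x) :=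
  .sum fun b _ => ((h.smooth_p b).pow 2).mul ((hf.pderiv b).jetSq m)

theorem Admissible.smooth_totSq (h : 𝒞.Admissible T δ κ₀) (σ : ℝ)
    {u ν φ : ℝ → (Fin n → ℝ) → ℝ} (hu : SmoothSlab T u) (hν : SmoothSlab T ν)
    (hφ : SmoothSlab T φ) (m : ℕ) :
    SmoothSlab T (fun t x => 𝒞.totSq σ m (u t) (ν t) (φ t) t x) :=
  (((hu.jetSq m).add (hν.jetSq m)).add ((SmoothSlab.const σ).mul (h.smooth_gradSq hν m))).add
    ((SmoothSlab.const σ).mul (h.smooth_gradSq hφ m))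

theorem smooth_srcSq {F₁ F₂ F₃ : ℝ → (Fin n → ℝ) → ℝ} (h₁ : SmoothSlab T F₁)
    (h₂ : SmoothSlab T F₂) (h₃ : SmoothSlab T F₃) (m : ℕ) :
    SmoothSlab T (fun t x => srcSq m (F₁ t) (F₂ t) (F₃ t) x) :=
  ((h₁.jetSq m).add (h₂.jetSq m)).add (.sum fun b _ => (h₃.pderiv b).jetSq m)

theorem Admissible.smooth_localSq (h : 𝒞.Admissible T δ κ₀) (σ : ℝ)
    {u ν φ : ℝ → (Fin n → ℝ) → ℝ} (hu : SmoothSlab T u) (hν : SmoothSlab T ν)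
    (hφ : SmoothSlab T φ) : SmoothSlab T (fun t x => 𝒞.localSq σ (u t) (ν t) (φ t) t x) :=
  (((hu.pow 2).add (hν.pow 2)).add ((SmoothSlab.const σ).mul
    (.sum fun a _ => ((h.smooth_p a).mul (hν.pderiv a)).pow 2))).add
    ((SmoothSlab.const σ).mul (.sum fun a _ => ((h.smooth_p a).mul (hφ.pderiv a)).pow 2))

theorem smooth_srcLocal {F₁ F₂ F₃ : ℝ → (Fin n → ℝ) → ℝ} (h₁ : SmoothSlab T F₁)
    (h₂ : SmoothSlab T F₂) (h₃ : SmoothSlab T F₃) :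
    SmoothSlab T (fun t x => srcLocal (F₁ t) (F₂ t) (F₃ t) x) :=
  ((h₁.pow 2).add (h₂.pow 2)).add (.sum fun b _ => (h₃.pderiv b).pow 2)

theorem Admissible.smooth_lowSq (h : 𝒞.Admissible T δ κ₀) (σ : ℝ)
    {u ν φ : ℝ → (Fin n → ℝ) → ℝ} (hu : SmoothSlab T u) (hν : SmoothSlab T ν)
    (hφ : SmoothSlab T φ) : SmoothSlab T (fun t x => 𝒞.lowSq σ (u t) (ν t) (φ t) t x) :=
  ((hu.pow 2).add ((SmoothSlab.const σ).mul
    (.sum fun a _ => ((h.smooth_p a).mul (hφ.pderiv a)).pow 2))).add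
    ((SmoothSlab.const σ).mul (hν.pow 2))

/-- The energy of order `l`. -/
def levelEnergy (𝒞 : Coeffs n) (σ : ℝ) (β : (Fin n → ℝ) → ℝ) (l : ℕ)
    (u φ : ℝ → (Fin n → ℝ) → ℝ) (t : ℝ) : ℝ :=
  levelSum l fun L => torusInt
    (𝒞.density σ β (fun t => listDeriv L (u t)) (fun t => listDeriv L (φ t)) t)

theorem Small.density_lower (hsm : 𝒞.Small T) (hσ : 0 ≤ σ) (hσ1 : σ ≤ 1)
    (β : (Fin n → ℝ) → ℝ) (U Φ : ℝ → (Fin n → ℝ) → ℝ) {t : ℝ} (ht : t ∈ Ioc 0 T)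
    (x : Fin n → ℝ) :
    t ^ (2 * β x) * (U t x ^ 2 + σ * ∑ a, (𝒞.p a t x * pderiv a (Φ t) x) ^ 2)
      ≤ 4 * 𝒞.density σ β U Φ t x := by
  have h1 := mul_le_mul_of_nonneg_left (hsm.P_lower t ht x fun a => pderiv a (Φ t) x) hσ
  have h2 := mul_le_mul_of_nonneg_right (hsm.w_le hσ hσ1 ht x).1 (sq_nonneg (U t x))
  have h3 : 1 / 2 * (U t x ^ 2 + σ * ∑ a, (𝒞.p a t x * pderiv a (Φ t) x) ^ 2)
      ≤ 𝒞.w σ t x * U t x ^ 2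
        + σ * ∑ a, ∑ b, 𝒞.P a b t x * (pderiv a (Φ t) x * pderiv b (Φ t) x) := by linarith
  have h4 := mul_le_mul_of_nonneg_left h3 (Real.rpow_nonneg ht.1.le (2 * β x))
  rw [density]
  linarith

theorem Admissible.wInt_le_levelEnergy (h : 𝒞.Admissible T δ κ₀) (hsm : 𝒞.Small T) (hσ : 0 ≤ σ)
    (hσ1 : σ ≤ 1) {β : (Fin n → ℝ) → ℝ} (hβ : SmoothTorus β) {u φ : ℝ → (Fin n → ℝ) → ℝ}
    (hu : SmoothSlab T u) (hφ : SmoothSlab T φ) (l : ℕ) {t : ℝ} (ht : t ∈ Ioc 0 T) :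
    wInt β t (fun x => levelSum l fun L => listDeriv L (u t) x ^ 2
        + σ * ∑ a, (𝒞.p a t x * pderiv a (listDeriv L (φ t)) x) ^ 2)
      ≤ 4 * 𝒞.levelEnergy σ β l u φ t := by
  have sL : ∀ L, SmoothSlab T (fun t x => listDeriv L (u t) x ^ 2
      + σ * ∑ a, (𝒞.p a t x * pderiv a (listDeriv L (φ t)) x) ^ 2) := fun L =>
    ((hu.listDeriv L).pow 2).add ((SmoothSlab.const σ).mul
      (.sum fun a _ => ((h.smooth_p a).mul ((hφ.listDeriv L).pderiv a)).pow 2))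
  rw [wInt_levelSum hβ ht.1 (fun L => (sL L).torus ht), levelEnergy, ← levelSum_const_mul]
  refine levelSum_mono fun L _ => ?_
  rw [← torusInt_const_mul]
  exact torusInt_mono ((smooth_weight hβ ht.1).mul ((sL L).torus ht))
    ((SmoothTorus.const 4).mul ((h.smooth_density hsm σ hβ (hu.listDeriv L)
      (hφ.listDeriv L)).torus ht)) fun x =>
    hsm.density_lower hσ hσ1 β (fun t => listDeriv L (u t)) (fun t => listDeriv L (φ t)) ht x

theorem Admissible.levelEnergy_nonneg (h : 𝒞.Admissible T δ κ₀) (hsm : 𝒞.Small T) (hσ : 0 ≤ σ)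
    (hσ1 : σ ≤ 1) {β : (Fin n → ℝ) → ℝ} (hβ : SmoothTorus β) {u φ : ℝ → (Fin n → ℝ) → ℝ}
    (hu : SmoothSlab T u) (hφ : SmoothSlab T φ) (l : ℕ) {t : ℝ} (ht : t ∈ Ioc 0 T) :
    0 ≤ 𝒞.levelEnergy σ β l u φ t := by
  have h1 := h.wInt_le_levelEnergy hsm hσ hσ1 hβ hu hφ l ht
  have h2 : 0 ≤ wInt β t (fun x => levelSum l fun L => listDeriv L (u t) x ^ 2
        + σ * ∑ a, (𝒞.p a t x * pderiv a (listDeriv L (φ t)) x) ^ 2) :=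
    wInt_nonneg ht.1 fun x => levelSum_nonneg fun L => add_nonneg (sq_nonneg _)
      (mul_nonneg hσ (Finset.sum_nonneg fun _ _ => sq_nonneg _))
  linarith

theorem Admissible.levelEnergy_hasDerivAt (h : 𝒞.Admissible T δ κ₀) (hsm : 𝒞.Small T) (σ : ℝ)
    {β : (Fin n → ℝ) → ℝ} (hβ : SmoothTorus β) {u ν φ : ℝ → (Fin n → ℝ) → ℝ}
    (hu : SmoothSlab T u) (hν : SmoothSlab T ν) (hφ : SmoothSlab T φ) (l : ℕ) {t : ℝ}
    (ht : t ∈ Ioo 0 T) :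
    HasDerivAt (𝒞.levelEnergy σ β l u φ) (t⁻¹ * levelSum l fun L => wInt β t
      (𝒞.rate T σ β (fun t => listDeriv L (u t)) (fun t => listDeriv L (ν t))
        (fun t => listDeriv L (φ t)) t)) t := by
  rw [← levelSum_const_mul]
  refine HasDerivAt.fun_sum fun a _ => ?_
  have sd := h.smooth_density hsm σ hβ (hu.listDeriv (List.ofFn a)) (hφ.listDeriv (List.ofFn a))
  have e := (h.torusInt_density hsm σ hβ (hu.listDeriv (List.ofFn a)) (hν.listDeriv (List.ofFn a))
    (hφ.listDeriv (List.ofFn a)) ht).2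
  have d := sd.hasDerivAt_torusInt ht
  refine d.congr_deriv ?_
  have e' : wInt β t _ = _ := e.symm
  dsimp only
  rw [e', inv_mul_cancel_left₀ ht.1.ne']

theorem Admissible.continuousOn_levelEnergy (h : 𝒞.Admissible T δ κ₀) (hsm : 𝒞.Small T) (σ : ℝ)
    {β : (Fin n → ℝ) → ℝ} (hβ : SmoothTorus β) {u φ : ℝ → (Fin n → ℝ) → ℝ}
    (hu : SmoothSlab T u) (hφ : SmoothSlab T φ) (l : ℕ) {a : ℝ} (ha : 0 < a) :
    ContinuousOn (𝒞.levelEnergy σ β l u φ) (Icc a T) :=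
  continuousOn_finsetSum _ fun _ _ => (h.smooth_density hsm σ hβ (hu.listDeriv _)
    (hφ.listDeriv _)).continuousOn_torusInt ha

/-- Derivatives of `ν` of positive order are controlled by lower order terms away from `t = 0`. -/
theorem Admissible.levelSum_ν_sq_le (h : 𝒞.Admissible T δ κ₀) (hσ : 0 ≤ σ)
    {t t₁ : ℝ} (ht₁ : 0 < t₁) (ht : t ∈ Icc t₁ T) (l : ℕ) (u ν φ : (Fin n → ℝ) → ℝ)
    (x : Fin n → ℝ) :
    σ * levelSum (l + 1) (fun L => listDeriv L ν x ^ 2)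
      ≤ (t₁ ^ 4)⁻¹ * 𝒞.totSq σ (l + 1) u ν φ t x := by
  have t0 : 0 < t := ht₁.trans_le ht.1
  have hp : ∀ i, t₁ ^ 4 ≤ 𝒞.p i t x ^ 2 := fun i => by
    -- Because `1 - q_i ≤ 2`, the weight of the gradient is at least `t²` and is bounded below for
    -- `t ≥ t₁`.
    have h1 : t ^ (2 : ℝ) ≤ 𝒞.p i t x :=
      rpow_le_rpow_of_le_one t0 (ht.2.trans h.T_le) (h.le_q x i)
    rw [Real.rpow_two] at h1
    calc t₁ ^ 4 ≤ t ^ 4 := by gcongr; exact ht.1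
      _ = (t ^ 2) ^ 2 := by ring
      _ ≤ _ := by gcongr
  have h1 : t₁ ^ 4 * levelSum (l + 1) (fun L => listDeriv L ν x ^ 2) ≤ 𝒞.gradSq (l + 1) ν t x := by
    rw [levelSum_succ, Finset.mul_sum]
    refine Finset.sum_le_sum fun i _ => ?_
    exact mul_le_mul (hp i) (levelSum_le_cumSum (F := fun L => listDeriv L (LapseScalar.pderiv i ν) x ^ 2)
      (fun _ => sq_nonneg _) (Nat.lt_succ_self l)) (levelSum_nonneg fun _ => sq_nonneg _) (sq_nonneg _)
  have h2 : σ * 𝒞.gradSq (l + 1) ν t x ≤ 𝒞.totSq σ (l + 1) u ν φ t x := by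
    have k1 := jetSq_nonneg (l + 1) u x
    have k2 := jetSq_nonneg (l + 1) ν x
    have k3 := mul_nonneg hσ (gradSq_nonneg (𝒞 := 𝒞) t (l + 1) φ x)
    rw [totSq]; linarith
  rw [inv_mul_eq_div, le_div_iff₀ (by positivity)]
  nlinarith [mul_le_mul_of_nonneg_left h1 hσ]

/-- The energy contains no `ν`, so `K t^δ σ ν²` with a large `K` cannot be left to Gronwall. For `t
≤ t₁` the factor `K t^δ` is at most `η` and the term is absorbed. For `t ≥ t₁` degenerate weights
are bounded below: at order zero the elliptic estimate bounds `ν` by `u` and `F₂`, and at positive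
order a derivative of `ν` is a gradient already controlled at the previous order. The interval need
not be shortened, whatever `l` and `K` are. -/
theorem Admissible.exists_wInt_ν_sq_le (h : 𝒞.Admissible T δ κ₀) (hsm : 𝒞.Small T)
    {β : (Fin n → ℝ) → ℝ} (hβ : SmoothTorus β) (hβ0 : ∀ x, 0 < β x) (l : ℕ) {K η : ℝ} (hK : 0 < K)
    (hη : 0 < η) : ∃ C > 0, ∀ {σ : ℝ} {F₁ F₂ F₃ u ν φ : ℝ → (Fin n → ℝ) → ℝ}, 0 ≤ σ → σ ≤ 1 →
      𝒞.Solves T σ F₁ F₂ F₃ u ν φ → ∀ t ∈ Ioc 0 T,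
      K * t ^ δ * (σ * wInt β t (fun x => levelSum l fun L => listDeriv L (ν t) x ^ 2))
        ≤ η * wInt β t (𝒞.totSq σ (l + 1) (u t) (ν t) (φ t) t)
          + C * (wInt β t (𝒞.totSq σ l (u t) (ν t) (φ t) t)
            + wInt β t (srcSq (l + 1) (F₁ t) (F₂ t) (F₃ t))
            + t ^ δ * 𝒞.levelEnergy σ β l u φ t) := by
  obtain ⟨t₁, ht₁, hsmall⟩ := exists_rpow_le h.T_pos h.δ_pos (div_pos hη hK)
  obtain ⟨B, hB, hB'⟩ := hβ.exists_abs_le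
  have q0 : 0 < t₁ ^ (2 * B) := Real.rpow_pos_of_pos ht₁.1 _
  have q1 : 0 < t₁ ^ 4 := pow_pos ht₁.1 4
  refine ⟨K * (t₁ ^ 4)⁻¹ + K * 160 * (t₁ ^ (2 * B))⁻¹, by positivity, ?_⟩
  intro σ F₁ F₂ F₃ u ν φ hσ hσ1 hs t ht
  have sν : SmoothTorus (fun x => levelSum l fun L => listDeriv L (ν t) x ^ 2) :=
    (SmoothSlab.levelSum fun L => (hs.smooth_ν.listDeriv L).pow 2).torus ht
  have st : ∀ m, SmoothTorus (𝒞.totSq σ m (u t) (ν t) (φ t) t) := fun m =>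
    (h.smooth_totSq σ hs.smooth_u hs.smooth_ν hs.smooth_φ m).torus ht
  have W0 := wInt_nonneg (β := β) ht.1 (totSq_nonneg (𝒞 := 𝒞) hσ l (u t) (ν t) (φ t) t)
  have W1 := wInt_nonneg (β := β) ht.1 (totSq_nonneg (𝒞 := 𝒞) hσ (l + 1) (u t) (ν t) (φ t) t)
  have W2 := wInt_nonneg (β := β) ht.1 (srcSq_nonneg (l + 1) (F₁ t) (F₂ t) (F₃ t))
  have W3 := h.levelEnergy_nonneg hsm hσ hσ1 hβ hs.smooth_u hs.smooth_φ l ht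
  have W4 : 0 ≤ wInt β t (fun x => levelSum l fun L => listDeriv L (ν t) x ^ 2) :=
    wInt_nonneg ht.1 fun x => levelSum_nonneg fun _ => sq_nonneg _
  have pδ := Real.rpow_nonneg ht.1.le δ
  have δ1 := h.rpow_le_one ht
  by_cases htt : t ≤ t₁
  · have h1 : K * t ^ δ ≤ η := by
      have := hsmall t ⟨ht.1, htt⟩
      rw [le_div_iff₀ hK] at this; linarith
    have h2 : wInt β t (fun x => levelSum l fun L => listDeriv L (ν t) x ^ 2)
        ≤ wInt β t (𝒞.totSq σ (l + 1) (u t) (ν t) (φ t) t) := by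
      refine wInt_mono hβ ht.1 sν (st _) fun x => ?_
      have k0 : levelSum l (fun L => listDeriv L (ν t) x ^ 2) ≤ jetSq (l + 1) (ν t) x :=
        levelSum_le_cumSum (fun _ => sq_nonneg _) (Nat.lt_succ_self l)
      have k1 := jetSq_nonneg (l + 1) (u t) x
      have k3 := mul_nonneg hσ (gradSq_nonneg (𝒞 := 𝒞) t (l + 1) (φ t) x)
      have k4 := mul_nonneg hσ (gradSq_nonneg (𝒞 := 𝒞) t (l + 1) (ν t) x)
      rw [totSq]; linarith
    have h3 : K * t ^ δ * (σ * wInt β t (fun x => levelSum l fun L => listDeriv L (ν t) x ^ 2))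
        ≤ η * (1 * wInt β t (𝒞.totSq σ (l + 1) (u t) (ν t) (φ t) t)) := by gcongr
    rw [one_mul] at h3
    refine h3.trans (le_add_of_nonneg_right ?_)
    have := mul_nonneg pδ W3
    positivity
  · have htI : t ∈ Icc t₁ T := ⟨(not_le.1 htt).le, ht.2⟩
    have e1 : K * t ^ δ * (σ * wInt β t (fun x => levelSum l fun L => listDeriv L (ν t) x ^ 2))
        ≤ (K * (t₁ ^ 4)⁻¹ + K * 160 * (t₁ ^ (2 * B))⁻¹)
          * (wInt β t (𝒞.totSq σ l (u t) (ν t) (φ t) t)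
            + wInt β t (srcSq (l + 1) (F₁ t) (F₂ t) (F₃ t))
            + t ^ δ * 𝒞.levelEnergy σ β l u φ t) := by
      have V3 := mul_nonneg pδ W3
      rcases l with _ | l
      · -- the elliptic estimate
        have su := hs.smooth_u.torus ht
        have sF := hs.smooth_F₂.torus ht
        have se : SmoothTorus (fun x => u t x ^ 2 + F₂ t x ^ 2) := (su.pow 2).add (sF.pow 2)
        have a0 : wInt β t (fun x => levelSum 0 fun L => listDeriv L (ν t) x ^ 2)
            ≤ torusInt (fun x => ν t x ^ 2) := by
          refine torusInt_mono ((smooth_weight hβ ht.1).mul sν) ((hs.smooth_ν.torus ht).pow 2)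
            fun x => ?_
          dsimp only
          rw [levelSum_zero]
          exact mul_le_of_le_one_left (sq_nonneg _) (Real.rpow_le_one ht.1.le
            (ht.2.trans h.T_le) (by linarith [hβ0 x]))
        have a1 := h.torusInt_ν_sq_le hsm hσ hσ1 hs ht
        -- The elliptic estimate carries no weight. For `t ≥ t₁` the weight `t^{2β}` lies between
        -- `t₁^{2B}` and `1`, so it can be removed and restored at the cost of a constant.
        have a2 : t₁ ^ (2 * B) * torusInt (fun x => u t x ^ 2 + F₂ t x ^ 2)
            ≤ wInt β t (fun x => u t x ^ 2 + F₂ t x ^ 2) := by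
          rw [← torusInt_const_mul]
          refine torusInt_mono ((SmoothTorus.const _).mul se) ((smooth_weight hβ ht.1).mul se)
            fun x => mul_le_mul_of_nonneg_right ?_ (by positivity)
          calc t₁ ^ (2 * B) ≤ t ^ (2 * B) := Real.rpow_le_rpow ht₁.1.le htI.1 (by linarith)
            _ ≤ t ^ (2 * β x) := rpow_le_rpow_of_le_one ht.1 (ht.2.trans h.T_le) (by
                linarith [le_abs_self (β x), hB' x])
        rw [wInt_add hβ ht.1 (su.pow 2) (sF.pow 2)] at a2
        have a3 : wInt β t (fun x => u t x ^ 2) ≤ 4 * 𝒞.levelEnergy σ β 0 u φ t := by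
          refine le_trans ?_ (h.wInt_le_levelEnergy hsm hσ hσ1 hβ hs.smooth_u hs.smooth_φ 0 ht)
          refine wInt_mono hβ ht.1 (su.pow 2) ((SmoothSlab.levelSum fun L =>
            ((hs.smooth_u.listDeriv L).pow 2).add ((SmoothSlab.const σ).mul
            (.sum fun a _ => ((h.smooth_p a).mul ((hs.smooth_φ.listDeriv L).pderiv a)).pow
              2))).torus ht) fun x => ?_
          rw [levelSum_zero]
          exact le_add_of_nonneg_right (mul_nonneg hσ (Finset.sum_nonneg fun _ _ => sq_nonneg _))
        have a4 : wInt β t (fun x => F₂ t x ^ 2)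
            ≤ wInt β t (srcSq (0 + 1) (F₁ t) (F₂ t) (F₃ t)) := by
          refine wInt_mono hβ ht.1 (sF.pow 2)
            ((smooth_srcSq hs.smooth_F₁ hs.smooth_F₂ hs.smooth_F₃ 1).torus ht) fun x => ?_
          have k0 : F₂ t x ^ 2 ≤ jetSq (0 + 1) (F₂ t) x :=
            le_cumSum (F := fun L => listDeriv L (F₂ t) x ^ 2) (fun _ => sq_nonneg _) (L := [])
              (by simp)
          have k1 := jetSq_nonneg (0 + 1) (F₁ t) x
          have k2 : 0 ≤ ∑ b, jetSq (0 + 1) (LapseScalar.pderiv b (F₃ t)) x :=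
            Finset.sum_nonneg fun _ _ => jetSq_nonneg _ _ _
          rw [srcSq]; linarith
        have a5 : torusInt (fun x => u t x ^ 2 + F₂ t x ^ 2)
            ≤ (t₁ ^ (2 * B))⁻¹ * (4 * 𝒞.levelEnergy σ β 0 u φ t
              + wInt β t (srcSq (0 + 1) (F₁ t) (F₂ t) (F₃ t))) := by
          rw [inv_mul_eq_div, le_div_iff₀ q0]; linarith
        generalize 𝒞.levelEnergy σ β 0 u φ t = E at *
        generalize wInt β t (srcSq (0 + 1) (F₁ t) (F₂ t) (F₃ t)) = Z at *
        generalize wInt β t (𝒞.totSq σ 0 (u t) (ν t) (φ t) t) = Y at *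
        generalize wInt β t (fun x => levelSum 0 fun L => listDeriv L (ν t) x ^ 2) = X at *
        have a6 : X ≤ 160 * (t₁ ^ (2 * B))⁻¹ * (E + Z) := by
          have : 0 ≤ (t₁ ^ (2 * B))⁻¹ * Z := by positivity
          linarith
        calc K * t ^ δ * (σ * X) ≤ K * t ^ δ * (1 * (160 * (t₁ ^ (2 * B))⁻¹ * (E + Z))) := by
              gcongr
          _ = K * 160 * (t₁ ^ (2 * B))⁻¹ * (t ^ δ * E + t ^ δ * Z) := by ring
          _ ≤ K * 160 * (t₁ ^ (2 * B))⁻¹ * (t ^ δ * E + 1 * Z) := by gcongr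
          _ ≤ (K * (t₁ ^ 4)⁻¹ + K * 160 * (t₁ ^ (2 * B))⁻¹) * (Y + Z + t ^ δ * E) := by
              refine mul_le_mul (le_add_of_nonneg_left (by positivity)) (by linarith)
                (by positivity) (by positivity)
      -- At level `l + 1` the total square of order less than `l + 1` is a quantity of the previous
      -- step of the induction.
      · have a0 : σ * wInt β t (fun x => levelSum (l + 1) fun L => listDeriv L (ν t) x ^ 2)
            ≤ (t₁ ^ 4)⁻¹ * wInt β t (𝒞.totSq σ (l + 1) (u t) (ν t) (φ t) t) := by
          rw [← wInt_const_mul, ← wInt_const_mul]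
          exact wInt_mono hβ ht.1 ((SmoothTorus.const σ).mul sν)
            ((SmoothTorus.const _).mul (st _)) fun x =>
            h.levelSum_ν_sq_le hσ ht₁.1 htI l (u t) (ν t) (φ t) x
        generalize 𝒞.levelEnergy σ β (l + 1) u φ t = E at *
        generalize wInt β t (srcSq (l + 1 + 1) (F₁ t) (F₂ t) (F₃ t)) = Z at *
        generalize wInt β t (𝒞.totSq σ (l + 1) (u t) (ν t) (φ t) t) = Y at *
        generalize wInt β t (fun x => levelSum (l + 1) fun L => listDeriv L (ν t) x ^ 2) = X at *
        calc K * t ^ δ * (σ * X) ≤ K * 1 * ((t₁ ^ 4)⁻¹ * Y) := by gcongr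
          _ = K * (t₁ ^ 4)⁻¹ * Y := by ring
          _ ≤ _ := by
              refine mul_le_mul (le_add_of_nonneg_right (by positivity)) (by linarith)
                (by positivity) (by positivity)
    exact e1.trans (le_add_of_nonneg_left (by positivity))

end Coeffs

end LapseScalar

/-! ### The differential inequality for the energy of fixed order -/

namespace LapseScalar

variable {n : ℕ} {T δ κ₀ σ : ℝ}

namespace Coeffs

variable {𝒞 : Coeffs n}

/-- The pointwise bound is integrated and summed over multi-indices of length `l`. What cannot be
absorbed is `t^δ` times the energy, for Gronwall, and quantities of lower order, for the induction.
-/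
theorem Admissible.exists_levelEnergy_ineq (h : 𝒞.Admissible T δ κ₀) (hsm : 𝒞.Small T)
    {β : (Fin n → ℝ) → ℝ} (hβ : SmoothTorus β) (hβ0 : ∀ x, 0 < β x) (l : ℕ) :
    ∃ c > 0, ∃ C > 0, ∀ {σ : ℝ} {F₁ F₂ F₃ u ν φ : ℝ → (Fin n → ℝ) → ℝ}, 0 ≤ σ → σ ≤ 1 →
      𝒞.Solves T σ F₁ F₂ F₃ u ν φ → ∀ t ∈ Ioo 0 T,
      c * wInt β t (𝒞.totSq σ (l + 1) (u t) (ν t) (φ t) t)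
        - C * t ^ δ * 𝒞.levelEnergy σ β l u φ t
        - C * (wInt β t (𝒞.totSq σ l (u t) (ν t) (φ t) t)
          + wInt β t (srcSq (l + 1) (F₁ t) (F₂ t) (F₃ t)))
      ≤ levelSum l fun L => wInt β t (𝒞.rate T σ β (fun t => listDeriv L (u t))
          (fun t => listDeriv L (ν t)) (fun t => listDeriv L (φ t)) t) := by
  obtain ⟨c, hc, hrate⟩ := h.exists_rate_lower hsm hβ hβ0
  have hn : (0 : ℝ) < (n + 1 : ℝ) ^ l := by positivity
  -- There are `n^l` multi-indices of length `l`, so their commutator errors add up to at most `c /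
  -- 4`. A further `c / 4` is spent on the terms in `ν`, and `c / 2` remains. The base `n + 1`
  -- avoids division by zero.
  obtain ⟨C, hC, hrate⟩ := hrate l (c / (4 * (n + 1 : ℝ) ^ l)) (by positivity)
  obtain ⟨D, hD, hν⟩ := h.exists_wInt_ν_sq_le hsm hβ hβ0 l hC (by positivity : 0 < c / 4)
  refine ⟨c / 2, by positivity, 4 * C + D + c + C * (n : ℝ) ^ l, by positivity, ?_⟩
  intro σ F₁ F₂ F₃ u ν φ hσ hσ1 hs t ht
  have ht' : t ∈ Ioc 0 T := ⟨ht.1, ht.2.le⟩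
  have su := fun L => (hs.smooth_u.listDeriv L)
  have sν := fun L => (hs.smooth_ν.listDeriv L)
  have sφ := fun L => (hs.smooth_φ.listDeriv L)
  have s1 := fun L => (h.smooth_localSq σ (su L) (sν L) (sφ L)).torus ht'
  have s2 := fun m => (h.smooth_totSq σ hs.smooth_u hs.smooth_ν hs.smooth_φ m).torus ht'
  have s3 := fun L => (h.smooth_lowSq σ (su L) (sν L) (sφ L)).torus ht'
  have s4 := fun L => (smooth_srcLocal (hs.smooth_F₁.listDeriv L) (hs.smooth_F₂.listDeriv L)
    (hs.smooth_F₃.listDeriv L)).torus ht'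
  have s5 := fun m => (smooth_srcSq hs.smooth_F₁ hs.smooth_F₂ hs.smooth_F₃ m).torus ht'
  have W0 := wInt_nonneg (β := β) ht.1 (totSq_nonneg (𝒞 := 𝒞) hσ l (u t) (ν t) (φ t) t)
  have W1 := wInt_nonneg (β := β) ht.1 (totSq_nonneg (𝒞 := 𝒞) hσ (l + 1) (u t) (ν t) (φ t) t)
  have W2 := wInt_nonneg (β := β) ht.1 (srcSq_nonneg (l + 1) (F₁ t) (F₂ t) (F₃ t))
  have W3 := h.levelEnergy_nonneg hsm hσ hσ1 hβ hs.smooth_u hs.smooth_φ l ht'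
  have pδ := Real.rpow_nonneg ht.1.le δ
  have a1 : levelSum l (fun L =>
      c * wInt β t (𝒞.localSq σ (listDeriv L (u t)) (listDeriv L (ν t)) (listDeriv L (φ t)) t)
        - c / (4 * (n + 1 : ℝ) ^ l) * wInt β t (𝒞.totSq σ (l + 1) (u t) (ν t) (φ t) t)
        - C * (t ^ δ * wInt β t (𝒞.lowSq σ (listDeriv L (u t)) (listDeriv L (ν t))
            (listDeriv L (φ t)) t)
          + (wInt β t (𝒞.totSq σ l (u t) (ν t) (φ t) t)
            + wInt β t (srcLocal (listDeriv L (F₁ t)) (listDeriv L (F₂ t)) (listDeriv L (F₃ t))))))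
      ≤ levelSum l fun L => wInt β t (𝒞.rate T σ β (fun t => listDeriv L (u t))
          (fun t => listDeriv L (ν t)) (fun t => listDeriv L (φ t)) t) := by
    refine levelSum_mono fun L hL => ?_
    have k1 := (SmoothTorus.const c).mul (s1 L)
    have k2 := (SmoothTorus.const (c / (4 * (n + 1 : ℝ) ^ l))).mul (s2 (l + 1))
    have k3 := (SmoothTorus.const (t ^ δ)).mul (s3 L)
    have k4 := (s2 l).add (s4 L)
    have k5 := (SmoothTorus.const C).mul (k3.add k4)
    have e : c * wInt β t (𝒞.localSq σ (listDeriv L (u t)) (listDeriv L (ν t))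
            (listDeriv L (φ t)) t)
        - c / (4 * (n + 1 : ℝ) ^ l) * wInt β t (𝒞.totSq σ (l + 1) (u t) (ν t) (φ t) t)
        - C * (t ^ δ * wInt β t (𝒞.lowSq σ (listDeriv L (u t)) (listDeriv L (ν t))
            (listDeriv L (φ t)) t)
          + (wInt β t (𝒞.totSq σ l (u t) (ν t) (φ t) t)
            + wInt β t (srcLocal (listDeriv L (F₁ t)) (listDeriv L (F₂ t)) (listDeriv L (F₃ t)))))
        = wInt β t (fun x => c * 𝒞.localSq σ (listDeriv L (u t)) (listDeriv L (ν t))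
            (listDeriv L (φ t)) t x
          - c / (4 * (n + 1 : ℝ) ^ l) * 𝒞.totSq σ (l + 1) (u t) (ν t) (φ t) t x
          - C * (t ^ δ * 𝒞.lowSq σ (listDeriv L (u t)) (listDeriv L (ν t)) (listDeriv L (φ t)) t x
          + (𝒞.totSq σ l (u t) (ν t) (φ t) t x
            + srcLocal (listDeriv L (F₁ t)) (listDeriv L (F₂ t)) (listDeriv L (F₃ t)) x))) := by
      rw [wInt_sub hβ ht.1 (k1.sub k2) k5, wInt_sub hβ ht.1 k1 k2, wInt_const_mul, wInt_const_mul,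
        wInt_const_mul, wInt_add hβ ht.1 k3 k4, wInt_const_mul, wInt_add hβ ht.1 (s2 l) (s4 L)]
    rw [e]
    exact torusInt_mono ((smooth_weight hβ ht.1).mul ((k1.sub k2).sub k5))
      (h.torusInt_density hsm σ hβ (su L) (sν L) (sφ L) ht).1 fun x =>
      mul_le_mul_of_nonneg_left (hrate hσ hσ1 hs t ht x L hL) (Real.rpow_nonneg ht.1.le _)
  simp only [sub_eq_add_neg, levelSum_add, ← neg_mul, levelSum_const_mul, levelSum_const] at a1
  have a2 : levelSum l (fun L => wInt β t (𝒞.localSq σ (listDeriv L (u t)) (listDeriv L (ν t))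
      (listDeriv L (φ t)) t)) = wInt β t (𝒞.totSq σ (l + 1) (u t) (ν t) (φ t) t)
        - wInt β t (𝒞.totSq σ l (u t) (ν t) (φ t) t) := by
    rw [← wInt_levelSum hβ ht.1 s1, ← wInt_sub hβ ht.1 (s2 _) (s2 _)]
    congr 1
    funext x
    rw [totSq_succ (hs.smooth_ν.torus ht') (hs.smooth_φ.torus ht')]
    ring
  have a3 : levelSum l (fun L => wInt β t (srcLocal (listDeriv L (F₁ t)) (listDeriv L (F₂ t))
      (listDeriv L (F₃ t)))) ≤ wInt β t (srcSq (l + 1) (F₁ t) (F₂ t) (F₃ t)) := by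
    rw [← wInt_levelSum hβ ht.1 s4]
    refine wInt_mono hβ ht.1 ((SmoothSlab.levelSum fun L => smooth_srcLocal
      (hs.smooth_F₁.listDeriv L) (hs.smooth_F₂.listDeriv L)
      (hs.smooth_F₃.listDeriv L)).torus ht') (s5 _) fun x => ?_
    rw [srcSq_succ (hs.smooth_F₃.torus ht')]
    exact le_add_of_nonneg_left (srcSq_nonneg _ _ _ _ _)
  have a4 : levelSum l (fun L => wInt β t (𝒞.lowSq σ (listDeriv L (u t)) (listDeriv L (ν t))
      (listDeriv L (φ t)) t)) ≤ 4 * 𝒞.levelEnergy σ β l u φ t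
        + σ * wInt β t (fun x => levelSum l fun L => listDeriv L (ν t) x ^ 2) := by
    have k1 : SmoothTorus (fun x => levelSum l fun L => listDeriv L (u t) x ^ 2
        + σ * ∑ a, (𝒞.p a t x * pderiv a (listDeriv L (φ t)) x) ^ 2) :=
      (SmoothSlab.levelSum fun L => ((su L).pow 2).add ((SmoothSlab.const σ).mul
        (.sum fun a _ => ((h.smooth_p a).mul ((sφ L).pderiv a)).pow 2))).torus ht'
    have k2 : SmoothTorus (fun x => levelSum l fun L => listDeriv L (ν t) x ^ 2) :=
      (SmoothSlab.levelSum fun L => (sν L).pow 2).torus ht'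
    refine le_trans (le_of_eq ?_) (add_le_add_left (h.wInt_le_levelEnergy hsm hσ hσ1 hβ
      hs.smooth_u hs.smooth_φ l ht') _)
    rw [← wInt_levelSum hβ ht.1 s3, ← wInt_const_mul,
      ← wInt_add hβ ht.1 k1 ((SmoothTorus.const σ).mul k2)]
    congr 1
    funext x
    rw [← levelSum_const_mul, ← levelSum_add]
    rfl
  have a5 := hν hσ hσ1 hs t ht'
  have a6 : c / (4 * (n + 1 : ℝ) ^ l) * (n : ℝ) ^ l ≤ c / 4 := by
    rw [div_mul_eq_mul_div, div_le_div_iff₀ (by positivity) (by norm_num)]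
    have : (n : ℝ) ^ l ≤ (n + 1 : ℝ) ^ l := by gcongr; linarith
    nlinarith
  rw [a2] at a1
  have b1 := mul_le_mul_of_nonneg_left a4 (mul_nonneg hC.le pδ)
  have b2 := mul_le_mul_of_nonneg_left a3 hC.le
  have b3 := mul_le_mul_of_nonneg_right a6 W1
  generalize wInt β t (𝒞.totSq σ (l + 1) (u t) (ν t) (φ t) t) = X1 at *
  generalize wInt β t (𝒞.totSq σ l (u t) (ν t) (φ t) t) = X0 at *
  generalize wInt β t (srcSq (l + 1) (F₁ t) (F₂ t) (F₃ t)) = X2 at *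
  generalize 𝒞.levelEnergy σ β l u φ t = E at *
  generalize levelSum l (fun L => wInt β t (𝒞.rate T σ β (fun t => listDeriv L (u t))
          (fun t => listDeriv L (ν t)) (fun t => listDeriv L (φ t)) t)) = R at *
  generalize levelSum l (fun L => wInt β t (𝒞.lowSq σ (listDeriv L (u t)) (listDeriv L (ν t))
      (listDeriv L (φ t)) t)) = Y at *
  generalize levelSum l (fun L => wInt β t (srcLocal (listDeriv L (F₁ t)) (listDeriv L (F₂ t))
      (listDeriv L (F₃ t)))) = Z at *
  generalize wInt β t (fun x => levelSum l fun L => listDeriv L (ν t) x ^ 2) = V at *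
  generalize c / (4 * (n + 1 : ℝ) ^ l) = s at *
  have N0 : (0 : ℝ) ≤ (n : ℝ) ^ l := by positivity
  generalize (n : ℝ) ^ l = N at *
  have r1 := mul_nonneg pδ W3
  have q1 : 0 ≤ (c + C * N) * (t ^ δ * E) := by positivity
  have q2 : 0 ≤ C * X0 := by positivity
  have q3 : 0 ≤ (3 * C + c + C * N) * X2 := by positivity
  linarith only [a1, a5, b1, b2, b3, q1, q2, q3]

theorem totSq_zero (u ν φ : (Fin n → ℝ) → ℝ) (t : ℝ) (x : Fin n → ℝ) :
    𝒞.totSq σ 0 u ν φ t x = 0 := by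
  simp [totSq, gradSq, jetSq, cumSum]

theorem srcSq_mono {l m : ℕ} (hlm : l ≤ m) (F₁ F₂ F₃ : (Fin n → ℝ) → ℝ) (x : Fin n → ℝ) :
    srcSq l F₁ F₂ F₃ x ≤ srcSq m F₁ F₂ F₃ x :=
  add_le_add (add_le_add (jetSq_mono hlm _ _) (jetSq_mono hlm _ _))
    (Finset.sum_le_sum fun _ _ => jetSq_mono hlm _ _)

end Coeffs

/-! ### Weighted space-time integrals -/

section timeInt

variable {β : (Fin n → ℝ) → ℝ} {F G : ℝ → (Fin n → ℝ) → ℝ} {t : ℝ}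

theorem intervalIntegrable_wInt (hβ : SmoothTorus β) (hF : SmoothSlab T F) (ht : t ∈ Ioc 0 T) :
    IntervalIntegrable (fun s => wInt β s (F s) * s⁻¹) volume t T :=
  ((continuousOn_wInt hβ hF ht.1).mul (continuousOn_inv₀.mono fun _ hs =>
    (ht.1.trans_le hs.1).ne')).intervalIntegrable_of_Icc ht.2

/-- The space-time integral with weight `s ^ (2 β)` and measure `ds / s`. -/
def timeInt (β : (Fin n → ℝ) → ℝ) (t T : ℝ) (F : ℝ → (Fin n → ℝ) → ℝ) : ℝ :=
  ∫ s in t..T, wInt β s (F s) * s⁻¹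

theorem timeInt_mono (hβ : SmoothTorus β) (hF : SmoothSlab T F) (hG : SmoothSlab T G)
    (ht : t ∈ Ioc 0 T) (h : ∀ s ∈ Icc t T, ∀ x, F s x ≤ G s x) :
    timeInt β t T F ≤ timeInt β t T G := by
  refine intervalIntegral.integral_mono_on ht.2 (intervalIntegrable_wInt hβ hF ht)
    (intervalIntegrable_wInt hβ hG ht) fun s hs => ?_
  have s0 := ht.1.trans_le hs.1
  have hs' : s ∈ Ioc 0 T := ⟨s0, hs.2⟩
  exact mul_le_mul_of_nonneg_right (wInt_mono hβ s0 (hF.torus hs') (hG.torus hs') (h s hs))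
    (inv_nonneg.2 s0.le)

theorem timeInt_nonneg (ht : t ∈ Ioc 0 T) (h : ∀ s ∈ Icc t T, ∀ x, 0 ≤ F s x) :
    0 ≤ timeInt β t T F :=
  intervalIntegral.integral_nonneg ht.2 fun s hs =>
    mul_nonneg (wInt_nonneg (ht.1.trans_le hs.1) (h s hs)) (inv_nonneg.2 (ht.1.trans_le hs.1).le)

theorem timeInt_const_mul (c : ℝ) (F : ℝ → (Fin n → ℝ) → ℝ) :
    timeInt β t T (fun t x => c * F t x) = c * timeInt β t T F := by
  simp only [timeInt, wInt_const_mul, mul_assoc, intervalIntegral.integral_const_mul]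

theorem timeInt_add (hβ : SmoothTorus β) (hF : SmoothSlab T F) (hG : SmoothSlab T G)
    (ht : t ∈ Ioc 0 T) :
    timeInt β t T (fun t x => F t x + G t x) = timeInt β t T F + timeInt β t T G := by
  rw [timeInt, timeInt, timeInt, ← intervalIntegral.integral_add
    (intervalIntegrable_wInt hβ hF ht) (intervalIntegrable_wInt hβ hG ht)]
  refine intervalIntegral.integral_congr fun s hs => ?_
  rw [uIcc_of_le ht.2] at hs
  have s0 := ht.1.trans_le hs.1
  rw [wInt_add hβ s0 (hF.torus ⟨s0, hs.2⟩) (hG.torus ⟨s0, hs.2⟩), add_mul]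

/-- The differential inequality for a weighted quantity, integrated in time. -/
theorem timeInt_le_of_ineq {K δ : ℝ} {E E' : ℝ → ℝ} (hβ : SmoothTorus β) (hF : SmoothSlab T F)
    (hG : SmoothSlab T G) (ht : t ∈ Ioc 0 T) (hT : T ≤ 1) (hδ : 0 < δ) (hK : 0 ≤ K)
    (hE : ContinuousOn E (Icc t T)) (hE' : ∀ s ∈ Ioo t T, HasDerivAt E (E' s) s)
    (E0 : ∀ s ∈ Icc t T, 0 ≤ E s) (hF0 : ∀ s ∈ Icc t T, ∀ x, 0 ≤ F s x)
    (hG0 : ∀ s ∈ Icc t T, ∀ x, 0 ≤ G s x)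
    (hineq : ∀ s ∈ Ioo t T, wInt β s (F s) - K * s ^ δ * E s - wInt β s (G s) ≤ s * E' s) :
    E t + timeInt β t T F ≤ Real.exp (K / δ) * (E T + timeInt β t T G) :=
  le_of_fuchsian_ineq ht.1 ht.2 hT hδ hK hE hE' (continuousOn_wInt hβ hF ht.1)
    (continuousOn_wInt hβ hG ht.1) E0
    (fun s hs => wInt_nonneg (ht.1.trans_le hs.1) (hF0 s hs))
    (fun s hs => wInt_nonneg (ht.1.trans_le hs.1) (hG0 s hs)) hineq

end timeInt

/-! ### Space-time estimates for `u`, `ν`, `∂φ` and for `φ` -/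

namespace Coeffs

variable {𝒞 : Coeffs n}

/-- The weighted space-time estimate for `(u, ν)` and the weighted gradient of `φ`. -/
theorem Admissible.exists_timeInt_totSq_le (h : 𝒞.Admissible T δ κ₀) (hsm : 𝒞.Small T)
    {β : (Fin n → ℝ) → ℝ} (hβ : SmoothTorus β) (hβ0 : ∀ x, 0 < β x) (l : ℕ) :
    ∃ C > 0, ∀ {σ : ℝ} {F₁ F₂ F₃ u ν φ : ℝ → (Fin n → ℝ) → ℝ}, 0 ≤ σ → σ ≤ 1 →
      𝒞.Solves T σ F₁ F₂ F₃ u ν φ → ∀ t ∈ Ioc 0 T,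
      timeInt β t T (fun t => 𝒞.totSq σ l (u t) (ν t) (φ t) t)
        ≤ C * (∑ j ∈ Finset.range l, 𝒞.levelEnergy σ β j u φ T
          + timeInt β t T (fun t => srcSq l (F₁ t) (F₂ t) (F₃ t))) := by
  induction l with
  | zero =>
    refine ⟨1, one_pos, fun {σ F₁ F₂ F₃ u ν φ} hσ hσ1 hs t ht => ?_⟩
    have e : timeInt β t T (fun t => 𝒞.totSq σ 0 (u t) (ν t) (φ t) t) = 0 := by
      simp [timeInt, wInt, totSq_zero, torusInt]
    rw [e, Finset.sum_range_zero, zero_add, one_mul]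
    exact timeInt_nonneg ht fun s _ x => srcSq_nonneg _ _ _ _ _
  | succ l ih =>
    obtain ⟨D, hD, ih⟩ := ih
    obtain ⟨c, hc, C, hC, hineq⟩ := h.exists_levelEnergy_ineq hsm hβ hβ0 l
    refine ⟨c⁻¹ * (Real.exp (C / δ) * (1 + C * D + C)), by positivity, ?_⟩
    intro σ F₁ F₂ F₃ u ν φ hσ hσ1 hs t ht
    have s2 := fun m => (h.smooth_totSq σ hs.smooth_u hs.smooth_ν hs.smooth_φ m)
    have s5 := fun m => (smooth_srcSq hs.smooth_F₁ hs.smooth_F₂ hs.smooth_F₃ m)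
    have tT : T ∈ Ioc 0 T := ⟨h.T_pos, le_rfl⟩
    have sub : ∀ s ∈ Icc t T, s ∈ Ioc 0 T := fun s hs => ⟨ht.1.trans_le hs.1, hs.2⟩
    -- The order-`l` inequality is integrated with the total square of lower order treated as a
    -- source; the induction hypothesis bounds that source.
    have key := timeInt_le_of_ineq (t := t) (K := C) (δ := δ)
      (E := 𝒞.levelEnergy σ β l u φ) hβ ((SmoothSlab.const c).mul (s2 (l + 1)))
      ((SmoothSlab.const C).mul ((s2 l).add (s5 (l + 1)))) ht h.T_le h.δ_pos hC.le
      (h.continuousOn_levelEnergy hsm σ hβ hs.smooth_u hs.smooth_φ l ht.1)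
      (fun s hs' => h.levelEnergy_hasDerivAt hsm σ hβ hs.smooth_u hs.smooth_ν hs.smooth_φ l
        ⟨ht.1.trans hs'.1, hs'.2⟩)
      (fun s hs' => h.levelEnergy_nonneg hsm hσ hσ1 hβ hs.smooth_u hs.smooth_φ l (sub s hs'))
      (fun s _ x => mul_nonneg hc.le (totSq_nonneg hσ _ _ _ _ _ _))
      (fun s _ x => mul_nonneg hC.le (add_nonneg (totSq_nonneg hσ _ _ _ _ _ _)
        (srcSq_nonneg _ _ _ _ _)))
      (fun s hs' => by
        have s0 := ht.1.trans hs'.1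
        rw [mul_inv_cancel_left₀ s0.ne', wInt_const_mul, wInt_const_mul,
          wInt_add hβ s0 ((s2 l).torus ⟨s0, hs'.2.le⟩) ((s5 (l + 1)).torus ⟨s0, hs'.2.le⟩)]
        exact hineq hσ hσ1 hs s ⟨s0, hs'.2⟩)
    rw [timeInt_const_mul, timeInt_const_mul, timeInt_add hβ (s2 l) (s5 (l + 1)) ht] at key
    have e0 := h.levelEnergy_nonneg hsm hσ hσ1 hβ hs.smooth_u hs.smooth_φ l ht
    have e1 := h.levelEnergy_nonneg hsm hσ hσ1 hβ hs.smooth_u hs.smooth_φ l tT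
    have e2 : 0 ≤ ∑ j ∈ Finset.range l, 𝒞.levelEnergy σ β j u φ T :=
      Finset.sum_nonneg fun j _ => h.levelEnergy_nonneg hsm hσ hσ1 hβ hs.smooth_u hs.smooth_φ j tT
    have e3 := ih hσ hσ1 hs t ht
    have e4 : timeInt β t T (fun t => srcSq l (F₁ t) (F₂ t) (F₃ t))
        ≤ timeInt β t T (fun t => srcSq (l + 1) (F₁ t) (F₂ t) (F₃ t)) :=
      timeInt_mono hβ (s5 l) (s5 (l + 1)) ht fun s _ x => srcSq_mono (Nat.le_succ l) _ _ _ _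
    have e5 : 0 ≤ timeInt β t T (fun t => srcSq l (F₁ t) (F₂ t) (F₃ t)) :=
      timeInt_nonneg ht fun s _ x => srcSq_nonneg _ _ _ _ _
    rw [Finset.sum_range_succ]
    rw [mul_assoc, inv_mul_eq_div, le_div_iff₀ hc]
    generalize timeInt β t T (fun t => srcSq l (F₁ t) (F₂ t) (F₃ t)) = S at *
    generalize timeInt β t T (fun t => srcSq (l + 1) (F₁ t) (F₂ t) (F₃ t)) = S' at *
    generalize timeInt β t T (fun t => 𝒞.totSq σ l (u t) (ν t) (φ t) t) = X at *
    generalize timeInt β t T (fun t => 𝒞.totSq σ (l + 1) (u t) (ν t) (φ t) t) = X' at *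
    generalize ∑ j ∈ Finset.range l, 𝒞.levelEnergy σ β j u φ T = S₀ at *
    generalize 𝒞.levelEnergy σ β l u φ T = E at *
    have k1 : E + C * (X + S') ≤ (1 + C * D + C) * (S₀ + E + S') := by
      have k2 : C * X ≤ C * (D * (S₀ + S')) := by
        gcongr
        exact e3.trans (by gcongr)
      have k3 : 0 ≤ (1 + C) * S₀ := by positivity
      have k4 : 0 ≤ (C * D + C) * E := by positivity
      have k5 : 0 ≤ S' := e5.trans e4
      linarith only [k2, k3, k4, k5]
    calc X' * c ≤ Real.exp (C / δ) * (E + C * (X + S')) := by linarith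
      _ ≤ Real.exp (C / δ) * ((1 + C * D + C) * (S₀ + E + S')) := by gcongr
      _ = _ := by ring

end Coeffs

theorem SmoothSlab.jetSq_hasDerivAt {f : ℝ → (Fin n → ℝ) → ℝ} (hf : SmoothSlab T f) (m : ℕ)
    {t : ℝ} (ht : t ∈ Ioo 0 T) (x : Fin n → ℝ) :
    HasDerivAt (fun s => LapseScalar.jetSq m (f s) x) (cumSum m fun L =>
      2 * LapseScalar.listDeriv L (f t) x
        * LapseScalar.listDeriv L (LapseScalar.timeDeriv T f t) x) t := by
  unfold LapseScalar.jetSq cumSum LapseScalar.levelSum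
  refine HasDerivAt.fun_sum fun l _ => HasDerivAt.fun_sum fun a _ => ?_
  have d := (hf.hasDerivAt_listDeriv ht (List.ofFn a) x).fun_pow 2
  refine d.congr_deriv ?_
  norm_num

namespace Coeffs

variable {𝒞 : Coeffs n}

/-- The weighted space-time estimate for `φ`. -/
theorem Admissible.exists_timeInt_φ_le (h : 𝒞.Admissible T δ κ₀)
    {β : (Fin n → ℝ) → ℝ} (hβ : SmoothTorus β) (hβ0 : ∀ x, 0 < β x) (l : ℕ) :
    ∃ C > 0, ∀ {σ : ℝ} {F₁ F₂ F₃ u ν φ : ℝ → (Fin n → ℝ) → ℝ}, 0 ≤ σ → σ ≤ 1 →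
      𝒞.Solves T σ F₁ F₂ F₃ u ν φ → ∀ t ∈ Ioc 0 T,
      timeInt β t T (fun t => jetSq l (φ t))
        ≤ C * (wInt β T (jetSq l (φ T)) + timeInt β t T (fun t x => jetSq l (F₃ t) x
          + 𝒞.totSq σ l (u t) (ν t) (φ t) t x)) := by
  obtain ⟨b₀, hb₀, hb⟩ := hβ.exists_pos_le hβ0
  obtain ⟨C, hC, hφ⟩ := h.exists_listDeriv_eq_φ l
  obtain ⟨j, hj, hj'⟩ := exists_jetAbs_sq_le n l
  obtain ⟨N, hN⟩ : ∃ N, N = ∑ i ∈ Finset.range l, (n : ℝ) ^ i := ⟨_, rfl⟩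
  have hN0 : 0 ≤ N := by rw [hN]; positivity
  obtain ⟨D, hD⟩ : ∃ D, D = 1 / b₀ * (2 + 4 * C ^ 2 * N * j) := ⟨_, rfl⟩
  have hD0 : 0 < D := by rw [hD]; positivity
  refine ⟨b₀⁻¹ * (1 + D), by positivity, ?_⟩
  intro σ F₁ F₂ F₃ u ν φ hσ hσ1 hs t ht
  have sub : ∀ s ∈ Icc t T, s ∈ Ioc 0 T := fun s hs => ⟨ht.1.trans_le hs.1, hs.2⟩
  have s1 := hs.smooth_φ.jetSq l
  have s2 : SmoothSlab T (fun t x => jetSq l (F₃ t) x + 𝒞.totSq σ l (u t) (ν t) (φ t) t x) :=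
    (hs.smooth_F₃.jetSq l).add (h.smooth_totSq σ hs.smooth_u hs.smooth_ν hs.smooth_φ l)
  have s3 : SmoothSlab T (fun t x => t ^ (2 * β x) * jetSq l (φ t) x) :=
    (SmoothSlab.rpow ((SmoothTorus.const 2).mul hβ)).mul s1
  have key := timeInt_le_of_ineq (t := t) (K := 0) (δ := 1)
      (E := fun t => wInt β t (jetSq l (φ t)))
      (E' := fun t => torusInt (timeDeriv T (fun t x => t ^ (2 * β x) * jetSq l (φ t) x) t))
      hβ ((SmoothSlab.const b₀).mul s1) ((SmoothSlab.const D).mul s2)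
      ht h.T_le one_pos le_rfl (continuousOn_wInt hβ s1 ht.1)
      (fun s hs' => s3.hasDerivAt_torusInt ⟨ht.1.trans hs'.1, hs'.2⟩)
      (fun s hs' => wInt_nonneg (sub s hs').1 (jetSq_nonneg _ _))
      (fun s _ x => mul_nonneg hb₀.le (jetSq_nonneg _ _ _))
      (fun s _ x => mul_nonneg hD0.le (add_nonneg (jetSq_nonneg _ _ _)
        (totSq_nonneg hσ _ _ _ _ _ _)))
      (fun s hs' => by
        have s0 := ht.1.trans hs'.1
        have hs0 : s ∈ Ioo 0 T := ⟨s0, hs'.2⟩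
        have hs1 : s ∈ Ioc 0 T := ⟨s0, hs'.2.le⟩
        have k1 := (SmoothTorus.const b₀).mul (s1.torus hs1)
        have k2 := (SmoothTorus.const D).mul (s2.torus hs1)
        rw [zero_mul, zero_mul, sub_zero, ← wInt_sub hβ s0 k1 k2, wInt, ← torusInt_const_mul]
        refine torusInt_mono ((smooth_weight hβ s0).mul (k1.sub k2))
          ((SmoothTorus.const s).mul (s3.timeDeriv.torus hs1)) fun x => ?_
        have d1 : HasDerivAt (fun s : ℝ => s ^ (2 * β x)) (2 * β x * s ^ (2 * β x) * s⁻¹) s := by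
          have := Real.hasDerivAt_rpow_const (x := s) (p := 2 * β x) (Or.inl s0.ne')
          rwa [Real.rpow_sub_one s0.ne', div_eq_mul_inv, ← mul_assoc] at this
        rw [(s3.hasDerivAt hs0 x).unique (d1.mul (hs.smooth_φ.jetSq_hasDerivAt l hs0 x))]
        have e1 : s * (2 * β x * s ^ (2 * β x) * s⁻¹ * jetSq l (φ s) x + s ^ (2 * β x)
            * cumSum l fun L => 2 * listDeriv L (φ s) x * listDeriv L (timeDeriv T φ s) x)
            = s ^ (2 * β x) * (2 * β x * jetSq l (φ s) x + cumSum l fun L =>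
              2 * listDeriv L (φ s) x * (s * listDeriv L (timeDeriv T φ s) x)) := by
          have e2 : cumSum l (fun L =>
              2 * listDeriv L (φ s) x * (s * listDeriv L (timeDeriv T φ s) x))
              = s * cumSum l fun L => 2 * listDeriv L (φ s) x * listDeriv L (timeDeriv T φ s) x := by
            rw [← cumSum_const_mul]
            congr 1
            funext L
            ring
          rw [e2]
          field_simp
        rw [e1]
        refine mul_le_mul_of_nonneg_left ?_ (Real.rpow_nonneg s0.le _)
        have ju := jetSq_nonneg l (u s) x
        have jν := jetSq_nonneg l (ν s) x
        have gφ := mul_nonneg hσ (gradSq_nonneg (𝒞 := 𝒞) s l (φ s) x)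
        have gν := mul_nonneg hσ (gradSq_nonneg (𝒞 := 𝒞) s l (ν s) x)
        have hcum : cumSum l (fun L => -b₀ * listDeriv L (φ s) x ^ 2
            + (-(1 / b₀ * 2) * listDeriv L (F₃ s) x ^ 2
              + -(1 / b₀ * (4 * C ^ 2 * j) * (jetSq l (u s) x + jetSq l (ν s) x))))
            ≤ cumSum l fun L =>
              2 * listDeriv L (φ s) x * (s * listDeriv L (timeDeriv T φ s) x) := by
          refine cumSum_mono fun L hL => ?_
          have b1 := hφ hσ hσ1 hs s hs1 x L hL.le
          have mu := jetAbs_mono (by omega : L.length + 1 ≤ l) (u s) x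
          have mν := jetAbs_mono (by omega : L.length + 1 ≤ l) (ν s) x
          have gu := jetAbs_nonneg l (u s) x
          have gν := jetAbs_nonneg l (ν s) x
          have b2 : |s * listDeriv L (timeDeriv T φ s) x|
              ≤ |listDeriv L (F₃ s) x| + C * (jetAbs l (u s) x + jetAbs l (ν s) x) :=
            b1.trans (by gcongr)
          have b3 : (s * listDeriv L (timeDeriv T φ s) x) ^ 2 ≤ 2 * listDeriv L (F₃ s) x ^ 2
              + 4 * C ^ 2 * j * (jetSq l (u s) x + jetSq l (ν s) x) := by
            have c1 := sq_le_sq' (by linarith [abs_nonneg (s * listDeriv L (timeDeriv T φ s) x)]) b2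
            rw [sq_abs] at c1
            have c2 := mul_le_mul_of_nonneg_left (add_le_add (hj' (u s) x) (hj' (ν s) x))
              (sq_nonneg C)
            have c3 := sq_nonneg (|listDeriv L (F₃ s) x|
              - C * (jetAbs l (u s) x + jetAbs l (ν s) x))
            have c4 := mul_nonneg (sq_nonneg C) (sq_nonneg (jetAbs l (u s) x - jetAbs l (ν s) x))
            have c5 := sq_abs (listDeriv L (F₃ s) x)
            linarith only [c1, c2, c3, c4, c5]
          -- The sign is put into `y` so that Young's inequality bounds the product from below.
          have b4 := young (x := listDeriv L (φ s) x)
            (y := -(2 * (s * listDeriv L (timeDeriv T φ s) x))) hb₀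
          have b5 := mul_le_mul_of_nonneg_left b3 (by positivity : 0 ≤ 1 / b₀)
          have e : 1 / (4 * b₀) * (-(2 * (s * listDeriv L (timeDeriv T φ s) x))) ^ 2
              = 1 / b₀ * (s * listDeriv L (timeDeriv T φ s) x) ^ 2 := by field_simp; ring
          rw [e] at b4
          linarith only [b4, b5]
        rw [cumSum_add, cumSum_add, cumSum_const_mul, cumSum_const_mul] at hcum
        have e4 : cumSum l (fun _ : List (Fin n) => -(1 / b₀ * (4 * C ^ 2 * j)
            * (jetSq l (u s) x + jetSq l (ν s) x)))
            = -(1 / b₀ * (4 * C ^ 2 * j) * (jetSq l (u s) x + jetSq l (ν s) x)) * N := by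
          rw [hN, cumSum, Finset.mul_sum]
          exact Finset.sum_congr rfl fun i _ => by rw [levelSum_const]; ring
        rw [e4] at hcum
        have e5 : cumSum l (fun L => listDeriv L (φ s) x ^ 2) = jetSq l (φ s) x := rfl
        have e6 : cumSum l (fun L => listDeriv L (F₃ s) x ^ 2) = jetSq l (F₃ s) x := rfl
        rw [e5, e6] at hcum
        have f0 := jetSq_nonneg l (F₃ s) x
        have f1 := jetSq_nonneg l (φ s) x
        have f2 := mul_le_mul_of_nonneg_right (hb x) f1
        have f3 : 0 ≤ 1 / b₀ * (4 * C ^ 2 * N * j) * jetSq l (F₃ s) x := by positivity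
        have f4 : 0 ≤ 1 / b₀ * 2 * (jetSq l (u s) x + jetSq l (ν s) x) := by positivity
        have f5 : 0 ≤ D * (σ * 𝒞.gradSq l (ν s) s x + σ * 𝒞.gradSq l (φ s) s x) := by positivity
        rw [hD] at f5 ⊢
        rw [totSq]
        linarith only [hcum, f2, f3, f4, f5])
  rw [timeInt_const_mul, timeInt_const_mul, zero_div, Real.exp_zero, one_mul] at key
  have z1 := wInt_nonneg (β := β) ht.1 (jetSq_nonneg l (φ t))
  have z2 := wInt_nonneg (β := β) h.T_pos (jetSq_nonneg l (φ T))
  have z3 : 0 ≤ timeInt β t T (fun t x => jetSq l (F₃ t) x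
      + 𝒞.totSq σ l (u t) (ν t) (φ t) t x) := timeInt_nonneg ht fun s _ x =>
    add_nonneg (jetSq_nonneg _ _ _) (totSq_nonneg hσ _ _ _ _ _ _)
  rw [mul_assoc, inv_mul_eq_div, le_div_iff₀ hb₀]
  have z4 := mul_nonneg hD0.le z2
  linarith

end Coeffs

end LapseScalar

namespace LapseScalar

variable {n : ℕ} {T δ κ₀ σ : ℝ}

/-! ### Decay of `u` -/

/-- Here no structure is exploited: two derivatives of `f` are given up in exchange for the full
power `t^s` of the coefficients. This is affordable because `ν` and `φ` have already been bounded at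
higher order. -/
theorem exists_listDeriv_operator_le {s : (Fin n → ℝ) → ℝ}
    {P : Fin n → Fin n → ℝ → (Fin n → ℝ) → ℝ} {G : Fin n → ℝ → (Fin n → ℝ) → ℝ}
    (hP : ∀ a b, IsDom T s (P a b)) (hG : ∀ b, IsDom T s (G b)) (m : ℕ) :
    ∃ C > 0, ∀ t ∈ Ioc 0 T, ∀ x, ∀ L : List (Fin n), L.length ≤ m → ∀ f, SmoothTorus f →
      |listDeriv L (fun y => ∑ a, ∑ b, P a b t y * pderiv b (pderiv a f) y
          + ∑ b, G b t y * pderiv b f y) x| ≤ C * t ^ s x * jetAbs (L.length + 3) f x := by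
  choose C hC hb using fun a b => (hP a b).listDeriv_mul_le m
  choose D hD hd using fun b => (hG b).listDeriv_mul_le m
  refine ⟨∑ a, ∑ b, C a b + ∑ b, D b + 1, by
    have h1 : 0 ≤ ∑ a, ∑ b, C a b :=
      Finset.sum_nonneg fun a _ => Finset.sum_nonneg fun b _ => (hC a b).le
    have h2 : 0 ≤ ∑ b, D b := Finset.sum_nonneg fun b _ => (hD b).le
    positivity, fun t ht x L hL f hf => ?_⟩
  have s1 : ∀ a b, SmoothTorus (fun y => P a b t y * pderiv b (pderiv a f) y) := fun a b =>
    ((hP a b).1.torus ht).mul ((hf.pderiv a).pderiv b)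
  have s2 : ∀ b, SmoothTorus (fun y => G b t y * pderiv b f y) := fun b =>
    ((hG b).1.torus ht).mul (hf.pderiv b)
  rw [listDeriv_add (.sum fun a _ => .sum fun b _ => s1 a b) (.sum fun b _ => s2 b),
    listDeriv_sum fun a _ => .sum fun b _ => s1 a b, listDeriv_sum fun b _ => s2 b]
  have e : ∀ a, listDeriv L (fun y => ∑ b, P a b t y * pderiv b (pderiv a f) y) x
      = ∑ b, listDeriv L (fun y => P a b t y * pderiv b (pderiv a f) y) x := fun a => by
    rw [listDeriv_sum fun b _ => s1 a b]
  simp only [e]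
  have p0 := Real.rpow_nonneg ht.1.le (s x)
  have j0 := jetAbs_nonneg (L.length + 3) f x
  have h1 : |∑ a, ∑ b, listDeriv L (fun y => P a b t y * pderiv b (pderiv a f) y) x|
      ≤ ∑ a, ∑ b, C a b * (t ^ s x * jetAbs (L.length + 3) f x) := by
    refine (Finset.abs_sum_le_sum_abs _ _).trans (Finset.sum_le_sum fun a _ =>
      (Finset.abs_sum_le_sum_abs _ _).trans (Finset.sum_le_sum fun b _ =>
        (hb a b t ht x L hL _ ((hf.pderiv a).pderiv b)).trans ?_))
    have h2 := (jetAbs_pderiv_le (L.length + 1) (pderiv a f) b x).trans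
      (jetAbs_pderiv_le (L.length + 2) f a x)
    have h3 := (hC a b).le
    rw [mul_assoc]
    gcongr
  have h2 : |∑ b, listDeriv L (fun y => G b t y * pderiv b f y) x|
      ≤ ∑ b, D b * (t ^ s x * jetAbs (L.length + 3) f x) := by
    refine (Finset.abs_sum_le_sum_abs _ _).trans (Finset.sum_le_sum fun b _ =>
        (hd b t ht x L hL _ (hf.pderiv b)).trans ?_)
    have h2 := (jetAbs_pderiv_le (L.length + 1) f b x).trans
      (jetAbs_mono (by omega : L.length + 2 ≤ L.length + 3) f x)
    have h3 := (hD b).le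
    rw [mul_assoc]
    gcongr
  simp only [← Finset.sum_mul] at h1 h2
  have h3 := mul_nonneg p0 j0
  refine (abs_add_le _ _).trans ?_
  linarith

theorem levelSum_abs_le {l : ℕ} {F : List (Fin n) → ℝ} {r : ℝ}
    (h : ∀ L, L.length = l → F L ≤ r) : levelSum l F ≤ (n : ℝ) ^ l * r :=
  (levelSum_mono h).trans (le_of_eq (levelSum_const l r))

theorem jetAbs_succ (m : ℕ) (f : (Fin n → ℝ) → ℝ) (x : Fin n → ℝ) :
    jetAbs (m + 1) f x = jetAbs m f x + levelSum m fun L => |listDeriv L f x| := cumSum_succ _ _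

namespace Coeffs

variable {𝒞 : Coeffs n}

/-- The lapse equation read as an algebraic equation for `ν`, with the second-order operator
regarded as a source of size `t^s`. At top order `c₃ ν` is absorbed because `|c₃| ≤ 1/8`; its
commutator contains only lower derivatives of `ν`, which the induction handles. The point is to
replace `ν`, which is not known to decay, by `u`, `F₂` and terms with the gain `t^s`. -/
theorem Admissible.exists_jetAbs_ν_le (h : 𝒞.Admissible T δ κ₀) (hsm : 𝒞.Small T)
    {s : (Fin n → ℝ) → ℝ} {ε : ℝ} (hε : 0 < ε) (hs : ∀ x b, s x ≤ 2 - 2 * 𝒞.q b x - ε) (l : ℕ) :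
    ∃ C > 0, ∀ {σ : ℝ} {F₁ F₂ F₃ u ν φ : ℝ → (Fin n → ℝ) → ℝ}, 0 ≤ σ → σ ≤ 1 →
      𝒞.Solves T σ F₁ F₂ F₃ u ν φ → ∀ t ∈ Ioc 0 T, ∀ x,
      jetAbs l (ν t) x ≤ C * (jetAbs l (u t) x + jetAbs l (F₂ t) x
        + t ^ s x * jetAbs (l + 2) (ν t) x) := by
  induction l with
  | zero =>
    refine ⟨1, one_pos, fun {σ F₁ F₂ F₃ u ν φ} hσ hσ1 hsol t ht x => ?_⟩
    have e : jetAbs 0 (ν t) x = 0 := by simp [jetAbs, cumSum]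
    have h1 := jetAbs_nonneg 0 (u t) x
    have h2 := jetAbs_nonneg 0 (F₂ t) x
    have h3 := jetAbs_nonneg (0 + 2) (ν t) x
    have h4 := Real.rpow_nonneg ht.1.le (s x)
    rw [e]; positivity
  | succ l ih =>
    obtain ⟨D, hD, ih⟩ := ih
    have dP : ∀ a b, IsDom T s (𝒞.P a b) := fun a b =>
      (h.P_dom a b ε hε).mono h.T_le fun x => hs x b
    have dG : ∀ b, IsDom T s (𝒞.G b) := fun b => (h.G_dom b ε hε).mono h.T_le fun x => hs x b
    obtain ⟨C1, hC1, h1⟩ := (IsDom.torus (T := T)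
      ((SmoothTorus.const 2).mul h.smooth_A)).listDeriv_mul_le l
    obtain ⟨C2, hC2, h2⟩ := h.c₃_dom.listDeriv_mul_sub_le l
    obtain ⟨C3, hC3, h3⟩ := h.c₄_dom.listDeriv_mul_le l
    obtain ⟨C4, hC4, h4⟩ := exists_listDeriv_operator_le dP dG l
    obtain ⟨R, hR⟩ : ∃ R, R = 2 * (C1 + 1 + C2 * D + C3 + C4) := ⟨_, rfl⟩
    refine ⟨D + (n : ℝ) ^ l * R, by rw [hR]; positivity, ?_⟩
    intro σ F₁ F₂ F₃ u ν φ hσ hσ1 hsol t ht x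
    have su := hsol.smooth_u.torus ht
    have sν := hsol.smooth_ν.torus ht
    have sF := hsol.smooth_F₂.torus ht
    have s1 : SmoothTorus (fun y => 2 * 𝒞.A y * u t y) :=
      ((SmoothTorus.const 2).mul h.smooth_A).mul su
    have s2 : SmoothTorus (fun y => 𝒞.c₃ t y * ν t y) := (h.c₃_dom.1.torus ht).mul sν
    have s3 : SmoothTorus (fun y => 𝒞.c₄ t y * u t y) := (h.c₄_dom.1.torus ht).mul su
    have s4 : SmoothTorus (fun y => ∑ a, ∑ b, 𝒞.P a b t y * pderiv b (pderiv a (ν t)) y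
        + ∑ b, 𝒞.G b t y * pderiv b (ν t) y) :=
      (SmoothTorus.sum fun a _ => .sum fun b _ =>
        ((dP a b).1.torus ht).mul ((sν.pderiv a).pderiv b)).add
        (.sum fun b _ => ((dG b).1.torus ht).mul (sν.pderiv b))
    have pδ := Real.rpow_nonneg ht.1.le δ
    have δ1 := h.rpow_le_one ht
    have ps := Real.rpow_nonneg ht.1.le (s x)
    have gu := jetAbs_nonneg (l + 1) (u t) x
    have gν := jetAbs_nonneg l (ν t) x
    have gν2 := jetAbs_nonneg (l + 3) (ν t) x
    have gF := jetAbs_nonneg (l + 1) (F₂ t) x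
    have hL : ∀ L : List (Fin n), L.length = l → |listDeriv L (ν t) x|
        ≤ R * (jetAbs (l + 1) (u t) x + jetAbs (l + 1) (F₂ t) x
          + t ^ s x * jetAbs (l + 3) (ν t) x) := by
      intro L hL
      have e : (fun y => ν t y) = fun y => (-(2 * 𝒞.A y * u t y) - F₂ t y)
          + σ * ((𝒞.c₃ t y * ν t y + 𝒞.c₄ t y * u t y)
            + (∑ a, ∑ b, 𝒞.P a b t y * pderiv b (pderiv a (ν t)) y
              + ∑ b, 𝒞.G b t y * pderiv b (ν t) y)) := funext fun y =>
        (hsol.eq_ν t ht y).trans (by ring)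
      have e' := congrFun (congrArg (listDeriv L) e) x
      rw [listDeriv_add (s1.neg.sub sF) ((SmoothTorus.const σ).mul ((s2.add s3).add s4)),
        listDeriv_sub s1.neg sF, listDeriv_neg s1, listDeriv_const_mul σ ((s2.add s3).add s4),
        listDeriv_add (s2.add s3) s4, listDeriv_add s2 s3] at e'
      change listDeriv L (ν t) x = _ at e'
      have b1 := h1 t ht x L hL.le _ su
      have b2 := h2 t ht x L hL.le _ sν
      have b3 := h3 t ht x L hL.le _ su
      have b4 := h4 t ht x L hL.le _ sν
      have b5 := hsm.c₃_le t ht x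
      have b6 := abs_listDeriv_le_jetAbs (m := l + 1) (F₂ t) x (L := L) (by omega)
      have b7 := ih hσ hσ1 hsol t ht x
      rw [hL] at b1 b2 b3 b4
      rw [Real.rpow_zero, mul_one] at b1
      have b8 := jetAbs_mono (Nat.le_succ l) (u t) x
      have b9 := jetAbs_mono (Nat.le_succ l) (F₂ t) x
      have b10 := jetAbs_mono (Nat.le_succ (l + 2)) (ν t) x
      dsimp only at e'
      simp only [Nat.succ_eq_add_one] at b8 b9 b10
      change jetAbs (l + 2) (ν t) x ≤ jetAbs (l + 3) (ν t) x at b10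
      generalize listDeriv L (fun y => 2 * 𝒞.A y * u t y) x = v1 at *
      generalize listDeriv L (fun y => 𝒞.c₃ t y * ν t y) x = v2 at *
      generalize listDeriv L (fun y => 𝒞.c₄ t y * u t y) x = v3 at *
      generalize listDeriv L (fun y => ∑ a, ∑ b, 𝒞.P a b t y * pderiv b (pderiv a (ν t)) y
        + ∑ b, 𝒞.G b t y * pderiv b (ν t) y) x = v4 at *
      generalize listDeriv L (F₂ t) x = f at *
      generalize listDeriv L (ν t) x = νL at *
      generalize jetAbs (l + 1) (u t) x = J1 at *
      generalize jetAbs (l + 1) (F₂ t) x = J2 at *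
      generalize jetAbs (l + 3) (ν t) x = J3 at *
      generalize jetAbs l (ν t) x = J4 at *
      generalize jetAbs l (u t) x = J5 at *
      generalize jetAbs l (F₂ t) x = J6 at *
      generalize jetAbs (l + 2) (ν t) x = J7 at *
      generalize t ^ δ = τ at *
      generalize t ^ s x = θ at *
      generalize 𝒞.c₃ t x = c3 at *
      -- Moving `|νL| / 8` to the left leaves `7/8`, more than the `1/2` that corresponds to the
      -- factor `2` in `R`.
      have c1 : |νL| ≤ |v1| + |f| + (|v2 - c3 * νL| + 1 / 8 * |νL| + |v3| + |v4|) := by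
        have e5 : νL = -v1 + -f + σ * ((v2 - c3 * νL) + c3 * νL + v3 + v4) := by
          rw [e']; ring
        calc |νL| = |-v1 + -f + σ * ((v2 - c3 * νL) + c3 * νL + v3 + v4)| := by rw [← e5]
          _ ≤ |v1| + |f| + 1 * (|v2 - c3 * νL| + |c3 * νL| + |v3| + |v4|) := by
              refine (abs_add_le _ _).trans (add_le_add ((abs_add_le _ _).trans ?_) ?_)
              · rw [abs_neg, abs_neg]
              · rw [abs_mul, abs_of_nonneg hσ]
                exact mul_le_mul hσ1 ((abs_add_le _ _).trans (add_le_add ((abs_add_le _ _).trans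
                  (add_le_add (abs_add_le _ _) le_rfl)) le_rfl)) (abs_nonneg _) zero_le_one
          _ ≤ _ := by
              rw [one_mul, abs_mul]; gcongr
      have c2 : |v2 - c3 * νL| ≤ C2 * D * (J1 + J2 + θ * J3) := by
        calc _ ≤ C2 * τ * J4 := b2
          _ ≤ C2 * 1 * (D * (J1 + J2 + θ * J3)) := by
              gcongr
              exact b7.trans (by gcongr)
          _ = _ := by ring
      have c3' : |v3| ≤ C3 * J1 := by
        calc _ ≤ C3 * τ * J1 := b3
          _ ≤ C3 * 1 * J1 := by gcongr
          _ = _ := by ring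
      have q1 : 0 ≤ (1 + C4) * J1 := by positivity
      have q2 : 0 ≤ (C1 + C3 + C4) * J2 := by positivity
      have q3 : 0 ≤ (C1 + 1 + C3) * (θ * J3) := by positivity
      have q4 := abs_nonneg νL
      rw [hR]
      have q5 : 0 ≤ C2 * D * (J1 + J2 + θ * J3) := by positivity
      have q6 : 0 ≤ C1 * J1 := by positivity
      have q7 : 0 ≤ C3 * J1 := by positivity
      have q8 : 0 ≤ C4 * (θ * J3) := by positivity
      linarith only [c1, c2, c3', b1, b4, b6, q1, q2, q3, q4, q5, q6, q7, q8, gF]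
    rw [jetAbs_succ]
    have k1 := levelSum_abs_le hL
    have k2 := ih hσ hσ1 hsol t ht x
    have k3 : D * (jetAbs l (u t) x + jetAbs l (F₂ t) x + t ^ s x * jetAbs (l + 2) (ν t) x)
        ≤ D * (jetAbs (l + 1) (u t) x + jetAbs (l + 1) (F₂ t) x
          + t ^ s x * jetAbs (l + 3) (ν t) x) := by
      have b8 := jetAbs_mono (Nat.le_succ l) (u t) x
      have b9 := jetAbs_mono (Nat.le_succ l) (F₂ t) x
      have b10 := jetAbs_mono (Nat.le_succ (l + 2)) (ν t) x
      gcongr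
    change _ ≤ (D + (n : ℝ) ^ l * R) * (jetAbs (l + 1) (u t) x + jetAbs (l + 1) (F₂ t) x
          + t ^ s x * jetAbs (l + 3) (ν t) x)
    rw [add_mul, mul_assoc]
    exact add_le_add (k2.trans k3) k1

/-- Eliminating `ν` through `-A ν = 2 A² u + A F₂ - …` reveals the ordinary differential equation `t
∂_t u = 2 A² u` that governs `u` near `t = 0`. The remaining occurrence of `ν` without derivatives
has a coefficient of size `t^δ` and is removed by the algebraic bound for `ν`. -/
theorem Admissible.exists_listDeriv_eq_u' (h : 𝒞.Admissible T δ κ₀) (hsm : 𝒞.Small T)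
    {s : (Fin n → ℝ) → ℝ} {ε : ℝ} (hε : 0 < ε) (hs : ∀ x b, s x ≤ 2 - 2 * 𝒞.q b x - ε) (l : ℕ) :
    ∃ C > 0, ∀ {σ : ℝ} {F₁ F₂ F₃ u ν φ : ℝ → (Fin n → ℝ) → ℝ}, 0 ≤ σ → σ ≤ 1 →
      𝒞.Solves T σ F₁ F₂ F₃ u ν φ → ∀ t ∈ Ioc 0 T, ∀ x, ∀ L : List (Fin n), L.length = l →
      |t * listDeriv L (timeDeriv T u t) x - 2 * 𝒞.A x ^ 2 * listDeriv L (u t) x|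
        ≤ C * (jetAbs l (u t) x + t ^ δ * jetAbs (l + 1) (u t) x + jetAbs (l + 1) (F₁ t) x
          + jetAbs (l + 1) (F₂ t) x
          + t ^ s x * (jetAbs (l + 3) (ν t) x + jetAbs (l + 3) (φ t) x)) := by
  have dP : ∀ a b, IsDom T s (𝒞.P a b) := fun a b =>
    (h.P_dom a b ε hε).mono h.T_le fun x => hs x b
  have dG : ∀ b, IsDom T s (𝒞.G b) := fun b => (h.G_dom b ε hε).mono h.T_le fun x => hs x b
  have dB : ∀ b, IsDom T s (𝒞.B b) := fun b => (h.B_dom b ε hε).mono h.T_le fun x => hs x b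
  have dH : ∀ b, IsDom T s (𝒞.H b) := fun b => (h.H_dom b ε hε).mono h.T_le fun x => hs x b
  have dαP : ∀ a b, IsDom T s (fun t x => 𝒞.α t x * 𝒞.P a b t x) := fun a b =>
    (h.αP_dom a b hε).mono h.T_le fun x => hs x b
  have dA := IsDom.torus (T := T) h.smooth_A
  have dAP : ∀ a b, IsDom T s (fun t x => -(𝒞.A x * 𝒞.P a b t x)) := fun a b =>
    (dA.mul (dP a b)).neg.mono h.T_le fun x => by simp
  have dAG : ∀ b, IsDom T s (fun t x => 𝒞.H b t x - 𝒞.A x * 𝒞.G b t x) := fun b =>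
    (dH b).sub ((dA.mul (dG b)).mono h.T_le fun x => by simp)
  have d1 : IsDom T (fun _ => δ) (fun t x => -(𝒞.A x * 𝒞.c₄ t x) - (𝒞.α t x - 1)) :=
    ((dA.mul h.c₄_dom).neg.mono h.T_le fun x => by simp).sub h.α_dom
  have d2 : IsDom T (fun _ => δ) (fun t x => 𝒞.c₁ t x - 𝒞.A x * 𝒞.c₃ t x) :=
    h.c₁_dom.sub ((dA.mul h.c₃_dom).mono h.T_le fun x => by simp)
  obtain ⟨C1, hC1, h1⟩ := (IsDom.torus (T := T)
    ((SmoothTorus.const 2).mul (h.smooth_A.pow 2))).listDeriv_mul_sub_le l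
  obtain ⟨C2, hC2, h2⟩ := dA.listDeriv_mul_le l
  obtain ⟨C3, hC3, h3⟩ := d1.listDeriv_mul_le l
  obtain ⟨C4, hC4, h4⟩ := d2.listDeriv_mul_le l
  obtain ⟨C5, hC5, h5⟩ := exists_listDeriv_operator_le dAP dAG l
  obtain ⟨C6, hC6, h6⟩ := exists_listDeriv_operator_le dαP dB l
  obtain ⟨D, hD, hν⟩ := h.exists_jetAbs_ν_le hsm hε hs (l + 1)
  refine ⟨C1 + C2 + 1 + C3 + C4 * D + C5 + C6, by positivity, ?_⟩
  intro σ F₁ F₂ F₃ u ν φ hσ hσ1 hsol t ht x L hL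
  have su := hsol.smooth_u.torus ht
  have sν := hsol.smooth_ν.torus ht
  have sφ := hsol.smooth_φ.torus ht
  have sF1 := hsol.smooth_F₁.torus ht
  have sF2 := hsol.smooth_F₂.torus ht
  have s1 : SmoothTorus (fun y => 2 * 𝒞.A y ^ 2 * u t y) :=
    ((SmoothTorus.const 2).mul (h.smooth_A.pow 2)).mul su
  have s2 : SmoothTorus (fun y => 𝒞.A y * F₂ t y) := h.smooth_A.mul sF2
  have s3 : SmoothTorus (fun y => (-(𝒞.A y * 𝒞.c₄ t y) - (𝒞.α t y - 1)) * u t y) :=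
    (d1.1.torus ht).mul su
  have s4 : SmoothTorus (fun y => (𝒞.c₁ t y - 𝒞.A y * 𝒞.c₃ t y) * ν t y) := (d2.1.torus ht).mul sν
  have s5 : SmoothTorus (fun y => ∑ a, ∑ b, -(𝒞.A y * 𝒞.P a b t y) * pderiv b (pderiv a (ν t)) y
      + ∑ b, (𝒞.H b t y - 𝒞.A y * 𝒞.G b t y) * pderiv b (ν t) y) :=
    (SmoothTorus.sum fun a _ => .sum fun b _ =>
      ((dAP a b).1.torus ht).mul ((sν.pderiv a).pderiv b)).add
      (.sum fun b _ => ((dAG b).1.torus ht).mul (sν.pderiv b))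
  have s6 : SmoothTorus (fun y => ∑ a, ∑ b, 𝒞.α t y * 𝒞.P a b t y * pderiv b (pderiv a (φ t)) y
      + ∑ b, 𝒞.B b t y * pderiv b (φ t) y) :=
    (SmoothTorus.sum fun a _ => .sum fun b _ =>
      ((dαP a b).1.torus ht).mul ((sφ.pderiv a).pderiv b)).add
      (.sum fun b _ => ((dB b).1.torus ht).mul (sφ.pderiv b))
  -- The substitution is made before differentiating, so that the commutator of the leading term
  -- involves lower derivatives of `u` alone.
  have e : (fun y => t * timeDeriv T u t y) = fun y => ((2 * 𝒞.A y ^ 2 * u t y + 𝒞.A y * F₂ t y)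
      - F₁ t y) + σ * ((((-(𝒞.A y * 𝒞.c₄ t y) - (𝒞.α t y - 1)) * u t y
        + (𝒞.c₁ t y - 𝒞.A y * 𝒞.c₃ t y) * ν t y)
        + (∑ a, ∑ b, -(𝒞.A y * 𝒞.P a b t y) * pderiv b (pderiv a (ν t)) y
          + ∑ b, (𝒞.H b t y - 𝒞.A y * 𝒞.G b t y) * pderiv b (ν t) y))
        + (∑ a, ∑ b, 𝒞.α t y * 𝒞.P a b t y * pderiv b (pderiv a (φ t)) y
          + ∑ b, 𝒞.B b t y * pderiv b (φ t) y)) := funext fun y => by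
    have e1 : ∑ a, ∑ b, -(𝒞.A y * 𝒞.P a b t y) * pderiv b (pderiv a (ν t)) y
        = -(𝒞.A y * ∑ a, ∑ b, 𝒞.P a b t y * pderiv b (pderiv a (ν t)) y) := by
      simp only [Finset.mul_sum, ← Finset.sum_neg_distrib]
      exact Finset.sum_congr rfl fun a _ => Finset.sum_congr rfl fun b _ => by ring
    have e2 : ∑ b, (𝒞.H b t y - 𝒞.A y * 𝒞.G b t y) * pderiv b (ν t) y
        = ∑ b, 𝒞.H b t y * pderiv b (ν t) y - 𝒞.A y * ∑ b, 𝒞.G b t y * pderiv b (ν t) y := by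
      simp only [Finset.mul_sum, ← Finset.sum_sub_distrib]
      exact Finset.sum_congr rfl fun b _ => by ring
    have e3 := congrArg (𝒞.A y * ·) (hsol.eq_ν t ht y)
    rw [hsol.eq_u t ht y, e1, e2]
    linear_combination (-1) * e3
  have e' := congrFun (congrArg (listDeriv L) e) x
  rw [listDeriv_const_mul t (hsol.smooth_u.timeDeriv.torus ht),
    listDeriv_add ((s1.add s2).sub sF1) ((SmoothTorus.const σ).mul (((s3.add s4).add s5).add s6)),
    listDeriv_sub (s1.add s2) sF1, listDeriv_add s1 s2,
    listDeriv_const_mul σ (((s3.add s4).add s5).add s6), listDeriv_add ((s3.add s4).add s5) s6,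
    listDeriv_add (s3.add s4) s5, listDeriv_add s3 s4] at e'
  have pδ := Real.rpow_nonneg ht.1.le δ
  have δ1 := h.rpow_le_one ht
  have ps := Real.rpow_nonneg ht.1.le (s x)
  have gu := jetAbs_nonneg (l + 1) (u t) x
  have gu' := jetAbs_nonneg l (u t) x
  have gν := jetAbs_nonneg (l + 1) (ν t) x
  have gν2 := jetAbs_nonneg (l + 3) (ν t) x
  have gφ2 := jetAbs_nonneg (l + 3) (φ t) x
  have gF1 := jetAbs_nonneg (l + 1) (F₁ t) x
  have gF2 := jetAbs_nonneg (l + 1) (F₂ t) x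
  have b1 := h1 t ht x L hL.le _ su
  have b2 := h2 t ht x L hL.le _ sF2
  have b3 := h3 t ht x L hL.le _ su
  have b4 := h4 t ht x L hL.le _ sν
  have b5 := h5 t ht x L hL.le _ sν
  have b6 := h6 t ht x L hL.le _ sφ
  have b7 := abs_listDeriv_le_jetAbs (m := l + 1) (F₁ t) x (L := L) (by omega)
  have b8 := hν hσ hσ1 hsol t ht x
  rw [hL] at b1 b2 b3 b4 b5 b6
  rw [Real.rpow_zero, mul_one] at b1 b2
  dsimp only at e'
  change jetAbs (l + 1) (ν t) x ≤ D * (_ + _ + t ^ s x * jetAbs (l + 3) (ν t) x) at b8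
  rw [e']
  generalize listDeriv L (fun y => 2 * 𝒞.A y ^ 2 * u t y) x = v1 at *
  generalize listDeriv L (fun y => 𝒞.A y * F₂ t y) x = v2 at *
  generalize listDeriv L (fun y => (-(𝒞.A y * 𝒞.c₄ t y) - (𝒞.α t y - 1)) * u t y) x = v3 at *
  generalize listDeriv L (fun y => (𝒞.c₁ t y - 𝒞.A y * 𝒞.c₃ t y) * ν t y) x = v4 at *
  generalize listDeriv L (fun y => ∑ a, ∑ b, -(𝒞.A y * 𝒞.P a b t y) * pderiv b (pderiv a (ν t)) y
      + ∑ b, (𝒞.H b t y - 𝒞.A y * 𝒞.G b t y) * pderiv b (ν t) y) x = v5 at *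
  generalize listDeriv L (fun y => ∑ a, ∑ b, 𝒞.α t y * 𝒞.P a b t y * pderiv b (pderiv a (φ t)) y
      + ∑ b, 𝒞.B b t y * pderiv b (φ t) y) x = v6 at *
  generalize listDeriv L (F₁ t) x = f at *
  generalize listDeriv L (u t) x = uL at *
  generalize jetAbs (l + 1) (u t) x = J1 at *
  generalize jetAbs (l + 1) (F₂ t) x = J2 at *
  generalize jetAbs (l + 3) (ν t) x = J3 at *
  generalize jetAbs (l + 1) (ν t) x = J4 at *
  generalize jetAbs l (u t) x = J5 at *
  generalize jetAbs (l + 1) (F₁ t) x = J6 at *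
  generalize jetAbs (l + 3) (φ t) x = J7 at *
  generalize t ^ δ = τ at *
  generalize t ^ s x = θ at *
  generalize 𝒞.A x = A at *
  have c1 : |v1 + v2 - f + σ * (v3 + v4 + v5 + v6) - 2 * A ^ 2 * uL|
      ≤ |v1 - 2 * A ^ 2 * uL| + |v2| + |f| + 1 * (|v3| + |v4| + |v5| + |v6|) := by
    have e5 : v1 + v2 - f + σ * (v3 + v4 + v5 + v6) - 2 * A ^ 2 * uL
        = (v1 - 2 * A ^ 2 * uL) + v2 + -f + σ * (v3 + v4 + v5 + v6) := by ring
    rw [e5]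
    refine (abs_add_le _ _).trans (add_le_add ((abs_add_le _ _).trans (add_le_add
      (abs_add_le _ _) (abs_neg _).le)) ?_)
    rw [abs_mul, abs_of_nonneg hσ]
    exact mul_le_mul hσ1 ((abs_add_le _ _).trans (add_le_add ((abs_add_le _ _).trans
      (add_le_add (abs_add_le _ _) le_rfl)) le_rfl)) (abs_nonneg _) zero_le_one
  have c2 : |v4| ≤ C4 * D * (τ * J1 + J2 + θ * J3) := by
    calc _ ≤ C4 * τ * J4 := b4
      _ ≤ C4 * τ * (D * (J1 + J2 + θ * J3)) := by gcongr
      _ = C4 * D * (τ * J1 + τ * (J2 + θ * J3)) := by ring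
      _ ≤ C4 * D * (τ * J1 + 1 * (J2 + θ * J3)) := by gcongr
      _ = _ := by ring
  have q1 : 0 ≤ (C2 + 1 + C3 + C4 * D + C5 + C6) * J5 := by positivity
  have q2 : 0 ≤ (C1 + C2 + 1 + C5 + C6) * (τ * J1) := by positivity
  have q3 : 0 ≤ (C1 + C2 + C3 + C4 * D + C5 + C6) * J6 := by positivity
  have q4 : 0 ≤ (C1 + 1 + C3 + C5 + C6) * J2 := by positivity
  have q5 : 0 ≤ (C1 + C2 + 1 + C3 + C6) * (θ * J3) := by positivity
  have q6 : 0 ≤ (C1 + C2 + 1 + C3 + C4 * D + C5) * (θ * J7) := by positivity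
  linarith only [c1, c2, b1, b2, b3, b5, b6, b7, q1, q2, q3, q4, q5, q6]

end Coeffs

end LapseScalar

/-! ### The weighted estimate that yields the decay of `u` -/

namespace LapseScalar

variable {n : ℕ} {T δ κ₀ σ : ℝ}

theorem SmoothSlab.levelSum_sq_hasDerivAt {f : ℝ → (Fin n → ℝ) → ℝ} (hf : SmoothSlab T f) (l : ℕ)
    {t : ℝ} (ht : t ∈ Ioo 0 T) (x : Fin n → ℝ) :
    HasDerivAt (fun s => LapseScalar.levelSum l fun L => LapseScalar.listDeriv L (f s) x ^ 2)
      (LapseScalar.levelSum l fun L => 2 * LapseScalar.listDeriv L (f t) x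
        * LapseScalar.listDeriv L (LapseScalar.timeDeriv T f t) x) t := by
  refine HasDerivAt.fun_sum fun a _ => ?_
  refine ((hf.hasDerivAt_listDeriv ht (List.ofFn a) x).fun_pow 2).congr_deriv ?_
  norm_num

/-- The right-hand side of the estimate for `u`. -/
def drift (s : (Fin n → ℝ) → ℝ) (l : ℕ) (F₁ F₂ ν φ : (Fin n → ℝ) → ℝ) (t : ℝ) (x : Fin n → ℝ) :
    ℝ :=
  jetSq l F₁ x + jetSq l F₂ x + (t ^ s x) ^ 2 * (jetSq (l + 2) ν x + jetSq (l + 2) φ x)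

theorem drift_nonneg (s : (Fin n → ℝ) → ℝ) (l : ℕ) (F₁ F₂ ν φ : (Fin n → ℝ) → ℝ) (t : ℝ)
    (x : Fin n → ℝ) : 0 ≤ drift s l F₁ F₂ ν φ t x :=
  add_nonneg (add_nonneg (jetSq_nonneg _ _ _) (jetSq_nonneg _ _ _))
    (mul_nonneg (sq_nonneg _) (add_nonneg (jetSq_nonneg _ _ _) (jetSq_nonneg _ _ _)))

theorem drift_mono (s : (Fin n → ℝ) → ℝ) {l m : ℕ} (h : l ≤ m) (F₁ F₂ ν φ : (Fin n → ℝ) → ℝ)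
    (t : ℝ) (x : Fin n → ℝ) : drift s l F₁ F₂ ν φ t x ≤ drift s m F₁ F₂ ν φ t x :=
  add_le_add (add_le_add (jetSq_mono h _ _) (jetSq_mono h _ _))
    (mul_le_mul_of_nonneg_left (add_le_add (jetSq_mono (by omega) _ _)
      (jetSq_mono (by omega) _ _)) (sq_nonneg _))

theorem smooth_drift {s : (Fin n → ℝ) → ℝ} (hs : SmoothTorus s) (l : ℕ)
    {F₁ F₂ ν φ : ℝ → (Fin n → ℝ) → ℝ} (h₁ : SmoothSlab T F₁) (h₂ : SmoothSlab T F₂)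
    (hν : SmoothSlab T ν) (hφ : SmoothSlab T φ) :
    SmoothSlab T (fun t => drift s l (F₁ t) (F₂ t) (ν t) (φ t) t) :=
  ((h₁.jetSq l).add (h₂.jetSq l)).add (((SmoothSlab.rpow hs).pow 2).mul
    ((hν.jetSq (l + 2)).add (hφ.jetSq (l + 2))))

namespace Coeffs

variable {𝒞 : Coeffs n}

/-- The leading term contributes `2 (2 A² - λ) (∂_L u)² ≥ 2 g (∂_L u)²`. One `g` pays for Young's
inequality with the sources, and the other survives. Top-order errors in `u` carry `t^δ` and are
left to Gronwall. -/
theorem Admissible.exists_levelSum_drift_le (h : 𝒞.Admissible T δ κ₀) (hsm : 𝒞.Small T)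
    {lam : (Fin n → ℝ) → ℝ} {g : ℝ} (hg0 : 0 < g) (hg : ∀ x, g ≤ 2 * 𝒞.A x ^ 2 - lam x)
    {s : (Fin n → ℝ) → ℝ} {ε : ℝ} (hε : 0 < ε) (hs : ∀ x b, s x ≤ 2 - 2 * 𝒞.q b x - ε) (l : ℕ) :
    ∃ C > 0, ∀ {σ : ℝ} {F₁ F₂ F₃ u ν φ : ℝ → (Fin n → ℝ) → ℝ}, 0 ≤ σ → σ ≤ 1 →
      𝒞.Solves T σ F₁ F₂ F₃ u ν φ → ∀ t ∈ Ioc 0 T, ∀ x,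
      g * levelSum l (fun L => listDeriv L (u t) x ^ 2)
        - C * t ^ δ * levelSum l (fun L => listDeriv L (u t) x ^ 2)
        - C * (jetSq l (u t) x + drift s (l + 1) (F₁ t) (F₂ t) (ν t) (φ t) t x)
      ≤ levelSum l fun L => 2 * listDeriv L (u t) x * (t * listDeriv L (timeDeriv T u t) x)
          - 2 * lam x * listDeriv L (u t) x ^ 2 := by
  obtain ⟨C, hC, hu⟩ := h.exists_listDeriv_eq_u' hsm hε hs l
  obtain ⟨j₀, hj₀, hJ₀⟩ := exists_jetAbs_sq_le n l
  obtain ⟨j₁, hj₁, hJ₁⟩ := exists_jetAbs_sq_le n (l + 1)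
  obtain ⟨j₃, hj₃, hJ₃⟩ := exists_jetAbs_sq_le n (l + 3)
  obtain ⟨J, hJ⟩ : ∃ J, J = j₀ + j₁ + j₃ := ⟨_, rfl⟩
  have hJ0 : 0 < J := by rw [hJ]; positivity
  obtain ⟨N, hN⟩ : ∃ N, N = (n : ℝ) ^ l := ⟨_, rfl⟩
  have hN0 : 0 ≤ N := by rw [hN]; positivity
  refine ⟨C + N * (C * J) + N * (C ^ 2 / g * (5 * J)), by positivity, ?_⟩
  intro σ F₁ F₂ F₃ u ν φ hσ hσ1 hsol t ht x
  have pδ := Real.rpow_nonneg ht.1.le δ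
  have δ1 := h.rpow_le_one ht
  have k0 := hJ₀ (u t) x
  have k1 := hJ₁ (u t) x
  have k2 := hJ₁ (F₁ t) x
  have k3 := hJ₁ (F₂ t) x
  have k4 := hJ₃ (ν t) x
  have k5 := hJ₃ (φ t) x
  rw [jetSq_succ] at k1
  have hL : ∀ L : List (Fin n), L.length = l →
      (g * listDeriv L (u t) x ^ 2 + -(C * t ^ δ) * listDeriv L (u t) x ^ 2)
        + -((C ^ 2 / g * (5 * J)) * (jetSq l (u t) x
            + drift s (l + 1) (F₁ t) (F₂ t) (ν t) (φ t) t x)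
          + C * t ^ δ * (J * (jetSq l (u t) x
            + levelSum l fun L => listDeriv L (u t) x ^ 2)))
      ≤ 2 * listDeriv L (u t) x * (t * listDeriv L (timeDeriv T u t) x)
          - 2 * lam x * listDeriv L (u t) x ^ 2 := by
    intro L hL
    have b := hu hσ hσ1 hsol t ht x L hL
    have g0 := jetSq_nonneg l (u t) x
    have g1 : 0 ≤ levelSum l fun L => listDeriv L (u t) x ^ 2 := levelSum_nonneg fun _ => sq_nonneg _
    have g2 := jetSq_nonneg (l + 1) (F₁ t) x
    have g3 := jetSq_nonneg (l + 1) (F₂ t) x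
    have g4 := jetSq_nonneg (l + 3) (ν t) x
    have g5 := jetSq_nonneg (l + 3) (φ t) x
    have hgx := hg x
    rw [drift]
    change _ + -(_ * (_ + (_ + _ + (t ^ s x) ^ 2 * (jetSq (l + 3) (ν t) x
      + jetSq (l + 3) (φ t) x))) + _) ≤ _
    generalize (levelSum l fun L => listDeriv L (u t) x ^ 2) = D at *
    generalize listDeriv L (u t) x = v at *
    generalize t * listDeriv L (timeDeriv T u t) x = w at *
    generalize jetAbs l (u t) x = a0 at *
    generalize jetAbs (l + 1) (u t) x = a1 at *
    generalize jetAbs (l + 1) (F₁ t) x = a2 at *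
    generalize jetAbs (l + 1) (F₂ t) x = a3 at *
    generalize jetAbs (l + 3) (ν t) x = a4 at *
    generalize jetAbs (l + 3) (φ t) x = a5 at *
    generalize jetSq l (u t) x = Q0 at *
    generalize jetSq (l + 1) (F₁ t) x = Q2 at *
    generalize jetSq (l + 1) (F₂ t) x = Q3 at *
    generalize jetSq (l + 3) (ν t) x = Q4 at *
    generalize jetSq (l + 3) (φ t) x = Q5 at *
    generalize t ^ δ = τ at *
    generalize t ^ s x = θ at *
    generalize 𝒞.A x = A at *
    generalize lam x = lx at *
    -- `X` contains everything except the top-order jet `a1` of `u`, which must be kept with its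
    -- factor `τ`.
    obtain ⟨X, hX⟩ : ∃ X, X = a0 + a2 + a3 + θ * (a4 + a5) := ⟨_, rfl⟩
    have X2 : X ^ 2 ≤ 5 * J * (Q0 + (Q2 + Q3 + θ ^ 2 * (Q4 + Q5))) := by
      have m0 : j₀ * Q0 ≤ J * Q0 := by gcongr; linarith
      have m2 : j₁ * Q2 ≤ J * Q2 := by gcongr; linarith
      have m3 : j₁ * Q3 ≤ J * Q3 := by gcongr; linarith
      have m4 : j₃ * Q4 ≤ J * Q4 := by gcongr; linarith
      have m5 : j₃ * Q5 ≤ J * Q5 := by gcongr; linarith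
      have m6 : X ^ 2 ≤ 5 * (a0 ^ 2 + a2 ^ 2 + a3 ^ 2 + θ ^ 2 * (a4 ^ 2 + a5 ^ 2)) := by
        rw [hX]
        linarith only [sq_nonneg (a0 - a2), sq_nonneg (a0 - a3), sq_nonneg (a0 - θ * a4),
          sq_nonneg (a0 - θ * a5), sq_nonneg (a2 - a3), sq_nonneg (a2 - θ * a4),
          sq_nonneg (a2 - θ * a5), sq_nonneg (a3 - θ * a4), sq_nonneg (a3 - θ * a5),
          sq_nonneg (θ * a4 - θ * a5)]
      have m7 : θ ^ 2 * (a4 ^ 2 + a5 ^ 2) ≤ θ ^ 2 * (J * Q4 + J * Q5) := by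
        gcongr <;> linarith
      linarith only [m0, m2, m3, m6, m7, k0, k2, k3]
    have c1 : |w - 2 * A ^ 2 * v| ≤ C * X + C * τ * a1 := by rw [hX]; linarith only [b]
    have c2 : -(2 * |v| * (C * X + C * τ * a1)) ≤ 2 * v * (w - 2 * A ^ 2 * v) := by
      have d1 := neg_abs_le (2 * v * (w - 2 * A ^ 2 * v))
      rw [abs_mul, abs_mul, abs_two] at d1
      have d2 : 2 * |v| * |w - 2 * A ^ 2 * v| ≤ 2 * |v| * (C * X + C * τ * a1) := by gcongr
      linarith
    have c3 := young (x := |v|) (y := 2 * C * X) hg0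
    have c4 : 1 / (4 * g) * (2 * C * X) ^ 2 = C ^ 2 / g * X ^ 2 := by field_simp; ring
    rw [c4, sq_abs] at c3
    have c5 : 2 * |v| * a1 ≤ v ^ 2 + J * (Q0 + D) := by
      have d1 : j₁ * (Q0 + D) ≤ J * (Q0 + D) := by gcongr; linarith
      have d2 := sq_nonneg (|v| - a1)
      have d3 := sq_abs v
      linarith only [d1, d2, d3, k1]
    have c6 := mul_le_mul_of_nonneg_left c5 (mul_nonneg hC.le pδ)
    have c7 := mul_le_mul_of_nonneg_left X2 (by positivity : 0 ≤ C ^ 2 / g)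
    have c8 := mul_le_mul_of_nonneg_right hgx (sq_nonneg v)
    linarith only [c2, c3, c6, c7, c8]
  have hsum := levelSum_mono hL
  rw [levelSum_add, levelSum_add, levelSum_const_mul, levelSum_const_mul, levelSum_const,
    ← hN] at hsum
  refine le_trans ?_ hsum
  have g0 := jetSq_nonneg l (u t) x
  have g1 : 0 ≤ levelSum l fun L => listDeriv L (u t) x ^ 2 := levelSum_nonneg fun _ => sq_nonneg _
  have g2 := drift_nonneg s (l + 1) (F₁ t) (F₂ t) (ν t) (φ t) t x
  generalize (levelSum l fun L => listDeriv L (u t) x ^ 2) = D at *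
  generalize jetSq l (u t) x = Q0 at *
  generalize drift s (l + 1) (F₁ t) (F₂ t) (ν t) (φ t) t x = Q1 at *
  generalize t ^ δ = τ at *
  have e1 : 0 ≤ (N * (C ^ 2 / g * (5 * J))) * (τ * D) := by positivity
  have e2 : 0 ≤ C * (Q0 + Q1) := by positivity
  have e3 : 0 ≤ N * (C * J) * Q1 := by positivity
  have e4 : N * (C * J) * (τ * Q0) ≤ N * (C * J) * (1 * Q0) := by gcongr
  linarith only [e1, e2, e3, e4]

/-- The improved decay estimate for `u`, in terms of `ν`, `φ` and the sources. -/
theorem Admissible.exists_wInt_u_le (h : 𝒞.Admissible T δ κ₀) (hsm : 𝒞.Small T)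
    {lam : (Fin n → ℝ) → ℝ} (hlam : SmoothTorus lam) {g : ℝ} (hg0 : 0 < g)
    (hg : ∀ x, g ≤ 2 * 𝒞.A x ^ 2 - lam x) {s : (Fin n → ℝ) → ℝ} (hss : SmoothTorus s) {ε : ℝ}
    (hε : 0 < ε) (hs : ∀ x b, s x ≤ 2 - 2 * 𝒞.q b x - ε) (l : ℕ) :
    ∃ C > 0, ∀ {σ : ℝ} {F₁ F₂ F₃ u ν φ : ℝ → (Fin n → ℝ) → ℝ}, 0 ≤ σ → σ ≤ 1 →
      𝒞.Solves T σ F₁ F₂ F₃ u ν φ → ∀ t ∈ Ioc 0 T,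
      wInt (fun x => -lam x) t (jetSq l (u t)) + timeInt (fun x => -lam x) t T (fun t => jetSq l (u t))
        ≤ C * (wInt (fun x => -lam x) T (jetSq l (u T))
          + timeInt (fun x => -lam x) t T (fun t => drift s l (F₁ t) (F₂ t) (ν t) (φ t) t)) := by
  have hβ : SmoothTorus (fun x => -lam x) := hlam.neg
  induction l with
  | zero =>
    refine ⟨1, one_pos, fun {σ F₁ F₂ F₃ u ν φ} hσ hσ1 hsol t ht => ?_⟩
    have e : ∀ f : (Fin n → ℝ) → ℝ, jetSq 0 f = fun _ => 0 := fun f => by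
      funext x; simp [jetSq, cumSum]
    have h1 := timeInt_nonneg (β := fun x => -lam x) ht (F := fun t =>
      drift s 0 (F₁ t) (F₂ t) (ν t) (φ t) t) fun s' _ x => drift_nonneg _ _ _ _ _ _ _ _
    simp only [e]
    have h2 : ∀ t, wInt (fun x => -lam x) t (fun _ : Fin n → ℝ => 0) = 0 := fun t => by
      simp [wInt, torusInt]
    simp only [timeInt, h2, zero_mul, intervalIntegral.integral_zero] at h1 ⊢
    linarith
  | succ l ih =>
    obtain ⟨D, hD, ih⟩ := ih
    obtain ⟨C, hC, hineq⟩ := h.exists_levelSum_drift_le hsm hg0 hg hε hs l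
    obtain ⟨X, hX⟩ : ∃ X, X = Real.exp (C / δ) * (1 + C * D + C) := ⟨_, rfl⟩
    have hX0 : 0 < X := by rw [hX]; positivity
    refine ⟨D + X * (1 + g⁻¹), by positivity, ?_⟩
    intro σ F₁ F₂ F₃ u ν φ hσ hσ1 hsol t ht
    have sub : ∀ s ∈ Icc t T, s ∈ Ioc 0 T := fun s hs => ⟨ht.1.trans_le hs.1, hs.2⟩
    have s1 : SmoothSlab T (fun t x => levelSum l fun L => listDeriv L (u t) x ^ 2) :=
      .levelSum fun L => (hsol.smooth_u.listDeriv L).pow 2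
    have s2 := hsol.smooth_u.jetSq l
    have s3 := fun l => smooth_drift hss l hsol.smooth_F₁ hsol.smooth_F₂ hsol.smooth_ν hsol.smooth_φ
    have s4 : SmoothSlab T (fun t x => t ^ (2 * -lam x)
        * levelSum l fun L => listDeriv L (u t) x ^ 2) :=
      (SmoothSlab.rpow ((SmoothTorus.const 2).mul hβ)).mul s1
    have n1 : ∀ t x, 0 ≤ levelSum l fun L => listDeriv L (u t) x ^ 2 := fun t x =>
      levelSum_nonneg fun _ => sq_nonneg _
    -- Only the derivatives of order exactly `l` enter this energy; those of lower order, produced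
    -- by the commutator with `2 A²`, are bounded by the space-time integral in the induction
    -- hypothesis.
    have key := timeInt_le_of_ineq (t := t) (K := C) (δ := δ)
      (E := fun t => wInt (fun x => -lam x) t fun x => levelSum l fun L => listDeriv L (u t) x ^ 2)
      (E' := fun t => torusInt (timeDeriv T (fun t x => t ^ (2 * -lam x)
        * levelSum l fun L => listDeriv L (u t) x ^ 2) t))
      hβ ((SmoothSlab.const g).mul s1) ((SmoothSlab.const C).mul (s2.add (s3 (l + 1))))
      ht h.T_le h.δ_pos hC.le (continuousOn_wInt hβ s1 ht.1)
      (fun s hs' => s4.hasDerivAt_torusInt ⟨ht.1.trans hs'.1, hs'.2⟩)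
      (fun s hs' => wInt_nonneg (sub s hs').1 (n1 s))
      (fun s _ x => mul_nonneg hg0.le (n1 s x))
      (fun s _ x => mul_nonneg hC.le (add_nonneg (jetSq_nonneg _ _ _) (drift_nonneg _ _ _ _ _ _ _ _)))
      (fun s hs' => by
        have s0 := ht.1.trans hs'.1
        have hs0 : s ∈ Ioo 0 T := ⟨s0, hs'.2⟩
        have hs1 : s ∈ Ioc 0 T := ⟨s0, hs'.2.le⟩
        have k1 := (SmoothTorus.const g).mul (s1.torus hs1)
        have k2 := (SmoothTorus.const C).mul ((s2.torus hs1).add ((s3 (l + 1)).torus hs1))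
        have k3 := (SmoothTorus.const (C * s ^ δ)).mul (s1.torus hs1)
        rw [← wInt_const_mul (C * s ^ δ), ← wInt_sub hβ s0 k1 k3, ← wInt_sub hβ s0 (k1.sub k3) k2,
          wInt, ← torusInt_const_mul]
        refine torusInt_mono ((smooth_weight hβ s0).mul ((k1.sub k3).sub k2))
          ((SmoothTorus.const s).mul (s4.timeDeriv.torus hs1)) fun x => ?_
        have d1 : HasDerivAt (fun s : ℝ => s ^ (2 * -lam x))
            (2 * -lam x * s ^ (2 * -lam x) * s⁻¹) s := by
          have := Real.hasDerivAt_rpow_const (x := s) (p := 2 * -lam x) (Or.inl s0.ne')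
          rwa [Real.rpow_sub_one s0.ne', div_eq_mul_inv, ← mul_assoc] at this
        rw [(s4.hasDerivAt hs0 x).unique
          (d1.mul (hsol.smooth_u.levelSum_sq_hasDerivAt l hs0 x))]
        have e1 : s * (2 * -lam x * s ^ (2 * -lam x) * s⁻¹
              * (levelSum l fun L => listDeriv L (u s) x ^ 2) + s ^ (2 * -lam x)
            * levelSum l fun L => 2 * listDeriv L (u s) x * listDeriv L (timeDeriv T u s) x)
            = s ^ (2 * -lam x) * levelSum l fun L =>
              2 * listDeriv L (u s) x * (s * listDeriv L (timeDeriv T u s) x)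
                - 2 * lam x * listDeriv L (u s) x ^ 2 := by
          have e2 : (fun L : List (Fin n) =>
              2 * listDeriv L (u s) x * (s * listDeriv L (timeDeriv T u s) x)
                - 2 * lam x * listDeriv L (u s) x ^ 2)
              = fun L => s * (2 * listDeriv L (u s) x * listDeriv L (timeDeriv T u s) x)
                + (-2 * lam x) * listDeriv L (u s) x ^ 2 := funext fun L => by ring
          rw [e2, levelSum_add, levelSum_const_mul, levelSum_const_mul]
          field_simp
          ring
        rw [e1]
        exact mul_le_mul_of_nonneg_left (hineq hσ hσ1 hsol s hs1 x) (Real.rpow_nonneg s0.le _))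
    rw [timeInt_const_mul, timeInt_const_mul, timeInt_add hβ s2 (s3 (l + 1)) ht] at key
    have e1 : ∀ t ∈ Ioc 0 T, wInt (fun x => -lam x) t (jetSq (l + 1) (u t))
        = wInt (fun x => -lam x) t (jetSq l (u t))
          + wInt (fun x => -lam x) t fun x => levelSum l fun L => listDeriv L (u t) x ^ 2 :=
      fun t ht => by
        rw [← wInt_add hβ ht.1 (s2.torus ht) (s1.torus ht)]
        exact congrArg (wInt _ t) (funext fun x => jetSq_succ l (u t) x)
    have e2 : timeInt (fun x => -lam x) t T (fun t => jetSq (l + 1) (u t))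
        = timeInt (fun x => -lam x) t T (fun t => jetSq l (u t))
          + timeInt (fun x => -lam x) t T
            (fun t x => levelSum l fun L => listDeriv L (u t) x ^ 2) := by
      rw [← timeInt_add hβ s2 s1 ht]
      exact congrArg (timeInt _ t T) (funext fun t => funext fun x => jetSq_succ l (u t) x)
    have tT : T ∈ Ioc 0 T := ⟨h.T_pos, le_rfl⟩
    rw [e1 t ht, e1 T tT, e2]
    have k1 := ih hσ hσ1 hsol t ht
    have k2 : timeInt (fun x => -lam x) t T (fun t => drift s l (F₁ t) (F₂ t) (ν t) (φ t) t)
        ≤ timeInt (fun x => -lam x) t T (fun t => drift s (l + 1) (F₁ t) (F₂ t) (ν t) (φ t) t) :=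
      timeInt_mono hβ (s3 l) (s3 (l + 1)) ht fun s' _ x => drift_mono s (Nat.le_succ l) _ _ _ _ _ _
    have k3 : 0 ≤ timeInt (fun x => -lam x) t T
        (fun t => drift s l (F₁ t) (F₂ t) (ν t) (φ t) t) :=
      timeInt_nonneg ht fun s' _ x => drift_nonneg _ _ _ _ _ _ _ _
    have k4 := wInt_nonneg (β := fun x => -lam x) ht.1 (jetSq_nonneg l (u t))
    have k5 := wInt_nonneg (β := fun x => -lam x) h.T_pos (jetSq_nonneg l (u T))
    have k6 := wInt_nonneg (β := fun x => -lam x) ht.1 (n1 t)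
    have k7 := wInt_nonneg (β := fun x => -lam x) h.T_pos (n1 T)
    have k8 : 0 ≤ timeInt (fun x => -lam x) t T (fun t => jetSq l (u t)) :=
      timeInt_nonneg ht fun s' _ x => jetSq_nonneg _ _ _
    have k9 : 0 ≤ timeInt (fun x => -lam x) t T
        (fun t x => levelSum l fun L => listDeriv L (u t) x ^ 2) :=
      timeInt_nonneg ht fun s' _ x => n1 s' x
    generalize timeInt (fun x => -lam x) t T (fun t => drift s l (F₁ t) (F₂ t) (ν t) (φ t) t) = R at *
    generalize timeInt (fun x => -lam x) t T
      (fun t => drift s (l + 1) (F₁ t) (F₂ t) (ν t) (φ t) t) = R' at *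
    generalize timeInt (fun x => -lam x) t T (fun t => jetSq l (u t)) = I0 at *
    generalize timeInt (fun x => -lam x) t T
      (fun t x => levelSum l fun L => listDeriv L (u t) x ^ 2) = I1 at *
    generalize (wInt (fun x => -lam x) t fun x => levelSum l fun L => listDeriv L (u t) x ^ 2)
      = W1 at *
    generalize (wInt (fun x => -lam x) T fun x => levelSum l fun L => listDeriv L (u T) x ^ 2)
      = V1 at *
    generalize wInt (fun x => -lam x) t (jetSq l (u t)) = W0 at *
    generalize wInt (fun x => -lam x) T (jetSq l (u T)) = V0 at *
    have m1 : W1 + g * I1 ≤ X * (V0 + V1 + R') := by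
      refine key.trans ?_
      rw [hX, mul_assoc]
      refine mul_le_mul_of_nonneg_left ?_ (Real.exp_nonneg _)
      have k2' : C * I0 ≤ C * (D * (V0 + R')) := by
        gcongr
        exact (by linarith : I0 ≤ D * (V0 + R)).trans (by gcongr)
      have : 0 ≤ V0 + C * V0 + C * D * V1 + C * V1 + R' := by
        have : 0 ≤ R' := k3.trans k2
        positivity
      linarith
    have m2 : g * I1 ≤ X * (V0 + V1 + R') := by linarith
    have m3 : I1 ≤ X * g⁻¹ * (V0 + V1 + R') := by
      calc I1 = g⁻¹ * (g * I1) := by rw [inv_mul_cancel_left₀ hg0.ne']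
        _ ≤ g⁻¹ * (X * (V0 + V1 + R')) := by gcongr
        _ = _ := by ring
    have m4 : W1 ≤ X * (V0 + V1 + R') := by
      have := mul_nonneg hg0.le k9
      linarith
    have m5 : W0 + I0 ≤ D * (V0 + V1 + R') := k1.trans (by gcongr; linarith)
    linarith only [m3, m4, m5]

end Coeffs

end LapseScalar

namespace LapseScalar

variable {n : ℕ} {T δ κ₀ σ : ℝ}

/-! ### The weights -/

/-- A smooth weight `β` for the estimates of `φ` and `ν` that leads to an estimate for `u` with
weight `-lam`. -/
theorem exists_weight {q : Fin n → (Fin n → ℝ) → ℝ} (hq : ∀ i, SmoothTorus (q i))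
    {lam κ : (Fin n → ℝ) → ℝ} (hlam : SmoothTorus lam) (hκ : SmoothTorus κ)
    (hlamq : ∀ x i, lam x < 2 * (1 - q i x)) (hκq : ∀ x i, κ x < 1 - q i x) :
    ∃ β : (Fin n → ℝ) → ℝ, SmoothTorus β ∧ (∀ x, 0 < β x) ∧ (∀ x, 2 * κ x - lam x ≤ β x) ∧
      ∃ ε > 0, ∀ x i, lam x + β x ≤ 2 - 2 * q i x - ε := by
  choose c hc hc' using fun i => (((SmoothTorus.const 2).mul ((SmoothTorus.const 1).sub
    (hq i))).sub hlam).exists_pos_le fun x => sub_pos.2 (hlamq x i)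
  choose d hd hd' using fun i => (((SmoothTorus.const 1).sub
    (hq i)).sub hκ).exists_pos_le fun x => sub_pos.2 (hκq x i)
  -- The margin needed is `2 η ≤ 2 (1 - q_i) - λ` where `2 κ ≤ λ`, and `η ≤ 1 - q_i - κ` where `2 κ
  -- ≥ λ`. Hence the minimum of `c i / 2` and `d i`.
  obtain ⟨η, hη, he⟩ := Pi.exists_forall_pos_add_lt (x := fun _ : Fin n => (0 : ℝ))
    (y := fun i => min (c i / 2) (d i)) fun i => lt_min (half_pos (hc i)) (hd i)
  have sq0 : ∀ x, 0 < (κ x - lam x / 2) ^ 2 + η ^ 2 := fun x => by positivity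
  have hs : SmoothTorus (fun x => Real.sqrt ((κ x - lam x / 2) ^ 2 + η ^ 2)) :=
    ⟨(((hκ.1.sub (hlam.1.div_const 2)).pow 2).add contDiff_const).sqrt fun x => (sq0 x).ne',
      fun x i => by dsimp only; rw [hκ.2, hlam.2]⟩
  have r1 : ∀ x, |κ x - lam x / 2| < Real.sqrt ((κ x - lam x / 2) ^ 2 + η ^ 2) := fun x =>
    Real.lt_sqrt_of_sq_lt (by rw [sq_abs]; linarith [pow_pos hη 2])
  have r2 : ∀ x, Real.sqrt ((κ x - lam x / 2) ^ 2 + η ^ 2) ≤ |κ x - lam x / 2| + η := fun x =>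
    Real.sqrt_le_iff.2 ⟨by positivity, by
      have := mul_nonneg (abs_nonneg (κ x - lam x / 2)) hη.le
      linarith [sq_abs (κ x - lam x / 2)]⟩
  -- A smooth substitute for `max(0, 2 κ - λ)`: with `m = κ - λ / 2` this maximum equals `m + |m|`,
  -- and `√(m² + η²)` lies between `|m|` and `|m| + η`.
  refine ⟨fun x => κ x - lam x / 2 + Real.sqrt ((κ x - lam x / 2) ^ 2 + η ^ 2), ?_, fun x => ?_,
    fun x => ?_, η, hη, fun x i => ?_⟩
  · have := (hκ.add ((SmoothTorus.const (-1 / 2)).mul hlam)).add hs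
    have e : (fun x => κ x - lam x / 2 + Real.sqrt ((κ x - lam x / 2) ^ 2 + η ^ 2))
        = fun x => κ x + -1 / 2 * lam x + Real.sqrt ((κ x - lam x / 2) ^ 2 + η ^ 2) :=
      funext fun x => by ring
    rwa [e]
  · linarith [neg_abs_le (κ x - lam x / 2), r1 x]
  · linarith [le_abs_self (κ x - lam x / 2), r1 x]
  · have h1 := hc' i x
    have h2 := hd' i x
    have h3 := he i
    have h4 := r2 x
    have h5 := min_le_left (c i / 2) (d i)
    have h6 := min_le_right (c i / 2) (d i)
    dsimp only at h3 ⊢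
    rcases abs_cases (κ x - lam x / 2) with ⟨e, -⟩ | ⟨e, -⟩ <;> rw [e] at h4 <;> linarith

theorem SmoothTorus.jetSq {f : (Fin n → ℝ) → ℝ} (hf : SmoothTorus f) (m : ℕ) :
    SmoothTorus (LapseScalar.jetSq m f) := ((hf.slab 1).jetSq m).torus ⟨one_pos, le_rfl⟩

theorem sobolevSq_eq {f : (Fin n → ℝ) → ℝ} (hf : SmoothTorus f) (k : ℕ) :
    sobolevSq k f = torusInt (jetSq (k + 1) f) := by
  have e : ∀ l, SmoothTorus fun x => levelSum l fun L => listDeriv L f x ^ 2 := fun l =>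
    .sum fun a _ => (hf.listDeriv _).pow 2
  unfold jetSq cumSum
  rw [torusInt_sum fun l _ => e l]
  simp only [sobolevSq, derivNormSq_eq hf, torusInt]

theorem energy_eq {lam : (Fin n → ℝ) → ℝ} (hlam : SmoothTorus lam) {u : ℝ → (Fin n → ℝ) → ℝ}
    (hu : SmoothSlab T u) (k : ℕ) {t : ℝ} (ht : t ∈ Ioc 0 T) :
    energy k lam u t = 1 / 2 * wInt (fun x => -lam x) t (jetSq (k + 1) (u t)) := by
  have e : ∀ l, SmoothTorus fun x => t ^ (2 * -lam x) * levelSum l fun L =>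
      listDeriv L (u t) x ^ 2 := fun l =>
    (smooth_weight hlam.neg ht.1).mul (.sum fun a _ => ((hu.torus ht).listDeriv _).pow 2)
  unfold wInt jetSq cumSum
  simp only [Finset.mul_sum]
  rw [torusInt_sum fun l _ => e l, Finset.mul_sum]
  refine Finset.sum_congr rfl fun l _ => ?_
  rw [torusInt]
  congr 2
  funext x
  rw [derivNormSq_eq (hu.torus ht), ← Real.rpow_mul_natCast ht.1.le, mul_comm (-lam x)]
  norm_num

/-! ### Commuting weights and derivatives -/

/-- The estimates have the weight outside the derivatives, the theorem has it inside. Writing `f =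
t^{-θ} (t^θ f)` and differentiating produces logarithms, which cost `t^{-ε}` and hence `t^{-2ε}` in
the square. This is the factor `s^{-2ε}` in the final integral. -/
theorem exists_jetSq_le_rpow (hT : T ≤ 1) {θ : (Fin n → ℝ) → ℝ} (hθ : SmoothTorus θ) {ε : ℝ}
    (hε : 0 < ε) (m : ℕ) : ∃ C > 0, ∀ t ∈ Ioc 0 T, ∀ x, ∀ f, SmoothTorus f →
      t ^ (2 * θ x) * jetSq m f x ≤ C * t ^ (-2 * ε) * jetSq m (fun y => t ^ θ y * f y) x := by
  obtain ⟨C, hC, hb⟩ := (IsDom.rpow (T := T) hθ.neg hT hε).listDeriv_mul_le m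
  obtain ⟨j, hj, hJ⟩ := exists_jetAbs_sq_le n m
  obtain ⟨N, hN⟩ : ∃ N, N = ∑ i ∈ Finset.range m, (n : ℝ) ^ i := ⟨_, rfl⟩
  have hN0 : 0 ≤ N := by rw [hN]; positivity
  refine ⟨N * (C ^ 2 * j) + 1, by positivity, fun t ht x f hf => ?_⟩
  obtain ⟨g, hg⟩ : ∃ g, g = fun y => t ^ θ y * f y := ⟨_, rfl⟩
  have sg : SmoothTorus g := by
    rw [hg]; exact ((SmoothSlab.rpow (T := T) hθ).torus ht).mul hf
  have ef : f = fun y => t ^ (-θ y) * g y := by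
    funext y
    rw [hg, ← mul_assoc, ← Real.rpow_add ht.1, neg_add_cancel, Real.rpow_zero, one_mul]
  rw [← hg]
  have h1 : jetSq m f x ≤ N * (C ^ 2 * j) * ((t ^ (-θ x - ε)) ^ 2 * jetSq m g x) := by
    have h2 : ∀ L : List (Fin n), L.length < m → listDeriv L f x ^ 2
        ≤ C ^ 2 * j * ((t ^ (-θ x - ε)) ^ 2 * jetSq m g x) := fun L hL => by
      have b := hb t ht x L hL.le g sg
      rw [← ef] at b
      have b1 := jetAbs_mono (by omega : L.length + 1 ≤ m) g x
      have p := Real.rpow_nonneg ht.1.le (-θ x - ε)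
      have b2 : |listDeriv L f x| ≤ C * t ^ (-θ x - ε) * jetAbs m g x := b.trans (by gcongr)
      have b3 := pow_le_pow_left₀ (abs_nonneg _) b2 2
      rw [sq_abs] at b3
      calc _ ≤ _ := b3
        _ = (C * t ^ (-θ x - ε)) ^ 2 * jetAbs m g x ^ 2 := by ring
        _ ≤ (C * t ^ (-θ x - ε)) ^ 2 * (j * jetSq m g x) := by gcongr; exact hJ g x
        _ = _ := by ring
    refine (cumSum_mono h2).trans (le_of_eq ?_)
    rw [cumSum, hN, Finset.sum_mul, Finset.sum_mul]
    exact Finset.sum_congr rfl fun i _ => by rw [levelSum_const]; ring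
  have e1 : t ^ (2 * θ x) * (t ^ (-θ x - ε)) ^ 2 = t ^ (-2 * ε) := by
    rw [← Real.rpow_mul_natCast ht.1.le, ← Real.rpow_add ht.1]
    congr 1
    push_cast
    ring
  have g0 := jetSq_nonneg m g x
  calc _ ≤ t ^ (2 * θ x) * (N * (C ^ 2 * j) * ((t ^ (-θ x - ε)) ^ 2 * jetSq m g x)) :=
        mul_le_mul_of_nonneg_left h1 (Real.rpow_nonneg ht.1.le _)
    _ = N * (C ^ 2 * j) * t ^ (-2 * ε) * jetSq m g x := by rw [← e1]; ring
    _ ≤ _ := by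
        have := Real.rpow_nonneg ht.1.le (-2 * ε)
        gcongr
        linarith

theorem intervalIntegrable_sobolevSq {θ : (Fin n → ℝ) → ℝ} (hθ : SmoothTorus θ) (ε : ℝ)
    {F : ℝ → (Fin n → ℝ) → ℝ} (hF : SmoothSlab T F) (k : ℕ) {t : ℝ} (ht : t ∈ Ioc 0 T) :
    IntervalIntegrable (fun s => sobolevSq k (fun x => s ^ θ x * F s x) * s ^ (-1 - 2 * ε))
      volume t T := by
  refine ContinuousOn.intervalIntegrable ?_
  rw [uIcc_of_le ht.2]
  have s1 : SmoothSlab T (fun s x => s ^ θ x * F s x) := (SmoothSlab.rpow hθ).mul hF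
  refine ContinuousOn.mul ((SmoothSlab.continuousOn_torusInt (s1.jetSq (k + 1)) ht.1).congr
    fun s hs => sobolevSq_eq (s1.torus ⟨ht.1.trans_le hs.1, hs.2⟩) k) ?_
  exact continuousOn_id.rpow_const fun s hs => Or.inl (ht.1.trans_le hs.1).ne'

theorem exists_timeInt_jetSq_le (hT : T ≤ 1) {β θ : (Fin n → ℝ) → ℝ} (hβ : SmoothTorus β)
    (hθ : SmoothTorus θ) (hle : ∀ x, θ x ≤ β x) {ε : ℝ} (hε : 0 < ε) (k : ℕ) :
    ∃ C > 0, ∀ {F : ℝ → (Fin n → ℝ) → ℝ}, SmoothSlab T F → ∀ t ∈ Ioc 0 T,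
      timeInt β t T (fun s => jetSq (k + 1) (F s))
        ≤ C * ∫ s in t..T, sobolevSq k (fun x => s ^ θ x * F s x) * s ^ (-1 - 2 * ε) := by
  obtain ⟨C, hC, hb⟩ := exists_jetSq_le_rpow hT hθ hε (k + 1)
  refine ⟨C, hC, fun {F} hF t ht => ?_⟩
  rw [timeInt, ← intervalIntegral.integral_const_mul]
  refine intervalIntegral.integral_mono_on ht.2 (intervalIntegrable_wInt hβ (hF.jetSq _) ht)
    ((intervalIntegrable_sobolevSq hθ ε hF k ht).const_mul C) fun s hs => ?_
  have s0 := ht.1.trans_le hs.1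
  have hs0 : s ∈ Ioc 0 T := ⟨s0, hs.2⟩
  have s1 : SmoothTorus (fun x => s ^ θ x * F s x) :=
    ((SmoothSlab.rpow hθ).mul hF).torus hs0
  rw [sobolevSq_eq s1]
  -- The `s⁻¹` is the measure `ds / s`, and the rest is the price of commuting the weight past the
  -- derivatives.
  have e : s ^ (-1 - 2 * ε) = s ^ (-2 * ε) * s⁻¹ := by
    rw [← Real.rpow_neg_one, ← Real.rpow_add s0]
    congr 1
    ring
  rw [e, mul_comm (torusInt _), ← mul_assoc, ← mul_assoc, mul_right_comm]
  refine mul_le_mul_of_nonneg_right ?_ (inv_nonneg.2 s0.le)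
  rw [← torusInt_const_mul]
  refine torusInt_mono ((smooth_weight hβ s0).mul ((hF.torus hs0).jetSq _))
    ((SmoothTorus.const _).mul (s1.jetSq _)) fun x => ?_
  exact (mul_le_mul_of_nonneg_right (rpow_le_rpow_of_le_one s0 (hs.2.trans hT)
    (by linarith [hle x])) (jetSq_nonneg _ _ _)).trans (hb s hs0 x _ (hF.torus hs0))

theorem timeInt_mono_weight (hT : T ≤ 1) {β β' : (Fin n → ℝ) → ℝ} (hβ : SmoothTorus β)
    (hβ' : SmoothTorus β') (hle : ∀ x, β x ≤ β' x) {F : ℝ → (Fin n → ℝ) → ℝ} (hF : SmoothSlab T F)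
    {t : ℝ} (ht : t ∈ Ioc 0 T) (F0 : ∀ s ∈ Icc t T, ∀ x, 0 ≤ F s x) :
    timeInt β' t T F ≤ timeInt β t T F := by
  refine intervalIntegral.integral_mono_on ht.2 (intervalIntegrable_wInt hβ' hF ht)
    (intervalIntegrable_wInt hβ hF ht) fun s hs => ?_
  have s0 := ht.1.trans_le hs.1
  have sF := hF.torus ⟨s0, hs.2⟩
  refine mul_le_mul_of_nonneg_right (torusInt_mono ((smooth_weight hβ' s0).mul sF)
    ((smooth_weight hβ s0).mul sF) fun x => ?_) (inv_nonneg.2 s0.le)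
  exact mul_le_mul_of_nonneg_right (rpow_le_rpow_of_le_one s0 (hs.2.trans hT)
    (by linarith [hle x])) (F0 s hs x)

namespace Coeffs

variable {𝒞 : Coeffs n}

/-! ### The energy at the final time -/

/-- The gradient of `φ` enters the energy with the factor `σ`; this explains the term with `σ` and
one extra derivative of `φ` in the final estimate. -/
theorem Admissible.exists_levelEnergy_le (h : 𝒞.Admissible T δ κ₀) (hsm : 𝒞.Small T)
    {β : (Fin n → ℝ) → ℝ} (hβ : SmoothTorus β) (hβ0 : ∀ x, 0 < β x) :
    ∃ C > 0, ∀ {σ : ℝ} {u φ : ℝ → (Fin n → ℝ) → ℝ}, 0 ≤ σ → σ ≤ 1 → SmoothSlab T u →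
      SmoothSlab T φ → ∀ k j, j ≤ k →
      𝒞.levelEnergy σ β j u φ T ≤ C * (sobolevSq k (u T) + σ * sobolevSq (k + 1) (φ T)) := by
  obtain ⟨C, hC, hP⟩ := h.exists_P_le
  refine ⟨1 + C * n * n, by positivity, ?_⟩
  intro σ u φ hσ hσ1 hu hφ k j hjk
  have tT : T ∈ Ioc 0 T := ⟨h.T_pos, le_rfl⟩
  have su := hu.torus tT
  have sφ := hφ.torus tT
  have sd : ∀ L, SmoothTorus (𝒞.density σ β (fun t => listDeriv L (u t))
      (fun t => listDeriv L (φ t)) T) := fun L =>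
    (h.smooth_density hsm σ hβ (hu.listDeriv L) (hφ.listDeriv L)).torus tT
  have s1 : SmoothTorus fun x => jetSq (k + 1) (u T) x + σ * jetSq (k + 2) (φ T) x :=
    (su.jetSq _).add ((SmoothTorus.const σ).mul (sφ.jetSq _))
  rw [sobolevSq_eq su, sobolevSq_eq sφ, ← torusInt_const_mul, ← torusInt_add (su.jetSq _)
    ((SmoothTorus.const σ).mul (sφ.jetSq _)), ← torusInt_const_mul, levelEnergy, levelSum,
    ← torusInt_sum fun a _ => sd _]
  refine torusInt_mono (.sum fun a _ => sd _) ((SmoothTorus.const _).mul s1) fun x => ?_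
  have hd : ∀ L : List (Fin n), L.length = j →
      𝒞.density σ β (fun t => listDeriv L (u t)) (fun t => listDeriv L (φ t)) T x
        ≤ listDeriv L (u T) x ^ 2
          + σ * (C * n) * ∑ a, listDeriv L (pderiv a (φ T)) x ^ 2 := by
    intro L hL
    have e : ∀ a, pderiv a (listDeriv L (φ T)) x = listDeriv L (pderiv a (φ T)) x := fun a => by
      rw [pderiv_listDeriv sφ]
    rw [density]
    simp only [e]
    have k1 : ∑ a, ∑ b, 𝒞.P a b T x
        * (listDeriv L (pderiv a (φ T)) x * listDeriv L (pderiv b (φ T)) x)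
        ≤ C * (n * ∑ a, listDeriv L (pderiv a (φ T)) x ^ 2) := by
      have k2 := sq_sum_le_card_mul_sum_sq (s := Finset.univ)
        (f := fun a : Fin n => |listDeriv L (pderiv a (φ T)) x|)
      simp only [sq_abs, Finset.card_univ, Fintype.card_fin] at k2
      refine le_trans ?_ (mul_le_mul_of_nonneg_left k2 hC.le)
      rw [sq, Finset.sum_mul_sum, Finset.mul_sum]
      refine Finset.sum_le_sum fun a _ => ?_
      rw [Finset.mul_sum]
      refine Finset.sum_le_sum fun b _ => ?_
      refine (le_abs_self _).trans ?_
      rw [abs_mul, abs_mul]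
      refine mul_le_mul_of_nonneg_right ((hP T tT x a b).trans ?_) (by positivity)
      have := mul_le_one₀ (h.p_le_one tT a x) (p_pos tT.1 b x).le (h.p_le_one tT b x)
      exact mul_le_of_le_one_right hC.le this
    have k3 : T ^ (2 * β x) ≤ 1 :=
      Real.rpow_le_one h.T_pos.le h.T_le (by linarith [hβ0 x])
    have k4 := Real.rpow_nonneg h.T_pos.le (2 * β x)
    have k5 := mul_le_mul_of_nonneg_right (hsm.w_le hσ hσ1 tT x).2 (sq_nonneg (listDeriv L (u T) x))
    have k6 := mul_le_mul_of_nonneg_left k1 hσ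
    have k7 : 0 ≤ σ * (C * (n * ∑ a, listDeriv L (pderiv a (φ T)) x ^ 2)) := by positivity
    have k8 : 0 ≤ 2 * listDeriv L (u T) x ^ 2
        + σ * (C * (n * ∑ a, listDeriv L (pderiv a (φ T)) x ^ 2)) := by positivity
    calc _ ≤ 1 / 2 * T ^ (2 * β x) * (2 * listDeriv L (u T) x ^ 2
          + σ * (C * (n * ∑ a, listDeriv L (pderiv a (φ T)) x ^ 2))) := by gcongr
      _ ≤ 1 / 2 * 1 * (2 * listDeriv L (u T) x ^ 2
          + σ * (C * (n * ∑ a, listDeriv L (pderiv a (φ T)) x ^ 2))) := by gcongr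
      _ ≤ _ := by linarith
  have hsum := levelSum_mono hd
  rw [levelSum_add, levelSum_const_mul] at hsum
  refine hsum.trans ?_
  have e1 : levelSum j (fun L => listDeriv L (u T) x ^ 2) ≤ jetSq (k + 1) (u T) x :=
    levelSum_le_cumSum (fun _ => sq_nonneg _) (by omega)
  have e2 : levelSum j (fun L => ∑ a, listDeriv L (pderiv a (φ T)) x ^ 2)
      ≤ n * jetSq (k + 2) (φ T) x := by
    unfold levelSum
    rw [Finset.sum_comm]
    have : ∀ a ∈ (Finset.univ : Finset (Fin n)),
        ∑ i : Fin j → Fin n, listDeriv (List.ofFn i) (pderiv a (φ T)) x ^ 2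
        ≤ jetSq (k + 2) (φ T) x := fun a _ =>
      (levelSum_le_cumSum (F := fun L => listDeriv L (pderiv a (φ T)) x ^ 2)
        (fun _ => sq_nonneg _) (by omega : j < k + 1)).trans (jetSq_pderiv_le (k + 1) (φ T) a x)
    refine (Finset.sum_le_sum this).trans (le_of_eq ?_)
    simp
  have e3 := mul_le_mul_of_nonneg_left e2 (by positivity : 0 ≤ σ * (C * n))
  have e4 := jetSq_nonneg (k + 1) (u T) x
  have e5 := jetSq_nonneg (k + 2) (φ T) x
  have e6 : 0 ≤ σ * jetSq (k + 2) (φ T) x := by positivity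
  have e7 : 0 ≤ C * n * n * jetSq (k + 1) (u T) x := by positivity
  linarith

end Coeffs

end LapseScalar

/-! ### Assembling the estimates -/

namespace LapseScalar

variable {n : ℕ} {T δ κ₀ σ : ℝ}

theorem sobolevSq_nonneg {f : (Fin n → ℝ) → ℝ} (hf : SmoothTorus f) (k : ℕ) : 0 ≤ sobolevSq k f := by
  rw [sobolevSq_eq hf]
  exact torusInt_nonneg fun x => jetSq_nonneg _ _ _

namespace Coeffs

variable {𝒞 : Coeffs n}

theorem srcSq_le (m : ℕ) (F₁ F₂ F₃ : (Fin n → ℝ) → ℝ) (x : Fin n → ℝ) :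
    srcSq m F₁ F₂ F₃ x ≤ jetSq m F₁ x + jetSq m F₂ x + n * jetSq (m + 1) F₃ x := by
  have h := Finset.sum_le_sum fun b (_ : b ∈ Finset.univ) => jetSq_pderiv_le m F₃ b x
  simp only [Finset.sum_const, Finset.card_univ, Fintype.card_fin, nsmul_eq_mul] at h
  rw [srcSq]
  linarith

/-- The contribution of `ν` and `φ` to the estimate for `u`. -/
theorem Admissible.exists_timeInt_drift_le (h : 𝒞.Admissible T δ κ₀) (hsm : 𝒞.Small T)
    {lam β : (Fin n → ℝ) → ℝ} (hlam : SmoothTorus lam) (hβ : SmoothTorus β) (hβ0 : ∀ x, 0 < β x)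
    (hle : ∀ x, -lam x ≤ β x) (k : ℕ) :
    ∃ C > 0, ∀ {σ : ℝ} {F₁ F₂ F₃ u ν φ : ℝ → (Fin n → ℝ) → ℝ}, 0 ≤ σ → σ ≤ 1 →
      𝒞.Solves T σ F₁ F₂ F₃ u ν φ → ∀ t ∈ Ioc 0 T,
      timeInt (fun x => -lam x) t T
          (fun t => drift (fun x => lam x + β x) (k + 1) (F₁ t) (F₂ t) (ν t) (φ t) t)
        ≤ C * (sobolevSq (k + 2) (u T) + σ * sobolevSq (k + 3) (φ T) + sobolevSq (k + 2) (φ T)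
          + (timeInt (fun x => -lam x) t T (fun t => jetSq (k + 3) (F₁ t))
            + timeInt (fun x => -lam x) t T (fun t => jetSq (k + 3) (F₂ t))
            + timeInt β t T (fun t => jetSq (k + 4) (F₃ t)))) := by
  -- Derivatives of `u` up to order `k` require those of `ν` and `φ` up to order `k + 2`, that is,
  -- jets of order less than `k + 3`. The equation for `∂φ` then calls for one more derivative of
  -- `F₃`.
  obtain ⟨C1, hC1, h1⟩ := h.exists_timeInt_totSq_le hsm hβ hβ0 (k + 3)
  obtain ⟨C2, hC2, h2⟩ := h.exists_timeInt_φ_le hβ hβ0 (k + 3)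
  obtain ⟨C3, hC3, h3⟩ := h.exists_levelEnergy_le hsm hβ hβ0
  obtain ⟨X, hX⟩ : ∃ X, X = C1 * ((k + 3) * C3 + 1 + n) := ⟨_, rfl⟩
  have hX0 : 0 < X := by rw [hX]; positivity
  refine ⟨1 + X + C2 * (2 + X), by positivity, ?_⟩
  intro σ F₁ F₂ F₃ u ν φ hσ hσ1 hs t ht
  have tT : T ∈ Ioc 0 T := ⟨h.T_pos, le_rfl⟩
  have su := hs.smooth_u.torus tT
  have sφ := hs.smooth_φ.torus tT
  have f1 := hs.smooth_F₁.jetSq (k + 3)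
  have f2 := hs.smooth_F₂.jetSq (k + 3)
  have f3 := hs.smooth_F₃.jetSq (k + 3)
  have f4 := hs.smooth_F₃.jetSq (k + 4)
  have jν := hs.smooth_ν.jetSq (k + 3)
  have jφ := hs.smooth_φ.jetSq (k + 3)
  have stot := h.smooth_totSq σ hs.smooth_u hs.smooth_ν hs.smooth_φ (k + 3)
  have ssrc := smooth_srcSq hs.smooth_F₁ hs.smooth_F₂ hs.smooth_F₃ (k + 3)
  have sub : ∀ s ∈ Icc t T, 0 < s := fun s hs => ht.1.trans_le hs.1
  have a1 := h1 hσ hσ1 hs t ht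
  have a2 := h2 hσ hσ1 hs t ht
  rw [timeInt_add hβ f3 stot ht] at a2
  have a3 : ∑ j ∈ Finset.range (k + 3), 𝒞.levelEnergy σ β j u φ T
      ≤ (k + 3) * (C3 * (sobolevSq (k + 2) (u T) + σ * sobolevSq (k + 3) (φ T))) := by
    refine (Finset.sum_le_sum fun j hj => h3 hσ hσ1 hs.smooth_u hs.smooth_φ (k + 2) j
      (by have := Finset.mem_range.1 hj; omega)).trans (le_of_eq ?_)
    simp
  have a4 : wInt β T (jetSq (k + 3) (φ T)) ≤ sobolevSq (k + 2) (φ T) := by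
    rw [sobolevSq_eq sφ]
    refine torusInt_mono ((smooth_weight hβ h.T_pos).mul (sφ.jetSq _)) (sφ.jetSq _) fun x => ?_
    exact mul_le_of_le_one_left (jetSq_nonneg _ _ _)
      (Real.rpow_le_one h.T_pos.le h.T_le (by linarith [hβ0 x]))
  have a5 : timeInt β t T (fun t => srcSq (k + 3) (F₁ t) (F₂ t) (F₃ t))
      ≤ timeInt (fun x => -lam x) t T (fun t => jetSq (k + 3) (F₁ t))
        + timeInt (fun x => -lam x) t T (fun t => jetSq (k + 3) (F₂ t))
        + n * timeInt β t T (fun t => jetSq (k + 4) (F₃ t)) := by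
    refine (timeInt_mono hβ ssrc ((f1.add f2).add ((SmoothSlab.const n).mul f4)) ht
      fun s _ x => srcSq_le (k + 3) _ _ _ _).trans ?_
    rw [timeInt_add hβ (f1.add f2) ((SmoothSlab.const n).mul f4) ht, timeInt_add hβ f1 f2 ht,
      timeInt_const_mul]
    refine add_le_add (add_le_add ?_ ?_) le_rfl
    · exact timeInt_mono_weight h.T_le hlam.neg hβ hle f1 ht fun _ _ _ => jetSq_nonneg _ _ _
    · exact timeInt_mono_weight h.T_le hlam.neg hβ hle f2 ht fun _ _ _ => jetSq_nonneg _ _ _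
  have a6 : timeInt β t T (fun t => jetSq (k + 3) (F₃ t))
      ≤ timeInt β t T (fun t => jetSq (k + 4) (F₃ t)) :=
    timeInt_mono hβ f3 f4 ht fun s _ x => jetSq_mono (Nat.le_succ _) _ _
  have a7 : timeInt β t T (fun t => jetSq (k + 3) (ν t))
      ≤ timeInt β t T (fun t => 𝒞.totSq σ (k + 3) (u t) (ν t) (φ t) t) :=
    timeInt_mono hβ jν stot ht fun s _ x => by
      have k1 := jetSq_nonneg (k + 3) (u s) x
      have k3 := mul_nonneg hσ (gradSq_nonneg (𝒞 := 𝒞) s (k + 3) (φ s) x)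
      have k4 := mul_nonneg hσ (gradSq_nonneg (𝒞 := 𝒞) s (k + 3) (ν s) x)
      rw [totSq]; linarith
  have ed : timeInt (fun x => -lam x) t T
      (fun t => drift (fun x => lam x + β x) (k + 1) (F₁ t) (F₂ t) (ν t) (φ t) t)
      ≤ timeInt (fun x => -lam x) t T (fun t => jetSq (k + 3) (F₁ t))
        + timeInt (fun x => -lam x) t T (fun t => jetSq (k + 3) (F₂ t))
        + (timeInt β t T (fun t => jetSq (k + 3) (ν t))
          + timeInt β t T (fun t => jetSq (k + 3) (φ t))) := by
    have sl := hlam.add hβ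
    have w2 : SmoothSlab T (fun t x => (t ^ (lam x + β x)) ^ 2
        * (jetSq (k + 3) (ν t) x + jetSq (k + 3) (φ t) x)) :=
      ((SmoothSlab.rpow sl).pow 2).mul (jν.add jφ)
    -- The two steps fit together here: the gain `t^{2(λ + β)}` turns the weight `t^{-2λ}` into the
    -- weight `t^{2β}` of the rough estimate.
    have e1 : timeInt (fun x => -lam x) t T (fun t x => (t ^ (lam x + β x)) ^ 2
        * (jetSq (k + 3) (ν t) x + jetSq (k + 3) (φ t) x))
        = timeInt β t T (fun t x => jetSq (k + 3) (ν t) x + jetSq (k + 3) (φ t) x) := by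
      refine intervalIntegral.integral_congr fun s hs => ?_
      rw [uIcc_of_le ht.2] at hs
      have s0 := sub s hs
      simp only [wInt]
      congr 2
      funext x
      rw [← mul_assoc, ← Real.rpow_mul_natCast s0.le, ← Real.rpow_add s0]
      congr 2
      push_cast
      ring
    rw [← timeInt_add hβ jν jφ ht, ← e1, ← timeInt_add hlam.neg f1 f2 ht,
      ← timeInt_add hlam.neg (f1.add f2) w2 ht]
    refine timeInt_mono hlam.neg (smooth_drift sl _ hs.smooth_F₁ hs.smooth_F₂ hs.smooth_ν
      hs.smooth_φ) ((f1.add f2).add w2) ht fun s _ x => ?_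
    exact add_le_add (add_le_add (jetSq_mono (by omega) _ _) (jetSq_mono (by omega) _ _)) le_rfl
  have n1 : 0 ≤ timeInt (fun x => -lam x) t T (fun t => jetSq (k + 3) (F₁ t)) :=
    timeInt_nonneg ht fun _ _ _ => jetSq_nonneg _ _ _
  have n2 : 0 ≤ timeInt (fun x => -lam x) t T (fun t => jetSq (k + 3) (F₂ t)) :=
    timeInt_nonneg ht fun _ _ _ => jetSq_nonneg _ _ _
  have n3 : 0 ≤ timeInt β t T (fun t => jetSq (k + 4) (F₃ t)) :=
    timeInt_nonneg ht fun _ _ _ => jetSq_nonneg _ _ _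
  have n4 := sobolevSq_nonneg su (k + 2)
  have n5 := mul_nonneg hσ (sobolevSq_nonneg sφ (k + 3))
  have n6 := sobolevSq_nonneg sφ (k + 2)
  generalize timeInt (fun x => -lam x) t T (fun t => jetSq (k + 3) (F₁ t)) = I1 at *
  generalize timeInt (fun x => -lam x) t T (fun t => jetSq (k + 3) (F₂ t)) = I2 at *
  generalize timeInt β t T (fun t => jetSq (k + 4) (F₃ t)) = I4 at *
  generalize timeInt β t T (fun t => jetSq (k + 3) (F₃ t)) = I3 at *
  generalize timeInt β t T (fun t => srcSq (k + 3) (F₁ t) (F₂ t) (F₃ t)) = S at *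
  generalize timeInt β t T (fun t => 𝒞.totSq σ (k + 3) (u t) (ν t) (φ t) t) = Y at *
  generalize timeInt β t T (fun t => jetSq (k + 3) (ν t)) = Z1 at *
  generalize timeInt β t T (fun t => jetSq (k + 3) (φ t)) = Z2 at *
  generalize ∑ j ∈ Finset.range (k + 3), 𝒞.levelEnergy σ β j u φ T = E at *
  generalize wInt β T (jetSq (k + 3) (φ T)) = W at *
  generalize sobolevSq (k + 2) (u T) = A1 at *
  generalize σ * sobolevSq (k + 3) (φ T) = A2 at *
  generalize sobolevSq (k + 2) (φ T) = A3 at *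
  obtain ⟨R, hR⟩ : ∃ R, R = A1 + A2 + A3 + (I1 + I2 + I4) := ⟨_, rfl⟩
  have hY : Y ≤ X * R := by
    refine a1.trans ?_
    rw [hX, mul_assoc]
    refine mul_le_mul_of_nonneg_left ?_ hC1.le
    have m1 : 0 ≤ (k + 3) * C3 * (A3 + (I1 + I2 + I4)) := by positivity
    have m2 : 0 ≤ n * (A1 + A2 + A3 + (I1 + I2)) := by positivity
    rw [hR]
    linarith
  have hZ : Z2 ≤ C2 * ((2 + X) * R) := by
    refine a2.trans (mul_le_mul_of_nonneg_left ?_ hC2.le)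
    rw [add_mul, hR] at *
    linarith
  have hR' : I1 + I2 ≤ R := by rw [hR]; linarith
  rw [← hR]
  linarith

/-- The auxiliary weight `β` disappears at this point. Since `β ≥ -λ`, the sources `F₁` and `F₂` of
the rough estimate are covered by the weight `-λ`; since `β ≥ 2 κ - λ`, the source `F₃` is covered
by `-λ + 2 κ - ε`. -/
theorem Admissible.exists_energy_le (h : 𝒞.Admissible T δ κ₀) (hsm : 𝒞.Small T)
    {lam κ : (Fin n → ℝ) → ℝ} (hlam : SmoothTorus lam) (hκ : SmoothTorus κ)
    (hlamA : ∀ x, lam x < 2 * 𝒞.A x ^ 2) (hlamq : ∀ x i, lam x < 2 * (1 - 𝒞.q i x))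
    (hκ0 : ∀ x, 0 < κ x) (hκq : ∀ x i, κ x < 1 - 𝒞.q i x) {ε : ℝ} (hε : 0 < ε) (k : ℕ) :
    ∃ C > 0, ∀ {σ : ℝ} {F₁ F₂ F₃ u ν φ : ℝ → (Fin n → ℝ) → ℝ}, 0 ≤ σ → σ ≤ 1 →
      𝒞.Solves T σ F₁ F₂ F₃ u ν φ → ∀ t ∈ Ioc 0 T,
      energy k lam u t ≤
        C * (sobolevSq (k + 2) (u T) + σ * sobolevSq (k + 3) (φ T) + sobolevSq (k + 2) (φ T)
          + ∫ s in t..T, (sobolevSq (k + 2) (fun x => s ^ (-lam x) * F₁ s x)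
              + sobolevSq (k + 2) (fun x => s ^ (-lam x) * F₂ s x)
              + sobolevSq (k + 3) (fun x => s ^ (-lam x + 2 * κ x - ε) * F₃ s x))
            * s ^ (-1 - 2 * ε)) := by
  obtain ⟨β, hβ, hβ0, hβκ, ε', hε', hs⟩ := exists_weight h.smooth_q hlam hκ hlamq hκq
  obtain ⟨g, hg0, hg⟩ := (((SmoothTorus.const 2).mul (h.smooth_A.pow 2)).sub hlam).exists_pos_le
    fun x => sub_pos.2 (hlamA x)
  have hθ : SmoothTorus (fun x => -lam x + 2 * κ x - ε) :=
    (hlam.neg.add ((SmoothTorus.const 2).mul hκ)).sub (.const ε)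
  -- The exponent gained from the coefficients is taken to be exactly `λ + β`, which the choice of
  -- `β` keeps below `2 - 2 q_i - ε'`.
  obtain ⟨C1, hC1, h1⟩ := h.exists_wInt_u_le hsm hlam hg0 hg (hlam.add hβ) hε' hs (k + 1)
  obtain ⟨C2, hC2, h2⟩ := h.exists_timeInt_drift_le hsm hlam hβ hβ0
    (fun x => by linarith [hβκ x, hκ0 x]) k
  obtain ⟨C3, hC3, h3⟩ := exists_timeInt_jetSq_le h.T_le hlam.neg hlam.neg
    (fun x => le_rfl) hε (k + 2)
  obtain ⟨C4, hC4, h4⟩ := exists_timeInt_jetSq_le h.T_le hβ hθ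
    (fun x => by linarith [hβκ x]) hε (k + 3)
  obtain ⟨B, hB, hB'⟩ := (smooth_weight hlam.neg h.T_pos).exists_abs_le
  refine ⟨C1 * (B + C2 * (1 + C3 + C4)), by positivity, ?_⟩
  intro σ F₁ F₂ F₃ u ν φ hσ hσ1 hsol t ht
  have tT : T ∈ Ioc 0 T := ⟨h.T_pos, le_rfl⟩
  have su := hsol.smooth_u.torus tT
  have sφ := hsol.smooth_φ.torus tT
  have i1 := intervalIntegrable_sobolevSq hlam.neg ε hsol.smooth_F₁ (k + 2) ht
  have i2 := intervalIntegrable_sobolevSq hlam.neg ε hsol.smooth_F₂ (k + 2) ht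
  have i3 := intervalIntegrable_sobolevSq hθ ε hsol.smooth_F₃ (k + 3) ht
  rw [energy_eq hlam hsol.smooth_u k ht]
  simp only [add_mul _ _ ((_ : ℝ) ^ (-1 - 2 * ε))]
  rw [intervalIntegral.integral_add (i1.add i2) i3, intervalIntegral.integral_add i1 i2]
  have b1 := h1 hσ hσ1 hsol t ht
  have b2 := h2 hσ hσ1 hsol t ht
  have b3 := h3 hsol.smooth_F₁ t ht
  have b4 := h3 hsol.smooth_F₂ t ht
  have b5 := h4 hsol.smooth_F₃ t ht
  have b6 : wInt (fun x => -lam x) T (jetSq (k + 1) (u T)) ≤ B * sobolevSq (k + 2) (u T) := by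
    rw [sobolevSq_eq su, ← torusInt_const_mul]
    refine torusInt_mono ((smooth_weight hlam.neg h.T_pos).mul (su.jetSq _))
      ((SmoothTorus.const B).mul (su.jetSq _)) fun x => ?_
    exact mul_le_mul ((le_abs_self _).trans (hB' x)) (jetSq_mono (by omega) _ _)
      (jetSq_nonneg _ _ _) hB.le
  have n0 : 0 ≤ timeInt (fun x => -lam x) t T (fun t => jetSq (k + 1) (u t)) :=
    timeInt_nonneg ht fun _ _ _ => jetSq_nonneg _ _ _
  have n1 : 0 ≤ timeInt (fun x => -lam x) t T (fun t => jetSq (k + 3) (F₁ t)) :=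
    timeInt_nonneg ht fun _ _ _ => jetSq_nonneg _ _ _
  have n2 : 0 ≤ timeInt (fun x => -lam x) t T (fun t => jetSq (k + 3) (F₂ t)) :=
    timeInt_nonneg ht fun _ _ _ => jetSq_nonneg _ _ _
  have n3 : 0 ≤ timeInt β t T (fun t => jetSq (k + 4) (F₃ t)) :=
    timeInt_nonneg ht fun _ _ _ => jetSq_nonneg _ _ _
  have n4 := sobolevSq_nonneg su (k + 2)
  have n5 := mul_nonneg hσ (sobolevSq_nonneg sφ (k + 3))
  have n6 := sobolevSq_nonneg sφ (k + 2)
  have n7 := wInt_nonneg (β := fun x => -lam x) ht.1 (jetSq_nonneg (k + 1) (u t))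
  generalize timeInt (fun x => -lam x) t T (fun t => drift (fun x => lam x + β x) (k + 1) (F₁ t)
    (F₂ t) (ν t) (φ t) t) = D at *
  generalize timeInt (fun x => -lam x) t T (fun t => jetSq (k + 1) (u t)) = I0 at *
  change timeInt (fun x => -lam x) t T (fun t => jetSq (k + 3) (F₁ t)) ≤ _ at b3
  change timeInt (fun x => -lam x) t T (fun t => jetSq (k + 3) (F₂ t)) ≤ _ at b4
  change timeInt β t T (fun t => jetSq (k + 4) (F₃ t)) ≤ _ at b5
  generalize timeInt (fun x => -lam x) t T (fun t => jetSq (k + 3) (F₁ t)) = I1 at *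
  generalize timeInt (fun x => -lam x) t T (fun t => jetSq (k + 3) (F₂ t)) = I2 at *
  generalize timeInt β t T (fun t => jetSq (k + 4) (F₃ t)) = I4 at *
  generalize wInt (fun x => -lam x) T (jetSq (k + 1) (u T)) = W at *
  generalize wInt (fun x => -lam x) t (jetSq (k + 1) (u t)) = W' at *
  generalize (∫ s in t..T, sobolevSq (k + 2) (fun x => s ^ (-lam x) * F₁ s x)
    * s ^ (-1 - 2 * ε)) = J1 at *
  generalize (∫ s in t..T, sobolevSq (k + 2) (fun x => s ^ (-lam x) * F₂ s x)
    * s ^ (-1 - 2 * ε)) = J2 at *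
  generalize (∫ s in t..T, sobolevSq (k + 3) (fun x => s ^ (-lam x + 2 * κ x - ε) * F₃ s x)
    * s ^ (-1 - 2 * ε)) = J3 at *
  generalize sobolevSq (k + 2) (u T) = A1 at *
  generalize σ * sobolevSq (k + 3) (φ T) = A2 at *
  generalize sobolevSq (k + 2) (φ T) = A3 at *
  have p1 : 0 ≤ J1 := nonneg_of_mul_nonneg_right (n1.trans b3) hC3
  have p2 : 0 ≤ J2 := nonneg_of_mul_nonneg_right (n2.trans b4) hC3
  have p3 : 0 ≤ J3 := nonneg_of_mul_nonneg_right (n3.trans b5) hC4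
  obtain ⟨R, hR⟩ : ∃ R, R = A1 + A2 + A3 + (J1 + J2 + J3) := ⟨_, rfl⟩
  have q1 : A1 + A2 + A3 + (I1 + I2 + I4) ≤ (1 + C3 + C4) * R := by
    have m1 : 0 ≤ (C3 + C4) * (A1 + A2 + A3) := by positivity
    have m2 : 0 ≤ (1 + C4) * (J1 + J2) := by positivity
    have m3 : 0 ≤ (1 + C3) * J3 := by positivity
    rw [hR]
    linarith
  have q2 : D ≤ C2 * ((1 + C3 + C4) * R) := b2.trans (by gcongr)
  have q3 : W ≤ B * R := b6.trans (by rw [hR]; gcongr; linarith)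
  rw [← hR]
  calc 1 / 2 * W' ≤ W' + I0 := by linarith
    _ ≤ C1 * (W + D) := b1
    _ ≤ C1 * (B * R + C2 * ((1 + C3 + C4) * R)) := by gcongr
    _ = _ := by ring

end Coeffs

end LapseScalar

end

/-! ### The main theorem -/

open LapseScalar in
theorem mainTheorem3 {n : ℕ} (T₁ : ℝ) (hT₁ : T₁ ∈ Ioc (0 : ℝ) 1)
    (Γ : Background n) (q : Fin n → (Fin n → ℝ) → ℝ) (A β : (Fin n → ℝ) → ℝ)
    (hΓ : IsKasnerBackground T₁ Γ q A β) :
    ∃ T₀ ∈ Ioc 0 T₁, ∀ T ∈ Ioc 0 T₀, ∀ (k : ℕ) (ε : ℝ), 0 < ε →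
      ∀ lam : (Fin n → ℝ) → ℝ, SmoothTorus lam →
        (∀ x, lam x < min (2 * (1 - kasnerMax q x)) (2 * A x ^ 2)) →
      ∀ κ : (Fin n → ℝ) → ℝ, SmoothTorus κ →
        (∀ x, 0 < κ x ∧ κ x < 1 - kasnerMax q x) →
      ∃ C > 0, ∀ σ ∈ Icc (0 : ℝ) 1,
        ∀ F₁ F₂ F₃ : ℝ → (Fin n → ℝ) → ℝ,
          SmoothSlab T F₁ → SmoothSlab T F₂ → SmoothSlab T F₃ →
        ∀ uT φT : (Fin n → ℝ) → ℝ, SmoothTorus uT → SmoothTorus φT →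
        ∀ u ν φ : ℝ → (Fin n → ℝ) → ℝ,
          IsSolution T Γ A σ F₁ F₂ F₃ u ν φ → u T = uT → φ T = φT →
        ∀ t ∈ Ioc 0 T,
          energy k lam u t ≤
            C * (sobolevSq (k + 2) uT + σ * sobolevSq (k + 3) φT + sobolevSq (k + 2) φT
              + ∫ s in t..T,
                  (sobolevSq (k + 2) (fun x => s ^ (-lam x) * F₁ s x)
                    + sobolevSq (k + 2) (fun x => s ^ (-lam x) * F₂ s x)
                    + sobolevSq (k + 3) (fun x => s ^ (-lam x + 2 * κ x - ε) * F₃ s x))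
                  * s ^ (-1 - 2 * ε)) := by
  -- If `q_max < 1` everywhere, compactness gives a uniform gap `κ₀`. Otherwise no `κ` with `0 < κ <
  -- 1 - q_max` exists.
  by_cases hmax : ∀ x, kasnerMax q x < 1
  · have hle : ∀ x i, q i x ≤ kasnerMax q x := fun x i =>
      le_ciSup (f := fun i => q i x) (Set.finite_range _).bddAbove i
    have hq : ∀ i, ∃ c > 0, ∀ x, c ≤ 1 - q i x := fun i =>
      ((SmoothTorus.const 1).sub (hΓ.smooth_q i)).exists_pos_le fun x =>
        sub_pos.2 ((hle x i).trans_lt (hmax x))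
    choose c hc hc' using hq
    obtain ⟨κ₀, hκ₀, hκ₀c⟩ := Pi.exists_forall_pos_add_lt (x := fun _ : Fin n => (0 : ℝ)) hc
    obtain ⟨b, hb, hbβ⟩ := hΓ.smooth_β.exists_pos_le hΓ.pos_β
    -- The Fuchsian exponent is `δ = min(inf β, κ₀ / 2)`, with a positive lower bound of `β` in
    -- place of the infimum. It depends on the background alone, and so does `T₀`.
    have hadm := hΓ.admissible hT₁.1 hT₁.2 hκ₀
      (fun x i => by linarith [hκ₀c i, hc' i x]) (lt_min hb (half_pos hκ₀)) (min_le_right _ _)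
      fun x => (min_le_left _ _).trans (hbβ x)
    obtain ⟨T₀, hT₀, hsm⟩ := hadm.exists_small
    refine ⟨T₀, hT₀, fun T hT k ε hε lam hlam hlam' κ hκ hκ' => ?_⟩
    have hTT : T ≤ T₁ := hT.2.trans hT₀.2
    obtain ⟨C, hC, hE⟩ := (hadm.restrict hT.1 hTT).exists_energy_le (hsm.restrict hT.2) hlam hκ
      (fun x => (hlam' x).trans_le (min_le_right _ _))
      (fun x i => (hlam' x).trans_le ((min_le_left _ _).trans
        (by linarith [hle x i] : 2 * (1 - kasnerMax q x) ≤ 2 * (1 - q i x))))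
      (fun x => (hκ' x).1)
      (fun x i => (hκ' x).2.trans_le (by linarith [hle x i] : 1 - kasnerMax q x ≤ 1 - q i x)) hε k
    refine ⟨C, hC, fun σ hσ F₁ F₂ F₃ h₁ h₂ h₃ uT φT _ _ u ν φ hsol hu hφ t ht => ?_⟩
    have := hE hσ.1 hσ.2 (hΓ.solves hTT h₁ h₂ h₃ hsol) t ht
    rwa [hu, hφ] at this
  · push Not at hmax
    obtain ⟨x, hx⟩ := hmax
    -- The conclusion is vacuous here, so any time serves as `T₀`.
    exact ⟨T₁, ⟨hT₁.1, le_rfl⟩, fun T _ k ε _ lam _ _ κ _ hκ => absurd (hκ x) fun h => by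
      linarith [h.1, h.2]⟩
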